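/- Let $k$ be an algebraically closed field. A space curve is a locally Cohen–Macaulay, purely one-dimensional closed subscheme $C\subset\mathbb P^3_k$ (so without isolated or embedded points), with ideal sheaf $\mathcal I_C$; its degree and genus are defined by $\chi(\mathcal O_C(n))=n\deg(C)+1-g(C)$ for all $n$. A $d$-uple line (triple line for $d=3$, quadruple line for $d=4$) is a space curve of degree $d$ whose support is a line $L$; let $L_j$ be the subscheme defined by $\mathcal I_L^j$. Fix an integer $\ell\ge 0$. A $d$-uple line $C$ * satisfies condition $\mathscr C_{d,\ell}$ if $H^0(\mathcal I_C(n))=H^0(\mathcal I_L^d(n))$ for every $n\le \ell+d-1$; * is a $C_{d,\ell}$ if $g(C)=-(d-1)-\binom d3-\ell\binom d2$ and $H^0(\mathcal I_C(\ell+d-1))=H^0(\mathcal I_L^d(\ell+d-1))$. Let $C_j$ be the curve obtained from $C\cap L_j$ by removing its embedded points, and let $\mathcal L_j=\mathcal I_{C_j}/\mathcal I_{C_{j+1}}$, a vector bundle on $L$. The multiple line $C$ is quasiprimitive if it generically has embedding dimension two, i.e. if $\operatorname{rank}\mathcal L_1=1$. In that case, for $1\le j\le d-1$, $\mathcal L_j$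 is a line bundle and the generically surjective multiplication map $\mathcal L_1^{\otimes j}\to\mathcal L_j$ gives an effective divisor $D_j$ on $L$ with $\mathcal L_j\cong\mathcal L_1^{\otimes j}(D_j)$; the type of $C$ is $(a;b_2,\dots,b_{d-1})$ with $a=\deg\mathcal L_1$ and $b_j=\deg D_j$. Families of curves (the line $L$ is allowed to vary) are regarded as subspaces of the Hilbert scheme, and a property holds for a sufficiently general member of a family if it holds on a dense open subset of the family. **Theorem.** 1. A triple line satisfies condition $\mathscr C_{3,\ell}$ if and only if it is quasiprimitive of type $(a;b)$ with either $a=\ell$ and $b\ge 1$, or $a\ge \ell+1$. A triple line is a $C_{3,\ell}$ if and only if it is quasiprimitive of type $(\ell;1)$. The curves $C_{3,\ell}$ form a nonempty irreducible family of dimension $5\ell+12$. 2. If a quadruple line satisfies condition $\mathscr C_{4,\ell}$, then it is quasiprimitive of type $(a;b_2,b_3)$ with either $a=\ell$ and $b_2\ge 2$, or $a\ge \ell+1$. If a quadruple line is a $C_{4,\ell}$, then it is quasiprimitive of type $(\ell;2,2)$, and a sufficiently general quasiprimitive quadruple line of type $(\ell;2,2)$ is a $C_{4,\ell}$. The curves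 $C_{4,\ell}$ form a nonempty irreducible family of dimension $9\ell+21$. -/

import Mathlib

open Filter

noncomputable section

namespace MultipleLines

/-! Closed subschemes of `ℙ³` over a field `k` are represented by their saturated homogeneous
ideals in `k[x₀, x₁, x₂, x₃]`; a subscheme `C` with ideal `I` has
`H⁰(ℙ³, 𝓘_C(n)) = Iₙ`, the degree `n` part of `I`. -/

/-- The homogeneous coordinate ring of `ℙ³`. -/
abbrev Coord (k : Type*) [Field k] := MvPolynomial (Fin 4) k

/-- The vector space of forms of degree `n` on `ℙ³`. -/
abbrev Forms (k : Type*) [Field k] (n : ℕ) : Submodule k (Coord k) :=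
  MvPolynomial.homogeneousSubmodule (Fin 4) k n

/-- The degree `n` part of an ideal, as a subspace of the space of forms of degree `n`. -/
def gradedPart {k : Type*} [Field k] (I : Ideal (Coord k)) (n : ℕ) : Submodule k (Forms k n) :=
  (I.restrictScalars k).comap (Forms k n).subtype

/-- `dim_k (J / I)ₙ` for homogeneous ideals `I ≤ J`. -/
def quotDim {k : Type*} [Field k] (I J : Ideal (Coord k)) (n : ℕ) : ℤ :=
  (Module.finrank k (gradedPart J n) : ℤ) - Module.finrank k (gradedPart I n)

/-- A space curve: a closed subscheme of `ℙ³`, locally Cohen-Macaulay and purely of dimension one,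
i.e. without isolated or embedded zero dimensional components. In terms of its homogeneous ideal
`I`: every associated prime of `k[x₀, x₁, x₂, x₃] / I` is the ideal of an integral curve
(in particular the irrelevant ideal is not associated, so that `I` is saturated). -/
structure IsSpaceCurve {k : Type*} [Field k] (I : Ideal (Coord k)) : Prop where
  homogeneous : ∀ f ∈ I, ∀ n : ℕ, MvPolynomial.homogeneousComponent n f ∈ I
  ne_top : I ≠ ⊤
  pure : ∀ P ∈ associatedPrimes (Coord k) (Coord k ⧸ I), ringKrullDim (Coord k ⧸ P) = 2

/-- The curve has degree `d` and arithmetic genus `g`: its Hilbert polynomial, which is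
the value of `dim_k (k[x₀, x₁, x₂, x₃] / I)ₙ` for large `n`, is `χ(𝓞_C(n)) = n d + 1 - g`. -/
def HasDegreeGenus {k : Type*} [Field k] (I : Ideal (Coord k)) (d : ℕ) (g : ℤ) : Prop :=
  ∀ᶠ n : ℕ in atTop, quotDim I ⊤ n = (n : ℤ) * d + 1 - g

/-- The ideal of a line in `ℙ³`: generated by two linearly independent linear forms. -/
def IsLineIdeal {k : Type*} [Field k] (P : Ideal (Coord k)) : Prop :=
  ∃ u v : Coord k, u ∈ Forms k 1 ∧ v ∈ Forms k 1 ∧ LinearIndependent k ![u, v] ∧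
    P = Ideal.span {u, v}

/-- A `d`-uple line: a space curve of degree `d` whose support is a line. The ideal of the
supporting line `L` is then `I.radical`, and its powers `I.radical ^ j` are the ideals of the
infinitesimal neighbourhoods `L_j`. -/
structure IsMultipleLine {k : Type*} [Field k] (d : ℕ) (I : Ideal (Coord k)) : Prop where
  curve : IsSpaceCurve I
  support : IsLineIdeal I.radical
  degree : ∃ g : ℤ, HasDegreeGenus I d g

/-- Condition `𝒞_{d,ℓ}`: `H⁰(𝓘_C(n)) = H⁰(𝓘_L^d(n))` for every `n ≤ ℓ + d - 1`. -/
def SatisfiesCondition {k : Type*} [Field k] (d ℓ : ℕ) (I : Ideal (Coord k)) : Prop :=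
  ∀ n : ℕ, n ≤ ℓ + d - 1 → gradedPart I n = gradedPart (I.radical ^ d) n

/-- `C` is a `C_{d,ℓ}`: a `d`-uple line of genus `-(d-1) - binom(d,3) - ℓ binom(d,2)` with
`H⁰(𝓘_C(ℓ+d-1)) = H⁰(𝓘_L^d(ℓ+d-1))`. -/
structure IsC {k : Type*} [Field k] (d ℓ : ℕ) (I : Ideal (Coord k)) : Prop where
  line : IsMultipleLine d I
  genus : HasDegreeGenus I d (-((d : ℤ) - 1) - (d.choose 3 : ℤ) - (ℓ : ℤ) * (d.choose 2 : ℤ))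
  sections : gradedPart I (ℓ + d - 1) = gradedPart (I.radical ^ d) (ℓ + d - 1)

/-- The ideal obtained from `J` by discarding its embedded components: the contraction of `J`
from the localization at the elements that lie in no minimal prime of `J`. -/
def removeEmbedded {k : Type*} [Field k] (J : Ideal (Coord k)) : Ideal (Coord k) where
  carrier := {f | ∃ s : Coord k, (∀ p ∈ J.minimalPrimes, s ∉ p) ∧ s * f ∈ J}
  zero_mem' := ⟨1, fun p hp h => hp.1.1.ne_top ((Ideal.eq_top_iff_one p).2 h), by simp⟩
  add_mem' := by
    rintro f g ⟨s, hs, hsf⟩ ⟨t, ht, htg⟩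
    refine ⟨s * t, fun p hp h => (hp.1.1.mem_or_mem h).elim (hs p hp) (ht p hp), ?_⟩
    have h1 := J.mul_mem_left t hsf
    have h2 := J.mul_mem_left s htg
    have h3 : s * t * (f + g) = t * (s * f) + s * (t * g) := by ring
    rw [h3]
    exact J.add_mem h1 h2
  smul_mem' := by
    rintro c f ⟨s, hs, hsf⟩
    refine ⟨s, hs, ?_⟩
    have h1 := J.mul_mem_left c hsf
    have h2 : s * (c • f) = c * (s * f) := by rw [smul_eq_mul]; ring
    rw [h2]
    exact h1

/-- The ideal of the member `C_j` of the Cohen-Macaulay filtration of a multiple line `C`: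
the scheme `C ∩ L_j` with its embedded points removed. -/
def filtrant {k : Type*} [Field k] (I : Ideal (Coord k)) (j : ℕ) : Ideal (Coord k) :=
  removeEmbedded (I ⊔ I.radical ^ j)

/-- For homogeneous ideals `I ≤ J` such that `J / I` is a module over the coordinate ring of a
line `L ≅ ℙ¹`: the sheaf `𝓕` on `L` given by `J / I` has rank `r` and degree `δ`, that is
`χ(𝓕(n)) = r (n + 1) + δ`. For `r = 0` the degree is the length of `𝓕`. -/
def HasRankDegree {k : Type*} [Field k] (I J : Ideal (Coord k)) (r : ℕ) (δ : ℤ) : Prop :=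
  ∀ᶠ n : ℕ in atTop, quotDim I J n = (r : ℤ) * (n + 1) + δ

/-- A multiple line is quasiprimitive if the vector bundle `𝓛₁ = 𝓘_{C₁} / 𝓘_{C₂}` on its support
has rank one, i.e. if it has generically embedding dimension two. -/
def IsQuasiprimitive {k : Type*} [Field k] (I : Ideal (Coord k)) : Prop :=
  ∃ δ : ℤ, HasRankDegree (filtrant I 2) (filtrant I 1) 1 δ

/-- `C` is a quasiprimitive `(m+2)`-uple line of type `(a; b₂, …, b_{m+1})`. Here
`a = deg 𝓛₁`, and `b_j = deg D_j` where `D_j` is the effective divisor with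
`𝓛_j ≅ 𝓛₁^j(D_j)` given by the generically surjective map `𝓛₁^j → 𝓛_j = 𝓘_{C_j} / 𝓘_{C_{j+1}}`;
its degree is the length of the cokernel `𝓘_{C_j} / (𝓘_{C_{j+1}} + 𝓘_L^j)` of that map.
The entry `b i` is `b_{i+2}`. -/
structure HasType {k : Type*} [Field k] (I : Ideal (Coord k)) (a : ℤ) {m : ℕ} (b : Fin m → ℕ) :
    Prop where
  line : IsMultipleLine (m + 2) I
  quasiprimitive : IsQuasiprimitive I
  degree_one : HasRankDegree (filtrant I 2) (filtrant I 1) 1 a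
  degree_divisor : ∀ i : Fin m,
    HasRankDegree (filtrant I (i + 3) ⊔ I.radical ^ ((i : ℕ) + 2)) (filtrant I (i + 2)) 0 (b i)

/-- The Zariski topology on (the `k`-points of) a vector space `V`: closed sets are the common
zero loci of families of polynomials in linear functionals on `V`. -/
abbrev zariskiTopology (k V : Type*) [Field k] [AddCommGroup V] [Module k V] : TopologicalSpace V :=
  TopologicalSpace.induced
    (fun v : V => MvPolynomial.pointToPoint (k := k) (fun φ : Module.Dual k V => φ v)) inferInstance

/-- Linearly independent `r`-tuples in `V`. -/
def Frame (k V : Type*) [Field k] [AddCommGroup V] [Module k V] (r : ℕ) :=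
  {v : Fin r → V // LinearIndependent k v}

/-- Linearly independent tuples carry the subspace topology of the Zariski topology on `V^r`. -/
instance (k V : Type*) [Field k] [AddCommGroup V] [Module k V] (r : ℕ) :
    TopologicalSpace (Frame k V r) :=
  TopologicalSpace.induced Subtype.val (zariskiTopology k (Fin r → V))

/-- The disjoint union over `r` of the Grassmannians `Gr(r, V)` of a finite dimensional space. -/
def Grassmannian (k V : Type*) [Field k] [AddCommGroup V] [Module k V] := Submodule k V

/-- The Zariski topology on the Grassmannians: each `Gr(r, V)` is the quotient of the variety of
linearly independent `r`-tuples by `GL_r`, and is open and closed in the union. -/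
instance (k V : Type*) [Field k] [AddCommGroup V] [Module k V] :
    TopologicalSpace (Grassmannian k V) :=
  TopologicalSpace.coinduced
    (fun p : (Σ r : ℕ, Frame k V r) => Submodule.span k (Set.range p.2.1)) inferInstance

/-- The image of the subscheme with ideal `I` in the Grassmannian of subspaces of the space of
forms of degree `m`. On subschemes with a fixed Hilbert polynomial, for all large `m`,
`I ↦ I_m` is the standard embedding of the Hilbert scheme in a Grassmannian. -/
def hilbertPoint {k : Type*} [Field k] (m : ℕ) (I : Ideal (Coord k)) :
    Grassmannian k (Forms k m) :=
  gradedPart I m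

/-- A family of subschemes (with the same Hilbert polynomial) is nonempty, irreducible and of
dimension `N`, as a subspace of the Hilbert scheme. -/
def IsIrreducibleFamily {k : Type*} [Field k] (F : Set (Ideal (Coord k))) (N : ℕ) : Prop :=
  ∀ᶠ m : ℕ in atTop, IsIrreducible (hilbertPoint m '' F) ∧
    topologicalKrullDim (hilbertPoint m '' F) = N

/-- The sufficiently general member of the family `F` has property `Q`: in the topology induced
from the Hilbert scheme, `Q` holds on a dense open subset of `F`. -/
def GeneralMember {k : Type*} [Field k] (F : Set (Ideal (Coord k)))
    (Q : Ideal (Coord k) → Prop) : Prop :=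
  ∀ᶠ m : ℕ in atTop, ∃ U : Set (Grassmannian k (Forms k m)), IsOpen U ∧
    hilbertPoint m '' F ⊆ closure (hilbertPoint m '' F ∩ U) ∧
    ∀ I ∈ F, hilbertPoint m I ∈ U → Q I

end MultipleLines

end

/-!
The line is moved to `x₀ = x₁ = 0`, and multiple structures on it are studied over the ring of
binary forms in `x₂, x₃`. A multiple line either contains the first infinitesimal neighbourhood of
the line, or it lies on a surface that is smooth at the generic point of the line
(`IsMultipleLine.normal_position`). In the first case it is not quasiprimitive, and
`x₀^{d-1}` vanishes on it for reasons of degree (`IsStdMultiple.X0_pow_mem`), so that it satisfies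
none of the conditions on sections. In the second case it is the kernel of the restriction to a jet
`x₀ = D t`, `x₁ = t E(t)` modulo `t^d`, with coefficients in the ring of binary forms
(`IsStdMultiple.exists_jet`).

The numerical data of a jet are read off term by term, in lowest terms (`Jet.Data`, `Jet.Data₃`):
the coprime components `f, g` of the tangent direction, of degree `α`; the second order term
`r / p` with `deg p = b`; and the third order term `e / s` with `deg s = σ`. The corresponding
equations are `q = g x₀ - f x₁`, then `v = p q - u(x₀, x₁)` with a quadratic form `u` such that
`u(f, g) = r`, and `w = f³ p s v - e x₀³`; they vanish on the double, triple and quadruple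
structure. Since coprime binary forms generate all binary forms of large degree
(`exists_bezout`), the sheaves `𝓛ⱼ` have the expected degrees, the type is `(α - 1; b)` or
`(α - 1; b, b + σ)`, and the genus is determined by these numbers. A form of small degree that
vanishes on the multiple structure is a combination of these equations modulo a power of the ideal
of the line, so that the conditions on sections become conditions on the data: for triple lines on
the degrees only (`sections_three`), and for quadruple lines with `α = ℓ + 1` on the linear
independence of `f` and `g` modulo `p` (`sections_four_iff`), which forces `2 ≤ b`.

For the statements on families, the multiple lines of type `(ℓ; 1)`, respectively `(ℓ; 2, 2)`, that
are in general position with respect to `x₃ = 0` (`IsTransverse`) are brought into a normal form: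
`f` and `p` have leading coefficient one, and two coefficients of `u` are divisible by a power of
`x₃`. They are thus parametrized bijectively by an open subset of an affine space `Param` of
dimension `5ℓ + 12`, respectively `9ℓ + 21` (`HasType.exists_param`). The parametrization is
continuous as the forms of large degree in the ideal are the kernel of a regular family of linear
maps. Conversely, the parameters are solutions of systems of linear equations expressing that
certain forms lie in the ideal, and they depend regularly on it by Cramer's rule
(`vreg_of_sections`). The one exception is the support, of which in characteristic dividing `d`
only a Frobenius power is found in this way; this does not matter for the topology. Hence the
transverse curves form an open piece of the family that is homeomorphic to an open subset of affine
space. As every curve of the family is made transverse by a linear change of coordinates, the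
family is irreducible of the same dimension (`irreducible_of_parametrization`). Among the quadruple
lines of type `(ℓ; 2, 2)`, the independence of `f` and `g` modulo `p` is an open condition on the
parameters, which holds for `f = x₂^{ℓ+1}`, `g = x₃^{ℓ+1}`, `p = x₂ (x₂ - x₃)`.
-/
noncomputable section

open Topology

namespace MultipleLines


/-! ### Functions that are regular up to Frobenius -/

section Regular

variable {k : Type*} [Field k]

/-- The polynomial functions on a vector space. -/
def polyFun (k V : Type*) [Field k] [AddCommGroup V] [Module k V] : Subalgebra k (V → k) :=
  Algebra.adjoin k (Set.range fun (φ : Module.Dual k V) (v : V) => φ v)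

theorem mem_polyFun_iff {V : Type*} [AddCommGroup V] [Module k V] {P : V → k} :
    P ∈ polyFun k V ↔ ∃ p : MvPolynomial (Module.Dual k V) k,
      ∀ v, P v = MvPolynomial.aeval (fun φ : Module.Dual k V => φ v) p := by
  have key : ∀ (p : MvPolynomial (Module.Dual k V) k) (v : V),
      MvPolynomial.aeval (fun (φ : Module.Dual k V) (v : V) => φ v) p v =
        MvPolynomial.aeval (fun φ : Module.Dual k V => φ v) p := by
    intro p v
    have := MvPolynomial.comp_aeval_apply (R := k)
      (fun (φ : Module.Dual k V) (v : V) => φ v) (Pi.evalAlgHom k (fun _ : V => k) v) p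
    simpa using this
  rw [polyFun, Algebra.adjoin_range_eq_range_aeval]
  constructor
  · rintro ⟨p, rfl⟩
    exact ⟨p, fun v => key p v⟩
  · rintro ⟨p, hp⟩
    exact ⟨p, funext fun v => (key p v).trans (hp v).symm⟩

theorem isClosed_zariski_iff {V : Type*} [AddCommGroup V] [Module k V] {Z : Set V} :
    IsClosed[zariskiTopology k V] Z ↔
      ∃ A : Set (V → k), A ⊆ polyFun k V ∧ Z = {v | ∀ P ∈ A, P v = 0} := by
  let := zariskiTopology k V
  rw [isClosed_induced_iff]
  constructor
  · rintro ⟨t, ht, rfl⟩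
    obtain ⟨s, rfl⟩ := (PrimeSpectrum.isClosed_iff_zeroLocus t).1 ht
    refine ⟨(fun (p : MvPolynomial (Module.Dual k V) k) (v : V) =>
      MvPolynomial.aeval (fun φ : Module.Dual k V => φ v) p) '' s, ?_, ?_⟩
    · rintro _ ⟨p, -, rfl⟩
      exact mem_polyFun_iff.2 ⟨p, fun v => rfl⟩
    · ext v
      simp only [Set.mem_preimage, PrimeSpectrum.mem_zeroLocus, Set.mem_ofPred_eq,
        Set.forall_mem_image, Set.subset_def, SetLike.mem_coe, MvPolynomial.pointToPoint,
        MvPolynomial.mem_vanishingIdeal_singleton_iff]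
  · rintro ⟨A, hA, rfl⟩
    refine ⟨PrimeSpectrum.zeroLocus {p | (fun v : V =>
      MvPolynomial.aeval (fun φ : Module.Dual k V => φ v) p) ∈ A},
      PrimeSpectrum.isClosed_zeroLocus _, ?_⟩
    ext v
    simp only [Set.mem_preimage, PrimeSpectrum.mem_zeroLocus, Set.mem_ofPred_eq,
      Set.subset_def, SetLike.mem_coe, MvPolynomial.pointToPoint,
      MvPolynomial.mem_vanishingIdeal_singleton_iff]
    constructor
    · intro h P hP
      obtain ⟨p, hp⟩ := mem_polyFun_iff.1 (hA hP)
      rw [hp]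
      refine h p ?_
      rw [← funext hp]
      exact hP
    · exact fun h p hp => h _ hp

theorem isOpen_polyFun_ne_zero {V : Type*} [AddCommGroup V] [Module k V] {P : V → k}
    (hP : P ∈ polyFun k V) : IsOpen[zariskiTopology k V] {v | P v ≠ 0} := by
  let := zariskiTopology k V
  rw [← isClosed_compl_iff, isClosed_zariski_iff]
  exact ⟨{P}, by simpa using hP, by ext; simp⟩

variable {T : Type*} (𝒜 : Subalgebra k (T → k))

/-- Near `t₀`, some power `h ^ (p ^ e)` of `h` (with `p` the characteristic exponent) is a
quotient of functions in `𝒜`. The powers cannot be avoided: when the characteristic divides the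
multiplicity, the ideal of a multiple line determines the equations of its support only up to
Frobenius by means of linear equations. Since a function and its powers have the same zeros, such
functions define the same topology. -/
def RegAt (t₀ : T) (h : T → k) : Prop :=
  ∃ e : ℕ, ∃ P ∈ 𝒜, ∃ Q ∈ 𝒜, Q t₀ ≠ 0 ∧ ∀ t, h t ^ (ringExpChar k ^ e) * Q t = P t

variable {𝒜}

instance : ExpChar k (ringExpChar k) := ringExpChar.expChar k

theorem RegAt.raise {t₀ : T} {h : T → k} {e : ℕ} {P Q : T → k} (hP : P ∈ 𝒜) (hQ : Q ∈ 𝒜)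
    (hQ0 : Q t₀ ≠ 0) (h1 : ∀ t, h t ^ (ringExpChar k ^ e) * Q t = P t) (e' : ℕ) :
    ∃ P' ∈ 𝒜, ∃ Q' ∈ 𝒜, Q' t₀ ≠ 0 ∧ ∀ t, h t ^ (ringExpChar k ^ (e + e')) * Q' t = P' t := by
  refine ⟨P ^ (ringExpChar k ^ e'), pow_mem hP _, Q ^ (ringExpChar k ^ e'), pow_mem hQ _,
    pow_ne_zero _ hQ0, fun t => ?_⟩
  simp only [Pi.pow_apply]
  rw [← h1 t, mul_pow, ← pow_mul, pow_add]

theorem RegAt.common {t₀ : T} {h₁ h₂ : T → k} (H₁ : RegAt 𝒜 t₀ h₁) (H₂ : RegAt 𝒜 t₀ h₂) :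
    ∃ e : ℕ, ∃ P₁ ∈ 𝒜, ∃ Q₁ ∈ 𝒜, ∃ P₂ ∈ 𝒜, ∃ Q₂ ∈ 𝒜, Q₁ t₀ ≠ 0 ∧ Q₂ t₀ ≠ 0 ∧
      (∀ t, h₁ t ^ (ringExpChar k ^ e) * Q₁ t = P₁ t) ∧
      ∀ t, h₂ t ^ (ringExpChar k ^ e) * Q₂ t = P₂ t := by
  obtain ⟨e₁, P₁, hP₁, Q₁, hQ₁, hQ₁0, E₁⟩ := H₁
  obtain ⟨e₂, P₂, hP₂, Q₂, hQ₂, hQ₂0, E₂⟩ := H₂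
  obtain ⟨P₁', a, Q₁', b, c, d⟩ := RegAt.raise hP₁ hQ₁ hQ₁0 E₁ e₂
  obtain ⟨P₂', a', Q₂', b', c', d'⟩ := RegAt.raise hP₂ hQ₂ hQ₂0 E₂ e₁
  exact ⟨e₁ + e₂, P₁', a, Q₁', b, P₂', a', Q₂', b', c, c', d, by rw [add_comm]; exact d'⟩

theorem RegAt.of_mem {h : T → k} (hh : h ∈ 𝒜) (t₀ : T) : RegAt 𝒜 t₀ h :=
  ⟨0, h, hh, 1, one_mem _, one_ne_zero, by simp⟩

theorem RegAt.add {t₀ : T} {h₁ h₂ : T → k} (H₁ : RegAt 𝒜 t₀ h₁) (H₂ : RegAt 𝒜 t₀ h₂) :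
    RegAt 𝒜 t₀ (h₁ + h₂) := by
  obtain ⟨e, P₁, hP₁, Q₁, hQ₁, P₂, hP₂, Q₂, hQ₂, h10, h20, E₁, E₂⟩ := RegAt.common H₁ H₂
  refine ⟨e, P₁ * Q₂ + P₂ * Q₁, add_mem (mul_mem hP₁ hQ₂) (mul_mem hP₂ hQ₁), Q₁ * Q₂,
    mul_mem hQ₁ hQ₂, mul_ne_zero h10 h20, fun t => ?_⟩
  simp only [Pi.add_apply, Pi.mul_apply, add_pow_expChar_pow, ← E₁, ← E₂]
  ring

theorem RegAt.mul {t₀ : T} {h₁ h₂ : T → k} (H₁ : RegAt 𝒜 t₀ h₁) (H₂ : RegAt 𝒜 t₀ h₂) :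
    RegAt 𝒜 t₀ (h₁ * h₂) := by
  obtain ⟨e, P₁, hP₁, Q₁, hQ₁, P₂, hP₂, Q₂, hQ₂, h10, h20, E₁, E₂⟩ := RegAt.common H₁ H₂
  refine ⟨e, P₁ * P₂, mul_mem hP₁ hP₂, Q₁ * Q₂,
    mul_mem hQ₁ hQ₂, mul_ne_zero h10 h20, fun t => ?_⟩
  simp only [Pi.mul_apply, ← E₁, ← E₂]
  ring

/-- A solution of `D h = E` is regular where `D` does not vanish. -/
theorem RegAt.of_mul_eq {t₀ : T} {D E h : T → k} (HD : RegAt 𝒜 t₀ D) (HE : RegAt 𝒜 t₀ E)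
    (hD : D t₀ ≠ 0) (hh : ∀ t, D t * h t = E t) : RegAt 𝒜 t₀ h := by
  obtain ⟨e, P₁, hP₁, Q₁, hQ₁, P₂, hP₂, Q₂, hQ₂, h10, h20, E₁, E₂⟩ := RegAt.common HD HE
  refine ⟨e, P₂ * Q₁, mul_mem hP₂ hQ₁, P₁ * Q₂, mul_mem hP₁ hQ₂, ?_, fun t => ?_⟩
  · simp only [Pi.mul_apply, ← E₁]
    exact mul_ne_zero (mul_ne_zero (pow_ne_zero _ hD) h10) h20
  · simp only [Pi.mul_apply, ← E₁, ← E₂, ← hh, mul_pow]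
    ring

variable (𝒜) in
/-- The algebra of functions that are everywhere regular up to Frobenius. -/
def reg : Subalgebra k (T → k) where
  carrier := {h | ∀ t₀, RegAt 𝒜 t₀ h}
  mul_mem' h₁ h₂ t := (h₁ t).mul (h₂ t)
  add_mem' h₁ h₂ t := (h₁ t).add (h₂ t)
  algebraMap_mem' c t := RegAt.of_mem (𝒜.algebraMap_mem c) t

theorem le_reg : 𝒜 ≤ reg 𝒜 := fun _ hh t => RegAt.of_mem hh t

theorem reg_of_pow {h : T → k} {e : ℕ} (hh : h ^ (ringExpChar k ^ e) ∈ reg 𝒜) : h ∈ reg 𝒜 := by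
  intro t
  obtain ⟨e', P, hP, Q, hQ, h0, E⟩ := hh t
  refine ⟨e + e', P, hP, Q, hQ, h0, fun t => ?_⟩
  rw [← E t, Pi.pow_apply, ← pow_mul, pow_add]

variable (𝒜) in
/-- Maps to a vector space that are regular up to Frobenius: finite sums `∑ hᵢ • vᵢ` with
regular `hᵢ` and constant vectors `vᵢ`. -/
def vreg (V : Type*) [AddCommGroup V] [Module k V] : Submodule k (T → V) :=
  Submodule.span k {F | ∃ h ∈ reg 𝒜, ∃ B : V, F = fun t => h t • B}

section VectorValued

variable {V V' V'' : Type*} [AddCommGroup V] [Module k V] [AddCommGroup V'] [Module k V']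
  [AddCommGroup V''] [Module k V'']

theorem vreg_smul_const {h : T → k} (hh : h ∈ reg 𝒜) (B : V) :
    (fun t => h t • B) ∈ vreg 𝒜 V := Submodule.subset_span ⟨h, hh, B, rfl⟩

theorem vreg_const (B : V) : (fun _ => B) ∈ vreg 𝒜 V := by
  simpa using vreg_smul_const (𝒜 := 𝒜) (one_mem _) B

theorem vreg_linear (L : V →ₗ[k] V') {F : T → V} (hF : F ∈ vreg 𝒜 V) :
    (fun t => L (F t)) ∈ vreg 𝒜 V' := by
  have h : vreg 𝒜 V ≤ (vreg 𝒜 V').comap (L.compLeft T) := by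
    refine Submodule.span_le.2 ?_
    rintro _ ⟨h, hh, B, rfl⟩
    have := vreg_smul_const hh (L B)
    refine Submodule.mem_comap.2 ?_
    convert this using 1
    ext t
    simp
  exact h hF

theorem vreg_smul {h : T → k} (hh : h ∈ reg 𝒜) {F : T → V} (hF : F ∈ vreg 𝒜 V) :
    (fun t => h t • F t) ∈ vreg 𝒜 V := by
  induction hF using Submodule.span_induction with
  | mem F hF =>
    obtain ⟨h', hh', B, rfl⟩ := hF
    have := vreg_smul_const (mul_mem hh hh') B
    simpa [mul_smul] using this
  | zero => convert (vreg 𝒜 V).zero_mem using 1; ext t; simp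
  | add F G _ _ h1 h2 => convert (vreg 𝒜 V).add_mem h1 h2 using 1; ext t; simp
  | smul c F _ h1 =>
    convert (vreg 𝒜 V).smul_mem c h1 using 1
    ext t
    simp [smul_comm c]

theorem vreg_bilin (L : V →ₗ[k] V' →ₗ[k] V'') {F : T → V} (hF : F ∈ vreg 𝒜 V) {G : T → V'}
    (hG : G ∈ vreg 𝒜 V') : (fun t => L (F t) (G t)) ∈ vreg 𝒜 V'' := by
  induction hF using Submodule.span_induction with
  | mem F hF =>
    obtain ⟨h, hh, B, rfl⟩ := hF
    have := vreg_smul hh (vreg_linear (L B) hG)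
    simpa using this
  | zero => convert (vreg 𝒜 V'').zero_mem using 1; ext t; simp
  | add F G _ _ h1 h2 => convert (vreg 𝒜 V'').add_mem h1 h2 using 1; ext t; simp
  | smul c F _ h1 => convert (vreg 𝒜 V'').smul_mem c h1 using 1; ext t; simp

theorem vreg_mul {A : Type*} [CommRing A] [Algebra k A] {F G : T → A} (hF : F ∈ vreg 𝒜 A)
    (hG : G ∈ vreg 𝒜 A) : (fun t => F t * G t) ∈ vreg 𝒜 A :=
  vreg_bilin (LinearMap.mul k A) hF hG

variable (𝒜) in
/-- Algebra valued regular maps form an algebra. -/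
def vregAlg (A : Type*) [CommRing A] [Algebra k A] : Subalgebra k (T → A) where
  toSubsemiring :=
    { carrier := vreg 𝒜 A
      mul_mem' := fun h1 h2 => vreg_mul h1 h2
      one_mem' := vreg_const 1
      add_mem' := fun h1 h2 => (vreg 𝒜 A).add_mem h1 h2
      zero_mem' := (vreg 𝒜 A).zero_mem }
  algebraMap_mem' c := vreg_const (algebraMap k A c)

theorem vreg_scalar {h : T → k} : h ∈ vreg 𝒜 k ↔ h ∈ reg 𝒜 := by
  constructor
  · intro hh
    induction hh using Submodule.span_induction with
    | mem F hF =>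
      obtain ⟨h, hh, B, rfl⟩ := hF
      have := (reg 𝒜).smul_mem hh B
      convert this using 1
      ext t
      simp [mul_comm]
    | zero => exact zero_mem _
    | add F G _ _ h1 h2 => exact add_mem h1 h2
    | smul c F _ h1 => exact (reg 𝒜).smul_mem h1 c
  · intro hh
    simpa using vreg_smul_const hh (1 : k)

theorem vreg_dual (φ : Module.Dual k V) {F : T → V} (hF : F ∈ vreg 𝒜 V) :
    (fun t => φ (F t)) ∈ reg 𝒜 := vreg_scalar.1 (vreg_linear φ hF)

theorem vreg_of_basis {ι : Type*} [Fintype ι] (b : Module.Basis ι k V) {F : T → V}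
    (hF : ∀ i, (fun t => b.repr (F t) i) ∈ reg 𝒜) : F ∈ vreg 𝒜 V := by
  have : F = ∑ i, fun t => b.repr (F t) i • b i := by
    ext1 t
    simp [b.sum_repr]
  rw [this]
  exact Submodule.sum_mem _ fun i _ => vreg_smul_const (hF i) (b i)

theorem vreg_of_dual [Module.Finite k V] {F : T → V}
    (hF : ∀ φ : Module.Dual k V, (fun t => φ (F t)) ∈ reg 𝒜) : F ∈ vreg 𝒜 V :=
  vreg_of_basis (Module.finBasis k V) fun i => hF ((Module.finBasis k V).coord i)

/-- Linear injections preserve and reflect regularity. -/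
theorem vreg_of_injective (L : V →ₗ[k] V') (hL : Function.Injective L) {F : T → V}
    (hF : (fun t => L (F t)) ∈ vreg 𝒜 V') : F ∈ vreg 𝒜 V := by
  obtain ⟨ρ, hρ⟩ := L.exists_leftInverse_of_injective (LinearMap.ker_eq_bot.2 hL)
  have := vreg_linear ρ hF
  convert this using 1
  ext t
  exact (LinearMap.congr_fun hρ (F t)).symm

theorem vreg_sum {ι : Type*} (s : Finset ι) {F : ι → T → V} (hF : ∀ i ∈ s, F i ∈ vreg 𝒜 V) :
    (fun t => ∑ i ∈ s, F i t) ∈ vreg 𝒜 V := by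
  have := Submodule.sum_mem (vreg 𝒜 V) hF
  convert this using 1
  ext t
  simp

theorem reg_matrix {n : Type*} [Fintype n] [DecidableEq n] {M : T → Matrix n n k}
    (hM : ∀ i j, (fun t => M t i j) ∈ reg 𝒜) :
    (fun t => (M t).det) ∈ reg 𝒜 ∧ ∀ i j, (fun t => (M t).adjugate i j) ∈ reg 𝒜 := by
  let N : Matrix n n (reg 𝒜) := fun i j => ⟨fun t => M t i j, hM i j⟩
  let ev : T → (reg 𝒜) →+* k := fun t => (Pi.evalRingHom (fun _ : T => k) t).comp
    (reg 𝒜).val.toRingHom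
  have hN : ∀ t, (ev t).mapMatrix N = M t := fun t => rfl
  constructor
  · have : (fun t => (M t).det) = (N.det : T → k) := by
      ext t
      rw [← hN, ← RingHom.map_det]
      rfl
    rw [this]
    exact N.det.2
  · intro i j
    have : (fun t => (M t).adjugate i j) = (N.adjugate i j : T → k) := by
      ext t
      rw [← hN, ← RingHom.map_adjugate]
      rfl
    rw [this]
    exact (N.adjugate i j).2

/-- If `A t₀` is injective, composition with a left inverse of `A t₀` gives a family of
endomorphisms with regular determinant and adjugate, and determinant one at `t₀`. -/
theorem exists_det_of_injective [Module.Finite k V] {A : T → V →ₗ[k] V'}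
    (hA : ∀ v, (fun t => A t v) ∈ vreg 𝒜 V') (t₀ : T) (h0 : Function.Injective (A t₀)) :
    ∃ ρ : V' →ₗ[k] V, (fun t => LinearMap.det (ρ ∘ₗ A t)) ∈ reg 𝒜 ∧
      LinearMap.det (ρ ∘ₗ A t₀) = 1 ∧
      ∀ i j, (fun t => (LinearMap.toMatrix (Module.finBasis k V) (Module.finBasis k V)
        (ρ ∘ₗ A t)).adjugate i j) ∈ reg 𝒜 := by
  obtain ⟨ρ, hρ⟩ := (A t₀).exists_leftInverse_of_injective (LinearMap.ker_eq_bot.2 h0)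
  let b := Module.finBasis k V
  have := reg_matrix (𝒜 := 𝒜) (M := fun t => LinearMap.toMatrix b b (ρ ∘ₗ A t)) (by
    intro i j
    simp only [LinearMap.toMatrix_apply]
    exact vreg_dual (b.coord i) (vreg_linear ρ (hA (b j))))
  refine ⟨ρ, ?_, by rw [hρ]; exact LinearMap.det_id, this.2⟩
  simpa using this.1

/-- **Cramer's rule.** The unique solution of a regular linear system is regular. -/
theorem vreg_solve [Module.Finite k V] {A : T → V →ₗ[k] V'}
    (hA : ∀ v, (fun t => A t v) ∈ vreg 𝒜 V') (hinj : ∀ t, Function.Injective (A t))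
    {b : T → V'} (hb : b ∈ vreg 𝒜 V') {x : T → V} (hx : ∀ t, A t (x t) = b t) :
    x ∈ vreg 𝒜 V := by
  refine vreg_of_basis (Module.finBasis k V) fun i t₀ => ?_
  obtain ⟨ρ, hdet, h1, hadj⟩ := exists_det_of_injective hA t₀ (hinj t₀)
  let β := Module.finBasis k V
  have hE : (fun t => ∑ j, (LinearMap.toMatrix β β (ρ ∘ₗ A t)).adjugate i j *
      β.repr (ρ (b t)) j) ∈ reg 𝒜 := by
    have : ∀ j ∈ Finset.univ, (fun t => (LinearMap.toMatrix β β (ρ ∘ₗ A t)).adjugate i j) *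
        (fun t => β.repr (ρ (b t)) j) ∈ reg 𝒜 := fun j _ =>
      mul_mem (hadj i j) (vreg_dual (β.coord j) (vreg_linear ρ hb))
    have h2 := sum_mem this
    convert h2 using 1
    ext t
    simp
  refine RegAt.of_mul_eq (hdet t₀) (hE t₀) (by rw [h1]; exact one_ne_zero) fun t => ?_
  have e1 : (LinearMap.toMatrix β β (ρ ∘ₗ A t)).mulVec (β.repr (x t)) = β.repr (ρ (b t)) := by
    rw [LinearMap.toMatrix_mulVec_repr, LinearMap.comp_apply, hx]
  have e2 := congrFun (congrArg (LinearMap.toMatrix β β (ρ ∘ₗ A t)).adjugate.mulVec e1) i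
  rw [Matrix.mulVec_mulVec, Matrix.adjugate_mul, Matrix.smul_mulVec, Matrix.one_mulVec,
    LinearMap.det_toMatrix] at e2
  simpa [Matrix.mulVec, dotProduct] using e2

end VectorValued

theorem polyFun_comp_mem_reg {V : Type*} [AddCommGroup V] [Module k V] {F : T → V}
    (hF : F ∈ vreg 𝒜 V) {P : V → k} (hP : P ∈ polyFun k V) : (fun t => P (F t)) ∈ reg 𝒜 := by
  induction hP using Algebra.adjoin_induction with
  | mem P hP =>
    obtain ⟨φ, rfl⟩ := hP
    exact vreg_dual φ hF
  | algebraMap c => exact (reg 𝒜).algebraMap_mem c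
  | add P Q _ _ h1 h2 => exact add_mem h1 h2
  | mul P Q _ _ h1 h2 => exact mul_mem h1 h2

section Topology

variable [TopologicalSpace T]

theorem isOpen_reg_ne_zero (h𝒜 : ∀ P ∈ 𝒜, IsOpen {t | P t ≠ 0})
    {h : T → k} (hh : h ∈ reg 𝒜) : IsOpen {t | h t ≠ 0} := by
  rw [isOpen_iff_forall_mem_open]
  intro t₀ ht₀
  obtain ⟨e, P, hP, Q, hQ, hQ0, E⟩ := hh t₀
  refine ⟨{t | P t ≠ 0}, fun t ht h0 => ht ?_, h𝒜 P hP, ?_⟩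
  · rw [← E t, h0, zero_pow (pow_ne_zero _ (expChar_pos k _).ne'), zero_mul]
  · change P t₀ ≠ 0
    rw [← E t₀]
    exact mul_ne_zero (pow_ne_zero _ ht₀) hQ0

theorem continuous_of_vreg (h𝒜 : ∀ P ∈ 𝒜, IsOpen {t | P t ≠ 0})
    {V : Type*} [AddCommGroup V] [Module k V] {F : T → V}
    (hF : F ∈ vreg 𝒜 V) : Continuous[_, zariskiTopology k V] F := by
  let := zariskiTopology k V
  rw [continuous_iff_isClosed]
  intro Z hZ
  obtain ⟨A, hA, rfl⟩ := isClosed_zariski_iff.1 hZ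
  have : F ⁻¹' {v | ∀ P ∈ A, P v = 0} = ⋂ P ∈ A, {t | P (F t) = 0} := by
    ext
    simp
  rw [this]
  refine isClosed_biInter fun P hP => ?_
  rw [← isOpen_compl_iff]
  exact isOpen_reg_ne_zero h𝒜 (polyFun_comp_mem_reg hF (hA hP))

theorem isOpen_injective (h𝒜 : ∀ P ∈ 𝒜, IsOpen {t | P t ≠ 0})
    {V V' : Type*} [AddCommGroup V] [Module k V] [AddCommGroup V']
    [Module k V'] [Module.Finite k V] {A : T → V →ₗ[k] V'}
    (hA : ∀ v, (fun t => A t v) ∈ vreg 𝒜 V') : IsOpen {t | Function.Injective (A t)} := by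
  rw [isOpen_iff_forall_mem_open]
  intro t₀ ht₀
  obtain ⟨ρ, hdet, h1, -⟩ := exists_det_of_injective hA t₀ ht₀
  refine ⟨_, fun t ht => ?_, isOpen_reg_ne_zero h𝒜 hdet, by simp [h1]⟩
  have : IsUnit (ρ ∘ₗ A t) := (LinearMap.isUnit_iff_isUnit_det _).2 (isUnit_iff_ne_zero.2 ht)
  have h2 := ((Module.End.isUnit_iff _).1 this).1
  exact Function.Injective.of_comp (f := ρ) (by simpa using h2)

theorem isOpen_surjective (h𝒜 : ∀ P ∈ 𝒜, IsOpen {t | P t ≠ 0})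
    {V V' : Type*} [AddCommGroup V] [Module k V] [AddCommGroup V']
    [Module k V'] [Module.Finite k V'] {A : T → V →ₗ[k] V'}
    (hA : ∀ v, (fun t => A t v) ∈ vreg 𝒜 V') : IsOpen {t | Function.Surjective (A t)} := by
  rw [isOpen_iff_forall_mem_open]
  intro t₀ ht₀
  obtain ⟨σ, hσ⟩ := (A t₀).exists_rightInverse_of_surjective (LinearMap.range_eq_top.2 ht₀)
  have hB : ∀ v, (fun t => (A t ∘ₗ σ) v) ∈ vreg 𝒜 V' := fun v => hA (σ v)
  obtain ⟨ρ, hdet, h1, -⟩ := exists_det_of_injective hB t₀ (by rw [hσ]; exact fun _ _ h => h)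
  refine ⟨_, fun t ht => ?_, isOpen_reg_ne_zero h𝒜 hdet, by
    rw [Set.mem_ofPred_eq, h1]; exact one_ne_zero⟩
  rw [Set.mem_ofPred_eq, LinearMap.det_comp] at ht
  have : IsUnit (A t ∘ₗ σ) :=
    (LinearMap.isUnit_iff_isUnit_det _).2 (isUnit_iff_ne_zero.2 (right_ne_zero_of_mul ht))
  have h2 := ((Module.End.isUnit_iff _).1 this).2
  exact Function.Surjective.of_comp (g := σ) (by simpa using h2)

end Topology

end Regular



/-! ### Irreducibility and dimension of open subsets of affine spaces -/

section AffineSpace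

variable {k : Type*} [Field k]

variable {E : Type*} [AddCommGroup E] [Module k E]

/-- A polynomial function restricted to a line is a polynomial. -/
theorem polyFun_line {P : E → k} (hP : P ∈ polyFun k E) (a b : E) :
    ∃ p : Polynomial k, ∀ t : k, P (a + t • b) = p.eval t := by
  induction hP using Algebra.adjoin_induction with
  | mem P hP =>
    obtain ⟨φ, rfl⟩ := hP
    exact ⟨Polynomial.C (φ a) + Polynomial.C (φ b) * Polynomial.X, fun t => by
      simp only [map_add, map_smul, smul_eq_mul, Polynomial.eval_add, Polynomial.eval_mul,
        Polynomial.eval_C, Polynomial.eval_X, mul_comm t]⟩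
  | algebraMap c => exact ⟨Polynomial.C c, fun t => by simp⟩
  | add P Q _ _ h1 h2 =>
    obtain ⟨p, hp⟩ := h1
    obtain ⟨q, hq⟩ := h2
    exact ⟨p + q, fun t => by simp [hp, hq]⟩
  | mul P Q _ _ h1 h2 =>
    obtain ⟨p, hp⟩ := h1
    obtain ⟨q, hq⟩ := h2
    exact ⟨p * q, fun t => by simp [hp, hq]⟩

theorem exists_on_line [Infinite k] {P Q : E → k} (hP : P ∈ polyFun k E) (hQ : Q ∈ polyFun k E)
    {a b : E} (s₁ s₂ : k) (h1 : P (a + s₁ • b) ≠ 0) (h2 : Q (a + s₂ • b) ≠ 0) (s₀ : k) :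
    ∃ t : k, t ≠ s₀ ∧ P (a + t • b) ≠ 0 ∧ Q (a + t • b) ≠ 0 := by
  obtain ⟨p, hp⟩ := polyFun_line hP a b
  obtain ⟨q, hq⟩ := polyFun_line hQ a b
  rw [hp] at h1
  rw [hq] at h2
  have hp0 : p ≠ 0 := fun h => h1 (by simp [h])
  have hq0 : q ≠ 0 := fun h => h2 (by simp [h])
  have h0 : (Polynomial.X - Polynomial.C s₀) * (p * q) ≠ 0 :=
    mul_ne_zero (Polynomial.X_sub_C_ne_zero s₀) (mul_ne_zero hp0 hq0)
  obtain ⟨t, ht⟩ : ∃ t, ((Polynomial.X - Polynomial.C s₀) * (p * q)).eval t ≠ 0 := by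
    by_contra! h
    exact h0 (Polynomial.funext fun t => by rw [h t, Polynomial.eval_zero])
  simp only [Polynomial.eval_mul, Polynomial.eval_sub, Polynomial.eval_X, Polynomial.eval_C,
    ne_eq, mul_eq_zero, not_or] at ht
  exact ⟨t, fun h => ht.1 (by simp [h]), by rw [hp]; exact ht.2.1, by rw [hq]; exact ht.2.2⟩

theorem polyFun_basis {ι : Type*} [Fintype ι] (b : Module.Basis ι k E) {P : E → k}
    (hP : P ∈ polyFun k E) :
    ∃ p : MvPolynomial ι k, ∀ v, P v = MvPolynomial.aeval (fun i => b.repr v i) p := by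
  induction hP using Algebra.adjoin_induction with
  | mem P hP =>
    obtain ⟨φ, rfl⟩ := hP
    refine ⟨∑ i, MvPolynomial.C (φ (b i)) * MvPolynomial.X i, fun v => ?_⟩
    conv_lhs => rw [← b.sum_repr v]
    simp only [map_sum, map_smul, smul_eq_mul, map_mul, MvPolynomial.aeval_C,
      MvPolynomial.aeval_X, Algebra.algebraMap_self, RingHom.id_apply, mul_comm]
  | algebraMap c => exact ⟨MvPolynomial.C c, fun t => by simp⟩
  | add P Q _ _ h1 h2 =>
    obtain ⟨p, hp⟩ := h1
    obtain ⟨q, hq⟩ := h2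
    exact ⟨p + q, fun t => by simp [hp, hq]⟩
  | mul P Q _ _ h1 h2 =>
    obtain ⟨p, hp⟩ := h1
    obtain ⟨q, hq⟩ := h2
    exact ⟨p * q, fun t => by simp [hp, hq]⟩

/-- The topology of the vector space `E` is its Zariski topology. -/
class IsZariski (k E : Type*) [Field k] [AddCommGroup E] [Module k E] [τ : TopologicalSpace E] :
    Prop where
  eq : τ = zariskiTopology k E

variable [TopologicalSpace E] [hE : IsZariski k E]

theorem isClosed_zar_iff {Z : Set E} :
    IsClosed Z ↔ ∃ A : Set (E → k), A ⊆ polyFun k E ∧ Z = {v : E | ∀ P ∈ A, P v = 0} := by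
  rw [hE.eq]
  exact isClosed_zariski_iff

theorem continuous_zar_iff {T : Type*} [TopologicalSpace T] {F : T → E} :
    Continuous F ↔ Continuous[_, zariskiTopology k E] F := by
  rw [hE.eq]

theorem exists_polyFun_of_isOpen {U : Set E} (hU : IsOpen U) {v : E} (hv : v ∈ U) :
    ∃ P ∈ polyFun k E, P v ≠ 0 ∧ ∀ u, P u ≠ 0 → u ∈ U := by
  obtain ⟨A, hA, hZ⟩ := (isClosed_zar_iff (k := k)).1 hU.isClosed_compl
  have : v ∉ Uᶜ := fun h => h hv
  rw [hZ] at this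
  simp only [Set.mem_ofPred_eq, not_forall] at this
  obtain ⟨P, hP, h0⟩ := this
  refine ⟨P, hA hP, h0, fun u hu => ?_⟩
  by_contra hn
  have hn' : u ∈ Uᶜ := hn
  rw [hZ] at hn'
  exact hu (hn' P hP)

/-- A subset of an open set that contains, with two points, the points of the open set on the
line through them is preirreducible. -/
theorem isPreirreducible_inter_of_lines [Infinite k] {A U : Set E} (hU : IsOpen U)
    (hA : ∀ a ∈ A, ∀ b ∈ A, ∀ t : k, a + t • (b - a) ∈ A) : IsPreirreducible (A ∩ U) := by
  rintro O O' hO hO' ⟨a, ⟨haA, haU⟩, haO⟩ ⟨b, ⟨hbA, hbU⟩, hbO⟩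
  obtain ⟨P, hP, hPa, hPU⟩ := exists_polyFun_of_isOpen (k := k) (hO.inter hU) ⟨haO, haU⟩
  obtain ⟨Q, hQ, hQb, hQU⟩ := exists_polyFun_of_isOpen (k := k) (hO'.inter hU) ⟨hbO, hbU⟩
  obtain ⟨t, -, h1, h2⟩ := exists_on_line hP hQ (a := a) (b := b - a) 0 1
    (by rw [zero_smul, add_zero]; exact hPa)
    (by rw [one_smul]; rwa [add_sub_cancel]) 0
  exact ⟨_, ⟨hA a haA b hbA t, (hPU _ h1).2⟩, (hPU _ h1).1, (hQU _ h2).1⟩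

variable (k) in
theorem isPreirreducible_zar [Infinite k] {U : Set E} (hU : IsOpen U) :
    IsPreirreducible U := by
  simpa using isPreirreducible_inter_of_lines (k := k) (A := Set.univ) hU (by simp)

variable (k E) in
theorem topologicalKrullDim_zar_le [Module.Finite k E] :
    topologicalKrullDim E ≤ (Module.finrank k E : ℕ) := by
  let b := Module.finBasis k E
  let f : E → PrimeSpectrum (MvPolynomial (Fin (Module.finrank k E)) k) :=
    fun v => MvPolynomial.pointToPoint (k := k) (fun i => b.repr v i)
  have hf : IsInducing f := by
    rw [isInducing_iff, TopologicalSpace.ext_iff_isClosed]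
    intro Z
    rw [isClosed_induced_iff, isClosed_zar_iff (k := k)]
    constructor
    · rintro ⟨A, hA, rfl⟩
      refine ⟨PrimeSpectrum.zeroLocus {p | (fun v : E =>
        MvPolynomial.aeval (fun i => b.repr v i) p) ∈ A},
        PrimeSpectrum.isClosed_zeroLocus _, ?_⟩
      ext v
      simp only [Set.mem_preimage, PrimeSpectrum.mem_zeroLocus, Set.mem_ofPred_eq,
        Set.subset_def, SetLike.mem_coe, MvPolynomial.pointToPoint, f,
        MvPolynomial.mem_vanishingIdeal_singleton_iff]
      constructor
      · intro h P hP
        obtain ⟨p, hp⟩ := polyFun_basis b (hA hP)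
        rw [hp]
        refine h p ?_
        rw [← funext hp]
        exact hP
      · exact fun h p hp => h _ hp
    · rintro ⟨t, ht, rfl⟩
      obtain ⟨s, rfl⟩ := (PrimeSpectrum.isClosed_iff_zeroLocus t).1 ht
      refine ⟨(fun (p : MvPolynomial (Fin (Module.finrank k E)) k) (v : E) =>
        MvPolynomial.aeval (fun i => b.repr v i) p) '' s, ?_, ?_⟩
      · rintro _ ⟨p, -, rfl⟩
        refine mem_polyFun_iff.2 ⟨MvPolynomial.rename (fun i => b.coord i) p, fun v => ?_⟩
        rw [MvPolynomial.aeval_rename]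
        rfl
      · ext v
        simp only [Set.mem_preimage, PrimeSpectrum.mem_zeroLocus, Set.mem_ofPred_eq,
          Set.forall_mem_image, Set.subset_def, SetLike.mem_coe, MvPolynomial.pointToPoint, f,
          MvPolynomial.mem_vanishingIdeal_singleton_iff]
  refine hf.topologicalKrullDim_le.trans ?_
  rw [PrimeSpectrum.topologicalKrullDim_eq_ringKrullDim,
    MvPolynomial.ringKrullDim_of_isNoetherianRing, ringKrullDim_eq_zero_of_field]
  simp

theorem isClosed_submodule_zar [Module.Finite k E] (N : Submodule k E) (v₀ : E) :
    IsClosed {v : E | v - v₀ ∈ N} := by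
  rw [isClosed_zar_iff (k := k)]
  obtain ⟨N', hN'⟩ := N.exists_isCompl
  refine ⟨{P | ∃ φ : Module.Dual k E, P = fun v => φ (N'.projection N hN'.symm (v - v₀))}, ?_, ?_⟩
  · rintro _ ⟨φ, rfl⟩
    have : (fun v : E => φ (N'.projection N hN'.symm (v - v₀))) =
        (fun v : E => (φ ∘ₗ N'.projection N hN'.symm) v) -
          algebraMap k (E → k) (φ (N'.projection N hN'.symm v₀)) := by
      ext v
      simp
    rw [this]
    exact sub_mem (Algebra.subset_adjoin ⟨φ ∘ₗ N'.projection N hN'.symm, rfl⟩)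
      ((polyFun k E).algebraMap_mem _)
  · ext v
    rw [Set.mem_ofPred_eq, ← Submodule.projection_apply_eq_zero_iff hN'.symm]
    constructor
    · rintro h _ ⟨φ, rfl⟩
      change φ _ = 0
      rw [h, map_zero]
    · intro h
      by_contra hne
      exact hne ((Module.forall_dual_apply_eq_zero_iff k _).1 fun φ => h _ ⟨φ, rfl⟩)

/-- A nonempty open subset of an affine space has the dimension of the space. -/
theorem topologicalKrullDim_isOpen_zar [Infinite k] [Module.Finite k E] {U : Set E}
    (hU : IsOpen U) (hne : U.Nonempty) :
    topologicalKrullDim U = (Module.finrank k E : ℕ) := by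
  refine le_antisymm ((topologicalKrullDim_subspace_le E U).trans
    (topologicalKrullDim_zar_le k E)) ?_
  obtain ⟨v₀, hv₀⟩ := hne
  set n := Module.finrank k E
  let b : Module.Basis (Fin n) k E := Module.finBasis k E
  -- The intersections of `U` with a full flag of affine subspaces through `v₀` are irreducible.
  let N : ℕ → Submodule k E := fun i => Submodule.span k (b '' {j | (j : ℕ) < i})
  have hmem : ∀ (i : ℕ) (t : k) (v : E), v ∈ N i → v₀ + t • v - v₀ ∈ N i := by
    intro i t v hv
    rw [add_sub_cancel_left]
    exact (N i).smul_mem t hv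
  let Z : ℕ → TopologicalSpace.IrreducibleCloseds U := fun i =>
    { carrier := Subtype.val ⁻¹' {v : E | v - v₀ ∈ N i}
      isIrreducible' := by
        refine ⟨⟨⟨v₀, hv₀⟩, by simp⟩, ?_⟩
        have := isPreirreducible_inter_of_lines (k := k) (A := {v : E | v - v₀ ∈ N i}) hU (by
          intro a ha b hb t
          have h : a + t • (b - a) - v₀ = (a - v₀) + t • ((b - v₀) - (a - v₀)) := by
            rw [sub_sub_sub_cancel_right]; abel
          rw [Set.mem_ofPred_eq, h]
          exact (N i).add_mem ha ((N i).smul_mem t ((N i).sub_mem hb ha)))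
        rintro O O' ⟨O, hO, rfl⟩ ⟨O', hO', rfl⟩ ⟨a, ha, haO⟩ ⟨c, hc, hcO⟩
        obtain ⟨u, ⟨hu, huU⟩, huO⟩ := this O O' hO hO' ⟨a, ⟨ha, a.2⟩, haO⟩ ⟨c, ⟨hc, c.2⟩, hcO⟩
        exact ⟨⟨u, huU⟩, hu, huO⟩
      isClosed' := (isClosed_submodule_zar (N i) v₀).preimage continuous_subtype_val }
  have hlt : ∀ i, i < n → Z i < Z (i + 1) := by
    intro i hi
    refine lt_of_le_of_ne (fun u hu => ?_) fun h => ?_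
    · exact (Submodule.span_mono (Set.image_mono fun j (hj : (j : ℕ) < i) =>
        Set.mem_ofPred.2 (Nat.lt_succ_of_lt hj)) : N i ≤ N (i + 1)) hu
    · obtain ⟨P, hP, hP0, hPU⟩ := exists_polyFun_of_isOpen (k := k) hU hv₀
      obtain ⟨t, ht0, ht, -⟩ := exists_on_line hP hP (a := v₀) (b := b ⟨i, hi⟩) 0 0
        (by simpa using hP0) (by simpa using hP0) 0
      have hb : b ⟨i, hi⟩ ∈ N (i + 1) := Submodule.subset_span ⟨⟨i, hi⟩, Nat.lt_succ_self i, rfl⟩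
      have h1 : (⟨_, hPU _ ht⟩ : U) ∈ Z (i + 1) := hmem (i + 1) t _ hb
      rw [← h] at h1
      have h2 : v₀ + t • b ⟨i, hi⟩ - v₀ ∈ N i := h1
      rw [add_sub_cancel_left, (N i).smul_mem_iff ht0] at h2
      exact (b.linearIndependent.notMem_span_image (s := {j | (j : ℕ) < i})
        (x := ⟨i, hi⟩) (by simp)) h2
  have hmono : StrictMono fun i : Fin (n + 1) => Z i := by
    rw [Fin.strictMono_iff_lt_succ]
    intro i
    exact hlt i i.2
  exact Order.LTSeries.length_le_krullDim (LTSeries.mk n (fun i => Z i) hmono)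

end AffineSpace

/-- The dimension can be bounded on an open cover. -/
theorem topologicalKrullDim_le_of_cover {X : Type*} [TopologicalSpace X] {N : ℕ}
    (h : ∀ x : X, ∃ O : Set X, IsOpen O ∧ x ∈ O ∧ topologicalKrullDim O ≤ N) :
    topologicalKrullDim X ≤ N := by
  refine iSup_le fun l => ?_
  obtain ⟨x, hx⟩ := l.head.isIrreducible.nonempty
  obtain ⟨O, hO, hxO, hdim⟩ := h x
  let e := TopologicalSpace.IrreducibleCloseds.orderIsoOfIsOpenEmbedding
    (Subtype.val : O → X) hO.isOpenEmbedding_subtypeVal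
  let l' : LTSeries {V : TopologicalSpace.IrreducibleCloseds X |
      ((Subtype.val : O → X) ⁻¹' V).Nonempty} :=
    LTSeries.mk l.length (fun i => ⟨l i, ⟨⟨x, hxO⟩, (l.monotone (Fin.zero_le i) :) hx⟩⟩)
      fun i j hij => l.strictMono hij
  exact (Order.LTSeries.length_le_krullDim (l'.map e.symm e.symm.strictMono)).trans hdim



/-! ### The Grassmannian -/

section Coordinates

variable {k : Type*} [Field k] {T : Type*} {V V' : Type*} [AddCommGroup V] [Module k V]
  [AddCommGroup V'] [Module k V']

/-- The functions on `T` that are polynomial in the coordinates `ι : T → V`. -/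
def coordAlg (k : Type*) [Field k] {T V : Type*} [AddCommGroup V] [Module k V] (ι : T → V) :
    Subalgebra k (T → k) :=
  (polyFun k V).map (AlgHom.pi fun t => Pi.evalAlgHom k (fun _ : V => k) (ι t))

theorem mem_coordAlg {ι : T → V} {h : T → k} :
    h ∈ coordAlg k ι ↔ ∃ P ∈ polyFun k V, (fun t => P (ι t)) = h := Iff.rfl

theorem isOpen_coordAlg [TopologicalSpace T] {ι : T → V}
    (hι : Continuous[_, zariskiTopology k V] ι) :
    ∀ P ∈ coordAlg k ι, IsOpen {t | P t ≠ 0} := by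
  rintro _ ⟨P, hP, rfl⟩
  let := zariskiTopology k V
  exact (isOpen_polyFun_ne_zero hP).preimage hι

theorem vreg_coord [Module.Finite k V] (ι : T → V) : ι ∈ vreg (coordAlg k ι) V :=
  vreg_of_dual fun φ => le_reg (mem_coordAlg.2
    ⟨fun v => φ v, Algebra.subset_adjoin ⟨φ, rfl⟩, rfl⟩)

theorem reg_comp {T' : Type*} {𝒜 : Subalgebra k (T → k)} {𝒜' : Subalgebra k (T' → k)} {g : T' → T}
    (hg : ∀ P ∈ 𝒜, (fun t => P (g t)) ∈ 𝒜') {h : T → k} (hh : h ∈ reg 𝒜) :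
    (fun t => h (g t)) ∈ reg 𝒜' := by
  intro t
  obtain ⟨e, P, hP, Q, hQ, h0, E⟩ := hh (g t)
  exact ⟨e, _, hg P hP, _, hg Q hQ, h0, fun t => E (g t)⟩

theorem vreg_comp {T' : Type*} {𝒜 : Subalgebra k (T → k)} {𝒜' : Subalgebra k (T' → k)}
    {g : T' → T} (hg : ∀ P ∈ 𝒜, (fun t => P (g t)) ∈ 𝒜') {F : T → V} (hF : F ∈ vreg 𝒜 V) :
    (fun t => F (g t)) ∈ vreg 𝒜' V := by
  induction hF using Submodule.span_induction with
  | mem F hF =>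
    obtain ⟨h, hh, B, rfl⟩ := hF
    exact vreg_smul_const (reg_comp hg hh) B
  | zero => exact (vreg 𝒜' V).zero_mem
  | add F G _ _ h1 h2 => exact (vreg 𝒜' V).add_mem h1 h2
  | smul c F _ h1 => exact (vreg 𝒜' V).smul_mem c h1

theorem coordAlg_comp {T' : Type*} (ι : T → V) (g : T' → T) :
    ∀ P ∈ coordAlg k ι, (fun t => P (g t)) ∈ coordAlg k (fun t => ι (g t)) := by
  rintro _ ⟨P, hP, rfl⟩
  exact ⟨P, hP, rfl⟩

theorem vreg_pi {𝒜 : Subalgebra k (T → k)} {n : Type*} [Fintype n] [DecidableEq n]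
    {F : T → n → V} (hF : ∀ i, (fun t => F t i) ∈ vreg 𝒜 V) : F ∈ vreg 𝒜 (n → V) := by
  have h := vreg_sum Finset.univ fun i _ =>
    vreg_linear (LinearMap.single k (fun _ : n => V) i) (hF i)
  convert h using 1
  ext t i
  simp [Finset.sum_apply, Pi.single_apply]

theorem vreg_hom [Module.Finite k V] {𝒜 : Subalgebra k (T → k)} {F : T → V →ₗ[k] V'}
    (hF : ∀ v, (fun t => F t v) ∈ vreg 𝒜 V') : F ∈ vreg 𝒜 (V →ₗ[k] V') := by
  let b := Module.finBasis k V
  have h := vreg_sum Finset.univ fun i _ =>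
    vreg_linear (LinearMap.smulRightₗ (b.coord i)) (hF (b i))
  convert h using 1
  ext t v
  have hv : F t v = F t (∑ i, b.repr v i • b i) := by rw [b.sum_repr]
  rw [hv, map_sum]
  simp [LinearMap.sum_apply]

end Coordinates

section Grassmannian

variable {k : Type*} [Field k] {V : Type*} [AddCommGroup V] [Module k V]

/-- The subspace underlying a point of the Grassmannian. -/
def Grassmannian.sub (S : Grassmannian k V) : Submodule k V := S

/-- The point of the Grassmannian given by a subspace. -/
def toGr (S : Submodule k V) : Grassmannian k V := S

/-- The vectors of a frame. -/
def Frame.vec {r : ℕ} (v : Frame k V r) : Fin r → V := v.1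

/-- The frame given by linearly independent vectors. -/
def Frame.mk {r : ℕ} (v : Fin r → V) (hv : LinearIndependent k v) : Frame k V r := ⟨v, hv⟩

theorem Frame.linearIndependent {r : ℕ} (v : Frame k V r) : LinearIndependent k v.vec := v.2

theorem isOpen_grassmannian_iff {U : Set (Grassmannian k V)} :
    IsOpen U ↔ ∀ r, IsOpen {v : Frame k V r | toGr (Submodule.span k (Set.range v.vec)) ∈ U} := by
  refine Iff.trans (isOpen_coinduced (f := fun p : (Σ r : ℕ, Frame k V r) =>
    toGr (Submodule.span k (Set.range p.2.vec)))) ?_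
  rw [isOpen_sigma_iff]
  rfl

theorem continuous_span (r : ℕ) : Continuous fun v : Frame k V r =>
    toGr (Submodule.span k (Set.range v.vec)) := by
  rw [continuous_def]
  exact fun U hU => isOpen_grassmannian_iff.1 hU r

/-- The regular functions on the space of frames. -/
abbrev frameAlg (k V : Type*) [Field k] [AddCommGroup V] [Module k V] (r : ℕ) :
    Subalgebra k (Frame k V r → k) := coordAlg k (fun v : Frame k V r => v.vec)

theorem isOpen_frameAlg (r : ℕ) : ∀ P ∈ frameAlg k V r, IsOpen {v | P v ≠ 0} := by
  let := zariskiTopology k (Fin r → V)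
  exact isOpen_coordAlg continuous_induced_dom

theorem vreg_frame [Module.Finite k V] (r : ℕ) (i : Fin r) :
    (fun v : Frame k V r => v.vec i) ∈ vreg (frameAlg k V r) V :=
  vreg_linear (LinearMap.proj i) (vreg_coord (k := k) (fun v : Frame k V r => v.vec))

theorem continuous_frame {T : Type*} [TopologicalSpace T] {𝒜 : Subalgebra k (T → k)}
    (h𝒜 : ∀ P ∈ 𝒜, IsOpen {t | P t ≠ 0}) {r : ℕ} {F : T → Frame k V r}
    (hF : ∀ i, (fun t => (F t).vec i) ∈ vreg 𝒜 V) : Continuous F := by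
  let := zariskiTopology k (Fin r → V)
  exact continuous_induced_rng.2 (continuous_of_vreg h𝒜 (vreg_pi hF))

/-- The map `k ^ r × W → V` given by an `r`-tuple of vectors and the inclusion of `W`. -/
def frameSum {r : ℕ} (v : Fin r → V) (W : Submodule k V) : (Fin r → k) × W →ₗ[k] V :=
  (Fintype.linearCombination k v).coprod W.subtype

theorem vreg_frameSum [Module.Finite k V] {r : ℕ} (W : Submodule k V) (x : (Fin r → k) × W) :
    (fun v : Frame k V r => frameSum v.vec W x) ∈ vreg (frameAlg k V r) V := by
  simp only [frameSum, LinearMap.coprod_apply, Fintype.linearCombination_apply]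
  exact (vreg _ V).add_mem (vreg_sum _ fun i _ => (vreg _ V).smul_mem (x.1 i) (vreg_frame r i))
    (vreg_const _)

theorem range_frameSum {r : ℕ} (v : Fin r → V) (W : Submodule k V) :
    LinearMap.range (frameSum v W) = Submodule.span k (Set.range v) ⊔ W := by
  rw [frameSum, LinearMap.range_coprod, Fintype.range_linearCombination, Submodule.range_subtype]

theorem injective_frameSum_iff {r : ℕ} (v : Frame k V r) (W : Submodule k V) :
    Function.Injective (frameSum v.vec W) ↔ Disjoint (Submodule.span k (Set.range v.vec)) W := by
  rw [← LinearMap.ker_eq_bot, frameSum, Submodule.disjoint_def]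
  constructor
  · intro h u hu huW
    rw [← Fintype.range_linearCombination] at hu
    obtain ⟨c, rfl⟩ := hu
    have h1 : (c, -(⟨_, huW⟩ : W)) ∈ LinearMap.ker
        ((Fintype.linearCombination k v.vec).coprod W.subtype) := by
      simp
    rw [h, Submodule.mem_bot, Prod.mk_eq_zero] at h1
    rw [h1.1, map_zero]
  · intro h
    rw [LinearMap.ker_eq_bot']
    rintro ⟨c, w⟩ hcw
    rw [LinearMap.coprod_apply] at hcw
    have h1 := h (Fintype.linearCombination k v.vec c)
      (by rw [← Fintype.range_linearCombination]; exact ⟨c, rfl⟩)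
      (by rw [eq_neg_of_add_eq_zero_left hcw]; exact W.neg_mem w.2)
    rw [h1, zero_add] at hcw
    have h2 : c = 0 := funext (Fintype.linearIndependent_iff.1 v.linearIndependent c h1)
    have h3 : w = 0 := Subtype.ext hcw
    rw [h2, h3, Prod.mk_zero_zero]

/-- The affine chart of the Grassmannian of complements of `W`. -/
abbrev Chart (k : Type*) {V : Type*} [Field k] [AddCommGroup V] [Module k V] (W : Submodule k V) :=
  {S : Grassmannian k V // IsCompl S.sub W}

/-- The affine coordinates on the chart of complements of `W`: the projection along `W`. -/
def Chart.proj {W : Submodule k V} (S : Chart k W) : V →ₗ[k] V :=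
  Submodule.projection S.1.sub W S.2

theorem Chart.proj_eq_iff {W : Submodule k V} (S : Chart k W) (v : V) :
    S.proj v = v ↔ v ∈ S.1.sub :=
  ⟨fun h => h ▸ Submodule.projection_apply_mem _ v,
    fun h => Submodule.projection_apply_of_mem_left _ h⟩

variable [Module.Finite k V]

/-- Being transverse to a fixed subspace is an open condition. -/
theorem isOpen_sup_eq_top (W : Submodule k V) :
    IsOpen {S : Grassmannian k V | S.sub ⊔ W = ⊤} := by
  rw [isOpen_grassmannian_iff]
  intro r
  convert isOpen_surjective (isOpen_frameAlg r) (fun x => vreg_frameSum (r := r) W x) using 1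
  ext v
  change _ ↔ Function.Surjective _
  rw [Set.mem_ofPred_eq, ← LinearMap.range_eq_top, range_frameSum]
  rfl

theorem isOpen_isCompl (W : Submodule k V) :
    IsOpen {S : Grassmannian k V | IsCompl S.sub W} := by
  rw [isOpen_grassmannian_iff]
  intro r
  have h1 := isOpen_injective (isOpen_frameAlg r) (fun x => vreg_frameSum (r := r) W x)
  have h2 := isOpen_surjective (isOpen_frameAlg r) (fun x => vreg_frameSum (r := r) W x)
  convert h1.inter h2 using 1
  ext v
  simp only [Set.mem_inter_iff, Set.mem_ofPred_eq, injective_frameSum_iff,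
    ← LinearMap.range_eq_top, range_frameSum, ← codisjoint_iff]
  exact isCompl_iff

/-- Polynomial functions of the affine coordinates are continuous on a chart: pulled back to frames
the coordinates are regular, being the solutions of the linear systems which express vectors by a
frame and a basis of the complement. -/
theorem isOpen_chart (W : Submodule k V) :
    ∀ P ∈ coordAlg k (Chart.proj (k := k) (W := W)), IsOpen {t | P t ≠ 0} := by
  rintro _ ⟨P, hP, rfl⟩
  suffices h : IsOpen {S : Grassmannian k V | ∃ h : IsCompl S.sub W,
      P (Chart.proj ⟨S, h⟩) ≠ 0} by
    convert h.preimage continuous_subtype_val using 1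
    ext S
    exact ⟨fun h => ⟨S.2, h⟩, fun ⟨_, h⟩ => h⟩
  rw [isOpen_grassmannian_iff]
  intro r
  let T' : Set (Frame k V r) := {v | IsCompl (Submodule.span k (Set.range v.vec)) W}
  have hT' : IsOpen T' := isOpen_grassmannian_iff.1 (isOpen_isCompl W) r
  let g : T' → Chart k W := fun v => ⟨toGr (Submodule.span k (Set.range v.1.vec)), v.2⟩
  let 𝒜 := coordAlg k (fun v : T' => v.1.vec)
  have h𝒜 : ∀ P ∈ 𝒜, IsOpen {t | P t ≠ 0} := by
    let := zariskiTopology k (Fin r → V)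
    exact isOpen_coordAlg (continuous_induced_dom.comp continuous_subtype_val)
  have hA : ∀ x, (fun v : T' => frameSum v.1.vec W x) ∈ vreg 𝒜 V := fun x =>
    vreg_comp (coordAlg_comp _ _) (vreg_frameSum W x)
  have hinj : ∀ v : T', Function.Injective (frameSum v.1.vec W) := fun v =>
    (injective_frameSum_iff v.1 W).2 v.2.disjoint
  have hsurj : ∀ v : T', Function.Surjective (frameSum v.1.vec W) := fun v => by
    rw [← LinearMap.range_eq_top, range_frameSum]
    exact v.2.sup_eq_top
  have hreg : (fun v : T' => (g v).proj) ∈ vreg 𝒜 (V →ₗ[k] V) := by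
    have h1 : ∀ u : V, (fun v : T' => (g v).proj u) ∈ vreg 𝒜 V := by
      intro u
      choose x hx using fun v => hsurj v u
      have hxr := vreg_solve hA hinj (vreg_const u) hx
      have h2 := vreg_sum Finset.univ fun i (_ : i ∈ Finset.univ) =>
        vreg_smul (vreg_dual (LinearMap.proj i ∘ₗ LinearMap.fst k _ W) hxr)
          (vreg_comp (𝒜' := 𝒜) (g := (Subtype.val : T' → Frame k V r))
            (coordAlg_comp _ _) (vreg_frame (k := k) (V := V) r i))
      convert h2 using 1
      ext v
      have e1 := hx v
      rw [frameSum, LinearMap.coprod_apply, Fintype.linearCombination_apply] at e1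
      have hs : ∑ i, (x v).1 i • v.1.vec i ∈ Submodule.span k (Set.range v.1.vec) :=
        Submodule.sum_mem _ fun i _ => Submodule.smul_mem _ _ (Submodule.subset_span ⟨i, rfl⟩)
      have e2 : (g v).proj u = ∑ i, (x v).1 i • v.1.vec i := by
        conv_lhs => rw [← e1]
        rw [map_add, (Chart.proj_eq_iff (g v) _).2 hs]
        have : (g v).proj (W.subtype (x v).2) = 0 :=
          (Submodule.projection_apply_eq_zero_iff _).2 (x v).2.2
        rw [this, add_zero]
      exact e2
    exact vreg_hom h1
  have hopen := isOpen_reg_ne_zero h𝒜 (polyFun_comp_mem_reg hreg hP)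
  convert hT'.isOpenMap_subtype_val _ hopen using 1
  ext v
  constructor
  · rintro ⟨h, hv⟩
    exact ⟨⟨v, h⟩, hv, rfl⟩
  · rintro ⟨v, hv, rfl⟩
    exact ⟨v.2, hv⟩

/-- Kernels of constant dimension of a regular family of linear maps vary continuously. -/
theorem continuous_ker {T V' : Type*} [TopologicalSpace T] [AddCommGroup V'] [Module k V']
    {𝒜 : Subalgebra k (T → k)} (h𝒜 : ∀ P ∈ 𝒜, IsOpen {t | P t ≠ 0}) {A : T → V →ₗ[k] V'}
    (hA : ∀ v, (fun t => A t v) ∈ vreg 𝒜 V') {r : ℕ}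
    (hr : ∀ t, Module.finrank k (LinearMap.ker (A t)) = r) :
    Continuous fun t => toGr (LinearMap.ker (A t)) := by
  rw [continuous_iff_continuousAt]
  intro t₀
  let N₀ := LinearMap.ker (A t₀)
  obtain ⟨N₁, hN⟩ := N₀.exists_isCompl
  obtain ⟨ρ, hρ⟩ := (A t₀ ∘ₗ N₁.subtype).exists_leftInverse_of_injective (by
    rw [LinearMap.ker_eq_bot']
    intro x hx
    have : (x : V) ∈ N₀ ⊓ N₁ := ⟨hx, x.2⟩
    rw [hN.inf_eq_bot] at this
    exact Subtype.ext this)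
  let π := N₀.projection N₁ hN
  -- `M t` is the identity for `t = t₀` and maps the kernel of `A t` to that of `A t₀`; where it is
  -- bijective, it gives a frame of the kernel of `A t`.
  let M : T → V →ₗ[k] V := fun t => π + N₁.subtype ∘ₗ ρ ∘ₗ A t
  have hM : ∀ v, (fun t => M t v) ∈ vreg 𝒜 V := fun v =>
    (vreg 𝒜 V).add_mem (vreg_const (π v)) (vreg_linear (N₁.subtype ∘ₗ ρ) (hA v))
  have hM0 : M t₀ = LinearMap.id := by
    ext v
    obtain ⟨a, ha, b, hb, rfl⟩ :=
      Submodule.mem_sup.1 (hN.sup_eq_top ▸ Submodule.mem_top : v ∈ N₀ ⊔ N₁)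
    have h1 : A t₀ a = 0 := ha
    have h2 : ρ (A t₀ b) = ⟨b, hb⟩ := LinearMap.congr_fun hρ ⟨b, hb⟩
    have h3 : π a = a := Submodule.projection_apply_of_mem_left _ ha
    have h4 : π b = 0 := (Submodule.projection_apply_eq_zero_iff _).2 hb
    simp [M, h1, h2, h3, h4]
  let O : Set T := {t | Function.Injective (M t)}
  have hO : IsOpen O := isOpen_injective h𝒜 hM
  have ht₀ : t₀ ∈ O := by
    change Function.Injective (M t₀)
    rw [hM0]
    exact fun _ _ h => h
  let b : Module.Basis (Fin r) k N₀ := Module.finBasisOfFinrankEq k N₀ (hr t₀)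
  have hbij : ∀ t : O, Function.Bijective (M t) := fun t =>
    ⟨t.2, LinearMap.injective_iff_surjective.1 t.2⟩
  choose x hx using fun (i : Fin r) (t : O) => (hbij t).2 (b i)
  have hli : ∀ t : O, LinearIndependent k fun i => x i t := by
    intro t
    refine LinearIndependent.of_comp (M t) ?_
    have : (M t ∘ fun i => x i t) = fun i => (b i : V) := funext fun i => hx i t
    rw [this]
    exact b.linearIndependent.map' N₀.subtype (Submodule.ker_subtype _)
  have hspan : ∀ t : O, Submodule.span k (Set.range fun i => x i t) = LinearMap.ker (A t) := by
    intro t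
    have h1 : LinearMap.ker (A t) ≤ N₀.comap (M t) := by
      intro v hv
      have : M t v = π v := by simp [M, LinearMap.mem_ker.1 hv]
      rw [Submodule.mem_comap, this]
      exact Submodule.projection_apply_mem _ v
    have h2 : Submodule.span k (Set.range fun i => x i t) ≤ N₀.comap (M t) := by
      rw [Submodule.span_le]
      rintro _ ⟨i, rfl⟩
      change M t (x i t) ∈ N₀
      rw [hx]
      exact (b i).2
    have h3 : Module.finrank k (N₀.comap (M t)) = r := by
      rw [← hr t₀]
      exact (Submodule.equivMapOfInjective (M t) t.2 _).finrank_eq.trans (by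
        rw [Submodule.map_comap_eq_of_surjective (hbij t).2])
    rw [Submodule.eq_of_le_of_finrank_eq h2 (by
      rw [h3, finrank_span_eq_card (hli t), Fintype.card_fin]),
      Submodule.eq_of_le_of_finrank_eq h1 (by rw [h3, hr])]
  refine ContinuousOn.continuousAt (s := O) ?_ (hO.mem_nhds ht₀)
  rw [continuousOn_iff_continuous_domRestrict]
  let 𝒜' : Subalgebra k (O → k) := 𝒜.map (AlgHom.pi fun t => Pi.evalAlgHom k (fun _ : T => k) t.1)
  have h𝒜' : ∀ P ∈ 𝒜', IsOpen {t | P t ≠ 0} := by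
    rintro _ ⟨P, hP, rfl⟩
    exact (h𝒜 P hP).preimage continuous_subtype_val
  have hcomp : ∀ P ∈ 𝒜, (fun t : O => P t) ∈ 𝒜' := fun P hP => ⟨P, hP, rfl⟩
  have hF : Continuous fun t : O => Frame.mk (fun i => x i t) (hli t) :=
    continuous_frame h𝒜' fun i => show (fun t : O => x i t) ∈ vreg 𝒜' V from
      vreg_solve (fun v => vreg_comp hcomp (hM v)) (fun t => t.2) (vreg_const (b i : V)) (hx i)
  convert (continuous_span r).comp hF using 1
  ext1 t
  exact (hspan t).symm

/-- The images of a fixed subspace under a regular family of injective maps vary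
continuously. -/
theorem continuous_map_subspace {T : Type*} [TopologicalSpace T]
    {𝒜 : Subalgebra k (T → k)} (h𝒜 : ∀ P ∈ 𝒜, IsOpen {t | P t ≠ 0}) {A : T → V →ₗ[k] V}
    (hA : ∀ v, (fun t => A t v) ∈ vreg 𝒜 V) (hinj : ∀ t, Function.Injective (A t))
    (S : Submodule k V) :
    Continuous fun t => toGr (S.map (A t)) := by
  let b := Module.finBasis k S
  have hli : ∀ t, LinearIndependent k fun i => A t (b i) := fun t =>
    (b.linearIndependent.map' S.subtype (Submodule.ker_subtype _)).map' (A t)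
      (LinearMap.ker_eq_bot.2 (hinj t))
  have hF : Continuous fun t => Frame.mk (fun i => A t (b i)) (hli t) :=
    continuous_frame h𝒜 fun i => hA (b i)
  convert (continuous_span _).comp hF using 1
  ext1 t
  change S.map (A t) = Submodule.span k (Set.range fun i => A t (b i))
  have : (Set.range fun i => A t (b i)) = A t '' (S.subtype '' Set.range b) := by
    rw [← Set.range_comp, ← Set.range_comp]
    rfl
  rw [this, ← Submodule.map_span, ← Submodule.map_span, b.span_eq, Submodule.map_top,
    Submodule.range_subtype]

theorem continuous_map_equiv (e : V ≃ₗ[k] V) :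
    Continuous fun S : Grassmannian k V =>
      toGr (S.sub.map (e : V →ₗ[k] V)) := by
  rw [continuous_def]
  intro U hU
  rw [isOpen_grassmannian_iff] at hU ⊢
  intro r
  have hF : Continuous fun v : Frame k V r => Frame.mk (fun i => e (v.vec i))
      (v.linearIndependent.map' (e : V →ₗ[k] V) e.ker) :=
    continuous_frame (isOpen_frameAlg r) fun i => vreg_linear (e : V →ₗ[k] V) (vreg_frame r i)
  convert (hU r).preimage hF using 1
  ext v
  change toGr (Submodule.map _ (Submodule.span k (Set.range v.vec))) ∈ U ↔ _
  rw [Submodule.map_span, ← Set.range_comp]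
  rfl

end Grassmannian


/-! ### Families with a group action and a parametrized open subset -/

section Framework

variable {k : Type*} [Field k] {V : Type*} [AddCommGroup V] [Module k V] [Module.Finite k V]

/-- A continuous injective family of subspaces is an embedding if the parameter is, on each affine
chart of the Grassmannian, a regular function of the affine coordinates. -/
theorem isInducing_of_vreg_chart {E : Type*} [AddCommGroup E] [Module k E]
    [TopologicalSpace E] [IsZariski k E] {Θ : Set E} {φ : Θ → Grassmannian k V}
    (hφ : Continuous φ)
    (hψ : ∀ W : Submodule k V,
      (fun t : {θ : Θ // IsCompl (φ θ).sub W} => (t.1 : E)) ∈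
        vreg (coordAlg k fun t : {θ : Θ // IsCompl (φ θ).sub W} =>
          Chart.proj (⟨φ t.1, t.2⟩ : Chart k W)) E) :
    IsInducing φ := by
  rw [isInducing_iff_nhds]
  intro θ₀
  refine le_antisymm (map_le_iff_le_comap.1 hφ.continuousAt) fun O hO => ?_
  obtain ⟨W, hW⟩ := (φ θ₀).sub.exists_isCompl
  let T := {θ : Θ // IsCompl (φ θ).sub W}
  let g : T → Chart k W := fun t => ⟨φ t.1, t.2⟩
  let τ : TopologicalSpace T := TopologicalSpace.induced g inferInstance
  have hg : Continuous g := continuous_induced_dom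
  have h𝒜 : ∀ P ∈ coordAlg k (fun t : T => (g t).proj), IsOpen {t | P t ≠ 0} := by
    rintro _ ⟨P, hP, rfl⟩
    exact (isOpen_chart W _ ⟨P, hP, rfl⟩).preimage hg
  have hc : Continuous fun t : T => (t.1 : E) :=
    continuous_zar_iff.2 (continuous_of_vreg h𝒜 (hψ W))
  obtain ⟨O', hO', hOO', hθO'⟩ := mem_nhds_iff.1 hO
  obtain ⟨O'', hO'', rfl⟩ := hOO'
  obtain ⟨G, hG, hGO⟩ := hO''.preimage hc
  have hGO' := Set.ext_iff.1 hGO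
  obtain ⟨G', hG', rfl⟩ := hG
  refine mem_comap.2 ⟨G' ∩ {S | IsCompl S.sub W}, (hG'.inter (isOpen_isCompl W)).mem_nhds
    ⟨(hGO' ⟨θ₀, hW⟩).2 hθO', hW⟩, ?_⟩
  rintro θ ⟨h1, h2⟩
  exact hO' ((hGO' ⟨θ, h2⟩).1 h1)

variable {G : Type*} [Group G]

/-- A set of subspaces, stable under an irreducible group, of which every orbit meets an
irreducible open subset, is irreducible. -/
theorem isIrreducible_of_orbits [TopologicalSpace G] [PreirreducibleSpace G]
    {𝒜 : Subalgebra k (G → k)}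
    (h𝒜 : ∀ P ∈ 𝒜, IsOpen {t | P t ≠ 0}) (ρ : G →* (V ≃ₗ[k] V))
    (hρ : ∀ v, (fun g => ρ g v) ∈ vreg 𝒜 V) {X U : Set (Grassmannian k V)}
    (hX : ∀ g, ∀ S ∈ X, toGr (S.sub.map (ρ g : V →ₗ[k] V)) ∈ X)
    (horb : ∀ S ∈ X, ∃ g, toGr (S.sub.map (ρ g : V →ₗ[k] V)) ∈ U) (hirr : IsIrreducible (X ∩ U)) :
    IsIrreducible X := by
  have hinv : ∀ g S, toGr ((toGr (S.sub.map (ρ g : V →ₗ[k] V))).sub.map (ρ g⁻¹ : V →ₗ[k] V)) = S := by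
    intro g S
    change toGr (Submodule.map _ (Submodule.map _ S.sub)) = S
    rw [← Submodule.map_comp]
    have : (ρ g⁻¹ : V →ₗ[k] V) ∘ₗ (ρ g : V →ₗ[k] V) = LinearMap.id := by
      ext v
      change (ρ g⁻¹ * ρ g) v = v
      rw [← map_mul, inv_mul_cancel, map_one]
      rfl
    rw [this, Submodule.map_id]
    rfl
  refine ⟨hirr.nonempty.mono Set.inter_subset_left, ?_⟩
  rintro O O' hO hO' ⟨S, hS, hSO⟩ ⟨S', hS', hSO'⟩
  obtain ⟨g, hg⟩ := horb S hS
  obtain ⟨g', hg'⟩ := horb S' hS'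
  obtain ⟨S'', ⟨hS''X, -⟩, hS''O, hS''O'⟩ := hirr.2 _ _
    (hO.preimage (continuous_map_equiv (ρ g⁻¹))) (hO'.preimage (continuous_map_equiv (ρ g'⁻¹)))
    ⟨_, ⟨hX g S hS, hg⟩, by rw [Set.mem_preimage, hinv]; exact hSO⟩
    ⟨_, ⟨hX g' S' hS', hg'⟩, by rw [Set.mem_preimage, hinv]; exact hSO'⟩
  have hc := continuous_map_subspace h𝒜 hρ (fun g => (ρ g).injective) S''.sub
  obtain ⟨h, hh, hh'⟩ := nonempty_preirreducible_inter (hO.preimage hc) (hO'.preimage hc)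
    ⟨_, hS''O⟩ ⟨_, hS''O'⟩
  exact ⟨_, hX h S'' hS''X, hh, hh'⟩

/-- The dimension of a set of subspaces, stable under a group, of which every orbit meets an open
subset that is homeomorphic to an open subset of an affine space. -/
theorem topologicalKrullDim_of_orbits [Infinite k] (ρ : G →* (V ≃ₗ[k] V))
    {X U : Set (Grassmannian k V)}
    (hX : ∀ g, ∀ S ∈ X, toGr (S.sub.map (ρ g : V →ₗ[k] V)) ∈ X) (hU : IsOpen U)
    (horb : ∀ S ∈ X, ∃ g, toGr (S.sub.map (ρ g : V →ₗ[k] V)) ∈ U)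
    {E : Type*} [AddCommGroup E] [Module k E] [Module.Finite k E]
    [TopologicalSpace E] [IsZariski k E] {Θ : Set E} (hΘ : IsOpen Θ) (hne : Θ.Nonempty)
    {φ : Θ → Grassmannian k V} (hφ : IsInducing φ) (hinj : Function.Injective φ)
    (hrange : Set.range φ = X ∩ U) :
    topologicalKrullDim X = Module.finrank k E := by
  have hdim := topologicalKrullDim_isOpen_zar (k := k) hΘ hne
  refine le_antisymm (topologicalKrullDim_le_of_cover fun x => ?_) ?_
  · obtain ⟨g, hg⟩ := horb x x.2
    let γ : Grassmannian k V → Grassmannian k V := fun S => toGr (S.sub.map (ρ g : V →ₗ[k] V))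
    have hγ : IsInducing γ := by
      refine IsInducing.of_comp (g := fun S => toGr (S.sub.map (ρ g⁻¹ : V →ₗ[k] V)))
        (continuous_map_equiv _) (continuous_map_equiv _) ?_
      convert IsInducing.id using 1
      ext1 S
      change toGr (Submodule.map _ (Submodule.map _ S.sub)) = S
      rw [← Submodule.map_comp]
      have : (ρ g⁻¹ : V →ₗ[k] V) ∘ₗ (ρ g : V →ₗ[k] V) = LinearMap.id := by
        ext v
        change (ρ g⁻¹ * ρ g) v = v
        rw [← map_mul, inv_mul_cancel, map_one]
        rfl
      rw [this, Submodule.map_id]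
      rfl
    refine ⟨{S : X | γ S ∈ U}, hU.preimage (hγ.continuous.comp continuous_subtype_val), hg, ?_⟩
    let e : Θ ≃ Set.range φ := Equiv.ofInjective φ hinj
    have he : IsInducing e := IsInducing.of_comp (g := Subtype.val)
      (hφ.continuous.subtype_mk fun θ => ⟨θ, rfl⟩) continuous_subtype_val hφ
    have h1 : topologicalKrullDim (Set.range φ) = (Module.finrank k E : ℕ) := by
      rw [← hdim]
      exact (e.toHomeomorphOfIsInducing he).symm.isHomeomorph.topologicalKrullDim_eq
    rw [← h1]
    have hmem : ∀ S : {S : X | γ S ∈ U}, γ S.1 ∈ Set.range φ := fun S => by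
      rw [hrange]
      exact ⟨hX g _ S.1.2, S.2⟩
    let f : {S : X | γ S ∈ U} → Set.range φ := fun S => ⟨γ S.1, hmem S⟩
    have hf : IsInducing f := by
      refine IsInducing.of_comp (g := Subtype.val) ?_ continuous_subtype_val ?_
      · exact (hγ.continuous.comp (continuous_subtype_val.comp continuous_subtype_val)).subtype_mk _
      · exact hγ.comp (IsInducing.subtypeVal.comp IsInducing.subtypeVal)
    exact hf.topologicalKrullDim_le
  · rw [← hdim]
    have hmem : ∀ θ, φ θ ∈ X := fun θ => (hrange.le ⟨θ, rfl⟩).1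
    let f : Θ → X := fun θ => ⟨φ θ, hmem θ⟩
    have hf : IsInducing f := IsInducing.of_comp (g := Subtype.val)
      (hφ.continuous.subtype_mk hmem) continuous_subtype_val hφ
    exact hf.topologicalKrullDim_le

end Framework

/-! ### Linear changes of coordinates -/

section LinearChange

variable {k : Type*} [Field k]

open MvPolynomial in
/-- The substitution `Xᵢ ↦ ∑ⱼ Mᵢⱼ Xⱼ`. -/
def subst (M : Matrix (Fin 4) (Fin 4) k) : Coord k →ₐ[k] Coord k :=
  aeval fun i => ∑ j, M i j • X j

theorem subst_X (M : Matrix (Fin 4) (Fin 4) k) (i : Fin 4) :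
    subst M (MvPolynomial.X i) = ∑ j, M i j • MvPolynomial.X j := by
  simp [subst]

theorem subst_subst (M N : Matrix (Fin 4) (Fin 4) k) (F : Coord k) :
    subst M (subst N F) = subst (N * M) F := by
  suffices h : (subst M).comp (subst N) = subst (N * M) from AlgHom.congr_fun h F
  refine MvPolynomial.algHom_ext fun i => ?_
  simp only [AlgHom.comp_apply, subst_X, map_sum, map_smul, Finset.smul_sum, Matrix.mul_apply,
    Finset.sum_smul, smul_smul]
  exact Finset.sum_comm

theorem subst_one (F : Coord k) : subst 1 F = F := by
  suffices h : subst (1 : Matrix (Fin 4) (Fin 4) k) = AlgHom.id k _ from AlgHom.congr_fun h F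
  refine MvPolynomial.algHom_ext fun i => ?_
  simp [subst_X, Matrix.one_apply]

theorem subst_isHomogeneous (M : Matrix (Fin 4) (Fin 4) k) {F : Coord k} {n : ℕ}
    (hF : F.IsHomogeneous n) : (subst M F).IsHomogeneous n := by
  have := hF.aeval (S := k) (n := 1) (fun i => ∑ j, M i j • MvPolynomial.X j) fun i =>
    MvPolynomial.IsHomogeneous.sum _ _ _ fun j _ => by
      rw [MvPolynomial.smul_eq_C_mul]
      exact MvPolynomial.isHomogeneous_C_mul_X _ _
  rwa [one_mul] at this

/-- The group of linear changes of the homogeneous coordinates. -/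
abbrev GL4 (k : Type*) [Field k] := GL (Fin 4) k

/-- The action of an invertible matrix on the coordinate ring by linear substitution. The inverse
makes it a left action. -/
def lin (g : GL4 k) : Coord k ≃ₐ[k] Coord k :=
  AlgEquiv.ofAlgHom (subst (g⁻¹ : GL4 k).1) (subst g.1)
    (AlgHom.ext fun F => by
      rw [AlgHom.comp_apply, subst_subst, ← Units.val_mul, mul_inv_cancel, Units.val_one,
        subst_one, AlgHom.id_apply])
    (AlgHom.ext fun F => by
      rw [AlgHom.comp_apply, subst_subst, ← Units.val_mul, inv_mul_cancel, Units.val_one,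
        subst_one, AlgHom.id_apply])

theorem lin_apply (g : GL4 k) (F : Coord k) : lin g F = subst (g⁻¹ : GL4 k).1 F := rfl

theorem lin_mul (g h : GL4 k) (F : Coord k) : lin (g * h) F = lin g (lin h F) := by
  rw [lin_apply, lin_apply, lin_apply, subst_subst, ← Units.val_mul, mul_inv_rev]

theorem lin_one (F : Coord k) : lin 1 F = F := by
  rw [lin_apply, inv_one, Units.val_one, subst_one]

theorem lin_mem_forms (g : GL4 k) {n : ℕ} {F : Coord k} (hF : F ∈ Forms k n) :
    lin g F ∈ Forms k n := subst_isHomogeneous _ hF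

/-- The action of linear substitutions on forms. -/
def linForms (m : ℕ) : GL4 k →* (Forms k m ≃ₗ[k] Forms k m) where
  toFun g :=
    { toFun := fun F => ⟨lin g F, lin_mem_forms g F.2⟩
      invFun := fun F => ⟨lin g⁻¹ F, lin_mem_forms g⁻¹ F.2⟩
      map_add' := fun F G => Subtype.ext (map_add (lin g) F.1 G.1)
      map_smul' := fun c F => Subtype.ext (map_smul (lin g) c F.1)
      left_inv := fun F => Subtype.ext (by
        change lin g⁻¹ (lin g F) = F
        rw [← lin_mul, inv_mul_cancel, lin_one])
      right_inv := fun F => Subtype.ext (by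
        change lin g (lin g⁻¹ F) = F
        rw [← lin_mul, mul_inv_cancel, lin_one]) }
  map_one' := by
    ext1 F
    exact Subtype.ext (lin_one F.1)
  map_mul' g h := by
    ext1 F
    exact Subtype.ext (lin_mul g h F.1)

/-- The ideal of the image of a subscheme under a linear change of coordinates. -/
def linIdeal (g : GL4 k) (I : Ideal (Coord k)) : Ideal (Coord k) := I.comap (lin g⁻¹)

theorem mem_linIdeal {g : GL4 k} {I : Ideal (Coord k)} {F : Coord k} :
    F ∈ linIdeal g I ↔ lin g⁻¹ F ∈ I := Iff.rfl

theorem linIdeal_linIdeal (g h : GL4 k) (I : Ideal (Coord k)) :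
    linIdeal g (linIdeal h I) = linIdeal (g * h) I := by
  ext F
  rw [mem_linIdeal, mem_linIdeal, mem_linIdeal, ← lin_mul, mul_inv_rev]

theorem linIdeal_one (I : Ideal (Coord k)) : linIdeal 1 I = I := by
  ext F
  rw [mem_linIdeal, inv_one, lin_one]

theorem linIdeal_inv_linIdeal (g : GL4 k) (I : Ideal (Coord k)) :
    linIdeal g⁻¹ (linIdeal g I) = I := by
  rw [linIdeal_linIdeal, inv_mul_cancel, linIdeal_one]

theorem gradedPart_linIdeal (g : GL4 k) (I : Ideal (Coord k)) (m : ℕ) :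
    gradedPart (linIdeal g I) m =
      (gradedPart I m).map (linForms m g : Forms k m →ₗ[k] Forms k m) := by
  ext F
  constructor
  · intro h
    refine ⟨linForms m g⁻¹ F, h, ?_⟩
    change (linForms m g * linForms m g⁻¹) F = F
    rw [← map_mul, mul_inv_cancel, map_one]
    rfl
  · rintro ⟨F, hF, rfl⟩
    change lin g⁻¹ (lin g F) ∈ I
    rw [← lin_mul, inv_mul_cancel, lin_one]
    exact hF

instance (σ : Type*) [Finite σ] (n : ℕ) :
    Module.Finite k (MvPolynomial.homogeneousSubmodule σ k n) :=
  Module.Finite.iff_fg.2 (MvPolynomial.homogeneousSubmodule_fg σ k n)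

theorem vreg_subst {T : Type*} {𝒜 : Subalgebra k (T → k)} {M : T → Matrix (Fin 4) (Fin 4) k}
    (hM : ∀ i j, (fun t => M t i j) ∈ reg 𝒜) (F : Coord k) :
    (fun t => subst (M t) F) ∈ vreg 𝒜 (Coord k) := by
  induction F using MvPolynomial.induction_on with
  | C c => simpa [subst] using vreg_const (𝒜 := 𝒜) (MvPolynomial.C c : Coord k)
  | add F G h1 h2 =>
    simp only [map_add]
    exact (vreg 𝒜 _).add_mem h1 h2
  | mul_X F i h =>
    simp only [map_mul, subst_X]
    exact vreg_mul h (vreg_sum _ fun j _ => vreg_smul_const (hM i j) _)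

/-- A family of subschemes stable under linear changes of coordinates and with an open subset
parametrized by an open subset of an affine space of dimension `N` is irreducible of
dimension `N`. -/
theorem irreducible_of_parametrization [Infinite k] (m : ℕ) {F : Set (Ideal (Coord k))}
    (hF : ∀ g, ∀ I ∈ F, linIdeal g I ∈ F) {U : Set (Grassmannian k (Forms k m))} (hU : IsOpen U)
    (horb : ∀ I ∈ F, ∃ g, hilbertPoint m (linIdeal g I) ∈ U)
    {E : Type*} [AddCommGroup E] [Module k E] [Module.Finite k E]
    [TopologicalSpace E] [IsZariski k E] {Θ : Set E} (hΘ : IsOpen Θ) (hne : Θ.Nonempty)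
    {Φ : Θ → Ideal (Coord k)} (hΦ : ∀ θ, Φ θ ∈ F ∧ hilbertPoint m (Φ θ) ∈ U)
    (hsurj : ∀ I ∈ F, hilbertPoint m I ∈ U → ∃ θ, Φ θ = I)
    (hcont : Continuous fun θ => hilbertPoint m (Φ θ))
    (hinj : Function.Injective fun θ => hilbertPoint m (Φ θ))
    (hψ : ∀ W : Submodule k (Forms k m),
      (fun t : {θ : Θ // IsCompl (hilbertPoint m (Φ θ)).sub W} => (t.1 : E)) ∈
        vreg (coordAlg k fun t : {θ : Θ // IsCompl (hilbertPoint m (Φ θ)).sub W} =>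
          Chart.proj (⟨hilbertPoint m (Φ t.1), t.2⟩ : Chart k W)) E) :
    IsInducing (fun θ => hilbertPoint m (Φ θ)) ∧ IsIrreducible (hilbertPoint m '' F) ∧
      topologicalKrullDim (hilbertPoint m '' F) = Module.finrank k E := by
  have hind := isInducing_of_vreg_chart hcont hψ
  have hrange : Set.range (fun θ => hilbertPoint m (Φ θ)) = hilbertPoint m '' F ∩ U := by
    ext S
    constructor
    · rintro ⟨θ, rfl⟩
      exact ⟨⟨_, (hΦ θ).1, rfl⟩, (hΦ θ).2⟩
    · rintro ⟨⟨I, hI, rfl⟩, hS⟩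
      obtain ⟨θ, rfl⟩ := hsurj I hI hS
      exact ⟨θ, rfl⟩
  have hX : ∀ g : GL4 k, ∀ S ∈ hilbertPoint m '' F,
      toGr (S.sub.map (linForms (k := k) m g : Forms k m →ₗ[k] Forms k m)) ∈
        hilbertPoint m '' F := by
    rintro g _ ⟨I, hI, rfl⟩
    exact ⟨_, hF g I hI, gradedPart_linIdeal g I m⟩
  have horb' : ∀ S ∈ hilbertPoint m '' F, ∃ g : GL4 k,
      toGr (S.sub.map (linForms m g : Forms k m →ₗ[k] Forms k m)) ∈ U := by
    rintro _ ⟨I, hI, rfl⟩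
    obtain ⟨g, hg⟩ := horb I hI
    refine ⟨g, ?_⟩
    rw [hilbertPoint, gradedPart_linIdeal] at hg
    exact hg
  refine ⟨hind, ?_, topologicalKrullDim_of_orbits (linForms m) hX hU horb' hΘ hne hind hinj hrange⟩
  let E' := Matrix (Fin 4) (Fin 4) k
  let τ : TopologicalSpace E' := zariskiTopology k E'
  have hz : IsZariski k E' := ⟨rfl⟩
  let ι : GL4 k → E' := fun g => (g⁻¹ : GL4 k).1
  let τ' : TopologicalSpace (GL4 k) := TopologicalSpace.induced ι τ
  have hι : Continuous[τ', τ] ι := continuous_induced_dom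
  have hreg : ∀ i j, (fun M : E' => M i j) ∈ polyFun k E' := fun i j =>
    Algebra.subset_adjoin ⟨LinearMap.proj j ∘ₗ LinearMap.proj i, rfl⟩
  have hdet : (fun M : E' => M.det) ∈ polyFun k E' := by
    have : (fun M : E' => M.det) = ∑ σ : Equiv.Perm (Fin 4), (Equiv.Perm.sign σ : ℤ) •
        ∏ i, (fun M : E' => M (σ i) i) := by
      ext M
      simp [Matrix.det_apply, Finset.prod_apply, Units.smul_def]
    rw [this]
    exact sum_mem fun σ _ => zsmul_mem (prod_mem fun i _ => hreg _ _) _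
  have hpre : PreirreducibleSpace (GL4 k) := by
    refine ⟨?_⟩
    rintro _ _ ⟨O, hO, rfl⟩ ⟨O', hO', rfl⟩ ⟨g, -, hg⟩ ⟨g', -, hg'⟩
    obtain ⟨M, hM, hMO, hMO'⟩ := isPreirreducible_zar k (E := E') (isOpen_polyFun_ne_zero hdet)
      O O' hO hO'
      ⟨_, (Matrix.isUnits_det_units (g⁻¹)).ne_zero, hg⟩
      ⟨_, (Matrix.isUnits_det_units (g'⁻¹)).ne_zero, hg'⟩
    let h : GL4 k := Matrix.GeneralLinearGroup.mkOfDetNeZero M hM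
    have hh : ι h⁻¹ = M := by
      change ((h⁻¹)⁻¹ : GL4 k).1 = M
      rw [inv_inv]
      rfl
    exact ⟨h⁻¹, trivial, by rwa [Set.mem_preimage, hh], by rwa [Set.mem_preimage, hh]⟩
  refine isIrreducible_of_orbits (isOpen_coordAlg (k := k) hι) (linForms m) (fun v => ?_) hX horb' ?_
  · refine vreg_of_injective (Forms k m).subtype Subtype.val_injective ?_
    exact vreg_subst (M := ι) (fun i j => le_reg (mem_coordAlg.2 ⟨_, hreg i j, rfl⟩)) v.1
  · rw [← hrange, ← Set.image_univ]
    have hirr : IsIrreducible (Set.univ : Set Θ) := by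
      have : IsPreirreducible Θ := isPreirreducible_zar k hΘ
      have := Subtype.preirreducibleSpace this
      exact ⟨⟨⟨hne.some, hne.some_mem⟩, trivial⟩, PreirreducibleSpace.isPreirreducible_univ⟩
    exact hirr.image _ hcont.continuousOn

end LinearChange


/-! ### Forms of integral degree -/

section IntegralDegree

open MvPolynomial

variable {k : Type*} [Field k] {σ : Type*}

/-- `F` is a form of degree `n`, where `n` is an integer; for negative `n` this means `F = 0`. -/
def ZHom (F : MvPolynomial σ k) (n : ℤ) : Prop := ∀ d, coeff d F ≠ 0 → (d.degree : ℤ) = n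

theorem zHom_natCast {F : MvPolynomial σ k} {n : ℕ} : ZHom F n ↔ F.IsHomogeneous n := by
  simp only [ZHom, IsHomogeneous, IsWeightedHomogeneous, Nat.cast_inj, Finsupp.degree_eq_weight_one]
  rfl

theorem ZHom.isHomogeneous {F : MvPolynomial σ k} {n : ℕ} (h : ZHom F n) : F.IsHomogeneous n :=
  zHom_natCast.1 h

theorem zHom_zero (n : ℤ) : ZHom (0 : MvPolynomial σ k) n := fun d h => absurd (coeff_zero d) h

theorem ZHom.eq_zero {F : MvPolynomial σ k} {n : ℤ} (h : ZHom F n) (hn : n < 0) : F = 0 := by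
  ext d
  rw [coeff_zero]
  by_contra hd
  have := h d hd
  omega

theorem ZHom.cases {F : MvPolynomial σ k} {n : ℤ} (h : ZHom F n) :
    F = 0 ∨ ∃ m : ℕ, n = m ∧ F.IsHomogeneous m := by
  rcases lt_or_ge n 0 with hn | hn
  · exact Or.inl (h.eq_zero hn)
  · obtain ⟨m, rfl⟩ := Int.eq_ofNat_of_zero_le hn
    exact Or.inr ⟨m, rfl, zHom_natCast.1 h⟩

theorem ZHom.add {F G : MvPolynomial σ k} {n : ℤ} (hF : ZHom F n) (hG : ZHom G n) :
    ZHom (F + G) n := by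
  intro d hd
  by_contra h
  exact hd (by rw [coeff_add, not_not.1 fun h' => h (hF d h'), not_not.1 fun h' => h (hG d h'),
    add_zero])

theorem ZHom.smul {F : MvPolynomial σ k} {n : ℤ} (c : k) (hF : ZHom F n) : ZHom (c • F) n := by
  intro d hd
  exact hF d fun h => hd (by rw [coeff_smul, h, smul_zero])

theorem ZHom.neg {F : MvPolynomial σ k} {n : ℤ} (hF : ZHom F n) : ZHom (-F) n := by
  simpa using hF.smul (-1)

theorem ZHom.sub {F G : MvPolynomial σ k} {n : ℤ} (hF : ZHom F n) (hG : ZHom G n) :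
    ZHom (F - G) n := by
  rw [sub_eq_add_neg]
  exact hF.add hG.neg

theorem ZHom.mul {F G : MvPolynomial σ k} {m n l : ℤ} (hF : ZHom F m) (hG : ZHom G n)
    (hl : l = m + n) : ZHom (F * G) l := by
  rcases hF.cases with rfl | ⟨m, rfl, hF⟩
  · rw [zero_mul]
    exact zHom_zero _
  rcases hG.cases with rfl | ⟨n, rfl, hG⟩
  · rw [mul_zero]
    exact zHom_zero _
  rw [hl, ← Nat.cast_add]
  exact zHom_natCast.2 (MvPolynomial.IsHomogeneous.mul (zHom_natCast.1 hF) (zHom_natCast.1 hG))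

theorem zHom_one : ZHom (1 : MvPolynomial σ k) 0 := by
  simpa using zHom_natCast.2 (isHomogeneous_one σ k)

theorem zHom_X (i : σ) : ZHom (X i : MvPolynomial σ k) 1 := by
  simpa using zHom_natCast.2 (isHomogeneous_X k i)

theorem ZHom.pow {F : MvPolynomial σ k} {m l : ℤ} (hF : ZHom F m) (n : ℕ) (hl : l = n * m) :
    ZHom (F ^ n) l := by
  subst hl
  induction n with
  | zero => simpa using zHom_one
  | succ n ih =>
    rw [pow_succ]
    exact ih.mul hF (by push_cast; ring)

theorem ZHom.sum {ι : Type*} {s : Finset ι} {F : ι → MvPolynomial σ k} {n : ℤ}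
    (h : ∀ i ∈ s, ZHom (F i) n) : ZHom (∑ i ∈ s, F i) n := by
  classical
  induction s using Finset.induction_on with
  | empty => exact zHom_zero _
  | insert a s ha ih =>
    rw [Finset.sum_insert ha]
    exact (h a (Finset.mem_insert_self _ _)).add
      (ih fun i hi => h i (Finset.mem_insert_of_mem hi))

theorem ZHom.degree_unique {F : MvPolynomial σ k} {m n : ℤ} (h1 : ZHom F m) (h2 : ZHom F n)
    (h : F ≠ 0) : m = n := by
  obtain ⟨d, hd⟩ := MvPolynomial.ne_zero_iff.1 h
  rw [← h1 d hd, h2 d hd]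

theorem ZHom.degree_nonneg {F : MvPolynomial σ k} {n : ℤ} (h1 : ZHom F n) (h : F ≠ 0) : 0 ≤ n := by
  by_contra hn
  exact h (h1.eq_zero (not_le.1 hn))

theorem ZHom.exists_C {F : MvPolynomial σ k} (h : ZHom F 0) : ∃ c : k, F = C c := by
  have h' : F.IsHomogeneous 0 := zHom_natCast.1 (by simpa using h)
  exact ⟨_, totalDegree_eq_zero_iff_eq_C.1 ((totalDegree_zero_iff_isHomogeneous σ).2 h')⟩

theorem ZHom.isUnit {F : MvPolynomial σ k} (h : ZHom F 0) (h0 : F ≠ 0) : IsUnit F := by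
  obtain ⟨c, rfl⟩ := h.exists_C
  exact (isUnit_iff_ne_zero.2 fun hc => h0 (by rw [hc, map_zero])).map C

/-- The degree `n` part of a polynomial, for an integer `n`. -/
def zcomp (n : ℤ) : MvPolynomial σ k →ₗ[k] MvPolynomial σ k :=
  if 0 ≤ n then homogeneousComponent n.toNat else 0

theorem zcomp_natCast (n : ℕ) (F : MvPolynomial σ k) :
    zcomp (n : ℤ) F = homogeneousComponent n F := by
  simp [zcomp]

theorem zHom_zcomp (n : ℤ) (F : MvPolynomial σ k) : ZHom (zcomp n F) n := by
  rw [zcomp]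
  split_ifs with h
  · obtain ⟨m, rfl⟩ := Int.eq_ofNat_of_zero_le h
    exact zHom_natCast.2 (homogeneousComponent_isHomogeneous _ _)
  · exact zHom_zero _

theorem coeff_zcomp (n : ℤ) (F : MvPolynomial σ k) (d : σ →₀ ℕ) :
    coeff d (zcomp n F) = if (d.degree : ℤ) = n then coeff d F else 0 := by
  rw [zcomp]
  split_ifs with h h1 h1
  · obtain ⟨m, rfl⟩ := Int.eq_ofNat_of_zero_le h
    rw [Int.toNat_natCast, coeff_homogeneousComponent, if_pos (by exact_mod_cast h1)]
  · obtain ⟨m, rfl⟩ := Int.eq_ofNat_of_zero_le h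
    rw [Int.toNat_natCast, coeff_homogeneousComponent, if_neg (by exact_mod_cast h1)]
  · omega
  · rfl

theorem ZHom.zcomp_eq {F : MvPolynomial σ k} {n : ℤ} (h : ZHom F n) : zcomp n F = F := by
  ext d
  rw [coeff_zcomp]
  split_ifs with h1
  · rfl
  · by_contra h2
    exact h1 (h d fun h => h2 h.symm)

theorem ZHom.zcomp_ne {F : MvPolynomial σ k} {n m : ℤ} (h : ZHom F n) (hm : n ≠ m) :
    zcomp m F = 0 := by
  ext d
  rw [coeff_zcomp, coeff_zero]
  split_ifs with h1
  · by_contra h2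
    exact hm ((h d h2).symm.trans h1)
  · rfl

theorem eq_sum_zcomp (F : MvPolynomial σ k) :
    F = ∑ i ∈ Finset.range (F.totalDegree + 1), zcomp (i : ℤ) F := by
  simp only [zcomp_natCast]
  exact (sum_homogeneousComponent F).symm

theorem zcomp_mul {F M : MvPolynomial σ k} {n j l : ℤ} (hM : ZHom M j) (hl : l = n + j) :
    zcomp l (F * M) = zcomp n F * M := by
  conv_lhs => rw [eq_sum_zcomp F, Finset.sum_mul, map_sum]
  have h1 : ∀ i : ℕ, zcomp l (zcomp (i : ℤ) F * M) = if (i : ℤ) = n then zcomp n F * M else 0 := by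
    intro i
    have h2 := (zHom_zcomp (i : ℤ) F).mul hM rfl
    split_ifs with h
    · subst h
      exact (hl ▸ h2).zcomp_eq
    · exact h2.zcomp_ne (by omega)
  simp only [h1]
  rcases lt_or_ge n 0 with hn | hn
  · rw [(zHom_zcomp n F).eq_zero hn, zero_mul]
    simp
  · obtain ⟨m, rfl⟩ := Int.eq_ofNat_of_zero_le hn
    simp only [Nat.cast_inj]
    rw [Finset.sum_ite_eq']
    split_ifs with hm
    · rfl
    · rw [Finset.mem_range, not_lt] at hm
      rw [zcomp_natCast, homogeneousComponent_eq_zero _ _ (by omega), zero_mul]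

/-- A linear map that shifts degrees commutes with taking homogeneous parts. -/
theorem zcomp_map {σ' : Type*} {c : ℤ} (L : MvPolynomial σ k →ₗ[k] MvPolynomial σ' k)
    (hL : ∀ F n, ZHom F n → ZHom (L F) (n + c)) (F : MvPolynomial σ k) (n : ℤ) :
    zcomp (n + c) (L F) = L (zcomp n F) := by
  conv_lhs => rw [eq_sum_zcomp F, map_sum, map_sum]
  conv_rhs => rw [eq_sum_zcomp F, map_sum, map_sum]
  refine Finset.sum_congr rfl fun i _ => ?_
  have h := zHom_zcomp (i : ℤ) F
  by_cases hi : (i : ℤ) = n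
  · subst hi
    rw [(hL _ _ h).zcomp_eq, h.zcomp_eq]
  · rw [(hL _ _ h).zcomp_ne (by omega), h.zcomp_ne hi, map_zero]

/-- `F ↦ ∑ᵢ Fᵢ tⁱ` with `Fᵢ` the homogeneous components of `F`. -/
def gradingHom (k σ : Type*) [Field k] : MvPolynomial σ k →ₐ[k] Polynomial (MvPolynomial σ k) :=
  aeval fun i => Polynomial.C (X i) * Polynomial.X

theorem coeff_gradingHom (F : MvPolynomial σ k) (n : ℕ) :
    (gradingHom k σ F).coeff n = homogeneousComponent n F := by
  suffices h : (Polynomial.lcoeff (MvPolynomial σ k) n).restrictScalars k ∘ₗ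
      (gradingHom k σ).toLinearMap = homogeneousComponent n from LinearMap.congr_fun h F
  refine (basisMonomials σ k).ext fun d => ?_
  rw [coe_basisMonomials]
  have h1 : gradingHom k σ (monomial d 1) = Polynomial.C (monomial d 1) * Polynomial.X ^ d.degree := by
    rw [gradingHom, aeval_monomial, map_one, one_mul, Finsupp.prod]
    simp only [mul_pow, Finset.prod_mul_distrib, Finset.prod_pow_eq_pow_sum, ← map_pow, ← map_prod]
    rw [monomial_eq, map_one, one_mul]
    rfl
  change (gradingHom k σ (monomial d 1)).coeff n = homogeneousComponent n (monomial d 1)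
  have h2 : IsHomogeneous (monomial d (1 : k)) d.degree := isHomogeneous_monomial _ rfl
  rw [h1, Polynomial.coeff_C_mul_X_pow, homogeneousComponent_of_mem h2]

theorem gradingHom_of_zHom {F : MvPolynomial σ k} {n : ℕ} (h : ZHom F n) :
    gradingHom k σ F = Polynomial.C F * Polynomial.X ^ n := by
  ext1 m
  rw [coeff_gradingHom, Polynomial.coeff_C_mul_X_pow,
    homogeneousComponent_of_mem h.isHomogeneous]

/-- Factors of forms are forms. -/
theorem ZHom.of_mul {F G : MvPolynomial σ k} {n : ℤ} (h : ZHom (F * G) n) (h0 : F * G ≠ 0) :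
    ∃ i : ℤ, ZHom F i ∧ ZHom G (n - i) := by
  obtain ⟨N, rfl⟩ := Int.eq_ofNat_of_zero_le (h.degree_nonneg h0)
  have hF0 : F ≠ 0 := left_ne_zero_of_mul h0
  have hG0 : G ≠ 0 := right_ne_zero_of_mul h0
  have e := gradingHom_of_zHom h
  rw [map_mul] at e
  have inj : ∀ {A : MvPolynomial σ k}, A ≠ 0 → gradingHom k σ A ≠ 0 := by
    intro A hA hz
    refine hA ?_
    rw [← sum_homogeneousComponent A]
    exact Finset.sum_eq_zero fun i _ => by rw [← coeff_gradingHom, hz, Polynomial.coeff_zero]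
  have d1 := Polynomial.natDegree_mul (inj hF0) (inj hG0)
  have d2 := Polynomial.natTrailingDegree_mul (inj hF0) (inj hG0)
  rw [e, Polynomial.natDegree_C_mul_X_pow _ _ h0] at d1
  rw [e, Polynomial.C_mul_X_pow_eq_monomial, Polynomial.natTrailingDegree_monomial h0] at d2
  have l1 := Polynomial.natTrailingDegree_le_natDegree (gradingHom k σ F)
  have l2 := Polynomial.natTrailingDegree_le_natDegree (gradingHom k σ G)
  have key : ∀ A : MvPolynomial σ k, (gradingHom k σ A).natTrailingDegree =
      (gradingHom k σ A).natDegree → ZHom A (gradingHom k σ A).natDegree := by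
    intro A hA d hd
    by_contra hne
    have hne' : d.degree ≠ (gradingHom k σ A).natDegree := fun h => hne (by exact_mod_cast h)
    have h3 : (gradingHom k σ A).coeff d.degree = 0 := by
      rcases lt_or_gt_of_ne hne' with h | h
      · exact Polynomial.coeff_eq_zero_of_lt_natTrailingDegree (by omega)
      · exact Polynomial.coeff_eq_zero_of_natDegree_lt h
    rw [coeff_gradingHom] at h3
    have h4 := congrArg (coeff d) h3
    rw [coeff_homogeneousComponent, if_pos rfl, coeff_zero] at h4
    exact hd h4
  refine ⟨_, key F (by omega), ?_⟩
  convert key G (by omega) using 1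
  omega

theorem ZHom.of_mul_left {F G : MvPolynomial σ k} {m n : ℤ} (h : ZHom (F * G) n) (hF : ZHom F m)
    (hF0 : F ≠ 0) : ZHom G (n - m) := by
  by_cases hG0 : G = 0
  · rw [hG0]
    exact zHom_zero _
  obtain ⟨i, h1, h2⟩ := h.of_mul (mul_ne_zero hF0 hG0)
  rwa [hF.degree_unique h1 hF0]

end IntegralDegree

/-! ### Binary forms -/

section BinaryForms

open MvPolynomial

variable {k : Type*} [Field k]

/-- The homogeneous coordinate ring of the line. -/
abbrev LineRing (k : Type*) [Field k] := MvPolynomial (Fin 2) k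

/-- Binary forms of degree `n`. -/
def binForms (k : Type*) [Field k] (n : ℤ) : Submodule k (LineRing k) where
  carrier := {F | ZHom F n}
  add_mem' h1 h2 := ZHom.add h1 h2
  zero_mem' := zHom_zero n
  smul_mem' c _ h := ZHom.smul c h

theorem binForms_natCast (n : ℕ) : binForms k n = homogeneousSubmodule (Fin 2) k n := by
  ext F
  exact zHom_natCast

theorem binForms_of_neg {n : ℤ} (hn : n < 0) : binForms k n = ⊥ := by
  rw [eq_bot_iff]
  exact fun F hF => ZHom.eq_zero hF hn

instance (n : ℤ) : Module.Finite k (binForms k n) := by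
  rcases lt_or_ge n 0 with hn | hn
  · rw [binForms_of_neg hn]
    infer_instance
  · obtain ⟨m, rfl⟩ := Int.eq_ofNat_of_zero_le hn
    rw [binForms_natCast]
    infer_instance

theorem finrank_binForms_natCast (n : ℕ) : Module.finrank k (binForms k n) = n + 1 := by
  let d : Fin (n + 1) → (Fin 2 →₀ ℕ) := fun i =>
    Finsupp.single 0 (i : ℕ) + Finsupp.single 1 (n - i)
  have hd : Function.Injective d := fun i j h => Fin.ext (by
    have := DFunLike.congr_fun h 0
    simpa [d] using this)
  have hli : LinearIndependent k fun i => basisMonomials (Fin 2) k (d i) :=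
    (basisMonomials (Fin 2) k).linearIndependent.comp d hd
  have hspan : binForms k n = Submodule.span k (Set.range fun i => basisMonomials (Fin 2) k (d i)) := by
    apply le_antisymm
    · intro F hF
      rw [F.as_sum]
      refine Submodule.sum_mem _ fun e he => ?_
      have hdeg : e.degree = n := by exact_mod_cast hF e (mem_support_iff.1 he)
      have he2 : e 0 + e 1 = n := by
        rw [← hdeg, Finsupp.degree_eq_sum, Fin.sum_univ_two]
      have : e = d ⟨e 0, by omega⟩ := by
        ext i
        fin_cases i
        · simp [d]
        · simp [d]; omega
      have h1 : monomial e (coeff e F) = coeff e F • basisMonomials (Fin 2) k (d ⟨e 0, by omega⟩) := by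
        rw [← this, coe_basisMonomials, smul_monomial, smul_eq_mul, mul_one]
      rw [h1]
      exact Submodule.smul_mem _ _ (Submodule.subset_span ⟨_, rfl⟩)
    · rw [Submodule.span_le]
      rintro _ ⟨i, rfl⟩
      rw [coe_basisMonomials]
      refine zHom_natCast.2 (isHomogeneous_monomial _ ?_)
      have := i.2
      simp [d, Finsupp.degree_eq_sum, Fin.sum_univ_two]
      omega
  rw [hspan, finrank_span_eq_card hli, Fintype.card_fin]

theorem finrank_binForms (n : ℤ) : Module.finrank k (binForms k n) = (n + 1).toNat := by
  rcases lt_or_ge n 0 with hn | hn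
  · rw [binForms_of_neg hn, finrank_bot]
    omega
  · obtain ⟨m, rfl⟩ := Int.eq_ofNat_of_zero_le hn
    rw [finrank_binForms_natCast]
    omega

theorem zHom_of_dvd_rel {F G : LineRing k} {m n : ℤ} (hG : ZHom G n) (hF : ZHom F m) (hF0 : F ≠ 0)
    (h : F ∣ G) : ∃ C, ZHom C (n - m) ∧ G = F * C := by
  obtain ⟨C, rfl⟩ := h
  exact ⟨C, hG.of_mul_left hF hF0, rfl⟩

/-- Coprime binary forms of degrees `m` and `n` generate all forms of degree at least
`m + n - 1`. -/
theorem exists_bezout {F G H : LineRing k} {m n N : ℤ} (hF : ZHom F m) (hG : ZHom G n)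
    (hFG : IsRelPrime F G) (hH : ZHom H N) (hN : m + n - 1 ≤ N) :
    ∃ A B, ZHom A (N - m) ∧ ZHom B (N - n) ∧ H = F * A + G * B := by
  by_cases uF : IsUnit F
  · obtain ⟨A, rfl⟩ := uF.dvd (a := H)
    exact ⟨A, 0, hH.of_mul_left hF uF.ne_zero, zHom_zero _, by simp⟩
  by_cases uG : IsUnit G
  · obtain ⟨A, rfl⟩ := uG.dvd (a := H)
    exact ⟨0, A, zHom_zero _, hH.of_mul_left hG uG.ne_zero, by simp⟩
  have hF0 : F ≠ 0 := fun h => uG (isRelPrime_zero_left.1 (h ▸ hFG))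
  have hG0 : G ≠ 0 := fun h => uF (isRelPrime_zero_right.1 (h ▸ hFG))
  have hm : 1 ≤ m := by
    have := hF.degree_nonneg hF0
    by_contra h
    obtain rfl : m = 0 := by omega
    exact uF (hF.isUnit hF0)
  have hn : 1 ≤ n := by
    have := hG.degree_nonneg hG0
    by_contra h
    obtain rfl : n = 0 := by omega
    exact uG (hG.isUnit hG0)
  let L : binForms k (N - m) × binForms k (N - n) →ₗ[k] binForms k N :=
    { toFun := fun x => ⟨F * x.1 + G * x.2,
        (hF.mul x.1.2 (by ring)).add (hG.mul x.2.2 (by ring))⟩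
      map_add' := fun x y => Subtype.ext (by
        simp only [Prod.fst_add, Prod.snd_add, Submodule.coe_add]; ring)
      map_smul' := fun c x => Subtype.ext (by
        simp only [Prod.smul_fst, Prod.smul_snd, Submodule.coe_smul, RingHom.id_apply, smul_add,
          mul_smul_comm]) }
  let K : binForms k (N - m - n) →ₗ[k] binForms k (N - m) × binForms k (N - n) :=
    { toFun := fun x => (⟨G * x, hG.mul x.2 (by ring)⟩, ⟨-(F * x), (hF.mul x.2 (by ring)).neg⟩)
      map_add' := fun x y => by ext1 <;> exact Subtype.ext (by
        simp only [Submodule.coe_add, Prod.fst_add, Prod.snd_add]; ring)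
      map_smul' := fun c x => by ext1 <;> exact Subtype.ext (by
        simp only [Prod.smul_fst, Prod.smul_snd, Submodule.coe_smul, RingHom.id_apply,
          mul_smul_comm, smul_neg]) }
  -- Surjectivity of `L` is a dimension count: its kernel consists of the Koszul relations.
  have hker : LinearMap.ker L ≤ LinearMap.range K := by
    rintro ⟨⟨A, hA⟩, ⟨B, hB⟩⟩ h
    have h1 : F * A + G * B = 0 := congrArg Subtype.val h
    have h2 : G ∣ A := hFG.symm.dvd_of_dvd_mul_left ⟨-B, by linear_combination h1⟩
    obtain ⟨C, hC, rfl⟩ := zHom_of_dvd_rel hA hG hG0 h2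
    refine ⟨⟨C, hC⟩, Prod.ext rfl (Subtype.ext ?_)⟩
    refine mul_left_cancel₀ hG0 ?_
    change G * -(F * C) = G * B
    linear_combination -h1
  have r1 := L.finrank_range_add_finrank_ker
  have r2 := (Submodule.finrank_mono hker).trans (LinearMap.finrank_range_le K)
  have r3 := Submodule.finrank_le (LinearMap.range L)
  rw [Module.finrank_prod, finrank_binForms, finrank_binForms] at r1
  rw [finrank_binForms] at r2 r3
  have hsurj : LinearMap.range L = ⊤ := by
    refine Submodule.eq_top_of_finrank_eq ?_
    rw [finrank_binForms]
    omega
  obtain ⟨⟨A, B⟩, hAB⟩ := LinearMap.range_eq_top.1 hsurj ⟨H, hH⟩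
  exact ⟨A, B, A.2, B.2, (congrArg Subtype.val hAB).symm⟩

/-- The forms in the `j`-th power of the ideal generated by two coprime forms of degree `α`. -/
theorem exists_power_combination {f g : LineRing k} {α : ℤ} (hf : ZHom f α) (hg : ZHom g α)
    (hfg : IsRelPrime f g) (j : ℕ) {n : ℤ} (hn : α - 1 ≤ n) {H : LineRing k}
    (hH : ZHom H (n + j * α)) :
    ∃ A : ℕ → LineRing k, (∀ i, ZHom (A i) n) ∧
      H = ∑ i ∈ Finset.range (j + 1), A i * f ^ (j - i) * g ^ i := by
  induction j generalizing H with
  | zero => exact ⟨fun _ => H, fun _ => by simpa using hH, by simp⟩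
  | succ j ih =>
    obtain ⟨H', B, hH', hB, e⟩ := exists_bezout hf (hg.pow (j + 1) rfl) hfg.pow_right hH (by
      push_cast
      linarith)
    obtain ⟨A, hA, rfl⟩ := ih (by convert hH' using 1; push_cast; ring)
    refine ⟨fun i => if i = j + 1 then B else A i, fun i => ?_, ?_⟩
    · dsimp only
      split_ifs
      · convert hB using 1; push_cast; ring
      · exact hA i
    · rw [e, Finset.sum_range_succ _ (j + 1), Finset.mul_sum]
      congr 1
      · refine Finset.sum_congr rfl fun i hi => ?_
        rw [Finset.mem_range] at hi
        dsimp only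
        rw [if_neg (by omega), show j + 1 - i = (j - i) + 1 by omega, pow_succ]
        ring
      · simp [mul_comm]

/-- The powers of two coprime forms satisfy no relations in low degrees. -/
theorem eq_zero_of_power_combination {f g : LineRing k} {α : ℤ} (hf : ZHom f α) (hf0 : f ≠ 0)
    (hfg : IsRelPrime f g) (j : ℕ) {n : ℤ} (hn : n < α) {A : ℕ → LineRing k}
    (hA : ∀ i, ZHom (A i) n)
    (h : ∑ i ∈ Finset.range (j + 1), A i * f ^ (j - i) * g ^ i = 0) : ∀ i ≤ j, A i = 0 := by
  induction j with
  | zero =>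
    intro i hi
    obtain rfl : i = 0 := by omega
    simpa using h
  | succ j ih =>
    rw [Finset.sum_range_succ] at h
    have e : ∑ i ∈ Finset.range (j + 1), A i * f ^ (j + 1 - i) * g ^ i =
        f * ∑ i ∈ Finset.range (j + 1), A i * f ^ (j - i) * g ^ i := by
      rw [Finset.mul_sum]
      refine Finset.sum_congr rfl fun i hi => ?_
      rw [Finset.mem_range] at hi
      rw [show j + 1 - i = (j - i) + 1 by omega, pow_succ]
      ring
    rw [e, Nat.sub_self, pow_zero, mul_one] at h
    have h1 : f ∣ A (j + 1) := hfg.pow_right.dvd_of_dvd_mul_right ⟨_, eq_neg_of_add_eq_zero_right h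
      |>.trans (neg_mul_eq_mul_neg _ _)⟩
    obtain ⟨C, hC, e2⟩ := zHom_of_dvd_rel (hA (j + 1)) hf hf0 h1
    have h0 : A (j + 1) = 0 := by rw [e2, hC.eq_zero (by omega), mul_zero]
    rw [h0, zero_mul, add_zero, mul_eq_zero, or_iff_right hf0] at h
    intro i hi
    rcases Nat.lt_or_ge j i with h2 | h2
    · obtain rfl : i = j + 1 := by omega
      exact h0
    · exact ih h i h2

/-- Two forms can be divided by their greatest common divisor. -/
theorem exists_reduced_forms {D N : LineRing k} {m n : ℤ} (hD : ZHom D m) (hD0 : D ≠ 0)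
    (hN : ZHom N n) : ∃ f g h : LineRing k, ∃ i : ℤ, IsRelPrime f g ∧ D = h * f ∧ N = h * g ∧
      ZHom f i ∧ ZHom g (n - m + i) ∧ ZHom h (m - i) ∧ h ≠ 0 ∧ f ≠ 0 := by
  obtain ⟨f, g, h, hfg, rfl, rfl⟩ := UniqueFactorizationMonoid.exists_reduced_factors D hD0 N
  have h0 : h ≠ 0 := left_ne_zero_of_mul hD0
  obtain ⟨j, h1, h2⟩ := hD.of_mul hD0
  refine ⟨f, g, h, m - j, hfg, rfl, rfl, h2, ?_, by simpa using h1, h0, right_ne_zero_of_mul hD0⟩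
  convert hN.of_mul_left h1 h0 using 1
  ring

end BinaryForms


/-! ### The coordinate ring of space along a line -/

section StandardLine

open MvPolynomial

variable {k : Type*} [Field k]

/-- Binary forms as forms in the last two coordinates. -/
def emb : LineRing k →ₐ[k] Coord k := aeval ![X 2, X 3]

/-- Restriction to the line `x₀ = x₁ = 0`. -/
def res : Coord k →ₐ[k] LineRing k := aeval ![0, 0, X 0, X 1]

@[simp] theorem emb_X0 : emb (X 0 : LineRing k) = X 2 := by simp [emb]

@[simp] theorem emb_X1 : emb (X 1 : LineRing k) = X 3 := by simp [emb]

@[simp] theorem res_X0 : res (X 0 : Coord k) = 0 := by simp [res]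

@[simp] theorem res_X1 : res (X 1 : Coord k) = 0 := by simp [res]

@[simp] theorem res_X2 : res (X 2 : Coord k) = X 0 := by simp [res]

@[simp] theorem res_X3 : res (X 3 : Coord k) = X 1 := by simp [res]

@[simp] theorem res_emb (c : LineRing k) : res (emb c) = c := by
  suffices h : res.comp emb = AlgHom.id k (LineRing k) from AlgHom.congr_fun h c
  refine algHom_ext fun i => ?_
  fin_cases i <;> simp

/-- The ideal of the line `x₀ = x₁ = 0`. -/
def stdLine (k : Type*) [Field k] : Ideal (Coord k) := Ideal.span {X 0, X 1}

theorem X0_mem : (X 0 : Coord k) ∈ stdLine k := Ideal.subset_span (by simp)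

theorem X1_mem : (X 1 : Coord k) ∈ stdLine k := Ideal.subset_span (by simp)

theorem sub_emb_res_mem (F : Coord k) : F - emb (res F) ∈ stdLine k := by
  suffices h : (Ideal.Quotient.mkₐ k (stdLine k)).comp (emb.comp res) =
      Ideal.Quotient.mkₐ k (stdLine k) by
    refine Ideal.Quotient.eq.1 ?_
    exact (AlgHom.congr_fun h F).symm
  refine algHom_ext fun i => ?_
  fin_cases i
  · simpa [eq_comm] using Ideal.Quotient.eq_zero_iff_mem.2 (X0_mem (k := k))
  · simpa [eq_comm] using Ideal.Quotient.eq_zero_iff_mem.2 (X1_mem (k := k))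
  · simp
  · simp

theorem mem_stdLine {F : Coord k} : F ∈ stdLine k ↔ res F = 0 := by
  constructor
  · intro h
    have h1 : stdLine k ≤ RingHom.ker (res (k := k)) := by
      refine Ideal.span_le.2 ?_
      rintro _ (rfl | rfl)
      · exact res_X0
      · exact res_X1
    exact h1 h
  · intro h
    have := sub_emb_res_mem F
    rwa [h, map_zero, sub_zero] at this

theorem emb_mem_stdLine {c : LineRing k} : emb c ∈ stdLine k ↔ c = 0 := by
  rw [mem_stdLine, res_emb]

instance stdLine_isPrime : (stdLine k).IsPrime := by
  have : stdLine k = RingHom.ker (res (k := k)) := by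
    ext F
    exact mem_stdLine
  rw [this]
  exact RingHom.ker_isPrime _

theorem ZHom.aeval {σ τ : Type*} {φ : σ → MvPolynomial τ k} (hφ : ∀ i, ZHom (φ i) 1)
    {F : MvPolynomial σ k} {n : ℤ} (hF : ZHom F n) : ZHom (MvPolynomial.aeval φ F) n := by
  rcases hF.cases with rfl | ⟨m, rfl, hF'⟩
  · rw [map_zero]
    exact zHom_zero _
  · have h := hF'.aeval φ (n := 1) fun i => by
      have := hφ i
      rwa [← Nat.cast_one, zHom_natCast] at this
    rw [one_mul] at h
    exact zHom_natCast.2 h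

theorem ZHom.emb {c : LineRing k} {n : ℤ} (h : ZHom c n) : ZHom (emb c) n := by
  refine ZHom.aeval (fun i => ?_) h
  fin_cases i
  · exact zHom_X 2
  · exact zHom_X 3

theorem ZHom.res {F : Coord k} {n : ℤ} (h : ZHom F n) : ZHom (res F) n := by
  refine ZHom.aeval (fun i => ?_) h
  fin_cases i
  · exact zHom_zero _
  · exact zHom_zero _
  · exact zHom_X 0
  · exact zHom_X 1

theorem mem_stdLine_pow_succ {j : ℕ} {F : Coord k} :
    F ∈ stdLine k ^ (j + 1) ↔ ∃ G ∈ stdLine k ^ j, ∃ H ∈ stdLine k ^ j, F = X 0 * G + X 1 * H := by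
  rw [pow_succ']
  generalize stdLine k ^ j = M
  rw [stdLine, Ideal.span_insert, Ideal.sup_mul, Submodule.mem_sup]
  constructor
  · rintro ⟨_, h1, _, h2, rfl⟩
    obtain ⟨G, hG, rfl⟩ := Ideal.mem_span_singleton_mul.1 h1
    obtain ⟨H, hH, rfl⟩ := Ideal.mem_span_singleton_mul.1 h2
    exact ⟨G, hG, H, hH, rfl⟩
  · rintro ⟨G, hG, H, hH, rfl⟩
    exact ⟨_, Ideal.mem_span_singleton_mul.2 ⟨G, hG, rfl⟩, _,
      Ideal.mem_span_singleton_mul.2 ⟨H, hH, rfl⟩, rfl⟩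

theorem stdLine_pow_zcomp {j : ℕ} {F : Coord k} (hF : F ∈ stdLine k ^ j) (n : ℤ) :
    zcomp n F ∈ stdLine k ^ j := by
  induction j generalizing F n with
  | zero => simp
  | succ j ih =>
    obtain ⟨G, hG, H, hH, rfl⟩ := mem_stdLine_pow_succ.1 hF
    rw [map_add, mul_comm, mul_comm (X 1), zcomp_mul (zHom_X _) (n := n - 1) (by ring),
      zcomp_mul (zHom_X _) (n := n - 1) (by ring), mul_comm, mul_comm _ (X 1)]
    exact mem_stdLine_pow_succ.2 ⟨_, ih hG _, _, ih hH _, rfl⟩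

/-- The form `∑ᵢ Aᵢ x₀ʲ⁻ⁱ x₁ⁱ` of degree `j` in the equations of the line. -/
def polyForm (j : ℕ) (A : ℕ → LineRing k) : Coord k :=
  ∑ i ∈ Finset.range (j + 1), emb (A i) * X 0 ^ (j - i) * X 1 ^ i

theorem polyForm_mem (j : ℕ) (A : ℕ → LineRing k) : polyForm j A ∈ stdLine k ^ j := by
  refine Submodule.sum_mem _ fun i hi => ?_
  rw [Finset.mem_range] at hi
  have := Ideal.mul_mem_mul (Ideal.pow_mem_pow (X0_mem (k := k)) (j - i))
    (Ideal.pow_mem_pow (X1_mem (k := k)) i)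
  rw [← pow_add, show j - i + i = j by omega] at this
  rw [mul_assoc]
  exact Ideal.mul_mem_left _ _ this

theorem zHom_polyForm {j : ℕ} {A : ℕ → LineRing k} {n : ℤ} (hA : ∀ i, ZHom (A i) (n - j)) :
    ZHom (polyForm j A) n := by
  refine ZHom.sum fun i hi => ?_
  rw [Finset.mem_range] at hi
  refine (((hA i).emb.mul ((zHom_X 0).pow (j - i) rfl) rfl).mul ((zHom_X 1).pow i rfl) ?_)
  rw [Nat.cast_sub (by omega)]
  ring

theorem zcomp_polyForm (j : ℕ) (A : ℕ → LineRing k) (n : ℤ) :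
    zcomp n (polyForm j A) = polyForm j fun i => zcomp (n - j) (A i) := by
  rw [polyForm, map_sum]
  refine Finset.sum_congr rfl fun i hi => ?_
  rw [Finset.mem_range] at hi
  have e : zcomp (n - j) (emb (A i)) = emb (zcomp (n - j) (A i)) := by
    have := zcomp_map (c := 0) (emb (k := k)).toLinearMap
      (fun F n h => by simpa using ZHom.emb h) (A i) (n - j)
    rwa [add_zero] at this
  rw [mul_assoc, zcomp_mul (n := n - j) (((zHom_X 0).pow (j - i) rfl).mul ((zHom_X 1).pow i rfl)
    rfl) (by rw [Nat.cast_sub (by omega)]; ring), e, mul_assoc]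

theorem exists_polyForm {j : ℕ} {F : Coord k} (hF : F ∈ stdLine k ^ j) :
    ∃ A, F - polyForm j A ∈ stdLine k ^ (j + 1) := by
  induction j generalizing F with
  | zero =>
    refine ⟨fun _ => res F, ?_⟩
    simpa [polyForm] using sub_emb_res_mem F
  | succ j ih =>
    obtain ⟨G, hG, H, hH, rfl⟩ := mem_stdLine_pow_succ.1 hF
    obtain ⟨A, hA⟩ := ih hG
    obtain ⟨B, hB⟩ := ih hH
    refine ⟨fun i => (if i ≤ j then A i else 0) + (if i = 0 then 0 else B (i - 1)), ?_⟩
    have e : polyForm (j + 1) (fun i => (if i ≤ j then A i else 0) +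
        (if i = 0 then 0 else B (i - 1))) = X 0 * polyForm j A + X 1 * polyForm j B := by
      simp only [polyForm, map_add, add_mul, Finset.sum_add_distrib]
      rw [Finset.sum_range_succ _ (j + 1), Finset.sum_range_succ' _ (j + 1)]
      simp only [if_neg (show ¬ j + 1 ≤ j by omega), map_zero, zero_mul, add_zero, if_true,
        if_neg (Nat.succ_ne_zero _), Nat.add_sub_cancel, Finset.mul_sum]
      congr 1
      · refine Finset.sum_congr rfl fun i hi => ?_
        rw [Finset.mem_range] at hi
        rw [if_pos (by omega), show j + 1 - i = (j - i) + 1 by omega, pow_succ]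
        ring
      · refine Finset.sum_congr rfl fun i hi => ?_
        rw [show j + 1 - (i + 1) = j - i by omega, pow_succ]
        ring
    rw [e]
    exact mem_stdLine_pow_succ.2 ⟨_, hA, _, hB, by ring⟩

/-- The leading form of an element of a power of the ideal of the line. -/
theorem exists_zHom_polyForm {j : ℕ} {F : Coord k} (hF : F ∈ stdLine k ^ j) {n : ℤ}
    (hn : ZHom F n) : ∃ A, (∀ i, ZHom (A i) (n - j)) ∧
      F - polyForm j A ∈ stdLine k ^ (j + 1) := by
  obtain ⟨A, hA⟩ := exists_polyForm hF
  refine ⟨fun i => zcomp (n - j) (A i), fun i => zHom_zcomp _ _, ?_⟩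
  have := stdLine_pow_zcomp hA n
  rwa [map_sub, hn.zcomp_eq, zcomp_polyForm] at this

/-- The homomorphism given by a family of arcs `x₀ = x(t)`, `x₁ = y(t)` over a ring `B` of
functions on the line. -/
def arcHom {B : Type*} [CommRing B] [Algebra k B] (φ : LineRing k →ₐ[k] B)
    (x y : Polynomial B) : Coord k →ₐ[k] Polynomial B :=
  aeval ![x, y, Polynomial.C (φ (X 0)), Polynomial.C (φ (X 1))]

section ArcHom

variable {B : Type*} [CommRing B] [Algebra k B] (φ : LineRing k →ₐ[k] B) (x y : Polynomial B)

@[simp] theorem arcHom_X0 : arcHom φ x y (X 0) = x := by simp [arcHom]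

@[simp] theorem arcHom_X1 : arcHom φ x y (X 1) = y := by simp [arcHom]

@[simp] theorem arcHom_emb (c : LineRing k) : arcHom φ x y (emb c) = Polynomial.C (φ c) := by
  suffices h : (arcHom φ x y).comp emb = (Polynomial.CAlgHom (R := k)).comp φ from
    AlgHom.congr_fun h c
  refine algHom_ext fun i => ?_
  fin_cases i <;> simp [arcHom]

variable {φ x y} {x' y' : Polynomial B}

theorem X_pow_dvd_arcHom (hx : x = Polynomial.X * x') (hy : y = Polynomial.X * y') {j : ℕ}
    {F : Coord k} (hF : F ∈ stdLine k ^ j) : Polynomial.X ^ j ∣ arcHom φ x y F := by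
  induction j generalizing F with
  | zero => simp
  | succ j ih =>
    obtain ⟨G, hG, H, hH, rfl⟩ := mem_stdLine_pow_succ.1 hF
    rw [map_add, map_mul, map_mul, arcHom_X0, arcHom_X1, hx, hy, pow_succ', mul_assoc, mul_assoc]
    rw [← mul_add]
    have h1 : Polynomial.X ^ j ∣ x' * arcHom φ (Polynomial.X * x') (Polynomial.X * y') G := by
      rw [← hx, ← hy]
      exact (ih hG).mul_left x'
    have h2 : Polynomial.X ^ j ∣ y' * arcHom φ (Polynomial.X * x') (Polynomial.X * y') H := by
      rw [← hx, ← hy]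
      exact (ih hH).mul_left y'
    exact mul_dvd_mul_left _ (dvd_add h1 h2)

theorem arcHom_polyForm (hx : x = Polynomial.X * x') (hy : y = Polynomial.X * y') (j : ℕ)
    (A : ℕ → LineRing k) : arcHom φ x y (polyForm j A) = Polynomial.X ^ j *
      ∑ i ∈ Finset.range (j + 1), Polynomial.C (φ (A i)) * x' ^ (j - i) * y' ^ i := by
  rw [polyForm, map_sum, Finset.mul_sum]
  refine Finset.sum_congr rfl fun i hi => ?_
  rw [Finset.mem_range] at hi
  obtain ⟨l, rfl⟩ := Nat.exists_eq_add_of_le (Nat.lt_succ_iff.1 hi)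
  rw [Nat.add_sub_cancel_left, map_mul, map_mul, map_pow, map_pow, arcHom_emb, arcHom_X0, arcHom_X1,
    hx, hy, mul_pow, mul_pow, pow_add]
  ring

theorem coeff_arcHom_of_sub_mem (hx : x = Polynomial.X * x') (hy : y = Polynomial.X * y') {j : ℕ}
    {F : Coord k} {A : ℕ → LineRing k} (h : F - polyForm j A ∈ stdLine k ^ (j + 1)) :
    (arcHom φ x y F).coeff j =
      ∑ i ∈ Finset.range (j + 1), φ (A i) * x'.coeff 0 ^ (j - i) * y'.coeff 0 ^ i := by
  have h1 := Polynomial.X_pow_dvd_iff.1 (X_pow_dvd_arcHom (φ := φ) hx hy h) j (by omega)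
  rw [map_sub, Polynomial.coeff_sub, sub_eq_zero, arcHom_polyForm hx hy] at h1
  rw [h1]
  rw [Polynomial.coeff_X_pow_mul', if_pos le_rfl, Nat.sub_self]
  simp [Polynomial.coeff_zero_eq_eval_zero, Polynomial.eval_finsetSum]

end ArcHom

/-- Leading forms are unique. -/
theorem polyForm_eq_zero {j : ℕ} {A : ℕ → LineRing k} (h : polyForm j A ∈ stdLine k ^ (j + 1)) :
    ∀ i ≤ j, A i = 0 := by
  have h1 : (0 : Coord k) - polyForm j A ∈ stdLine k ^ (j + 1) := by
    rw [zero_sub]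
    exact neg_mem h
  have h2 := coeff_arcHom_of_sub_mem (φ := (Polynomial.CAlgHom (R := k) (A := LineRing k)))
    (x := Polynomial.X) (y := Polynomial.X * Polynomial.C Polynomial.X) (mul_one _).symm rfl h1
  intro i hi
  have h3 := congrArg (fun P => Polynomial.coeff P i) h2
  simp only [map_zero, Polynomial.coeff_zero, Polynomial.coeff_one_zero, one_pow, mul_one,
    Polynomial.coeff_C_zero, Polynomial.CAlgHom_apply, Polynomial.finsetSum_coeff,
    Polynomial.coeff_C_mul_X_pow] at h3
  rw [Finset.sum_ite_eq, if_pos (Finset.mem_range.2 (by omega))] at h3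
  exact h3.symm

end StandardLine


/-! ### Multiple structures on the standard line -/

section StdMultiple

open MvPolynomial

variable {k : Type*} [Field k]

/-- The homogeneous ideals that are primary to the ideal of the line `x₀ = x₁ = 0`. -/
structure IsStdMultiple (I : Ideal (Coord k)) : Prop where
  zcomp_mem : ∀ F ∈ I, ∀ n : ℤ, zcomp n F ∈ I
  le : I ≤ stdLine k
  unmixed : ∀ c F, c ∉ stdLine k → c * F ∈ I → F ∈ I
  pow_le : ∃ N, stdLine k ^ N ≤ I

theorem ringKrullDim_stdLine : ringKrullDim (Coord k ⧸ stdLine k) = 2 := by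
  have hs : Function.Surjective (res (k := k)) := fun c => ⟨emb c, res_emb c⟩
  have hk : RingHom.ker (res (k := k)).toRingHom = stdLine k := by
    ext F
    exact mem_stdLine.symm
  rw [← hk, ringKrullDim_eq_of_ringEquiv (RingHom.quotientKerEquivOfSurjective hs),
    MvPolynomial.ringKrullDim_of_isNoetherianRing, ringKrullDim_eq_zero_of_field]
  simp

namespace IsStdMultiple

variable {I : Ideal (Coord k)}

theorem radical (h : IsStdMultiple I) : I.radical = stdLine k := by
  obtain ⟨N, hN⟩ := h.pow_le
  refine le_antisymm ?_ fun F hF => ⟨N, hN (Ideal.pow_mem_pow hF N)⟩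
  exact (Ideal.radical_mono h.le).trans stdLine_isPrime.radical.le

theorem emb_mul (h : IsStdMultiple I) {c : LineRing k} (hc : c ≠ 0) {F : Coord k} :
    emb c * F ∈ I ↔ F ∈ I :=
  ⟨h.unmixed _ _ fun hc' => hc (emb_mem_stdLine.1 hc'), I.mul_mem_left _⟩

theorem isSpaceCurve (h : IsStdMultiple I) : IsSpaceCurve I := by
  have hne : I ≠ ⊤ := fun h' => stdLine_isPrime.ne_top (top_le_iff.1 (h' ▸ h.le))
  refine ⟨fun F hF n => by simpa [zcomp_natCast] using h.zcomp_mem F hF n, hne, ?_⟩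
  have hp : I.IsPrimary := by
    refine Ideal.isPrimary_iff.2 ⟨hne, fun {F G} hFG => ?_⟩
    by_cases hG : G ∈ stdLine k
    · exact Or.inr (h.radical ▸ hG)
    · exact Or.inl (h.unmixed G F hG (by rwa [mul_comm]))
  rw [associatedPrimes.eq_singleton_of_isPrimary hp, h.radical]
  rintro _ rfl
  exact ringKrullDim_stdLine

end IsStdMultiple

/-- A homogeneous purely one-dimensional ideal supported on the line is primary: an associated prime
contains the ideal of the line and defines a curve, hence equals it, so that functions not vanishing
on the line are not zero divisors. -/
theorem IsSpaceCurve.isStdMultiple {I : Ideal (Coord k)} (h : IsSpaceCurve I)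
    (hr : I.radical = stdLine k) : IsStdMultiple I := by
  have hle : I ≤ stdLine k := hr ▸ Ideal.le_radical
  refine ⟨fun F hF n => ?_, hle, fun c F hc hcF => ?_, ?_⟩
  · rcases lt_or_ge n 0 with hn | hn
    · rw [(zHom_zcomp n F).eq_zero hn]
      exact I.zero_mem
    · obtain ⟨m, rfl⟩ := Int.eq_ofNat_of_zero_le hn
      rw [zcomp_natCast]
      exact h.homogeneous F hF m
  · by_contra hF
    have h1 : (Ideal.Quotient.mk I F) ≠ 0 := fun h => hF (Ideal.Quotient.eq_zero_iff_mem.1 h)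
    have h2 : c ∈ ⋃ p ∈ associatedPrimes (Coord k) (Coord k ⧸ I), (p : Set (Coord k)) := by
      rw [biUnion_associatedPrimes_eq_zero_divisors]
      refine ⟨_, h1, ?_⟩
      exact Ideal.Quotient.eq_zero_iff_mem.2 hcF
    simp only [Set.mem_iUnion] at h2
    obtain ⟨Q, hQ, hcQ⟩ := h2
    have hQp : Q.IsPrime := hQ.isPrime
    have hle : stdLine k ≤ Q := by
      rw [← hr]
      refine hQp.radical_le_iff.2 fun G hG => hQ.annihilator_le ?_
      rw [Submodule.mem_annihilator]
      rintro n -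
      obtain ⟨n, rfl⟩ := Ideal.Quotient.mk_surjective n
      exact Ideal.Quotient.eq_zero_iff_mem.2 (I.mul_mem_right n hG)
    have hnz : Ideal.Quotient.mk (stdLine k) c ∈ nonZeroDivisors (Coord k ⧸ stdLine k) :=
      mem_nonZeroDivisors_of_ne_zero fun h => hc (Ideal.Quotient.eq_zero_iff_mem.1 h)
    have h3 := ringKrullDim_succ_le_of_surjective (Ideal.Quotient.factor hle)
      (Ideal.Quotient.factor_surjective hle) hnz (by
        rw [Ideal.Quotient.factor_mk]
        exact Ideal.Quotient.eq_zero_iff_mem.2 hcQ)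
    rw [ringKrullDim_stdLine, h.pure Q hQ] at h3
    exact absurd h3 (by decide)
  · obtain ⟨N, hN⟩ := Ideal.exists_radical_pow_le_of_fg I (IsNoetherian.noetherian _)
    exact ⟨N, hr ▸ hN⟩

/-- Polynomials in `x₀` with coefficients in the coordinate ring of the line. -/
def polyX (k : Type*) [Field k] : Polynomial (LineRing k) →+* Coord k :=
  Polynomial.eval₂RingHom (emb (k := k) : LineRing k →+* Coord k) (X 0)

theorem polyX_C (c : LineRing k) : polyX k (Polynomial.C c) = emb c := by simp [polyX]

theorem polyX_X : polyX k Polynomial.X = X 0 := by simp [polyX]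

/-- If `I` contains an element whose linear part involves `x₁`, then generically on the line
all functions on the scheme defined by `I` are polynomials in `x₀`. -/
theorem exists_polyX {I : Ideal (Coord k)} {N : ℕ} (hN : stdLine k ^ N ≤ I) {F : Coord k}
    (hF : F ∈ I) {A : ℕ → LineRing k} (hA : F - polyForm 1 A ∈ stdLine k ^ 2) (hA1 : A 1 ≠ 0)
    (G : Coord k) : ∃ c ≠ 0, ∃ h, emb c * G - polyX k h ∈ I := by
  let M : Subring (Coord k) :=
    { carrier := {G | ∃ c ≠ 0, ∃ h, emb c * G - polyX k h ∈ I}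
      mul_mem' := by
        rintro G H ⟨c, hc, g, hg⟩ ⟨d, hd, h, hh⟩
        refine ⟨c * d, mul_ne_zero hc hd, g * h, ?_⟩
        have h1 := I.add_mem (I.mul_mem_left (emb d * H) hg) (I.mul_mem_left (polyX k g) hh)
        convert h1 using 1
        rw [map_mul, map_mul]
        ring
      one_mem' := ⟨1, one_ne_zero, 1, by simp⟩
      add_mem' := by
        rintro G H ⟨c, hc, g, hg⟩ ⟨d, hd, h, hh⟩
        refine ⟨c * d, mul_ne_zero hc hd, Polynomial.C d * g + Polynomial.C c * h, ?_⟩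
        have h1 := I.add_mem (I.mul_mem_left (emb d) hg) (I.mul_mem_left (emb c) hh)
        convert h1 using 1
        rw [map_mul, map_add, map_mul, map_mul, polyX_C, polyX_C]
        ring
      zero_mem' := ⟨1, one_ne_zero, 0, by simp⟩
      neg_mem' := by
        rintro G ⟨c, hc, g, hg⟩
        refine ⟨c, hc, -g, ?_⟩
        convert I.neg_mem hg using 1
        rw [map_neg]
        ring }
  have hI : ∀ G ∈ I, G ∈ M := fun G hG => ⟨1, one_ne_zero, 0, by simpa using hG⟩
  have hemb : ∀ c, emb c ∈ M := fun c => ⟨1, one_ne_zero, Polynomial.C c, by simp [polyX_C]⟩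
  have hX0 : X 0 ∈ M := ⟨1, one_ne_zero, Polynomial.X, by simp [polyX_X]⟩
  have hdiv : ∀ c ≠ 0, ∀ G, emb c * G ∈ M → G ∈ M := by
    rintro c hc G ⟨d, hd, h, hh⟩
    exact ⟨d * c, mul_ne_zero hd hc, h, by rwa [map_mul, mul_assoc]⟩
  have key : ∀ j, ∀ i ≤ N, j + i = N → ∀ G ∈ stdLine k ^ j, G ∈ M := by
    intro j i hi hj
    induction i generalizing j with
    | zero => exact fun G hG => hI G (hN (by rwa [show N = j by omega]))
    | succ i ih =>
      have ih := ih (j + 1) (by omega) (by omega)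
      rcases Nat.eq_zero_or_pos j with rfl | hj0
      · intro G _
        have h1 := ih (G - emb (res G)) (by simpa using sub_emb_res_mem G)
        simpa using M.add_mem h1 (hemb (res G))
      -- Modulo higher powers of the ideal of the line, `x₁` can be eliminated.
      have hpure : ∀ i, ∀ r, r + i = j → X 0 ^ r * X 1 ^ i ∈ M := by
        intro i
        induction i with
        | zero =>
          intro r _
          simpa using M.pow_mem hX0 r
        | succ i ih2 =>
          intro r hr
          refine hdiv _ hA1 _ ?_
          have h1 : X 0 ^ r * X 1 ^ i * (F - polyForm 1 A) ∈ M := by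
            refine ih _ ?_
            have := Ideal.mul_mem_mul (Ideal.mul_mem_mul (Ideal.pow_mem_pow (X0_mem (k := k)) r)
              (Ideal.pow_mem_pow (X1_mem (k := k)) i)) hA
            rwa [← pow_add, ← pow_add, show r + i + 2 = j + 1 by omega] at this
          have h2 := hI _ (I.mul_mem_left (X 0 ^ r * X 1 ^ i) hF)
          have h3 := M.mul_mem (hemb (A 0)) (ih2 (r + 1) (by omega))
          convert M.sub_mem (M.sub_mem h2 h1) h3 using 1
          simp only [polyForm, Finset.sum_range_succ, Finset.sum_range_zero]
          ring
      intro G hG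
      obtain ⟨B, hB⟩ := exists_polyForm hG
      have h1 : polyForm j B ∈ M := by
        refine M.sum_mem fun i hi => ?_
        rw [Finset.mem_range] at hi
        rw [mul_assoc]
        exact M.mul_mem (hemb _) (hpure _ _ (by omega))
      simpa using M.add_mem (ih _ hB) h1
  exact key 0 N le_rfl (by omega) G (by simp)

theorem polyX_sub_mem {I : Ideal (Coord k)} {e : ℕ} (he : X 0 ^ e ∈ I)
    (h : Polynomial (LineRing k)) :
    polyX k h - ∑ i ∈ Finset.range e, emb (h.coeff i) * X 0 ^ i ∈ I := by
  have h1 : Polynomial.X ^ e ∣ h - ∑ i ∈ Finset.range e,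
      Polynomial.C (h.coeff i) * Polynomial.X ^ i := by
    refine Polynomial.X_pow_dvd_iff.2 fun d hd => ?_
    simp only [Polynomial.coeff_sub, Polynomial.finsetSum_coeff, Polynomial.coeff_C_mul_X_pow]
    rw [Finset.sum_ite_eq, if_pos (Finset.mem_range.2 hd), sub_self]
  obtain ⟨g, hg⟩ := h1
  have h2 := congrArg (polyX k) hg
  simp only [map_sub, map_sum, map_mul, map_pow, polyX_C, polyX_X] at h2
  rw [h2]
  exact I.mul_mem_right _ he

/-- Powers of `x₀` that do not lie in `I` are independent modulo `I`. -/
theorem IsStdMultiple.coeff_eq_zero {I : Ideal (Coord k)} (hI : IsStdMultiple I) {e : ℕ}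
    (he : X 0 ^ e ∈ I) (he' : ∀ i < e, X 0 ^ i ∉ I) {a : ℕ → LineRing k}
    (h : ∑ i ∈ Finset.range e, emb (a i) * X 0 ^ i ∈ I) : ∀ i < e, a i = 0 := by
  intro i
  induction i using Nat.strong_induction_on with
  | _ i ih =>
    intro hi
    by_contra ha
    have h1 : X 0 ^ (e - 1 - i) * (∑ j ∈ Finset.range e, emb (a j) * X 0 ^ j) -
        emb (a i) * X 0 ^ (e - 1) ∈ I := by
      rw [Finset.mul_sum, ← Finset.add_sum_erase _ _ (Finset.mem_range.2 hi)]
      have h2 : X 0 ^ (e - 1 - i) * (emb (a i) * X 0 ^ i) - emb (a i) * X 0 ^ (e - 1) = 0 := by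
        rw [show e - 1 = (e - 1 - i) + i by omega, pow_add, Nat.add_sub_cancel]
        ring
      rw [add_sub_right_comm, h2, zero_add]
      refine I.sum_mem fun j hj => ?_
      rw [Finset.mem_erase, Finset.mem_range] at hj
      rcases lt_or_gt_of_ne hj.1 with h3 | h3
      · rw [ih j h3 hj.2, map_zero, zero_mul, mul_zero]
        exact I.zero_mem
      · have : X 0 ^ (e - 1 - i) * (emb (a j) * X 0 ^ j) =
            emb (a j) * X 0 ^ (e - 1 - i + j - e) * X 0 ^ e := by
          rw [mul_assoc, ← pow_add, show e - 1 - i + j - e + e = e - 1 - i + j by omega, pow_add]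
          ring
        rw [this]
        exact I.mul_mem_left _ he
    have h2 := (Submodule.sub_mem_iff_right I (I.mul_mem_left _ h)).1 h1
    exact he' (e - 1) (by omega) ((hI.emb_mul ha).1 h2)

/-- Two multiple structures on the line that are generically given by the same equations
`x₀ᵉ = 0` and `F = 0`, where the linear part of `F` involves `x₁`, coincide. -/
theorem IsStdMultiple.ext {I I' : Ideal (Coord k)} (hI : IsStdMultiple I) (hI' : IsStdMultiple I')
    {e : ℕ} (he : X 0 ^ e ∈ I) (he' : ∀ i < e, X 0 ^ i ∉ I) (hf : X 0 ^ e ∈ I')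
    (hf' : ∀ i < e, X 0 ^ i ∉ I') {F : Coord k} (hF : F ∈ I) (hF' : F ∈ I')
    {A : ℕ → LineRing k} (hA : F - polyForm 1 A ∈ stdLine k ^ 2) (hA1 : A 1 ≠ 0) : I = I' := by
  obtain ⟨N, hN⟩ := hI.pow_le
  obtain ⟨N', hN'⟩ := hI'.pow_le
  have hNN : stdLine k ^ (N + N') ≤ I ⊓ I' :=
    le_inf ((Ideal.pow_le_pow_right (by omega)).trans hN)
      ((Ideal.pow_le_pow_right (by omega)).trans hN')
  have key : ∀ G, ∃ c ≠ 0, ∃ a : ℕ → LineRing k,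
      emb c * G - ∑ i ∈ Finset.range e, emb (a i) * X 0 ^ i ∈ I ⊓ I' := by
    intro G
    obtain ⟨c, hc, h, hh⟩ := exists_polyX hNN ⟨hF, hF'⟩ hA hA1 G
    refine ⟨c, hc, h.coeff, ?_⟩
    have := (I ⊓ I').add_mem hh (polyX_sub_mem (I := I ⊓ I') ⟨he, hf⟩ h)
    simpa using this
  ext G
  obtain ⟨c, hc, a, ha⟩ := key G
  have h1 : G ∈ I ↔ ∑ i ∈ Finset.range e, emb (a i) * X 0 ^ i ∈ I := by
    rw [← hI.emb_mul hc]
    exact ⟨fun h => (Submodule.sub_mem_iff_right I h).1 ha.1,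
      fun h => (Submodule.sub_mem_iff_left I h).1 ha.1⟩
  have h2 : G ∈ I' ↔ ∑ i ∈ Finset.range e, emb (a i) * X 0 ^ i ∈ I' := by
    rw [← hI'.emb_mul hc]
    exact ⟨fun h => (Submodule.sub_mem_iff_right I' h).1 ha.2,
      fun h => (Submodule.sub_mem_iff_left I' h).1 ha.2⟩
  have h0 : ∀ J : Ideal (Coord k), (∀ i < e, a i = 0) →
      ∑ i ∈ Finset.range e, emb (a i) * X 0 ^ i ∈ J := by
    intro J h
    refine J.sum_mem fun i hi => ?_
    rw [h i (Finset.mem_range.1 hi), map_zero, zero_mul]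
    exact J.zero_mem
  rw [h1, h2]
  exact ⟨fun h => h0 _ (hI.coeff_eq_zero he he' h), fun h => h0 _ (hI'.coeff_eq_zero hf hf' h)⟩

end StdMultiple


/-! ### Hilbert functions -/

section HilbertFunction

variable {k : Type*} [Field k]

theorem mem_gradedPart {I : Ideal (Coord k)} {n : ℕ} {F : Forms k n} :
    F ∈ gradedPart I n ↔ (F : Coord k) ∈ I := Iff.rfl

theorem quotDim_eq_finrank_map {I J : Ideal (Coord k)} {n : ℕ} (hIJ : I ≤ J) {V : Type*}
    [AddCommGroup V] [Module k V] (L : Forms k n →ₗ[k] V)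
    (hL : ∀ F ∈ gradedPart J n, L F = 0 ↔ F ∈ gradedPart I n) :
    quotDim I J n = Module.finrank k ((gradedPart J n).map L) := by
  have h := LinearMap.finrank_range_add_finrank_ker (V := gradedPart J n)
    (L.domRestrict (gradedPart J n))
  have h1 : LinearMap.range (L.domRestrict (gradedPart J n)) = (gradedPart J n).map L := by
    rw [LinearMap.range_domRestrict]
  have h2 : (LinearMap.ker (L.domRestrict (gradedPart J n))).map (gradedPart J n).subtype =
      gradedPart I n := by
    ext F
    constructor
    · rintro ⟨⟨G, hG⟩, hG', rfl⟩
      exact (hL G hG).1 hG'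
    · intro hF
      have hJ : F ∈ gradedPart J n := hIJ hF
      exact ⟨⟨F, hJ⟩, (hL F hJ).2 hF, rfl⟩
  have h3 := (Submodule.equivMapOfInjective (gradedPart J n).subtype Subtype.val_injective
    (LinearMap.ker (L.domRestrict (gradedPart J n)))).finrank_eq
  rw [h2] at h3
  rw [h1, h3] at h
  rw [quotDim]
  omega

theorem finrank_le_quotDim {I J : Ideal (Coord k)} {n : ℕ} (hIJ : I ≤ J) {V : Type*}
    [AddCommGroup V] [Module k V] [Module.Finite k V] (L : V →ₗ[k] Forms k n)
    (hJ : ∀ x, (L x : Coord k) ∈ J) (hL : ∀ x, (L x : Coord k) ∈ I → x = 0) :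
    (Module.finrank k V : ℤ) ≤ quotDim I J n := by
  rw [quotDim_eq_finrank_map hIJ (gradedPart I n).mkQ (fun F _ => by simp)]
  have hinj : Function.Injective ((gradedPart I n).mkQ ∘ₗ L) := by
    rw [← LinearMap.ker_eq_bot, eq_bot_iff]
    intro x hx
    exact hL x (by simpa [mem_gradedPart] using hx)
  have h1 := LinearMap.finrank_range_of_inj hinj
  rw [← h1]
  refine Nat.cast_le.2 (Submodule.finrank_mono ?_)
  rintro _ ⟨x, rfl⟩
  exact ⟨L x, hJ x, rfl⟩

theorem quotDim_add (I J K : Ideal (Coord k)) (n : ℕ) :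
    quotDim I J n + quotDim J K n = quotDim I K n := by
  simp only [quotDim]
  ring

/-- Forms that are independent over the coordinate ring of the line give a lower bound for
the Hilbert function. -/
theorem le_quotDim {I J : Ideal (Coord k)} (hIJ : I ≤ J) {r : ℕ} {M : Fin r → Coord k}
    {δ : Fin r → ℕ} (hM : ∀ i, ZHom (M i) (δ i)) (hMJ : ∀ i, M i ∈ J)
    (hli : ∀ c : Fin r → LineRing k, ∑ i, emb (c i) * M i ∈ I → c = 0) (n : ℕ) :
    (r : ℤ) * (n + 1) - ∑ i, (δ i : ℤ) ≤ quotDim I J n := by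
  let L : (∀ i, binForms k ((n : ℤ) - δ i)) →ₗ[k] Forms k n :=
    { toFun := fun c => ⟨∑ i, emb (c i).1 * M i, zHom_natCast.1 (ZHom.sum fun i _ =>
        (c i).2.emb.mul (hM i) (by ring))⟩
      map_add' := fun c d => Subtype.ext (by
        simp [add_mul, Finset.sum_add_distrib])
      map_smul' := fun a c => Subtype.ext (by
        simp [Finset.smul_sum]) }
  have hLJ : ∀ x, (L x : Coord k) ∈ J := fun x => by
    change ∑ i, emb (x i).1 * M i ∈ J
    exact Submodule.sum_mem _ fun i _ => J.mul_mem_left _ (hMJ i)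
  refine le_trans ?_ (finrank_le_quotDim hIJ L hLJ fun x hx => ?_)
  · rw [Module.finrank_pi_fintype]
    simp only [finrank_binForms]
    push_cast
    have : (r : ℤ) * (n + 1) - ∑ i, (δ i : ℤ) = ∑ i : Fin r, ((n : ℤ) - δ i + 1) := by
      simp only [Finset.sum_add_distrib, Finset.sum_sub_distrib, Finset.sum_const,
        Finset.card_univ, Fintype.card_fin, nsmul_eq_mul]
      ring
    rw [this]
    exact Finset.sum_le_sum fun i _ => Int.self_le_toNat _
  · have := hli (fun i => (x i).1) hx
    ext1 i
    exact Subtype.ext (congrFun this i)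

theorem finrank_mul_binForms {m : LineRing k} (hm : m ≠ 0) (n : ℤ) :
    Module.finrank k ((binForms k n).map (LinearMap.mulLeft k m)) = (n + 1).toNat := by
  rw [← finrank_binForms (k := k)]
  exact (Submodule.equivMapOfInjective (LinearMap.mulLeft k m)
    (fun a b h => mul_left_cancel₀ hm h) (binForms k n)).finrank_eq.symm

theorem le_of_eventually_le {a b c d : ℤ}
    (h : ∀ᶠ n : ℕ in atTop, a * n + b ≤ c * n + d) : a ≤ c := by
  by_contra hac
  obtain ⟨N, hN⟩ := eventually_atTop.1 h
  have h1 := hN (N + (d - b).toNat + 1) (by omega)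
  have h3 : d - b ≤ (d - b).toNat := Int.self_le_toNat _
  push_cast at h1
  nlinarith

theorem HasRankDegree.unique {I J : Ideal (Coord k)} {r r' : ℕ} {δ δ' : ℤ}
    (h : HasRankDegree I J r δ) (h' : HasRankDegree I J r' δ') : r = r' ∧ δ = δ' := by
  have e : ∀ᶠ n : ℕ in atTop, (r : ℤ) * (n + 1) + δ = r' * (n + 1) + δ' := by
    filter_upwards [h, h'] with n h1 h2
    rw [← h1, h2]
  have h1 : (r : ℤ) = r' := le_antisymm
    (le_of_eventually_le (b := r + δ) (d := r' + δ') (e.mono fun n hn => by linarith))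
    (le_of_eventually_le (b := r' + δ') (d := r + δ) (e.mono fun n hn => by linarith))
  obtain ⟨n, hn⟩ := e.exists
  rw [h1] at hn
  exact ⟨by exact_mod_cast h1, by linarith⟩

theorem HasDegreeGenus.unique {I : Ideal (Coord k)} {d d' : ℕ} {g g' : ℤ}
    (h : HasDegreeGenus I d g) (h' : HasDegreeGenus I d' g') : d = d' ∧ g = g' := by
  have e : ∀ᶠ n : ℕ in atTop, (n : ℤ) * d + 1 - g = n * d' + 1 - g' := by
    filter_upwards [h, h'] with n h1 h2
    rw [← h1, h2]
  have h1 : (d : ℤ) = d' := le_antisymm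
    (le_of_eventually_le (b := 1 - g) (d := 1 - g') (e.mono fun n hn => by linarith))
    (le_of_eventually_le (b := 1 - g') (d := 1 - g) (e.mono fun n hn => by linarith))
  obtain ⟨n, hn⟩ := e.exists
  rw [h1] at hn
  exact ⟨by exact_mod_cast h1, by linarith⟩

/-- The degree of a curve bounds the number of independent functions over the line. -/
theorem HasDegreeGenus.card_le {I : Ideal (Coord k)} {d : ℕ} {g : ℤ} (h : HasDegreeGenus I d g)
    {r : ℕ} {M : Fin r → Coord k} {δ : Fin r → ℕ} (hM : ∀ i, ZHom (M i) (δ i))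
    (hli : ∀ c : Fin r → LineRing k, ∑ i, emb (c i) * M i ∈ I → c = 0) : r ≤ d := by
  have := le_of_eventually_le (a := r) (b := r - ∑ i, (δ i : ℤ)) (c := d) (d := 1 - g)
    (h.mono fun n hn => by
      have := le_quotDim (J := ⊤) le_top hM (fun _ => trivial) hli n
      rw [hn] at this
      linarith)
  exact_mod_cast this

end HilbertFunction

/-! ### Curvilinear multiple structures as kernels of jets -/

section Jets

open MvPolynomial

variable {k : Type*} [Field k]

/-- A homogeneous jet of curves `x₀ = D t`, `x₁ = t E(t)` transversal to the line, over the
generic point of the line; the parameter `t` has degree `-τ`. -/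
structure Jet (k : Type*) [Field k] where
  /-- The derivative of the coordinate `x₀`. -/
  D : LineRing k
  /-- The coordinate `x₁`, divided by the parameter. -/
  E : Polynomial (LineRing k)
  /-- Minus the degree of the parameter. -/
  τ : ℤ
  zHom_D : ZHom D (1 + τ)
  D_ne : D ≠ 0
  zHom_E : ∀ i : ℕ, ZHom (E.coeff i) (1 + τ + i * τ)

namespace Jet

variable (J : Jet k)

/-- Restriction of functions to the jet. -/
def hom : Coord k →ₐ[k] Polynomial (LineRing k) :=
  arcHom (AlgHom.id k _) (Polynomial.X * Polynomial.C J.D) (Polynomial.X * J.E)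

/-- The ideal of the multiple structure of multiplicity `j` given by a jet. -/
def ideal (j : ℕ) : Ideal (Coord k) :=
  (Ideal.span {(Polynomial.X : Polynomial (LineRing k)) ^ j}).comap J.hom

theorem mem_ideal {j : ℕ} {F : Coord k} : F ∈ J.ideal j ↔ Polynomial.X ^ j ∣ J.hom F := by
  rw [ideal, Ideal.mem_comap, Ideal.mem_span_singleton]

theorem mem_ideal_iff_coeff {j : ℕ} {F : Coord k} :
    F ∈ J.ideal j ↔ ∀ i < j, (J.hom F).coeff i = 0 := by
  rw [mem_ideal, Polynomial.X_pow_dvd_iff]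

@[simp] theorem hom_X0 : J.hom (X 0) = Polynomial.X * Polynomial.C J.D := by simp [hom]

@[simp] theorem hom_X1 : J.hom (X 1) = Polynomial.X * J.E := by simp [hom]

@[simp] theorem hom_emb (c : LineRing k) : J.hom (emb c) = Polynomial.C c := by simp [hom]

theorem pow_le_ideal (j : ℕ) : stdLine k ^ j ≤ J.ideal j := fun _ hF =>
  J.mem_ideal.2 (X_pow_dvd_arcHom rfl rfl hF)

theorem ideal_antitone {i j : ℕ} (h : i ≤ j) : J.ideal j ≤ J.ideal i := fun _ hF =>
  J.mem_ideal.2 ((pow_dvd_pow _ h).trans (J.mem_ideal.1 hF))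

theorem ideal_zero : J.ideal 0 = ⊤ := by
  ext F
  simp [mem_ideal]

theorem coeff_zero_hom (F : Coord k) : (J.hom F).coeff 0 = res F := by
  have h0 : F - polyForm 0 (fun _ => res F) ∈ stdLine k ^ (0 + 1) := by
    simpa [polyForm] using sub_emb_res_mem F
  have h := coeff_arcHom_of_sub_mem (φ := AlgHom.id k (LineRing k))
    (x := Polynomial.X * Polynomial.C J.D) (y := Polynomial.X * J.E) rfl rfl h0
  refine h.trans ?_
  rw [Finset.sum_range_one]
  exact (mul_one _).trans (mul_one _)

theorem ideal_one : J.ideal 1 = stdLine k := by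
  ext F
  rw [mem_ideal_iff_coeff, mem_stdLine, ← J.coeff_zero_hom]
  simp

/-- Restriction to the jet is homogeneous, the parameter having degree `-τ`. -/
theorem zHom_coeff {F : Coord k} {n : ℤ} (h : ZHom F n) (i : ℕ) :
    ZHom ((J.hom F).coeff i) (n + i * J.τ) := by
  let M (m : ℤ) (P : Polynomial (LineRing k)) : Prop := ∀ i : ℕ, ZHom (P.coeff i) (m + i * J.τ)
  have hmul : ∀ {m m' : ℤ} {P Q : Polynomial (LineRing k)}, M m P → M m' Q →
      M (m + m') (P * Q) := by
    intro m m' P Q hP hQ i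
    rw [Polynomial.coeff_mul]
    refine ZHom.sum fun ij hij => (hP ij.1).mul (hQ ij.2) ?_
    rw [← Finset.HasAntidiagonal.mem_antidiagonal.1 hij]
    push_cast
    ring
  have hC : ∀ {m : ℤ} {c : LineRing k}, ZHom c m → M m (Polynomial.C c) := by
    intro m c hc i
    rw [Polynomial.coeff_C]
    split_ifs with hi
    · subst hi
      simpa using hc
    · exact zHom_zero _
  have hX : M (-J.τ) Polynomial.X := by
    intro i
    rw [Polynomial.coeff_X]
    split_ifs with hi
    · subst hi
      simpa using zHom_one
    · exact zHom_zero _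
  have hpow : ∀ {P : Polynomial (LineRing k)}, M 1 P → ∀ r : ℕ, M r (P ^ r) := by
    intro P hP r
    induction r with
    | zero => simpa using hC zHom_one
    | succ r ih =>
      rw [pow_succ, Nat.cast_succ]
      exact hmul ih hP
  have hgen : ∀ i, M 1 (J.hom (X i)) := by
    intro i
    have h0 := hmul hX (hC J.zHom_D)
    have h1 := hmul hX (m' := 1 + J.τ) J.zHom_E
    fin_cases i
    · convert h0 using 1
      · ring
      · exact J.hom_X0
    · convert h1 using 1
      · ring
      · exact J.hom_X1
    · convert hC (zHom_X 0) using 1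
      simpa using J.hom_emb (X 0)
    · convert hC (zHom_X 1) using 1
      simpa using J.hom_emb (X 1)
  have key : ∀ (d : Fin 4 →₀ ℕ) (c : k), M d.degree (J.hom (monomial d c)) := by
    intro d c
    rw [monomial_eq, map_mul, Finsupp.prod_fintype _ _ (fun _ => pow_zero _), map_prod]
    have h1 : J.hom (C c) = Polynomial.C (C c) := by
      rw [← algebraMap_eq, AlgHom.commutes]
      rfl
    have h2 : ZHom (C c : LineRing k) 0 := by simpa using zHom_natCast.2 (isHomogeneous_C (Fin 2) c)
    rw [h1, Finsupp.degree_eq_sum]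
    simp only [map_pow, Fin.prod_univ_four, Fin.sum_univ_four]
    have h3 := hmul (hC h2) (hmul (hmul (hmul (hpow (hgen 0) (d 0)) (hpow (hgen 1) (d 1)))
      (hpow (hgen 2) (d 2))) (hpow (hgen 3) (d 3)))
    convert h3 using 1
    push_cast
    ring
  rw [F.as_sum, map_sum, Polynomial.finsetSum_coeff]
  refine ZHom.sum fun d hd => ?_
  rw [← h d (mem_support_iff.1 hd)]
  exact key _ _ _

/-- The `i`-th coefficient of the restriction to a jet. -/
def coeffHom (i : ℕ) : Coord k →ₗ[k] LineRing k :=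
  (Polynomial.lcoeff (LineRing k) i).restrictScalars k ∘ₗ J.hom.toLinearMap

theorem coeffHom_apply (i : ℕ) (F : Coord k) : J.coeffHom i F = (J.hom F).coeff i := rfl

theorem zcomp_coeff (F : Coord k) (n : ℤ) (i : ℕ) :
    zcomp (n + i * J.τ) ((J.hom F).coeff i) = (J.hom (zcomp n F)).coeff i :=
  zcomp_map (J.coeffHom i) (fun _ _ h => J.zHom_coeff h i) F n

theorem emb_ne_zero_hom {c : Coord k} (hc : c ∉ stdLine k) :
    ¬ (Polynomial.X : Polynomial (LineRing k)) ∣ J.hom c := by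
  rw [Polynomial.X_dvd_iff, J.coeff_zero_hom, ← mem_stdLine]
  exact hc

theorem isStdMultiple {j : ℕ} (hj : 1 ≤ j) : IsStdMultiple (J.ideal j) where
  zcomp_mem F hF n := by
    rw [mem_ideal_iff_coeff] at hF ⊢
    intro i hi
    rw [← zcomp_coeff, hF i hi, map_zero]
  le := J.ideal_one ▸ J.ideal_antitone hj
  unmixed c F hc hF := by
    rw [mem_ideal, map_mul] at hF
    exact J.mem_ideal.2 (Polynomial.prime_X.pow_dvd_of_dvd_mul_left j (J.emb_ne_zero_hom hc) hF)
  pow_le := ⟨j, J.pow_le_ideal j⟩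

theorem X0_pow_mem_ideal {i j : ℕ} : X 0 ^ i ∈ J.ideal j ↔ j ≤ i := by
  constructor
  · intro h
    by_contra hij
    have := J.mem_ideal_iff_coeff.1 h i (by omega)
    rw [map_pow, hom_X0, mul_pow, ← Polynomial.C_pow, Polynomial.coeff_X_pow_mul', if_pos le_rfl,
      Nat.sub_self, Polynomial.coeff_C_zero] at this
    exact pow_ne_zero _ J.D_ne this
  · exact fun h => J.pow_le_ideal _ (Ideal.pow_le_pow_right h (Ideal.pow_mem_pow X0_mem i))

/-- The jet lies on a surface that is smooth at the generic point of the line: the parameter can be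
eliminated after inverting `D`. -/
theorem exists_linear_mem_ker : ∃ F, J.hom F = 0 ∧ ∃ A : ℕ → LineRing k,
    F - polyForm 1 A ∈ stdLine k ^ 2 ∧ A 1 ≠ 0 := by
  let N := J.E.natDegree
  let F : Coord k := emb (J.D ^ (N + 1)) * X 1 -
    ∑ i ∈ Finset.range (N + 1), emb (J.E.coeff i * J.D ^ (N - i)) * X 0 ^ (i + 1)
  refine ⟨F, ?_, fun i => if i = 0 then -(J.E.coeff 0 * J.D ^ N) else J.D ^ (N + 1), ?_, ?_⟩
  · have h1 : J.E = ∑ i ∈ Finset.range (N + 1), Polynomial.C (J.E.coeff i) * Polynomial.X ^ i :=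
      J.E.as_sum_range_C_mul_X_pow
    simp only [F, map_sub, map_mul, map_sum, hom_emb, map_pow, hom_X0, hom_X1]
    rw [sub_eq_zero]
    conv_lhs => rw [h1]
    rw [Finset.mul_sum, Finset.mul_sum]
    refine Finset.sum_congr rfl fun i hi => ?_
    rw [Finset.mem_range] at hi
    rw [show N + 1 = (N - i) + (i + 1) by omega, pow_add, mul_pow, pow_succ Polynomial.X i]
    ring
  · have h1 : F - polyForm 1 (fun i => if i = 0 then -(J.E.coeff 0 * J.D ^ N) else J.D ^ (N + 1)) =
        -∑ i ∈ Finset.range N, emb (J.E.coeff (i + 1) * J.D ^ (N - (i + 1))) * X 0 ^ (i + 2) := by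
      simp only [F, polyForm]
      rw [Finset.sum_range_succ', Finset.sum_range_succ _ 1, Finset.sum_range_one]
      simp
      ring
    rw [h1]
    refine neg_mem (Submodule.sum_mem _ fun i _ => Ideal.mul_mem_left _ _ ?_)
    exact Ideal.pow_le_pow_right (by omega) (Ideal.pow_mem_pow X0_mem (i + 2))
  · simpa using pow_ne_zero (N + 1) J.D_ne

end Jet

end Jets


section JetStructure

open MvPolynomial

variable {k : Type*} [Field k]

/-- The ideal of `C_j` is the contraction of the localization of `I + stdLine ^ j` at the generic
point of the line, the line being the only component. -/
theorem IsStdMultiple.mem_filtrant {I : Ideal (Coord k)} (hI : IsStdMultiple I) {j : ℕ}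
    (hj : 1 ≤ j) {F : Coord k} :
    F ∈ filtrant I j ↔ ∃ s, s ∉ stdLine k ∧ s * F ∈ I ⊔ stdLine k ^ j := by
  have h1 : (I ⊔ stdLine k ^ j).radical = stdLine k := by
    refine le_antisymm ?_ ?_
    · rw [stdLine_isPrime.radical_le_iff]
      exact sup_le hI.le (Ideal.pow_le_self (by omega))
    · rw [← hI.radical]
      exact Ideal.radical_mono le_sup_left
  have h2 : (I ⊔ stdLine k ^ j).minimalPrimes = {stdLine k} := by
    rw [← Ideal.radical_minimalPrimes, h1, Ideal.minimalPrimes_eq_subsingleton_self]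
  rw [filtrant, hI.radical]
  change (∃ s, (∀ p ∈ (I ⊔ stdLine k ^ j).minimalPrimes, s ∉ p) ∧ _) ↔ _
  simp only [h2, Set.mem_singleton_iff, forall_eq]

/-- The curves `C_j` of the multiple structure given by a jet are given by its truncations. -/
theorem Jet.filtrant_ideal (J : Jet k) {d j : ℕ} (hj : 1 ≤ j) (hjd : j ≤ d) :
    filtrant (J.ideal d) j = J.ideal j := by
  have hd : 1 ≤ d := hj.trans hjd
  have hI := J.isStdMultiple hd
  ext F
  rw [hI.mem_filtrant hj]
  constructor
  · rintro ⟨s, hs, hsF⟩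
    exact (J.isStdMultiple hj).unmixed s F hs
      (sup_le (J.ideal_antitone hjd) (J.pow_le_ideal j) hsF)
  · intro hF
    obtain ⟨G, hG, A, hA, hA1⟩ := J.exists_linear_mem_ker
    have hG' : ∀ i, G ∈ J.ideal i := fun i => J.mem_ideal.2 (by rw [hG]; exact dvd_zero _)
    obtain ⟨c, hc, h, hh⟩ := exists_polyX (J.pow_le_ideal d) (hG' d) hA hA1 F
    have h1 := (J.ideal d).add_mem hh
      (polyX_sub_mem (I := J.ideal d) (J.X0_pow_mem_ideal.2 le_rfl) h)
    have h2 : emb c * F - ∑ i ∈ Finset.range d, emb (h.coeff i) * X 0 ^ i ∈ J.ideal d := by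
      simpa using h1
    have h3 : ∑ i ∈ Finset.range j, emb (h.coeff i) * X 0 ^ i ∈ J.ideal j := by
      have h4 := (Submodule.sub_mem_iff_right _ ((J.ideal j).mul_mem_left (emb c) hF)).1
        (J.ideal_antitone hjd h2)
      rw [← Finset.sum_range_add_sum_Ico _ hjd] at h4
      refine (Submodule.add_mem_iff_left _ (Submodule.sum_mem _ fun i hi => ?_)).1 h4
      exact Ideal.mul_mem_left _ _ (J.X0_pow_mem_ideal.2 (Finset.mem_Ico.1 hi).1)
    have h5 := (J.isStdMultiple hj).coeff_eq_zero (J.X0_pow_mem_ideal.2 le_rfl)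
      (fun i hi hi' => absurd (J.X0_pow_mem_ideal.1 hi') (by omega)) h3
    refine ⟨emb c, fun hc' => hc (emb_mem_stdLine.1 hc'), ?_⟩
    have h6 : ∑ i ∈ Finset.range d, emb (h.coeff i) * X 0 ^ i ∈ stdLine k ^ j := by
      refine Submodule.sum_mem _ fun i _ => ?_
      rcases lt_or_ge i j with hi | hi
      · rw [h5 i hi, map_zero, zero_mul]
        exact zero_mem _
      · exact Ideal.mul_mem_left _ _ (Ideal.pow_le_pow_right hi (Ideal.pow_mem_pow X0_mem i))
    have := add_mem (show _ ∈ J.ideal d ⊔ stdLine k ^ j from Ideal.mem_sup_left h2)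
      (Ideal.mem_sup_right h6)
    simpa using this

/-- A multiple structure that lies on a surface smooth at the generic point of the line, and
transversal to `x₀ = 0` there, comes from a jet. -/
theorem IsStdMultiple.exists_jet {I : Ideal (Coord k)} (hI : IsStdMultiple I) {F : Coord k}
    (hF : F ∈ I) {A : ℕ → LineRing k} (hA : F - polyForm 1 A ∈ stdLine k ^ 2) (hA1 : A 1 ≠ 0) :
    ∃ J : Jet k, ∃ d, 1 ≤ d ∧ I = J.ideal d := by
  classical
  obtain ⟨N, hN⟩ := hI.pow_le
  have hex : ∃ e, (X 0 : Coord k) ^ e ∈ I := ⟨N, hN (Ideal.pow_mem_pow X0_mem N)⟩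
  -- The minimality of `e` makes the powers `x₀ⁱ`, `i < e`, independent over the line.
  let e := Nat.find hex
  have he : X 0 ^ e ∈ I := Nat.find_spec hex
  have he' : ∀ i < e, X 0 ^ i ∉ I := fun i hi => Nat.find_min hex hi
  have he1 : 1 ≤ e := by
    by_contra h
    have h0 : e = 0 := by omega
    rw [h0, pow_zero] at he
    exact stdLine_isPrime.ne_top (Ideal.eq_top_of_isUnit_mem _ (hI.le he) isUnit_one)
  obtain ⟨c, hc, h, hh⟩ := exists_polyX hN hF hA hA1 (X 1)
  have h1 : emb c * X 1 - ∑ i ∈ Finset.range e, emb (h.coeff i) * X 0 ^ i ∈ I := by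
    simpa using I.add_mem hh (polyX_sub_mem he h)
  -- A homogeneous component of this relation with nonzero leading coefficient.
  obtain ⟨l, hl⟩ : ∃ l : ℕ, zcomp (l : ℤ) c ≠ 0 := by
    by_contra hcon
    push Not at hcon
    exact hc (by rw [eq_sum_zcomp c]; exact Finset.sum_eq_zero fun i _ => hcon i)
  let n : ℕ → LineRing k := fun i => zcomp ((l : ℤ) + 1 - i) (h.coeff i)
  let D : LineRing k := zcomp (l : ℤ) c
  have hzemb : ∀ (c : LineRing k) (n : ℤ), zcomp n (emb c) = emb (zcomp n c) := by
    intro c n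
    have := zcomp_map (c := 0) (emb (k := k)).toLinearMap
      (fun F n h => by simpa using ZHom.emb h) c n
    rwa [add_zero] at this
  have h2 : emb D * X 1 - ∑ i ∈ Finset.range e, emb (n i) * X 0 ^ i ∈ I := by
    have h3 := hI.zcomp_mem _ h1 (l + 1)
    rw [map_sub, map_sum, zcomp_mul (n := l) (zHom_X _) rfl, hzemb] at h3
    convert h3 using 2
    refine Finset.sum_congr rfl fun i _ => ?_
    rw [zcomp_mul (n := (l : ℤ) + 1 - i) ((zHom_X 0).pow i rfl) (by ring), hzemb]
  have hn0 : n 0 = 0 := by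
    have h3 := mem_stdLine.1 (hI.le h2)
    rw [← Nat.sub_add_cancel he1, Finset.sum_range_succ'] at h3
    simpa using h3
  -- The relation `D x₁ = ∑ nᵢ x₀ⁱ` is solved by `x₀ = D t`, `x₁ = ∑ nᵢ Dⁱ⁻¹ tⁱ`.
  let E : Polynomial (LineRing k) := ∑ i ∈ Finset.range (e - 1),
    Polynomial.C (n (i + 1) * D ^ i) * Polynomial.X ^ i
  let J : Jet k :=
    { D := D
      E := E
      τ := l - 1
      zHom_D := by simpa using zHom_zcomp (l : ℤ) c
      D_ne := hl
      zHom_E := by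
        intro i
        simp only [E, Polynomial.finsetSum_coeff, Polynomial.coeff_C_mul_X_pow]
        rw [Finset.sum_ite_eq]
        split_ifs
        · refine (zHom_zcomp _ (h.coeff (i + 1))).mul ((zHom_zcomp (l : ℤ) c).pow i rfl) ?_
          push_cast
          ring
        · exact zHom_zero _ }
  refine ⟨J, e, he1, ?_⟩
  have hJ : J.hom (emb D * X 1 - ∑ i ∈ Finset.range e, emb (n i) * X 0 ^ i) = 0 := by
    rw [← Nat.sub_add_cancel he1, Finset.sum_range_succ', hn0]
    simp only [map_sub, map_mul, map_sum, map_pow, Jet.hom_emb, Jet.hom_X0, Jet.hom_X1,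
      map_zero, zero_mul, add_zero]
    change Polynomial.C D * (Polynomial.X * E) - ∑ i ∈ Finset.range (e - 1),
      Polynomial.C (n (i + 1)) * (Polynomial.X * Polynomial.C D) ^ (i + 1) = 0
    rw [sub_eq_zero, Finset.mul_sum, Finset.mul_sum]
    refine Finset.sum_congr rfl fun i _ => ?_
    rw [Polynomial.C_mul, Polynomial.C_pow, mul_pow]
    ring
  refine hI.ext (J.isStdMultiple he1) he he' (J.X0_pow_mem_ideal.2 le_rfl)
    (fun i hi hi' => absurd (J.X0_pow_mem_ideal.1 hi') (by omega)) h2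
    (J.mem_ideal.2 (by rw [hJ]; exact dvd_zero _))
    (A := fun i => if i = 0 then -(n 1 * if 1 < e then 1 else 0) else D) ?_ (by simpa using hl)
  have h5 : ∀ m, 1 ≤ m → emb D * X 1 - ∑ i ∈ Finset.range m, emb (n i) * X 0 ^ i - polyForm 1
      (fun i => if i = 0 then -(n 1 * if 1 < m then 1 else 0) else D) ∈ stdLine k ^ 2 := by
    intro m hm
    induction m, hm using Nat.le_induction with
    | base => simp [polyForm, Finset.sum_range_succ, hn0]
    | succ m hm ih =>
      rcases Nat.eq_or_lt_of_le hm with rfl | hm'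
      · have : emb D * X 1 - emb (n 1) * X 0 - (-(emb (n 1) * X 0) + emb D * X 1) = 0 := by ring
        simp [polyForm, Finset.sum_range_succ, hn0, this]
      · have h6 : emb (n m) * X 0 ^ m ∈ stdLine k ^ 2 := Ideal.mul_mem_left _ _
          (Ideal.pow_le_pow_right (by omega) (Ideal.pow_mem_pow X0_mem m))
        have h7 := sub_mem ih h6
        rw [if_pos (by omega)] at h7
        rw [Finset.sum_range_succ, if_pos (by omega)]
        convert h7 using 1
        ring
  exact h5 e he1

theorem Jet.quotDim_succ_le (J : Jet k) (j n : ℕ) :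
    quotDim (J.ideal (j + 1)) (J.ideal j) n ≤ ((n : ℤ) + j * J.τ + 1).toNat := by
  rw [quotDim_eq_finrank_map (J.ideal_antitone (Nat.le_succ j))
    (J.coeffHom j ∘ₗ (Forms k n).subtype), ← finrank_binForms (k := k)]
  · refine Nat.cast_le.2 (Submodule.finrank_mono ?_)
    rintro _ ⟨F, -, rfl⟩
    exact J.zHom_coeff (zHom_natCast.2 F.2) j
  · intro F hF
    rw [mem_gradedPart, mem_ideal_iff_coeff] at hF ⊢
    constructor
    · intro h i hi
      rcases Nat.lt_succ_iff_lt_or_eq.1 hi with h1 | rfl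
      · exact hF i h1
      · exact h
    · exact fun h => h j (by omega)

theorem Jet.quotDim_le (J : Jet k) (j : ℕ) : ∃ c : ℤ, ∀ n : ℕ,
    quotDim (J.ideal j) ⊤ n ≤ j * n + c := by
  induction j with
  | zero => exact ⟨0, fun n => by rw [J.ideal_zero]; simp [quotDim]⟩
  | succ j ih =>
    obtain ⟨c, hc⟩ := ih
    refine ⟨c + j * |J.τ| + 1, fun n => ?_⟩
    have h1 := J.quotDim_succ_le j n
    have h2 := quotDim_add (J.ideal (j + 1)) (J.ideal j) ⊤ n
    have h3 := hc n
    have h4 : (((n : ℤ) + j * J.τ + 1).toNat : ℤ) ≤ n + j * |J.τ| + 1 := by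
      have h5 : (j : ℤ) * J.τ ≤ j * |J.τ| := mul_le_mul_of_nonneg_left (le_abs_self _) (by omega)
      have h6 : 0 ≤ (j : ℤ) * |J.τ| := by positivity
      omega
    push_cast
    linarith

/-- The multiplicity of the structure given by a jet is its degree. -/
theorem Jet.eq_of_hasDegreeGenus (J : Jet k) {e d : ℕ} {g : ℤ} (he : 1 ≤ e)
    (h : HasDegreeGenus (J.ideal e) d g) : e = d := by
  refine le_antisymm (h.card_le (M := fun i : Fin e => X 0 ^ (i : ℕ)) (δ := fun i => i)
    (fun i => by simpa using (zHom_X (k := k) (0 : Fin 4)).pow i rfl) fun c hc => ?_) ?_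
  · have h1 := (J.isStdMultiple he).coeff_eq_zero (J.X0_pow_mem_ideal.2 le_rfl)
      (fun i hi hi' => absurd (J.X0_pow_mem_ideal.1 hi') (by omega))
      (a := fun i => if hi : i < e then c ⟨i, hi⟩ else 0) (by
        rw [Finset.sum_range]
        simpa using hc)
    ext1 i
    simpa using h1 i i.2
  · obtain ⟨c, hc⟩ := J.quotDim_le e
    have := le_of_eventually_le (a := d) (b := 1 - g) (c := e) (d := c) (h.mono fun n hn => by
      have := hc n
      rw [hn] at this
      linarith)
    exact_mod_cast this

/-- On a multiple structure of degree `d` with two-dimensional tangent directions everywhere, the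
`(d-1)`-st power of an equation of the line vanishes. -/
theorem IsStdMultiple.X0_pow_mem {I : Ideal (Coord k)} (hI : IsStdMultiple I)
    (h2 : I ≤ stdLine k ^ 2) {d : ℕ} {g : ℤ} (hd : HasDegreeGenus I d g) :
    X 0 ^ (d - 1) ∈ I := by
  classical
  by_contra hX
  obtain ⟨N, hN⟩ := hI.pow_le
  have hex : ∃ e, (X 0 : Coord k) ^ e ∈ I := ⟨N, hN (Ideal.pow_mem_pow X0_mem N)⟩
  let e := Nat.find hex
  have he : X 0 ^ e ∈ I := Nat.find_spec hex
  have he' : ∀ i < e, X 0 ^ i ∉ I := fun i hi => Nat.find_min hex hi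
  have hde : d ≤ e := by
    by_contra h
    exact hX (I.pow_mem_of_pow_mem he (by omega))
  -- Otherwise `x₁, 1, x₀, …, x₀^{d-1}` are `d + 1` functions on the curve that are independent over
  -- the line.
  have hcon := hd.card_le (r := d + 1)
    (M := Fin.cases (X 1) fun i : Fin d => X 0 ^ (i : ℕ))
    (δ := Fin.cases 1 fun i : Fin d => (i : ℕ)) (fun i => by
      refine Fin.cases ?_ (fun i => ?_) i
      · exact zHom_X 1
      · simpa using (zHom_X (k := k) (0 : Fin 4)).pow i rfl) fun c hc => ?_
  · omega
  rw [Fin.sum_univ_succ] at hc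
  simp only [Fin.cases_zero, Fin.cases_succ] at hc
  let a : ℕ → LineRing k := fun i => if hi : i < d then c (Fin.succ ⟨i, hi⟩) else 0
  have ha : ∑ i : Fin d, emb (c i.succ) * X 0 ^ (i : ℕ) =
      ∑ i ∈ Finset.range e, emb (a i) * X 0 ^ i := by
    have h1 : ∀ i ∈ Finset.range e, i ∉ Finset.range d → emb (a i) * X 0 ^ i = 0 := by
      intro i _ hi
      rw [Finset.mem_range] at hi
      simp [a, hi]
    rw [← Finset.sum_subset (Finset.range_mono hde) h1, Finset.sum_range]
    refine Finset.sum_congr rfl fun i _ => ?_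
    simp only [a]
    rw [dif_pos i.2]
  rw [ha] at hc
  have hlin : emb (c 0) * X 1 + ∑ i ∈ Finset.range e, emb (a i) * X 0 ^ i -
      (emb (c 0) * X 1 + emb (a 0) + emb (a 1) * X 0) ∈ stdLine k ^ 2 := by
    have h1 : ∀ m, 2 ≤ m → ∑ i ∈ Finset.range m, emb (a i) * X 0 ^ i -
        (emb (a 0) + emb (a 1) * X 0) ∈ stdLine k ^ 2 := by
      intro m hm
      induction m, hm using Nat.le_induction with
      | base => simp [Finset.sum_range_succ]
      | succ m hm ih =>
        rw [Finset.sum_range_succ, add_sub_right_comm]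
        exact add_mem ih (Ideal.mul_mem_left _ _
          (Ideal.pow_le_pow_right hm (Ideal.pow_mem_pow X0_mem m)))
    have he2 : 2 ≤ e := by
      by_contra h
      have h3 : (X 0 : Coord k) ∈ stdLine k ^ 2 := h2 (by
        simpa using I.pow_mem_of_pow_mem he (show e ≤ 1 by omega))
      have h4 := polyForm_eq_zero (k := k) (j := 1) (A := fun i => if i = 0 then 1 else 0)
        (by simpa [polyForm, Finset.sum_range_succ] using h3) 0 (by omega)
      simp at h4
    convert h1 e he2 using 1
    ring
  have h3 := (Submodule.sub_mem_iff_right _ (h2 hc)).1 hlin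
  have h4 : a 0 = 0 := by
    have := mem_stdLine.1 (Ideal.pow_le_self two_ne_zero h3)
    simpa using this
  rw [h4, map_zero, add_zero] at h3
  have h5 := polyForm_eq_zero (k := k) (j := 1) (A := fun i => if i = 0 then a 1 else c 0)
    (by simpa [polyForm, Finset.sum_range_succ, add_comm] using h3) 1 le_rfl
  have h6 : c 0 = 0 := by simpa using h5
  rw [h6, map_zero, zero_mul, zero_add] at hc
  have h7 := hI.coeff_eq_zero he he' hc
  ext1 i
  refine Fin.cases h6 (fun i => ?_) i
  have h8 := h7 i (i.2.trans_le hde)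
  simp only [a] at h8
  rwa [dif_pos i.2] at h8

end JetStructure


/-! ### Leading coefficients along a jet -/

section LeadingCoefficients

open MvPolynomial

variable {k : Type*} [Field k]

/-- The value `∑ᵢ Aᵢ fʲ⁻ⁱ gⁱ` of the form `∑ᵢ Aᵢ x₀ʲ⁻ⁱ x₁ⁱ` at `(f, g)`. -/
def evalForm (j : ℕ) (A : ℕ → LineRing k) (f g : LineRing k) : LineRing k :=
  ∑ i ∈ Finset.range (j + 1), A i * f ^ (j - i) * g ^ i

theorem evalForm_one (A : ℕ → LineRing k) (f g : LineRing k) :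
    evalForm 1 A f g = A 0 * f + A 1 * g := by
  simp [evalForm, Finset.sum_range_succ]

theorem evalForm_two (A : ℕ → LineRing k) (f g : LineRing k) :
    evalForm 2 A f g = A 0 * f ^ 2 + A 1 * f * g + A 2 * g ^ 2 := by
  simp [evalForm, Finset.sum_range_succ]

theorem zHom_evalForm {j : ℕ} {A : ℕ → LineRing k} {f g : LineRing k} {n α l : ℤ}
    (hA : ∀ i, ZHom (A i) n) (hf : ZHom f α) (hg : ZHom g α) (hl : l = n + j * α) :
    ZHom (evalForm j A f g) l := by
  refine ZHom.sum fun i hi => ?_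
  rw [Finset.mem_range] at hi
  refine ((hA i).mul (hf.pow (j - i) rfl) rfl).mul (hg.pow i rfl) ?_
  rw [hl, Nat.cast_sub (by omega)]
  ring

/-- The equation `g x₀ - f x₁` of a surface containing the double structure. -/
def quadric (f g : LineRing k) : Coord k := emb g * X 0 - emb f * X 1

theorem quadric_mem (f g : LineRing k) : quadric f g ∈ stdLine k :=
  sub_mem (Ideal.mul_mem_left _ _ X0_mem) (Ideal.mul_mem_left _ _ X1_mem)

theorem zHom_quadric {f g : LineRing k} {α : ℤ} (hf : ZHom f α) (hg : ZHom g α) :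
    ZHom (quadric f g) (α + 1) :=
  (hg.emb.mul (zHom_X 0) rfl).sub (hf.emb.mul (zHom_X 1) rfl)

theorem coeff_mul_of_X_pow_dvd {P Q : Polynomial (LineRing k)} {i j : ℕ}
    (hP : Polynomial.X ^ i ∣ P) (hQ : Polynomial.X ^ j ∣ Q) :
    (P * Q).coeff (i + j) = P.coeff i * Q.coeff j := by
  obtain ⟨P, rfl⟩ := hP
  obtain ⟨Q, rfl⟩ := hQ
  rw [show Polynomial.X ^ i * P * (Polynomial.X ^ j * Q) = Polynomial.X ^ (i + j) * (P * Q) by ring]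
  simp only [Polynomial.coeff_X_pow_mul', if_pos le_rfl, Nat.sub_self, Polynomial.mul_coeff_zero]

/-- The numerical data of a jet to second order: the primitive direction `(f, g)` of its tangent
and, with `r / p` in lowest terms, the second order term. The multiplier `mⱼ` is the greatest
common divisor of the leading coefficients along the jet of the functions vanishing to order `j`. -/
structure Jet.Data (J : Jet k) where
  /-- The degree of the tangent direction. -/
  α : ℕ
  /-- The degree of the denominator `p`. -/
  b : ℕ
  /-- First component of the primitive tangent vector. -/
  f : LineRing k
  /-- Second component of the primitive tangent vector. -/
  g : LineRing k
  /-- The multiplier of order one. -/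
  m₁ : LineRing k
  /-- The multiplier of order two. -/
  m₂ : LineRing k
  /-- The denominator of the second order term. -/
  p : LineRing k
  /-- The numerator of the second order term. -/
  r : LineRing k
  zHom_f : ZHom f α
  zHom_g : ZHom g α
  zHom_p : ZHom p b
  zHom_r : ZHom r (3 * α - 1 + b)
  f_ne : f ≠ 0
  D_eq : J.D = m₁ * f
  E_zero_eq : J.E.coeff 0 = m₁ * g
  E_one_eq : -(f * J.E.coeff 1) = m₂ * r
  sq_eq : m₁ ^ 2 = m₂ * p
  isRelPrime_fg : IsRelPrime f g
  isRelPrime_pr : IsRelPrime p r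

theorem Jet.nonempty_data (J : Jet k) : Nonempty J.Data := by
  have hE0 : ZHom (J.E.coeff 0) (1 + J.τ) := by simpa using J.zHom_E 0
  obtain ⟨f, g, m₁, i, hfg, hD, hE, hf, hg, hm, hm0, hf0⟩ :=
    exists_reduced_forms J.zHom_D J.D_ne hE0
  obtain ⟨α, rfl⟩ := Int.eq_ofNat_of_zero_le (hf.degree_nonneg hf0)
  have h1 : ZHom (m₁ ^ 2) (2 * (1 + J.τ - α)) := hm.pow 2 (by push_cast; ring)
  have h2 : ZHom (-(f * J.E.coeff 1)) (α + 1 + 2 * J.τ) :=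
    (hf.mul (J.zHom_E 1) (by push_cast; ring)).neg
  obtain ⟨p, r, m₂, b, hpr, hp', hr', hp, hr, hm2, -, hp0⟩ :=
    exists_reduced_forms h1 (pow_ne_zero 2 hm0) h2
  obtain ⟨b, rfl⟩ := Int.eq_ofNat_of_zero_le (hp.degree_nonneg hp0)
  exact ⟨⟨α, b, f, g, m₁, m₂, p, r, hf, by convert hg using 1; ring, hp,
    by convert hr using 1; ring, hf0, hD, hE, hr', hp', hfg, hpr⟩⟩

namespace Jet.Data

variable {J : Jet k} (d : J.Data)

theorem m₁_ne : d.m₁ ≠ 0 := left_ne_zero_of_mul (d.D_eq ▸ J.D_ne)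

theorem m₂_ne : d.m₂ ≠ 0 := left_ne_zero_of_mul (d.sq_eq ▸ pow_ne_zero 2 d.m₁_ne)

theorem p_ne : d.p ≠ 0 := right_ne_zero_of_mul (d.sq_eq ▸ pow_ne_zero 2 d.m₁_ne)

theorem zHom_m₁ : ZHom d.m₁ (1 + J.τ - d.α) := by
  have h := J.zHom_D
  rw [d.D_eq, mul_comm] at h
  exact h.of_mul_left d.zHom_f d.f_ne

theorem zHom_m₂ : ZHom d.m₂ (2 * (1 + J.τ - d.α) - d.b) := by
  have h := d.zHom_m₁.pow 2 rfl
  rw [d.sq_eq, mul_comm] at h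
  simpa using h.of_mul_left d.zHom_p d.p_ne

/-- The surface of smallest degree containing the double structure. -/
def q : Coord k := quadric d.f d.g

theorem zHom_q : ZHom d.q (d.α + 1) := zHom_quadric d.zHom_f d.zHom_g

theorem coeff_of_sub_mem {j : ℕ} {F : Coord k} {A : ℕ → LineRing k}
    (h : F - polyForm j A ∈ stdLine k ^ (j + 1)) :
    (J.hom F).coeff j = d.m₁ ^ j * evalForm j A d.f d.g := by
  have h1 := coeff_arcHom_of_sub_mem (φ := AlgHom.id k (LineRing k))
    (x := Polynomial.X * Polynomial.C J.D) (y := Polynomial.X * J.E) rfl rfl h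
  refine h1.trans ?_
  rw [evalForm, Finset.mul_sum]
  refine Finset.sum_congr rfl fun i hi => ?_
  rw [Finset.mem_range] at hi
  obtain ⟨l, rfl⟩ := Nat.exists_eq_add_of_le (Nat.lt_succ_iff.1 hi)
  rw [Polynomial.coeff_C_zero, d.D_eq, d.E_zero_eq, Nat.add_sub_cancel_left, mul_pow, mul_pow,
    pow_add, AlgHom.id_apply]
  ring

theorem coeff_polyForm (j : ℕ) (A : ℕ → LineRing k) :
    (J.hom (polyForm j A)).coeff j = d.m₁ ^ j * evalForm j A d.f d.g :=
  d.coeff_of_sub_mem (by rw [sub_self]; exact zero_mem _)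

theorem hom_q : J.hom d.q =
    Polynomial.X * (Polynomial.C (d.g * J.D) - Polynomial.C d.f * J.E) := by
  simp only [q, quadric, map_sub, map_mul, Jet.hom_emb, Jet.hom_X0, Jet.hom_X1]
  ring

theorem coeff_two_q : (J.hom d.q).coeff 2 = d.m₂ * d.r := by
  rw [hom_q, Polynomial.coeff_X_mul, Polynomial.coeff_sub, Polynomial.coeff_C_mul,
    Polynomial.coeff_C_succ, zero_sub, d.E_one_eq]

theorem q_mem : d.q ∈ J.ideal 2 := by
  rw [mem_ideal_iff_coeff]
  intro i hi
  rw [hom_q]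
  interval_cases i
  · simp
  · rw [Polynomial.coeff_X_mul, Polynomial.coeff_sub, Polynomial.coeff_C_mul,
      Polynomial.coeff_C_zero, d.D_eq, d.E_zero_eq]
    ring

/-- The functions vanishing on the double structure, to second order. -/
theorem exists_second_order {F : Coord k} {n : ℤ} (hF : F ∈ J.ideal 2) (hn : ZHom F n) :
    ∃ h, ZHom h (n - 1 - d.α) ∧ ∃ A : ℕ → LineRing k, (∀ i, ZHom (A i) (n - 2)) ∧
      F - emb h * d.q - polyForm 2 A ∈ stdLine k ^ 3 := by
  have hF1 : F ∈ stdLine k ^ 1 := by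
    rw [pow_one, ← J.ideal_one]
    exact J.ideal_antitone (by omega) hF
  obtain ⟨B, hB, hFB⟩ := exists_zHom_polyForm hF1 hn
  have h1 := J.mem_ideal_iff_coeff.1 hF 1 (by omega)
  rw [d.coeff_of_sub_mem hFB, mul_eq_zero, or_iff_right (pow_ne_zero 1 d.m₁_ne),
    evalForm_one] at h1
  have h2 : d.f ∣ B 1 := d.isRelPrime_fg.dvd_of_dvd_mul_right ⟨-B 0, by linear_combination h1⟩
  obtain ⟨C, hC, hBC⟩ := zHom_of_dvd_rel (hB 1) d.zHom_f d.f_ne h2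
  have h3 : B 0 = -C * d.g := by
    refine mul_right_cancel₀ d.f_ne ?_
    linear_combination h1 - d.g * hBC
  have e : polyForm 1 B = emb (-C) * d.q := by
    simp only [polyForm, Finset.sum_range_succ, Finset.sum_range_zero, q, quadric]
    rw [h3, hBC]
    simp only [map_mul, map_neg]
    ring
  rw [e] at hFB
  have hC' : ZHom (-C) (n - 1 - d.α) := by simpa using hC.neg
  obtain ⟨A, hA, hA'⟩ := exists_zHom_polyForm hFB
    (hn.sub (hC'.emb.mul d.zHom_q (by ring)))
  exact ⟨-C, hC', A, hA, hA'⟩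

theorem coeff_two {F : Coord k} {c : LineRing k} {A : ℕ → LineRing k}
    (hF : F - emb c * d.q - polyForm 2 A ∈ stdLine k ^ 3) :
    (J.hom F).coeff 2 = d.m₂ * (c * d.r + d.p * evalForm 2 A d.f d.g) := by
  have h1 := d.coeff_of_sub_mem hF
  rw [map_sub, Polynomial.coeff_sub, map_mul, Jet.hom_emb, Polynomial.coeff_C_mul,
    coeff_two_q] at h1
  linear_combination h1 + evalForm 2 A d.f d.g * d.sq_eq

theorem exists_evalForm {j : ℕ} {n l : ℤ} (hn : d.α - 1 ≤ n) {H : LineRing k}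
    (hH : ZHom H l) (hl : l = n + j * d.α) :
    ∃ A : ℕ → LineRing k, (∀ i, ZHom (A i) n) ∧ evalForm j A d.f d.g = H := by
  subst hl
  obtain ⟨A, hA, h⟩ := exists_power_combination d.zHom_f d.zHom_g d.isRelPrime_fg j hn hH
  exact ⟨A, hA, h.symm⟩

theorem evalForm_eq_zero {j : ℕ} {n : ℤ} (hn : n < d.α) {A : ℕ → LineRing k}
    (hA : ∀ i, ZHom (A i) n) (h : evalForm j A d.f d.g = 0) : ∀ i ≤ j, A i = 0 :=
  eq_zero_of_power_combination d.zHom_f d.f_ne d.isRelPrime_fg j hn hA h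

/-- A quadratic form vanishing on the tangent direction is divisible by its equation. -/
theorem exists_linear_factor {B : ℕ → LineRing k} {n : ℤ} (hB : ∀ i, ZHom (B i) n)
    (h : evalForm 2 B d.f d.g = 0) : ∃ a : ℕ → LineRing k, (∀ i, ZHom (a i) (n - d.α)) ∧
      polyForm 2 B = polyForm 1 a * d.q := by
  rw [evalForm_two] at h
  have h1 : d.f ∣ B 2 := (d.isRelPrime_fg.pow_right (n := 2)).dvd_of_dvd_mul_right
    ⟨-(B 0 * d.f + B 1 * d.g), by linear_combination h⟩
  obtain ⟨c, hc, h2⟩ := zHom_of_dvd_rel (hB 2) d.zHom_f d.f_ne h1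
  have h3 : B 0 * d.f + (B 1 + c * d.g) * d.g = 0 := by
    refine mul_left_cancel₀ d.f_ne ?_
    linear_combination h - d.g ^ 2 * h2
  have h4 : d.f ∣ B 1 + c * d.g := d.isRelPrime_fg.dvd_of_dvd_mul_right
    ⟨-B 0, by linear_combination h3⟩
  obtain ⟨c', hc', h5⟩ := zHom_of_dvd_rel
    ((hB 1).add (hc.mul d.zHom_g (by ring))) d.zHom_f d.f_ne h4
  have h6 : B 0 = -c' * d.g := by
    refine mul_right_cancel₀ d.f_ne ?_
    linear_combination h3 - d.g * h5
  refine ⟨fun i => if i = 0 then -c' else -c, fun i => ?_, ?_⟩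
  · dsimp only
    split_ifs
    · exact hc'.neg
    · exact hc.neg
  · have h7 : B 1 = d.f * c' - c * d.g := by linear_combination h5
    simp only [polyForm, Finset.sum_range_succ, Finset.sum_range_zero, q, quadric]
    rw [h6, h2, h7]
    simp only [map_mul, map_neg, map_sub, if_true, one_ne_zero, if_false]
    ring

end Jet.Data

/-- The numerical data of a jet to third order; `e / s` in lowest terms is the third order
term of the equation `v = p (g x₀ - f x₁) - u(x₀, x₁)`, which vanishes on the triple structure. -/
structure Jet.Data₃ (J : Jet k) extends J.Data where
  /-- A quadratic form with value `r` on the tangent vector. -/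
  u : ℕ → LineRing k
  /-- The degree of the denominator `s`. -/
  σ : ℕ
  /-- The denominator of the third order term. -/
  s : LineRing k
  /-- The numerator of the third order term. -/
  e : LineRing k
  /-- The multiplier of order three. -/
  m₃ : LineRing k
  zHom_u : ∀ i, ZHom (u i) (α - 1 + b)
  evalForm_u : evalForm 2 u f g = r
  zHom_s : ZHom s σ
  zHom_e : ZHom e (4 * α - 2 + 2 * b + σ)
  mul_eq : m₁ * m₂ = m₃ * s
  v_eq : (J.hom (emb p * quadric f g - polyForm 2 u)).coeff 3 = m₃ * e
  isRelPrime_se : IsRelPrime s e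

theorem Jet.Data.zHom_v {J : Jet k} (d : J.Data) {u : ℕ → LineRing k}
    (hu : ∀ i, ZHom (u i) (d.α - 1 + d.b)) :
    ZHom (emb d.p * quadric d.f d.g - polyForm 2 u) (d.α + d.b + 1) :=
  (d.zHom_p.emb.mul d.zHom_q (by ring)).sub
    (zHom_polyForm fun i => by convert hu i using 1; push_cast; ring)

theorem Jet.Data.v_mem {J : Jet k} (d : J.Data) {u : ℕ → LineRing k}
    (hu : evalForm 2 u d.f d.g = d.r) :
    emb d.p * quadric d.f d.g - polyForm 2 u ∈ J.ideal 3 := by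
  have h2 : emb d.p * quadric d.f d.g - polyForm 2 u ∈ J.ideal 2 :=
    sub_mem (Ideal.mul_mem_left _ _ d.q_mem) (J.pow_le_ideal 2 (polyForm_mem 2 u))
  rw [mem_ideal_iff_coeff] at h2 ⊢
  intro i hi
  rcases Nat.lt_succ_iff_lt_or_eq.1 hi with h | rfl
  · exact h2 i h
  · rw [map_sub, Polynomial.coeff_sub, map_mul, Jet.hom_emb, Polynomial.coeff_C_mul,
      d.coeff_polyForm, hu]
    have := d.coeff_two_q
    rw [Jet.Data.q] at this
    rw [this]
    linear_combination -d.r * d.sq_eq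

theorem Jet.Data.exists_data₃_of {J : Jet k} (d : J.Data) {u : ℕ → LineRing k}
    (hu : ∀ i, ZHom (u i) (d.α - 1 + d.b)) (hur : evalForm 2 u d.f d.g = d.r) :
    ∃ d' : J.Data₃, d'.toData = d ∧ d'.u = u := by
  have h1 := d.zHom_m₁.mul d.zHom_m₂ rfl
  have h2 := J.zHom_coeff (d.zHom_v hu) 3
  obtain ⟨s, e, m₃, i, hse, hs', he', hs, he, -, -, hs0⟩ :=
    exists_reduced_forms h1 (mul_ne_zero d.m₁_ne d.m₂_ne) h2
  obtain ⟨σ, rfl⟩ := Int.eq_ofNat_of_zero_le (hs.degree_nonneg hs0)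
  exact ⟨{ d with
    u := u, σ := σ, s := s, e := e, m₃ := m₃, zHom_u := hu, evalForm_u := hur, zHom_s := hs
    zHom_e := by convert he using 1; push_cast; ring
    mul_eq := hs', v_eq := he', isRelPrime_se := hse }, rfl, rfl⟩

theorem Jet.Data.exists_data₃ {J : Jet k} (d : J.Data) : ∃ d' : J.Data₃, d'.toData = d := by
  obtain ⟨u, hu, hur⟩ := d.exists_evalForm (j := 2) (n := d.α - 1 + d.b) (by omega) d.zHom_r
    (by push_cast; ring)
  obtain ⟨d', h, -⟩ := d.exists_data₃_of hu hur
  exact ⟨d', h⟩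

namespace Jet.Data₃

variable {J : Jet k} (d : J.Data₃)

theorem m₃_ne : d.m₃ ≠ 0 := left_ne_zero_of_mul (d.mul_eq ▸ mul_ne_zero d.m₁_ne d.m₂_ne)

theorem s_ne : d.s ≠ 0 := right_ne_zero_of_mul (d.mul_eq ▸ mul_ne_zero d.m₁_ne d.m₂_ne)

/-- The surface of smallest degree containing the triple structure and generically smooth
along the line. -/
def v : Coord k := emb d.p * quadric d.f d.g - polyForm 2 d.u

theorem zHom_v : ZHom d.v (d.α + d.b + 1) := d.toData.zHom_v d.zHom_u

theorem v_mem : d.v ∈ J.ideal 3 := d.toData.v_mem d.evalForm_u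

/-- The functions vanishing on the triple structure, to third order. -/
theorem exists_third_order {F : Coord k} {n : ℤ} (hF : F ∈ J.ideal 3) (hn : ZHom F n) :
    ∃ γ, ZHom γ (n - 1 - d.α - d.b) ∧ ∃ a : ℕ → LineRing k, (∀ i, ZHom (a i) (n - 2 - d.α)) ∧
      ∃ C : ℕ → LineRing k, (∀ i, ZHom (C i) (n - 3)) ∧
      F - emb γ * d.v - polyForm 1 a * d.q - polyForm 3 C ∈ stdLine k ^ 4 := by
  obtain ⟨h, hh, A, hA, hFA⟩ := d.exists_second_order (J.ideal_antitone (by omega) hF) hn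
  have h1 := J.mem_ideal_iff_coeff.1 hF 2 (by omega)
  rw [d.coeff_two hFA, mul_eq_zero, or_iff_right d.m₂_ne] at h1
  have h2 : d.p ∣ h := d.isRelPrime_pr.dvd_of_dvd_mul_right
    ⟨-evalForm 2 A d.f d.g, by linear_combination h1⟩
  obtain ⟨γ, hγ, rfl⟩ := zHom_of_dvd_rel hh d.zHom_p d.p_ne h2
  have h3 : evalForm 2 (fun i => A i + γ * d.u i) d.f d.g = 0 := by
    refine mul_left_cancel₀ d.p_ne ?_
    have h4 := d.evalForm_u
    rw [evalForm_two] at h1 h4 ⊢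
    linear_combination h1 + d.p * γ * h4
  obtain ⟨a, ha, e⟩ := d.exists_linear_factor (n := n - 2)
    (fun i => (hA i).add (hγ.mul (d.zHom_u i) (by ring))) h3
  have h5 : F - emb γ * d.v - polyForm 1 a * d.q ∈ stdLine k ^ 3 := by
    rw [← e]
    convert hFA using 1
    simp only [v, Jet.Data.q, polyForm, Finset.sum_range_succ, Finset.sum_range_zero, map_add,
      map_mul]
    ring
  have h6 : ZHom (F - emb γ * d.v - polyForm 1 a * d.q) n :=
    (hn.sub (hγ.emb.mul d.zHom_v (by ring))).sub
      ((zHom_polyForm (n := n - 1 - d.α) fun i => by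
        convert ha i using 1; push_cast; ring).mul d.zHom_q (by ring))
  obtain ⟨C, hC, hFC⟩ := exists_zHom_polyForm h5 h6
  exact ⟨γ, hγ, a, ha, C, hC, hFC⟩

end Jet.Data₃

theorem Jet.Data.coeff_three_mul_q {J : Jet k} (d : J.Data) (a : ℕ → LineRing k) :
    (J.hom (polyForm 1 a * d.q)).coeff 3 = d.m₁ * d.m₂ * (d.r * evalForm 1 a d.f d.g) := by
  rw [map_mul]
  have h1 : Polynomial.X ^ 1 ∣ J.hom (polyForm 1 a) :=
    J.mem_ideal.1 (J.pow_le_ideal 1 (polyForm_mem 1 a))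
  rw [coeff_mul_of_X_pow_dvd (i := 1) (j := 2) h1 (J.mem_ideal.1 d.q_mem), d.coeff_polyForm,
    d.coeff_two_q]
  ring

theorem Jet.Data₃.coeff_three {J : Jet k} (d : J.Data₃) {F : Coord k} {γ : LineRing k}
    {a C : ℕ → LineRing k}
    (hF : F - emb γ * d.v - polyForm 1 a * d.q - polyForm 3 C ∈ stdLine k ^ 4) :
    (J.hom F).coeff 3 = d.m₃ * (γ * d.e + d.s *
      (d.r * evalForm 1 a d.f d.g + d.p * evalForm 3 C d.f d.g)) := by
  have h1 := d.coeff_of_sub_mem hF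
  have h2 : (J.hom d.v).coeff 3 = d.m₃ * d.e := d.v_eq
  rw [map_sub, map_sub, Polynomial.coeff_sub, Polynomial.coeff_sub, d.coeff_three_mul_q, map_mul,
    Jet.hom_emb, Polynomial.coeff_C_mul, h2] at h1
  linear_combination h1 + (d.r * evalForm 1 a d.f d.g + d.p * evalForm 3 C d.f d.g) * d.mul_eq +
    d.m₁ * evalForm 3 C d.f d.g * d.sq_eq

end LeadingCoefficients


/-! ### Types and genera of multiple lines given by jets -/

section JetTypes

open MvPolynomial

variable {k : Type*} [Field k]

theorem isLineIdeal_stdLine : IsLineIdeal (stdLine k) := by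
  refine ⟨X 0, X 1, isHomogeneous_X k 0, isHomogeneous_X k 1, ?_, rfl⟩
  rw [LinearIndependent.pair_iff]
  intro a b h
  have h0 := congrArg (coeff (Finsupp.single 0 1)) h
  have h1 := congrArg (coeff (Finsupp.single 1 1)) h
  simp [coeff_X, Finsupp.single_left_inj] at h0 h1
  exact ⟨h0, h1⟩

namespace Jet

variable (J : Jet k)

/-- The Hilbert function of `𝓘_{C_j} / 𝓘_{C_{j+1}}`, from the leading coefficients. -/
theorem quotDim_succ {j n : ℕ} {m : LineRing k} {N : ℤ} (hm : m ≠ 0)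
    (h1 : ∀ F ∈ J.ideal j, ZHom F n → ∃ c, ZHom c N ∧ (J.hom F).coeff j = m * c)
    (h2 : ∀ c, ZHom c N → ∃ F ∈ J.ideal j, ZHom F n ∧ (J.hom F).coeff j = m * c) :
    quotDim (J.ideal (j + 1)) (J.ideal j) n = (N + 1).toNat := by
  rw [quotDim_eq_finrank_map (J.ideal_antitone (Nat.le_succ j))
    (J.coeffHom j ∘ₗ (Forms k n).subtype), ← finrank_mul_binForms hm]
  · refine congrArg (fun S : Submodule k (LineRing k) => (Module.finrank k S : ℤ))
      (le_antisymm ?_ ?_)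
    · rintro _ ⟨F, hF, rfl⟩
      obtain ⟨c, hc, e⟩ := h1 F hF (zHom_natCast.2 F.2)
      exact ⟨c, hc, e.symm⟩
    · rintro _ ⟨c, hc, rfl⟩
      obtain ⟨F, hF, hn, e⟩ := h2 c hc
      exact ⟨⟨F, zHom_natCast.1 hn⟩, hF, e⟩
  · intro F hF
    rw [mem_gradedPart, mem_ideal_iff_coeff] at hF ⊢
    constructor
    · intro h i hi
      rcases Nat.lt_succ_iff_lt_or_eq.1 hi with h1 | rfl
      · exact hF i h1
      · exact h
    · exact fun h => h j (by omega)

theorem quotDim_ideal_one (n : ℕ) : quotDim (J.ideal 1) ⊤ n = n + 1 := by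
  rw [← J.ideal_zero, J.quotDim_succ (N := n) (m := 1) one_ne_zero]
  · omega
  · intro F _ hF
    exact ⟨res F, hF.res, by rw [one_mul, J.coeff_zero_hom]⟩
  · intro c hc
    exact ⟨emb c, by rw [ideal_zero]; trivial, hc.emb, by simp⟩

end Jet

namespace Jet.Data

variable {J : Jet k} (d : J.Data)

/-- As the multiplier is `m₁` and forms of large degree lie in the ideal generated by `f` and `g`,
the leading coefficients of order one are the multiples of `m₁`. -/
theorem quotDim_one {n : ℕ} (hn : d.α ≤ n) :
    quotDim (J.ideal 2) (J.ideal 1) n = n + d.α := by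
  rw [J.quotDim_succ (N := n - 1 + d.α) d.m₁_ne]
  · omega
  · intro F hF hn
    rw [J.ideal_one, ← pow_one (stdLine k)] at hF
    obtain ⟨A, hA, hFA⟩ := exists_zHom_polyForm hF hn
    exact ⟨evalForm 1 A d.f d.g, zHom_evalForm hA d.zHom_f d.zHom_g (by push_cast; ring), by
      rw [d.coeff_of_sub_mem hFA, pow_one]⟩
  · intro c hc
    obtain ⟨A, hA, e⟩ := d.exists_evalForm (j := 1) (n := n - 1) (by omega) hc
      (by push_cast; ring)
    refine ⟨polyForm 1 A, J.pow_le_ideal 1 (polyForm_mem 1 A), zHom_polyForm hA, ?_⟩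
    rw [d.coeff_polyForm, e, pow_one]

theorem quotDim_two {n : ℕ} (hn : d.α + d.b + 2 ≤ n) :
    quotDim (J.ideal 3) (J.ideal 2) n = n - 1 + 2 * d.α + d.b := by
  rw [J.quotDim_succ (N := n - 2 + 2 * d.α + d.b) d.m₂_ne]
  · omega
  · intro F hF hn
    obtain ⟨h, hh, A, hA, hFA⟩ := d.exists_second_order hF hn
    exact ⟨_, (hh.mul d.zHom_r (by ring)).add (d.zHom_p.mul
      (zHom_evalForm hA d.zHom_f d.zHom_g rfl) (by push_cast; ring)), d.coeff_two hFA⟩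
  · intro c hc
    obtain ⟨B, h, hB, hh, e⟩ := exists_bezout d.zHom_p d.zHom_r d.isRelPrime_pr hc (by omega)
    obtain ⟨A, hA, e'⟩ := d.exists_evalForm (j := 2) (n := n - 2) (by omega) hB
      (by push_cast; ring)
    refine ⟨emb h * d.q + polyForm 2 A, add_mem (Ideal.mul_mem_left _ _ d.q_mem)
      (J.pow_le_ideal 2 (polyForm_mem 2 A)),
      (hh.emb.mul d.zHom_q (by ring)).add (zHom_polyForm hA), ?_⟩
    rw [d.coeff_two (c := h) (A := A), e', e]
    · ring
    · rw [add_sub_cancel_left, sub_self]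
      exact zero_mem _

/-- The powers of `𝓛₁` inside `𝓛_j`. -/
theorem quotDim_sup_pow {j n : ℕ} (hn : d.α + j ≤ n + 1) :
    quotDim (J.ideal (j + 1)) (J.ideal (j + 1) ⊔ stdLine k ^ j) n = n + 1 + j * (d.α - 1) := by
  have hm := pow_ne_zero j d.m₁_ne
  have h0 := finrank_mul_binForms hm (n - j + j * d.α)
  have h1 : ((((n : ℤ) - j + j * d.α + 1).toNat : ℕ) : ℤ) = n + 1 + j * (d.α - 1) := by
    have h2 : 0 ≤ (j : ℤ) * d.α := by positivity
    have h3 : (j : ℤ) * (d.α - 1) = j * d.α - j := by ring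
    have h4 : (j : ℤ) ≤ n + 1 := by omega
    omega
  rw [← h1, ← h0, quotDim_eq_finrank_map le_sup_left (J.coeffHom j ∘ₗ (Forms k n).subtype)]
  · refine congrArg (fun S : Submodule k (LineRing k) => (Module.finrank k S : ℤ))
      (le_antisymm ?_ ?_)
    · rintro _ ⟨F, hF, rfl⟩
      obtain ⟨G, hG, H, hH, e⟩ := Submodule.mem_sup.1 hF
      have e' := congrArg (zcomp (n : ℤ)) e
      rw [map_add, show zcomp (n : ℤ) ((Forms k n).subtype F) = F.1 from
        (zHom_natCast.2 F.2).zcomp_eq] at e'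
      obtain ⟨A, hA, hHA⟩ := exists_zHom_polyForm (stdLine_pow_zcomp hH n) (zHom_zcomp n H)
      refine ⟨_, zHom_evalForm hA d.zHom_f d.zHom_g rfl, ?_⟩
      have h2 := (J.isStdMultiple (Nat.succ_pos j)).zcomp_mem G hG n
      change _ = J.coeffHom j F.1
      rw [← e', map_add, Jet.coeffHom_apply, Jet.coeffHom_apply,
        J.mem_ideal_iff_coeff.1 h2 j (Nat.lt_succ_self j), zero_add, d.coeff_of_sub_mem hHA]
      rfl
    · rintro _ ⟨c, hc, rfl⟩
      obtain ⟨A, hA, e⟩ := d.exists_evalForm (j := j) (n := n - j) (by omega) hc rfl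
      refine ⟨⟨polyForm j A, zHom_natCast.1 (zHom_polyForm hA)⟩,
        Ideal.mem_sup_right (polyForm_mem j A), ?_⟩
      change (J.hom (polyForm j A)).coeff j = _
      rw [d.coeff_polyForm, e]
      rfl
  · intro F hF
    have h2 : (F : Coord k) ∈ J.ideal j :=
      sup_le (J.ideal_antitone (Nat.le_succ j)) (J.pow_le_ideal j) hF
    rw [mem_gradedPart, mem_ideal_iff_coeff]
    rw [mem_ideal_iff_coeff] at h2
    constructor
    · intro h i hi
      rcases Nat.lt_succ_iff_lt_or_eq.1 hi with h1 | rfl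
      · exact h2 i h1
      · exact h
    · exact fun h => h j (by omega)

end Jet.Data

theorem Jet.Data₃.quotDim_three {J : Jet k} (d : J.Data₃) {n : ℕ}
    (hn : 2 * d.α + 2 * d.b + d.σ + 3 ≤ n) :
    quotDim (J.ideal 4) (J.ideal 3) n = n - 2 + 3 * d.α + d.b + d.σ := by
  rw [J.quotDim_succ (N := n - 3 + 3 * d.α + d.b + d.σ) d.m₃_ne]
  · omega
  · intro F hF hn
    obtain ⟨γ, hγ, a, ha, C, hC, hFC⟩ := d.exists_third_order hF hn
    refine ⟨_, (hγ.mul d.zHom_e (by ring)).add (d.zHom_s.mul ((d.zHom_r.mul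
      (zHom_evalForm ha d.zHom_f d.zHom_g rfl) ?_).add (d.zHom_p.mul
      (zHom_evalForm hC d.zHom_f d.zHom_g rfl) rfl)) ?_), d.coeff_three hFC⟩
    · push_cast
      ring
    · push_cast
      ring
  · intro c hc
    obtain ⟨B, γ, hB, hγ, e⟩ := exists_bezout d.zHom_s d.zHom_e d.isRelPrime_se hc (by omega)
    obtain ⟨B₂, B₁, hB₂, hB₁, e'⟩ := exists_bezout d.zHom_p d.zHom_r d.isRelPrime_pr hB (by omega)
    obtain ⟨a, ha, ea⟩ := d.exists_evalForm (j := 1) (n := n - 2 - d.α) (by omega) hB₁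
      (by push_cast; ring)
    obtain ⟨C, hC, eC⟩ := d.exists_evalForm (j := 3) (n := n - 3) (by omega) hB₂
      (by push_cast; ring)
    refine ⟨emb γ * d.v + polyForm 1 a * d.q + polyForm 3 C,
      add_mem (add_mem (Ideal.mul_mem_left _ _ d.v_mem) ?_)
      (J.pow_le_ideal 3 (polyForm_mem 3 C)),
      ((hγ.emb.mul d.zHom_v (by ring)).add ((zHom_polyForm (n := n - 1 - d.α)
      fun i => by convert ha i using 1; push_cast; ring).mul d.zHom_q (by ring))).add
      (zHom_polyForm hC), ?_⟩
    · rw [mem_ideal, map_mul, show 3 = 1 + 2 from rfl, pow_add]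
      exact mul_dvd_mul (J.mem_ideal.1 (J.pow_le_ideal 1 (polyForm_mem 1 a)))
        (J.mem_ideal.1 d.q_mem)
    · rw [d.coeff_three (γ := γ) (a := a) (C := C), ea, eC, e, e']
      · ring
      · convert zero_mem (stdLine k ^ 4) using 1
        ring

namespace Jet.Data

variable {J : Jet k} (d : J.Data)

theorem quotDim_ideal_three {n : ℕ} (hn : d.α + d.b + 2 ≤ n) :
    quotDim (J.ideal 3) ⊤ n = 3 * n + 3 * d.α + d.b := by
  rw [← quotDim_add _ (J.ideal 2), ← quotDim_add (J.ideal 2) (J.ideal 1), d.quotDim_two hn,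
    d.quotDim_one (by omega), J.quotDim_ideal_one]
  ring

theorem hasDegreeGenus_three : HasDegreeGenus (J.ideal 3) 3 (1 - 3 * d.α - d.b) := by
  refine eventually_atTop.2 ⟨d.α + d.b + 2, fun n hn => ?_⟩
  rw [d.quotDim_ideal_three hn]
  push_cast
  ring

theorem hasRankDegree_one {m : ℕ} (hm : 2 ≤ m) :
    HasRankDegree (filtrant (J.ideal m) 2) (filtrant (J.ideal m) 1) 1 (d.α - 1) := by
  rw [J.filtrant_ideal one_le_two hm, J.filtrant_ideal le_rfl (by omega)]
  refine eventually_atTop.2 ⟨d.α, fun n hn => ?_⟩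
  rw [d.quotDim_one hn]
  push_cast
  ring

theorem hasRankDegree_two {m : ℕ} (hm : 3 ≤ m) :
    HasRankDegree (filtrant (J.ideal m) 3 ⊔ (J.ideal m).radical ^ 2) (filtrant (J.ideal m) 2)
      0 d.b := by
  rw [J.filtrant_ideal one_le_two (by omega), J.filtrant_ideal (by omega) hm,
    (J.isStdMultiple (by omega)).radical]
  refine eventually_atTop.2 ⟨d.α + d.b + 2, fun n hn => ?_⟩
  have h1 := quotDim_add (J.ideal 3) (J.ideal 3 ⊔ stdLine k ^ 2) (J.ideal 2) n
  rw [d.quotDim_two hn, d.quotDim_sup_pow (j := 2) (by omega)] at h1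
  push_cast at h1 ⊢
  linarith

theorem isMultipleLine_three (d : J.Data) : IsMultipleLine 3 (J.ideal 3) where
  curve := (J.isStdMultiple (by omega)).isSpaceCurve
  support := by
    rw [(J.isStdMultiple (by omega)).radical]
    exact isLineIdeal_stdLine
  degree := ⟨_, d.hasDegreeGenus_three⟩

theorem hasType_three : HasType (J.ideal 3) (d.α - 1) ![d.b] where
  line := d.isMultipleLine_three
  quasiprimitive := ⟨_, d.hasRankDegree_one (by omega)⟩
  degree_one := d.hasRankDegree_one (by omega)
  degree_divisor i := by
    fin_cases i
    exact d.hasRankDegree_two le_rfl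

end Jet.Data

namespace Jet.Data₃

variable {J : Jet k} (d : J.Data₃)

theorem quotDim_ideal_four {n : ℕ} (hn : 2 * d.α + 2 * d.b + d.σ + 3 ≤ n) :
    quotDim (J.ideal 4) ⊤ n = 4 * n - 2 + 6 * d.α + 2 * d.b + d.σ := by
  rw [← quotDim_add _ (J.ideal 3), d.quotDim_three hn, d.quotDim_ideal_three (by omega)]
  ring

theorem hasDegreeGenus_four :
    HasDegreeGenus (J.ideal 4) 4 (3 - 6 * d.α - 2 * d.b - d.σ) := by
  refine eventually_atTop.2 ⟨2 * d.α + 2 * d.b + d.σ + 3, fun n hn => ?_⟩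
  rw [d.quotDim_ideal_four hn]
  push_cast
  ring

theorem hasRankDegree_three :
    HasRankDegree (filtrant (J.ideal 4) 4 ⊔ (J.ideal 4).radical ^ 3) (filtrant (J.ideal 4) 3)
      0 (d.b + d.σ) := by
  rw [J.filtrant_ideal (by omega) le_rfl, J.filtrant_ideal (by omega) (by omega),
    (J.isStdMultiple (by omega)).radical]
  refine eventually_atTop.2 ⟨2 * d.α + 2 * d.b + d.σ + 3, fun n hn => ?_⟩
  have h1 := quotDim_add (J.ideal 4) (J.ideal 4 ⊔ stdLine k ^ 3) (J.ideal 3) n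
  rw [d.quotDim_three hn, d.quotDim_sup_pow (j := 3) (by omega)] at h1
  push_cast at h1 ⊢
  linarith

theorem isMultipleLine_four (d : J.Data₃) : IsMultipleLine 4 (J.ideal 4) where
  curve := (J.isStdMultiple (by omega)).isSpaceCurve
  support := by
    rw [(J.isStdMultiple (by omega)).radical, ← (J.isStdMultiple (j := 3) (by omega)).radical]
    exact d.isMultipleLine_three.support
  degree := ⟨_, d.hasDegreeGenus_four⟩

theorem hasType_four : HasType (J.ideal 4) (d.α - 1) ![d.b, d.b + d.σ] where
  line := d.isMultipleLine_four
  quasiprimitive := ⟨_, d.hasRankDegree_one (by omega)⟩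
  degree_one := d.hasRankDegree_one (by omega)
  degree_divisor i := by
    fin_cases i
    · exact d.hasRankDegree_two (by omega)
    · simpa using d.hasRankDegree_three

end Jet.Data₃

end JetTypes


/-! ### Forms vanishing on a multiple line -/

section Sections

open MvPolynomial

variable {k : Type*} [Field k]

theorem stdLine_pow_unmixed {c F : Coord k} (hc : c ∉ stdLine k) {j : ℕ}
    (h : c * F ∈ stdLine k ^ j) : F ∈ stdLine k ^ j := by
  have key : ∀ i ≤ j, F ∈ stdLine k ^ i := by
    intro i
    induction i with
    | zero => simp
    | succ i ih =>
      intro hi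
      obtain ⟨A, hA⟩ := exists_polyForm (ih (by omega))
      have h1 : polyForm i (fun l => res c * A l) ∈ stdLine k ^ (i + 1) := by
        have e : polyForm i (fun l => res c * A l) =
            c * F - c * (F - polyForm i A) - (c - emb (res c)) * polyForm i A := by
          have : polyForm i (fun l => res c * A l) = emb (res c) * polyForm i A := by
            rw [polyForm, polyForm, Finset.mul_sum]
            refine Finset.sum_congr rfl fun l _ => ?_
            rw [map_mul]
            ring
          rw [this]
          ring
        rw [e]
        refine sub_mem (sub_mem (Ideal.pow_le_pow_right hi h) (Ideal.mul_mem_left _ _ hA)) ?_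
        rw [pow_succ']
        exact Ideal.mul_mem_mul (sub_emb_res_mem c) (polyForm_mem i A)
      have h2 : polyForm i A = 0 := by
        refine Finset.sum_eq_zero fun l hl => ?_
        have h3 := polyForm_eq_zero h1 l (by rw [Finset.mem_range] at hl; omega)
        rw [mul_eq_zero, or_iff_right fun h => hc (mem_stdLine.2 h)] at h3
        rw [h3, map_zero, zero_mul, zero_mul]
      simpa [h2] using hA
  exact key j le_rfl

theorem X3_notMem : (X 3 : Coord k) ∉ stdLine k := by
  rw [mem_stdLine, res_X3]
  exact X_ne_zero 1

theorem gradedPart_ne {I : Ideal (Coord k)} {j : ℕ} {F : Coord k} (hF : F ∈ I) {n' : ℤ} {n : ℕ}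
    (hn : ZHom F n') (hn' : n' ≤ n) (hFj : F ∉ stdLine k ^ j) :
    gradedPart I n ≠ gradedPart (stdLine k ^ j) n := by
  intro h
  obtain ⟨i, hi⟩ := Int.eq_ofNat_of_zero_le (sub_nonneg.2 hn')
  have h1 : ZHom (X 3 ^ i * F) n := ((zHom_X 3).pow i rfl).mul hn (by rw [← hi]; ring)
  have h2 : (⟨X 3 ^ i * F, zHom_natCast.1 h1⟩ : Forms k n) ∈ gradedPart I n :=
    I.mul_mem_left _ hF
  rw [h] at h2
  exact hFj (stdLine_pow_unmixed (fun h => X3_notMem (stdLine_isPrime.mem_of_pow_mem i h)) h2)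

theorem gradedPart_eq {I : Ideal (Coord k)} {j n : ℕ} (hI : stdLine k ^ j ≤ I)
    (h : ∀ F ∈ I, ZHom F n → F ∈ stdLine k ^ j) :
    gradedPart I n = gradedPart (stdLine k ^ j) n :=
  le_antisymm (fun (F : Forms k n) hF => h F.1 hF (zHom_natCast.2 F.2)) fun _ hF => hI hF

theorem polyForm_of_eq_zero {j : ℕ} {A : ℕ → LineRing k} (h : ∀ i ≤ j, A i = 0) :
    polyForm j A = 0 := by
  refine Finset.sum_eq_zero fun i hi => ?_
  rw [h i (by rw [Finset.mem_range] at hi; omega), map_zero, zero_mul, zero_mul]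

theorem Jet.mul_mem_ideal (J : Jet k) {i j : ℕ} {F G : Coord k} (hF : F ∈ J.ideal i)
    (hG : G ∈ J.ideal j) : F * G ∈ J.ideal (i + j) := by
  rw [mem_ideal, map_mul, pow_add]
  exact mul_dvd_mul (J.mem_ideal.1 hF) (J.mem_ideal.1 hG)

namespace Jet.Data

variable {J : Jet k} (d : J.Data)

theorem mul_q_mem (a : ℕ → LineRing k) : polyForm 1 a * d.q ∈ J.ideal 3 :=
  J.mul_mem_ideal (i := 1) (j := 2) (J.pow_le_ideal 1 (polyForm_mem 1 a)) d.q_mem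

theorem eq_zero_of_mul_q_mem {a : ℕ → LineRing k} (h : polyForm 1 a * d.q ∈ stdLine k ^ 3) :
    a 0 = 0 ∧ a 1 = 0 := by
  have e : polyForm 1 a * d.q = polyForm 2 (fun i => if i = 0 then a 0 * d.g else
      if i = 1 then a 1 * d.g - a 0 * d.f else -(a 1 * d.f)) := by
    simp only [polyForm, Finset.sum_range_succ, Finset.sum_range_zero, q, quadric]
    simp
    ring
  rw [e] at h
  have h2 := polyForm_eq_zero h 2 le_rfl
  have h1 := polyForm_eq_zero h 1 (by omega)
  have h3 : a 1 = 0 := by simpa [d.f_ne] using h2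
  exact ⟨by simpa [h3, d.f_ne] using h1, h3⟩

/-- Modulo the cube of the ideal of the line, the forms of smallest degree that vanish on the triple
structure are `x₀ q`, `x₁ q` of degree `α + 2` and `v` of degree `α + b + 1`. -/
theorem sections_three {n : ℕ} :
    gradedPart (J.ideal 3) n = gradedPart (stdLine k ^ 3) n ↔
      n < d.α + 2 ∧ n < d.α + d.b + 1 := by
  constructor
  · intro h
    constructor
    · by_contra hn
      refine gradedPart_ne (d.mul_q_mem fun i => if i = 0 then 1 else 0) (n' := d.α + 2)
        ((zHom_polyForm (n := 1) fun i => ?_).mul d.zHom_q (by ring)) (by omega) (fun h2 => ?_) h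
      · split_ifs
        · simpa using zHom_one
        · exact zHom_zero _
      · simpa using (d.eq_zero_of_mul_q_mem h2).1
    · by_contra hn
      obtain ⟨d', rfl⟩ := d.exists_data₃
      refine gradedPart_ne d'.v_mem d'.zHom_v (by omega) (fun h2 => ?_) h
      have h3 : polyForm 1 (fun i => if i = 0 then d'.p * d'.g else -(d'.p * d'.f)) ∈
          stdLine k ^ 2 := by
        have h4 := add_mem (Ideal.pow_le_pow_right (show 2 ≤ 3 by omega) h2) (polyForm_mem 2 d'.u)
        convert h4 using 1
        simp only [polyForm, Data₃.v, quadric, Finset.sum_range_succ, Finset.sum_range_zero]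
        simp
        ring
      have h4 := polyForm_eq_zero h3 1 le_rfl
      simp [d'.f_ne, d'.p_ne] at h4
  · rintro ⟨h1, h2⟩
    refine gradedPart_eq (J.pow_le_ideal 3) fun F hF hn => ?_
    obtain ⟨h, hh, A, hA, hFA⟩ := d.exists_second_order (J.ideal_antitone (by omega) hF) hn
    have e := J.mem_ideal_iff_coeff.1 hF 2 (by omega)
    rw [d.coeff_two hFA, mul_eq_zero, or_iff_right d.m₂_ne] at e
    have h3 : d.p ∣ h := d.isRelPrime_pr.dvd_of_dvd_mul_right
      ⟨-evalForm 2 A d.f d.g, by linear_combination e⟩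
    obtain ⟨γ, hγ, rfl⟩ := zHom_of_dvd_rel hh d.zHom_p d.p_ne h3
    obtain rfl : γ = 0 := hγ.eq_zero (by omega)
    rw [mul_zero, zero_mul, zero_add, mul_eq_zero, or_iff_right d.p_ne] at e
    have h4 := d.evalForm_eq_zero (by omega) hA e
    rw [polyForm_of_eq_zero h4, mul_zero, map_zero, zero_mul, sub_zero, sub_zero] at hFA
    exact hFA

/-- The quadruple structure lies on the surface `x₀² q` of degree `α + 3`. -/
theorem sections_four {n : ℕ} (h : gradedPart (J.ideal 4) n = gradedPart (stdLine k ^ 4) n) :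
    n < d.α + 3 := by
  by_contra hn
  have h1 : X 0 ^ 2 * d.q ∈ J.ideal 4 :=
    J.mul_mem_ideal (i := 2) (j := 2) (J.pow_le_ideal 2 (Ideal.pow_mem_pow X0_mem 2)) d.q_mem
  refine gradedPart_ne h1 (n' := d.α + 3) (((zHom_X 0).pow 2 rfl).mul d.zHom_q
    (by push_cast; ring)) (by omega) (fun h2 => ?_) h
  have e : X 0 ^ 2 * d.q = polyForm 3 (fun i => if i = 0 then d.g else
      if i = 1 then -d.f else 0) := by
    simp only [polyForm, Finset.sum_range_succ, Finset.sum_range_zero, q, quadric]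
    simp
    ring
  rw [e] at h2
  have h3 := polyForm_eq_zero h2 1 (by omega)
  simp [d.f_ne] at h3

/-- The components of the tangent direction are linearly independent modulo `p`. -/
def Indep : Prop := ∀ a : ℕ → LineRing k, (∀ i, ZHom (a i) 0) →
  d.p ∣ evalForm 1 a d.f d.g → a 0 = 0 ∧ a 1 = 0

/-- A dimension count: `f` and `g` are independent in the forms of degree `α` modulo `p`, a space of
dimension at most `b`. -/
theorem Indep.two_le {d : J.Data} (h : d.Indep) : 2 ≤ d.b := by
  let L : (binForms k 0 × binForms k 0) × binForms k (d.α - d.b) →ₗ[k] binForms k d.α :=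
    { toFun := fun x => ⟨x.1.1 * d.f + x.1.2 * d.g + d.p * x.2,
        ((x.1.1.2.mul d.zHom_f (by ring)).add (x.1.2.2.mul d.zHom_g (by ring))).add
          (d.zHom_p.mul x.2.2 (by ring))⟩
      map_add' := fun x y => Subtype.ext (by
        simp only [Prod.fst_add, Prod.snd_add, Submodule.coe_add]; ring)
      map_smul' := fun c x => Subtype.ext (by
        simp only [Prod.smul_fst, Prod.smul_snd, Submodule.coe_smul, RingHom.id_apply, smul_add,
          mul_smul_comm, smul_mul_assoc]) }
  have hL : Function.Injective L := by
    rw [← LinearMap.ker_eq_bot, eq_bot_iff]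
    rintro ⟨⟨⟨a, ha⟩, ⟨b, hb⟩⟩, ⟨c, hc⟩⟩ hx
    have e : a * d.f + b * d.g + d.p * c = 0 := congrArg Subtype.val hx
    have h1 := h (fun i => if i = 0 then a else b) (fun i => by
      split_ifs
      · exact ha
      · exact hb) ⟨-c, by rw [evalForm_one]; simp; linear_combination e⟩
    simp only [if_true, one_ne_zero, if_false] at h1
    obtain ⟨rfl, rfl⟩ := h1
    rw [zero_mul, zero_mul, zero_add, zero_add, mul_eq_zero, or_iff_right d.p_ne] at e
    subst e
    rfl
  have h1 := LinearMap.finrank_le_finrank_of_injective hL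
  simp only [Module.finrank_prod, finrank_binForms] at h1
  omega

/-- A form `(a₀ x₀ + a₁ x₁) q` of degree `α + 2` can be corrected by a cubic form in `x₀, x₁` to
vanish on the quadruple structure exactly if `p` divides `(a₀ f + a₁ g) r`, hence `a₀ f + a₁ g`. -/
theorem sections_four_iff :
    gradedPart (J.ideal 4) (d.α + 2) = gradedPart (stdLine k ^ 4) (d.α + 2) ↔ d.Indep := by
  constructor
  · intro h a ha ⟨c, hc⟩
    have hc' : ZHom c (d.α - d.b) := by
      refine ZHom.of_mul_left (n := d.α) ?_ d.zHom_p d.p_ne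
      rw [← hc]
      exact zHom_evalForm ha d.zHom_f d.zHom_g (by push_cast; ring)
    obtain ⟨C, hC, e⟩ := d.exists_evalForm (j := 3) (n := d.α - 1) le_rfl
      (d.zHom_r.mul hc' rfl).neg (by push_cast; ring)
    have h1 : polyForm 1 a * d.q + polyForm 3 C ∈ J.ideal 4 := by
      have h2 : polyForm 1 a * d.q + polyForm 3 C ∈ J.ideal 3 :=
        add_mem (d.mul_q_mem a) (J.pow_le_ideal 3 (polyForm_mem 3 C))
      rw [mem_ideal_iff_coeff] at h2 ⊢
      intro i hi
      rcases Nat.lt_succ_iff_lt_or_eq.1 hi with h3 | rfl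
      · exact h2 i h3
      · rw [map_add, Polynomial.coeff_add, d.coeff_three_mul_q, d.coeff_polyForm, e, hc]
        linear_combination -d.m₁ * d.r * c * d.sq_eq
    have h2 : polyForm 1 a * d.q + polyForm 3 C ∈ stdLine k ^ 4 := by
      by_contra h3
      refine gradedPart_ne h1 (n' := d.α + 2) (((zHom_polyForm (n := 1) fun i => ?_).mul d.zHom_q
        (by ring)).add (zHom_polyForm fun i => ?_)) (by push_cast; rfl) h3 h
      · simpa using ha i
      · convert hC i using 1
        push_cast
        ring
    refine d.eq_zero_of_mul_q_mem ?_
    exact (Submodule.add_mem_iff_left _ (polyForm_mem 3 C)).1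
      (Ideal.pow_le_pow_right (by omega) h2)
  · intro h
    have hb := h.two_le
    obtain ⟨d', rfl⟩ := d.exists_data₃
    refine gradedPart_eq (J.pow_le_ideal 4) fun F hF hn => ?_
    obtain ⟨γ, hγ, a, ha, C, hC, hFC⟩ :=
      d'.exists_third_order (J.ideal_antitone (by omega) hF) hn
    have e := J.mem_ideal_iff_coeff.1 hF 3 (by omega)
    obtain rfl : γ = 0 := hγ.eq_zero (by push_cast; omega)
    rw [d'.coeff_three hFC, mul_eq_zero, or_iff_right d'.m₃_ne, zero_mul, zero_add, mul_eq_zero,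
      or_iff_right d'.s_ne] at e
    have h1 := h a (fun i => by convert ha i using 1; push_cast; ring)
      (d'.isRelPrime_pr.dvd_of_dvd_mul_left ⟨-evalForm 3 C d'.f d'.g, by linear_combination e⟩)
    have h2 : ∀ i ≤ 1, a i = 0 := by
      intro i hi
      interval_cases i
      · exact h1.1
      · exact h1.2
    rw [evalForm_one, h1.1, h1.2, zero_mul, zero_mul, add_zero, mul_zero, zero_add, mul_eq_zero,
      or_iff_right d'.p_ne] at e
    have h3 := d'.evalForm_eq_zero (by push_cast; omega) hC e
    rw [polyForm_of_eq_zero h2, polyForm_of_eq_zero h3, map_zero, zero_mul, zero_mul, sub_zero,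
      sub_zero, sub_zero] at hFC
    exact hFC

end Jet.Data

end Sections


/-! ### Invariance under linear changes of coordinates -/

section Invariance

open MvPolynomial

variable {k : Type*} [Field k] (g : GL4 k)

theorem linIdeal_eq_map (I : Ideal (Coord k)) : linIdeal g I = I.map (lin g) := by
  ext F
  rw [mem_linIdeal]
  constructor
  · intro h
    have := Ideal.mem_map_of_mem (lin g) h
    rwa [← lin_mul, mul_inv_cancel, lin_one] at this
  · intro h
    have h1 : I.map (lin g) ≤ linIdeal g I := Ideal.map_le_iff_le_comap.2 fun G hG => by
      rw [Ideal.mem_comap, mem_linIdeal, ← lin_mul, inv_mul_cancel, lin_one]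
      exact hG
    exact h1 h

theorem linIdeal_linIdeal_inv (I : Ideal (Coord k)) : linIdeal g (linIdeal g⁻¹ I) = I := by
  rw [linIdeal_linIdeal, mul_inv_cancel, linIdeal_one]

theorem lin_mem_linIdeal {I : Ideal (Coord k)} {F : Coord k} : lin g F ∈ linIdeal g I ↔ F ∈ I := by
  rw [mem_linIdeal, ← lin_mul, inv_mul_cancel, lin_one]

theorem linIdeal_sup (I J : Ideal (Coord k)) : linIdeal g (I ⊔ J) = linIdeal g I ⊔ linIdeal g J := by
  simp only [linIdeal_eq_map, Ideal.map_sup]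

theorem linIdeal_pow (I : Ideal (Coord k)) (n : ℕ) : linIdeal g (I ^ n) = linIdeal g I ^ n := by
  simp only [linIdeal_eq_map, Ideal.map_pow]

theorem linIdeal_radical (I : Ideal (Coord k)) : linIdeal g I.radical = (linIdeal g I).radical :=
  Ideal.comap_radical _ _

theorem linIdeal_top : linIdeal g (⊤ : Ideal (Coord k)) = ⊤ := rfl

theorem quotDim_linIdeal (I J : Ideal (Coord k)) (n : ℕ) :
    quotDim (linIdeal g I) (linIdeal g J) n = quotDim I J n := by
  rw [quotDim, quotDim, gradedPart_linIdeal, gradedPart_linIdeal, LinearEquiv.finrank_map_eq,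
    LinearEquiv.finrank_map_eq]

theorem linIdeal_removeEmbedded (J : Ideal (Coord k)) :
    linIdeal g (removeEmbedded J) = removeEmbedded (linIdeal g J) := by
  have hmin : (linIdeal g J).minimalPrimes = Ideal.comap (lin g⁻¹) '' J.minimalPrimes :=
    Ideal.comap_minimalPrimes_eq_of_surjective (f := ((lin g⁻¹ : Coord k ≃ₐ[k] Coord k) :
      Coord k →+* Coord k)) (lin g⁻¹).surjective J
  ext F
  change (∃ s, (∀ p ∈ J.minimalPrimes, s ∉ p) ∧ s * lin g⁻¹ F ∈ J) ↔
    ∃ s, (∀ p ∈ (linIdeal g J).minimalPrimes, s ∉ p) ∧ s * F ∈ linIdeal g J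
  rw [hmin]
  simp only [Set.forall_mem_image]
  constructor
  · rintro ⟨s, hs, h⟩
    have e : lin g⁻¹ (lin g s) = s := by rw [← lin_mul, inv_mul_cancel, lin_one]
    refine ⟨lin g s, fun p hp h' => hs p hp ?_, ?_⟩
    · rwa [Ideal.mem_comap, e] at h'
    · rwa [mem_linIdeal, map_mul, e]
  · rintro ⟨s, hs, h⟩
    exact ⟨lin g⁻¹ s, fun p hp h' => hs hp h', by rwa [mem_linIdeal, map_mul] at h⟩

theorem linIdeal_filtrant (I : Ideal (Coord k)) (j : ℕ) :
    linIdeal g (filtrant I j) = filtrant (linIdeal g I) j := by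
  rw [filtrant, filtrant, linIdeal_removeEmbedded, linIdeal_sup, linIdeal_pow, linIdeal_radical]

theorem ZHom.lin {F : Coord k} {n : ℤ} (hF : ZHom F n) : ZHom (lin g F) n := by
  rcases hF.cases with rfl | ⟨m, rfl, hF'⟩
  · rw [map_zero]
    exact zHom_zero _
  · exact zHom_natCast.2 (lin_mem_forms g hF')

theorem zcomp_lin (F : Coord k) (n : ℤ) : zcomp n (lin g F) = lin g (zcomp n F) := by
  have := zcomp_map (c := 0) (lin g).toLinearMap (fun F n h => by simpa using h.lin g) F n
  rwa [add_zero] at this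

theorem mem_associatedPrimes_iff {I P : Ideal (Coord k)} :
    P ∈ associatedPrimes (Coord k) (Coord k ⧸ I) ↔ P.IsPrime ∧ ∃ F, ∀ r, r ∈ P ↔ r * F ∈ I := by
  rw [AssociatedPrimes.mem_iff, isAssociatedPrime_iff]
  refine and_congr_right fun _ => ?_
  constructor
  · rintro ⟨x, hx⟩
    obtain ⟨F, rfl⟩ := Ideal.Quotient.mk_surjective x
    refine ⟨F, fun r => ?_⟩
    rw [hx, Submodule.mem_colon_singleton, Submodule.mem_bot, ← Ideal.Quotient.eq_zero_iff_mem]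
    rfl
  · rintro ⟨F, hF⟩
    refine ⟨Ideal.Quotient.mk I F, ?_⟩
    ext r
    rw [hF, Submodule.mem_colon_singleton, Submodule.mem_bot, ← Ideal.Quotient.eq_zero_iff_mem]
    rfl

variable {I : Ideal (Coord k)}

theorem IsSpaceCurve.linIdeal (h : IsSpaceCurve I) : IsSpaceCurve (linIdeal g I) where
  homogeneous F hF n := by
    rw [mem_linIdeal, ← zcomp_natCast, ← zcomp_lin, zcomp_natCast]
    exact h.homogeneous _ hF n
  ne_top h' := h.ne_top (by
    rw [← linIdeal_inv_linIdeal g I, h']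
    rfl)
  pure P hP := by
    rw [mem_associatedPrimes_iff] at hP
    obtain ⟨hPp, F, hF⟩ := hP
    have h1 := h.pure (MultipleLines.linIdeal g⁻¹ P) (mem_associatedPrimes_iff.2
      ⟨Ideal.comap_isPrime _ P, lin g⁻¹ F, fun r => by
        rw [mem_linIdeal, inv_inv, hF, mem_linIdeal, map_mul, ← lin_mul, inv_mul_cancel,
          lin_one]⟩)
    rw [← h1]
    refine (ringKrullDim_eq_of_ringEquiv (Ideal.quotientEquiv _ _
      (lin g : Coord k ≃+* Coord k) ?_)).symm
    exact (linIdeal_linIdeal_inv g P).symm.trans (linIdeal_eq_map g _)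

theorem IsLineIdeal.linIdeal {P : Ideal (Coord k)} (h : IsLineIdeal P) :
    IsLineIdeal (linIdeal g P) := by
  obtain ⟨u, v, hu, hv, huv, rfl⟩ := h
  refine ⟨lin g u, lin g v, lin_mem_forms g hu, lin_mem_forms g hv, ?_, ?_⟩
  · have := huv.map' (lin g).toLinearMap (LinearMap.ker_eq_bot.2 (lin g).injective)
    have e : (lin g).toLinearMap ∘ ![u, v] = ![lin g u, lin g v] := by
      ext1 i
      fin_cases i <;> rfl
    rw [e] at this
    exact this
  · rw [linIdeal_eq_map, Ideal.map_span, Set.image_pair]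

theorem HasDegreeGenus.linIdeal {d : ℕ} {γ : ℤ} (h : HasDegreeGenus I d γ) :
    HasDegreeGenus (linIdeal g I) d γ := by
  refine h.mono fun n hn => ?_
  rw [← hn, ← quotDim_linIdeal g I ⊤ n, linIdeal_top]

theorem IsMultipleLine.linIdeal {d : ℕ} (h : IsMultipleLine d I) :
    IsMultipleLine d (linIdeal g I) where
  curve := h.curve.linIdeal g
  support := by
    rw [← linIdeal_radical]
    exact h.support.linIdeal g
  degree := by
    obtain ⟨γ, hγ⟩ := h.degree
    exact ⟨γ, hγ.linIdeal g⟩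

theorem gradedPart_linIdeal_pow {n d : ℕ} (h : gradedPart I n = gradedPart (I.radical ^ d) n) :
    gradedPart (linIdeal g I) n = gradedPart ((linIdeal g I).radical ^ d) n := by
  rw [← linIdeal_radical, ← linIdeal_pow, gradedPart_linIdeal, gradedPart_linIdeal, h]

theorem SatisfiesCondition.linIdeal {d ℓ : ℕ} (h : SatisfiesCondition d ℓ I) :
    SatisfiesCondition d ℓ (linIdeal g I) := fun n hn => gradedPart_linIdeal_pow g (h n hn)

theorem IsC.linIdeal {d ℓ : ℕ} (h : IsC d ℓ I) : IsC d ℓ (linIdeal g I) where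
  line := h.line.linIdeal g
  genus := h.genus.linIdeal g
  sections := gradedPart_linIdeal_pow g h.sections

theorem HasRankDegree.linIdeal {J : Ideal (Coord k)} {r : ℕ} {δ : ℤ} (h : HasRankDegree I J r δ) :
    HasRankDegree (linIdeal g I) (linIdeal g J) r δ :=
  h.mono fun n hn => by rw [quotDim_linIdeal, hn]

theorem HasType.linIdeal {a : ℤ} {m : ℕ} {b : Fin m → ℕ} (h : HasType I a b) :
    HasType (linIdeal g I) a b where
  line := h.line.linIdeal g
  quasiprimitive := by
    obtain ⟨δ, hδ⟩ := h.quasiprimitive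
    refine ⟨δ, ?_⟩
    rw [← linIdeal_filtrant, ← linIdeal_filtrant]
    exact hδ.linIdeal g
  degree_one := by
    rw [← linIdeal_filtrant, ← linIdeal_filtrant]
    exact h.degree_one.linIdeal g
  degree_divisor i := by
    rw [← linIdeal_filtrant, ← linIdeal_filtrant, ← linIdeal_radical, ← linIdeal_pow,
      ← linIdeal_sup]
    exact (h.degree_divisor i).linIdeal g

end Invariance


/-! ### Normal position -/

section NormalPosition

open MvPolynomial

variable {k : Type*} [Field k]

theorem eq_sum_coeff_X {F : Coord k} (hF : F ∈ Forms k 1) :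
    F = ∑ j, coeff (Finsupp.single j 1) F • X j := by
  ext d
  simp only [coeff_sum, coeff_smul, coeff_X, smul_eq_mul, mul_ite, mul_one, mul_zero]
  by_cases hd : coeff d F = 0
  · rw [hd]
    symm
    refine Finset.sum_eq_zero fun j _ => ?_
    split_ifs with h1
    · rw [h1, hd]
    · rfl
  · have h1 : d.degree = 1 := by exact_mod_cast zHom_natCast.2 hF d hd
    obtain ⟨j, rfl⟩ := Finsupp.range_single_one.ge h1
    simp [Finsupp.single_left_inj]

/-- The general linear group acts transitively on pairs of independent linear forms. -/
theorem exists_lin_eq {u v : Coord k} (hu : u ∈ Forms k 1) (hv : v ∈ Forms k 1)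
    (h : LinearIndependent k ![u, v]) : ∃ g : GL4 k, lin g u = X 0 ∧ lin g v = X 1 := by
  let c : Coord k → Fin 4 → k := fun F j => coeff (Finsupp.single j 1) F
  have hc : LinearIndependent k ![c u, c v] := by
    rw [LinearIndependent.pair_iff] at h ⊢
    intro s t hst
    refine h s t ?_
    rw [eq_sum_coeff_X hu, eq_sum_coeff_X hv, Finset.smul_sum, Finset.smul_sum,
      ← Finset.sum_add_distrib]
    refine Finset.sum_eq_zero fun j _ => ?_
    rw [smul_smul, smul_smul, ← add_smul]
    have := congrFun hst j
    simp only [Pi.add_apply, Pi.smul_apply, smul_eq_mul, Pi.zero_apply] at this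
    rw [show s * coeff (Finsupp.single j 1) u + t * coeff (Finsupp.single j 1) v = 0 from this,
      zero_smul]
  let B := Module.Basis.sumExtend hc
  have : Finite (Fin 2 ⊕ Module.Basis.sumExtendIndex hc) := Module.Finite.finite_basis B
  have : Finite (Module.Basis.sumExtendIndex hc) := Finite.sum_right (Fin 2)
  have := Fintype.ofFinite (Module.Basis.sumExtendIndex hc)
  have hcard : Fintype.card (Module.Basis.sumExtendIndex hc) = 2 := by
    have h1 := Module.finrank_eq_card_basis B
    rw [Module.finrank_fintype_fun_eq_card, Fintype.card_sum, Fintype.card_fin,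
      Fintype.card_fin] at h1
    omega
  let e : Fin 2 ⊕ Module.Basis.sumExtendIndex hc ≃ Fin 4 :=
    (Equiv.sumCongr (Equiv.refl (Fin 2)) (Fintype.equivFinOfCardEq hcard)).trans finSumFinEquiv
  let B' := B.reindex e
  let M : Matrix (Fin 4) (Fin 4) k := fun i => B' i
  have hM : LinearIndependent k M := B'.linearIndependent
  have hdet : M.det ≠ 0 := by
    have := Matrix.linearIndependent_rows_iff_isUnit.1 hM
    exact ((Matrix.isUnit_iff_isUnit_det M).1 this).ne_zero
  let g : GL4 k := Matrix.GeneralLinearGroup.mkOfDetNeZero M hdet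
  have hg : ∀ i, lin g⁻¹ (X i) = ∑ j, M i j • X j := by
    intro i
    rw [lin_apply, inv_inv]
    exact subst_X M i
  have hinl : ∀ i : Fin 2, B (Sum.inl i) = ![c u, c v] i := fun i => by
    simp only [B, Module.Basis.sumExtend, Module.Basis.reindex_apply, Module.Basis.extend_apply_self]
    rfl
  have h0 : lin g⁻¹ (X 0) = u := by
    rw [hg, eq_sum_coeff_X hu]
    refine Finset.sum_congr rfl fun j _ => ?_
    congr 1
    change B.reindex e 0 j = c u j
    rw [Module.Basis.reindex_apply, show e.symm 0 = Sum.inl 0 by rw [Equiv.symm_apply_eq]; rfl, hinl]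
    rfl
  have h1 : lin g⁻¹ (X 1) = v := by
    rw [hg, eq_sum_coeff_X hv]
    refine Finset.sum_congr rfl fun j _ => ?_
    congr 1
    change B.reindex e 1 j = c v j
    rw [Module.Basis.reindex_apply, show e.symm 1 = Sum.inl 1 by rw [Equiv.symm_apply_eq]; rfl, hinl]
    rfl
  refine ⟨g, ?_, ?_⟩
  · rw [← h0, ← lin_mul, mul_inv_cancel, lin_one]
  · rw [← h1, ← lin_mul, mul_inv_cancel, lin_one]

theorem IsLineIdeal.exists_linIdeal_eq {P : Ideal (Coord k)} (h : IsLineIdeal P) :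
    ∃ g, MultipleLines.linIdeal g P = stdLine k := by
  obtain ⟨u, v, hu, hv, huv, rfl⟩ := h
  obtain ⟨g, h0, h1⟩ := exists_lin_eq hu hv huv
  refine ⟨g, ?_⟩
  rw [linIdeal_eq_map, Ideal.map_span, Set.image_pair, h0, h1, stdLine]

theorem linearIndependent_X1_X0 : LinearIndependent k ![(X 1 : Coord k), X 0] := by
  rw [LinearIndependent.pair_iff]
  intro a b h
  have h0 := congrArg (coeff (Finsupp.single 1 1)) h
  have h1 := congrArg (coeff (Finsupp.single 0 1)) h
  simp [coeff_X, Finsupp.single_left_inj] at h0 h1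
  exact ⟨h0, h1⟩

/-- Up to a change of coordinates, a multiple line either contains the first infinitesimal
neighbourhood of its support or comes from a jet. -/
theorem IsMultipleLine.normal_position {d : ℕ} {I : Ideal (Coord k)} (h : IsMultipleLine d I) :
    ∃ g, IsStdMultiple (MultipleLines.linIdeal g I) ∧
      (MultipleLines.linIdeal g I ≤ stdLine k ^ 2 ∨
        ∃ J : Jet k, MultipleLines.linIdeal g I = J.ideal d) := by
  obtain ⟨g, hg⟩ := h.support.exists_linIdeal_eq
  have hstd : ∀ g, MultipleLines.linIdeal g I.radical = stdLine k →
      IsStdMultiple (MultipleLines.linIdeal g I) :=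
    fun g hg => (h.linIdeal g).curve.isStdMultiple (by rw [← linIdeal_radical, hg])
  have hjet : ∀ g, MultipleLines.linIdeal g I.radical = stdLine k →
      ∀ F ∈ MultipleLines.linIdeal g I, ∀ A : ℕ → LineRing k,
      F - polyForm 1 A ∈ stdLine k ^ 2 → A 1 ≠ 0 →
        ∃ J : Jet k, MultipleLines.linIdeal g I = J.ideal d := by
    intro g hg F hF A hA hA1
    obtain ⟨J, e, he, hJ⟩ := (hstd g hg).exists_jet hF hA hA1
    obtain ⟨γ, hγ⟩ := (h.linIdeal g).degree
    rw [hJ] at hγ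
    obtain rfl := J.eq_of_hasDegreeGenus he hγ
    exact ⟨J, hJ⟩
  by_cases hle : MultipleLines.linIdeal g I ≤ stdLine k ^ 2
  · exact ⟨g, hstd g hg, Or.inl hle⟩
  obtain ⟨F, hF, hF2⟩ := Set.not_subset.1 hle
  have hF1 : F ∈ stdLine k ^ 1 := by
    rw [pow_one]
    exact (hstd g hg).le hF
  obtain ⟨A, hA⟩ := exists_polyForm hF1
  by_cases hA1 : A 1 = 0
  · have hA0 : A 0 ≠ 0 := by
      intro hA0
      refine hF2 ?_
      simpa [polyForm, Finset.sum_range_succ, hA0, hA1] using hA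
    -- Exchange the two equations of the line.
    obtain ⟨w, hw1, hw0⟩ := exists_lin_eq (k := k) (u := X 1) (v := X 0) (isHomogeneous_X k 1)
      (isHomogeneous_X k 0) linearIndependent_X1_X0
    have hw : MultipleLines.linIdeal w (stdLine k) = stdLine k := by
      rw [linIdeal_eq_map, stdLine, Ideal.map_span, Set.image_pair, hw0, hw1, Set.pair_comm]
    have hg' : MultipleLines.linIdeal (w * g) I.radical = stdLine k := by
      rw [← linIdeal_linIdeal, hg, hw]
    refine ⟨w * g, hstd _ hg', Or.inr ?_⟩
    let G := lin w (emb (A 0))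
    have hG : G ∉ stdLine k := by
      rw [← hw, lin_mem_linIdeal, emb_mem_stdLine]
      exact hA0
    refine hjet _ hg' (lin w F) ?_ (fun i => if i = 1 then res G else 0) ?_ ?_
    · rw [← linIdeal_linIdeal]
      exact (lin_mem_linIdeal _).2 hF
    · have h1 : lin w (F - polyForm 1 A) ∈ stdLine k ^ 2 := by
        rw [← hw, ← linIdeal_pow, lin_mem_linIdeal]
        exact hA
      have h2 : (G - emb (res G)) * X 1 ∈ stdLine k ^ 2 := by
        rw [pow_two]
        exact Ideal.mul_mem_mul (sub_emb_res_mem G) X1_mem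
      have h3 := Ideal.add_mem _ h1 h2
      have h4 : lin w (polyForm 1 A) = G * X 1 := by
        simp [polyForm, Finset.sum_range_succ, hA1, hw0, G]
      rw [map_sub, h4] at h3
      convert h3 using 1
      simp [polyForm, Finset.sum_range_succ]
      ring
    · simpa using fun h => hG (mem_stdLine.2 h)
  · exact ⟨g, hstd g hg, Or.inr (hjet g hg F hF A hA hA1)⟩

end NormalPosition


/-! ### Triple and quadruple lines -/

section SmallMultiplicity

open MvPolynomial

variable {k : Type*} [Field k]

theorem linIdeal_iff {Q : Ideal (Coord k) → Prop} (hQ : ∀ g I, Q I → Q (linIdeal g I))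
    (g : GL4 k) (I : Ideal (Coord k)) : Q (linIdeal g I) ↔ Q I :=
  ⟨fun h => linIdeal_inv_linIdeal g I ▸ hQ g⁻¹ _ h, hQ g I⟩

namespace IsStdMultiple

variable {I : Ideal (Coord k)} (hI : IsStdMultiple I) (h2 : I ≤ stdLine k ^ 2)
include hI h2

/-- A multiple line containing the first infinitesimal neighbourhood of its support lies on the
surface `x₀^{d-1} = 0`, and violates the conditions on sections. -/
theorem gradedPart_ne_of_le {d : ℕ} (hd1 : 1 ≤ d) {γ : ℤ} (hd : HasDegreeGenus I d γ) {n : ℕ}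
    (hn : d - 1 ≤ n) :
    gradedPart I n ≠ gradedPart (I.radical ^ d) n := by
  rw [hI.radical]
  refine gradedPart_ne (hI.X0_pow_mem h2 hd) ((zHom_X 0).pow (d - 1) rfl) (by omega) fun h => ?_
  obtain ⟨j, rfl⟩ := Nat.exists_eq_add_of_le' hd1
  have h1 := polyForm_eq_zero (j := j) (A := fun i => if i = 0 then 1 else 0) (by
    convert h using 1
    rw [polyForm, Finset.sum_eq_single 0 (fun i _ hi => by simp [hi]) (by simp)]
    simp) 0 (Nat.zero_le _)
  simp at h1

/-- The equations `x₀` and `x₁` are independent in `𝓛₁`, which then does not have rank one. -/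
theorem not_isQuasiprimitive : ¬ IsQuasiprimitive I := by
  rintro ⟨δ, hδ⟩
  have h1 : (1 : Coord k) ∉ stdLine k := fun h =>
    stdLine_isPrime.ne_top ((Ideal.eq_top_iff_one _).2 h)
  have hle : filtrant I 2 ≤ stdLine k ^ 2 := by
    intro F hF
    obtain ⟨s, hs, hsF⟩ := (hI.mem_filtrant one_le_two).1 hF
    rw [sup_eq_right.2 h2] at hsF
    exact stdLine_pow_unmixed hs hsF
  have hmem : stdLine k ≤ filtrant I 1 := fun F hF =>
    (hI.mem_filtrant le_rfl).2 ⟨1, h1, by rw [one_mul, pow_one]; exact Ideal.mem_sup_right hF⟩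
  have h3 : ∀ n : ℕ, (2 : ℤ) * n + 0 ≤ quotDim (filtrant I 2) (filtrant I 1) n := by
    intro n
    have := le_quotDim (M := ![X 0, X 1]) (δ := ![1, 1])
      ((hle.trans (Ideal.pow_le_self two_ne_zero)).trans hmem)
      (fun i => by fin_cases i <;> exact_mod_cast zHom_X _)
      (fun i => by
        fin_cases i
        exacts [hmem X0_mem, hmem X1_mem])
      (fun c hc => by
        have h4 := polyForm_eq_zero (j := 1) (A := fun i => if i = 0 then c 0 else c 1) (by
          have h5 := hle hc
          simp only [polyForm, Finset.sum_range_succ, Finset.sum_range_zero]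
          simpa using h5)
        funext i
        fin_cases i
        · simpa using h4 0 (Nat.zero_le _)
        · simpa using h4 1 le_rfl) n
    simp at this
    linarith
  have := le_of_eventually_le (a := 2) (b := 0) (c := 1) (d := 1 + δ) (hδ.mono fun n hn => by
    have := h3 n
    rw [hn] at this
    push_cast at this
    linarith)
  omega

end IsStdMultiple

namespace Jet.Data

variable {J : Jet k} (d : J.Data)

theorem hasType_iff {m : ℕ} {a : ℤ} {b : Fin m → ℕ} {b' : Fin m → ℕ}
    (h : HasType (J.ideal (m + 2)) (d.α - 1) b') :
    HasType (J.ideal (m + 2)) a b ↔ a = d.α - 1 ∧ b = b' := by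
  constructor
  · intro h'
    refine ⟨(h'.degree_one.unique h.degree_one).2, funext fun i => ?_⟩
    exact_mod_cast ((h'.degree_divisor i).unique (h.degree_divisor i)).2
  · rintro ⟨rfl, rfl⟩
    exact h

theorem satisfiesCondition_three {ℓ : ℕ} :
    SatisfiesCondition 3 ℓ (J.ideal 3) ↔ ℓ < d.α ∧ ℓ + 1 < d.α + d.b := by
  have hr := (J.isStdMultiple (j := 3) (by omega)).radical
  rw [SatisfiesCondition, hr]
  constructor
  · intro h
    have := d.sections_three.1 (h (ℓ + 2) (by omega))
    omega
  · rintro h n hn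
    exact d.sections_three.2 (by omega)

theorem isC_three_iff {ℓ : ℕ} : IsC 3 ℓ (J.ideal 3) ↔ d.α = ℓ + 1 ∧ d.b = 1 := by
  have hr := (J.isStdMultiple (j := 3) (by omega)).radical
  constructor
  · intro h
    have h1 := (h.genus.unique d.hasDegreeGenus_three).2
    have h2 := h.sections
    rw [hr] at h2
    have h3 := d.sections_three.1 h2
    norm_num [Nat.choose] at h1
    omega
  · rintro ⟨h1, h2⟩
    refine ⟨d.isMultipleLine_three, ?_, ?_⟩
    · convert d.hasDegreeGenus_three using 1
      norm_num [Nat.choose, h1, h2]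
      ring
    · rw [hr]
      exact d.sections_three.2 (by omega)

/-- The sections of degree `ℓ + 3` bound `α`, and control the second order term if `α` is as small
as possible. -/
theorem of_sections_four {ℓ : ℕ}
    (h : gradedPart (J.ideal 4) (ℓ + 4 - 1) = gradedPart ((J.ideal 4).radical ^ 4) (ℓ + 4 - 1)) :
    ℓ < d.α ∧ (d.α = ℓ + 1 → d.Indep) := by
  have hr := (J.isStdMultiple (j := 4) (by omega)).radical
  rw [hr] at h
  have := d.sections_four h
  refine ⟨by omega, fun hα => d.sections_four_iff.1 ?_⟩
  rw [hα]
  exact h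

end Jet.Data

theorem Jet.Data₃.isC_four_iff {J : Jet k} (d : J.Data₃) {ℓ : ℕ} :
    IsC 4 ℓ (J.ideal 4) ↔ d.α = ℓ + 1 ∧ d.b = 2 ∧ d.σ = 0 ∧ d.Indep := by
  constructor
  · intro h
    have h1 := (h.genus.unique d.hasDegreeGenus_four).2
    obtain ⟨h2, h3⟩ := d.of_sections_four h.sections
    norm_num [Nat.choose] at h1
    have hα : d.α = ℓ + 1 := by omega
    have := (h3 hα).two_le
    exact ⟨hα, by omega, by omega, h3 hα⟩
  · rintro ⟨h1, h2, h3, h4⟩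
    refine ⟨d.isMultipleLine_four, ?_, ?_⟩
    · convert d.hasDegreeGenus_four using 1
      norm_num [Nat.choose, h1, h2, h3]
      ring
    · rw [(J.isStdMultiple (j := 4) (by omega)).radical]
      have := d.sections_four_iff.2 h4
      rwa [h1] at this

theorem hasType_linIdeal_iff {I : Ideal (Coord k)} {a : ℤ} {m : ℕ} {b : Fin m → ℕ} (g : GL4 k) :
    HasType (linIdeal g I) a b ↔ HasType I a b :=
  linIdeal_iff (Q := fun I => HasType I a b) (fun g _ h => h.linIdeal g) g I

theorem isC_linIdeal_iff {I : Ideal (Coord k)} {d ℓ : ℕ} (g : GL4 k) :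
    IsC d ℓ (linIdeal g I) ↔ IsC d ℓ I :=
  linIdeal_iff (fun g _ h => h.linIdeal g) g I

theorem satisfiesCondition_linIdeal_iff {I : Ideal (Coord k)} {d ℓ : ℕ} (g : GL4 k) :
    SatisfiesCondition d ℓ (linIdeal g I) ↔ SatisfiesCondition d ℓ I :=
  linIdeal_iff (fun g _ h => h.linIdeal g) g I

/-- Multiple lines containing the first infinitesimal neighbourhood of their support satisfy none of
the conditions; the others come from jets, for which the type is `(α - 1; b)`. -/
theorem IsMultipleLine.three {I : Ideal (Coord k)} (hI : IsMultipleLine 3 I) (ℓ : ℕ) :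
    (SatisfiesCondition 3 ℓ I ↔ ∃ (a : ℤ) (b : ℕ), HasType I a ![b] ∧
      ((a = ℓ ∧ 1 ≤ b) ∨ (ℓ : ℤ) + 1 ≤ a)) ∧
    (IsC 3 ℓ I ↔ HasType I ℓ ![1]) := by
  obtain ⟨g, hg, h⟩ := hI.normal_position
  obtain ⟨γ, hγ⟩ := (hI.linIdeal g).degree
  simp only [← satisfiesCondition_linIdeal_iff g (I := I), ← isC_linIdeal_iff g (I := I),
    ← hasType_linIdeal_iff g (I := I)]
  obtain h | ⟨J, hJ⟩ := h
  · have h1 : ∀ (a : ℤ) (b : ℕ), ¬ HasType (MultipleLines.linIdeal g I) a ![b] := fun a b hab =>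
      hg.not_isQuasiprimitive h hab.quasiprimitive
    refine ⟨⟨fun hc => ?_, fun ⟨a, b, hab, _⟩ => (h1 a b hab).elim⟩,
      ⟨fun hc => ?_, fun hab => (h1 _ _ hab).elim⟩⟩
    · exact (hg.gradedPart_ne_of_le h (by omega) hγ (n := ℓ + 3 - 1) (by omega)
        (hc _ le_rfl)).elim
    · exact (hg.gradedPart_ne_of_le h (by omega) hγ (n := ℓ + 3 - 1) (by omega) hc.sections).elim
  · obtain ⟨d⟩ := J.nonempty_data
    have ht : ∀ (a : ℤ) (b : ℕ), HasType (J.ideal 3) a ![b] ↔ a = d.α - 1 ∧ b = d.b := by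
      intro a b
      rw [d.hasType_iff d.hasType_three]
      simp
    simp only [hJ, ht, d.satisfiesCondition_three, d.isC_three_iff]
    refine ⟨⟨fun h => ⟨_, _, ⟨rfl, rfl⟩, by omega⟩, ?_⟩, by omega⟩
    rintro ⟨a, b, ⟨rfl, rfl⟩, h⟩
    omega

/-- Multiple lines containing the first infinitesimal neighbourhood of their support satisfy none of
the conditions; the others come from jets, for which the type is `(α - 1; b, b + σ)`. -/
theorem IsMultipleLine.four {I : Ideal (Coord k)} (hI : IsMultipleLine 4 I) (ℓ : ℕ) :
    (SatisfiesCondition 4 ℓ I → ∃ (a : ℤ) (b₂ b₃ : ℕ), HasType I a ![b₂, b₃] ∧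
      ((a = ℓ ∧ 2 ≤ b₂) ∨ (ℓ : ℤ) + 1 ≤ a)) ∧
    (IsC 4 ℓ I → HasType I ℓ ![2, 2]) := by
  obtain ⟨g, hg, h⟩ := hI.normal_position
  obtain ⟨γ, hγ⟩ := (hI.linIdeal g).degree
  simp only [← satisfiesCondition_linIdeal_iff g (I := I), ← isC_linIdeal_iff g (I := I),
    ← hasType_linIdeal_iff g (I := I)]
  obtain h | ⟨J, hJ⟩ := h
  · refine ⟨fun hc => ?_, fun hc => ?_⟩
    · exact (hg.gradedPart_ne_of_le h (by omega) hγ (n := ℓ + 4 - 1) (by omega)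
        (hc _ le_rfl)).elim
    · exact (hg.gradedPart_ne_of_le h (by omega) hγ (n := ℓ + 4 - 1) (by omega) hc.sections).elim
  · obtain ⟨d₀⟩ := J.nonempty_data
    obtain ⟨d, -⟩ := d₀.exists_data₃
    rw [hJ]
    refine ⟨fun h => ⟨_, _, _, d.hasType_four, ?_⟩, fun h => ?_⟩
    · obtain ⟨h1, h2⟩ := d.of_sections_four (h _ le_rfl)
      by_cases hα : d.α = ℓ + 1
      · exact Or.inl ⟨by omega, (h2 hα).two_le⟩
      · exact Or.inr (by omega)
    · obtain ⟨h1, h2, h3, -⟩ := d.isC_four_iff.1 h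
      have := d.hasType_four
      rw [h1, h2, h3] at this
      simpa using this

end SmallMultiplicity


/-! ### Normalized data of a jet -/

section Normalization

open MvPolynomial

variable {k : Type*} [Field k]

/-- The value of a binary form at the point `(1, 0)`, its leading coefficient. -/
def lead : LineRing k →ₐ[k] k := aeval ![1, 0]

@[simp] theorem lead_X0 : lead (X 0 : LineRing k) = 1 := by simp [lead]

@[simp] theorem lead_X1 : lead (X 1 : LineRing k) = 0 := by simp [lead]

theorem ne_zero_of_lead {c : LineRing k} (h : lead c ≠ 0) : c ≠ 0 := fun h0 => h (by simp [h0])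

/-- A binary form of degree `n` is the sum of its leading monomial and a multiple of the second
variable. -/
theorem ZHom.exists_lead {c : LineRing k} {n : ℕ} (hc : ZHom c n) :
    ∃ c', ZHom c' (n - 1) ∧ c = C (lead c) * X 0 ^ n + X 1 * c' := by
  have key : ∃ c', c = C (lead c) * X 0 ^ n + X 1 * c' := by
    have h : ∀ s : Finset (Fin 2 →₀ ℕ), (∀ d ∈ s, d.degree = n) →
        ∃ c', ∑ d ∈ s, monomial d (coeff d c) =
          C (lead (∑ d ∈ s, monomial d (coeff d c))) * X 0 ^ n + X 1 * c' := by
      classical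
      intro s
      induction s using Finset.induction_on with
      | empty => exact fun _ => ⟨0, by simp⟩
      | insert d s hd ih =>
        intro hs
        obtain ⟨c₁, h1⟩ := ih fun d hd => hs d (Finset.mem_insert_of_mem hd)
        have h2 : ∃ c₂, monomial d (coeff d c) =
            C (lead (monomial d (coeff d c))) * X 0 ^ n + X 1 * c₂ := by
          have hdeg := hs d (Finset.mem_insert_self _ _)
          rw [Finsupp.degree_eq_sum, Fin.sum_univ_two] at hdeg
          have e : monomial d (coeff d c) = C (coeff d c) * (X 0 ^ d 0 * X 1 ^ d 1) := by
            rw [monomial_eq, Finsupp.prod_fintype _ _ (by simp), Fin.prod_univ_two]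
          rcases Nat.eq_zero_or_pos (d 1) with h0 | h0
          · refine ⟨0, ?_⟩
            rw [e, h0, ← hdeg, h0]
            simp
          · refine ⟨C (coeff d c) * X 0 ^ d 0 * X 1 ^ (d 1 - 1), ?_⟩
            have e1 : (X 1 : LineRing k) ^ d 1 = X 1 * X 1 ^ (d 1 - 1) := by
              rw [← pow_succ', Nat.sub_add_cancel h0]
            rw [e, e1]
            simp
            ring
        obtain ⟨c₂, h2⟩ := h2
        refine ⟨c₁ + c₂, ?_⟩
        rw [Finset.sum_insert hd, map_add, map_add]
        linear_combination h1 + h2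
    have := h c.support fun d hd => by exact_mod_cast hc d (mem_support_iff.1 hd)
    rwa [support_sum_monomial_coeff] at this
  obtain ⟨c', h⟩ := key
  refine ⟨c', ?_, h⟩
  refine ZHom.of_mul_left (F := X 1) ?_ (zHom_X 1) (X_ne_zero 1)
  rw [show X 1 * c' = c - lead c • X 0 ^ n by rw [smul_eq_C_mul]; linear_combination -h]
  exact hc.sub (((zHom_X 0).pow n (by ring)).smul _)

/-- Division by a form with leading coefficient one. -/
theorem exists_division {f : LineRing k} {α : ℕ} (hf : ZHom f α) (hl : lead f = 1) (b : ℕ)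
    {u : LineRing k} (hu : ZHom u (α - 1 + b)) :
    ∃ c u', ZHom c (b - 1) ∧ ZHom u' (α - 1) ∧ u = c * f + X 1 ^ b * u' := by
  induction b generalizing u with
  | zero => exact ⟨0, u, zHom_zero _, by simpa using hu, by simp⟩
  | succ b ih =>
    have h1 : ZHom (u - lead u • (X 0 ^ b * f)) ((α + b : ℕ) : ℤ) := by
      refine ZHom.sub (by convert hu using 1; push_cast; ring) (ZHom.smul _ ?_)
      exact ((zHom_X 0).pow b rfl).mul hf (by push_cast; ring)
    obtain ⟨v, hv, e⟩ := h1.exists_lead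
    have h0 : lead (u - lead u • (X 0 ^ b * f)) = 0 := by simp [hl]
    rw [h0, C_0, zero_mul, zero_add] at e
    obtain ⟨c, u', hc, hu', e'⟩ := ih (u := v) (by convert hv using 1; push_cast; ring)
    refine ⟨lead u • X 0 ^ b + X 1 * c, u', ?_, hu', ?_⟩
    · refine (ZHom.smul _ ((zHom_X 0).pow b (by push_cast; ring))).add
        ((zHom_X 1).mul hc (by push_cast; ring))
    · rw [smul_eq_C_mul] at e ⊢
      linear_combination e + X 1 * e'

theorem ZHom.C_mul {F : LineRing k} {n : ℤ} (c : k) (hF : ZHom F n) : ZHom (C c * F) n := by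
  rw [← smul_eq_C_mul]
  exact hF.smul c

namespace Jet.Data

variable {J : Jet k} (d : J.Data)

/-- The two forms `f` and `p` can be normalized to have leading coefficient one. -/
theorem exists_monic (hf : lead d.f ≠ 0) (hp : lead d.p ≠ 0) :
    ∃ d' : J.Data, d'.α = d.α ∧ d'.b = d.b ∧ lead d'.f = 1 ∧ lead d'.p = 1 := by
  let a := (lead d.f)⁻¹
  let c := (lead d.p)⁻¹
  have ha : a ≠ 0 := inv_ne_zero hf
  have hc : c ≠ 0 := inv_ne_zero hp
  have hC : ∀ {x : k}, x ≠ 0 → IsUnit (C x : LineRing k) := fun hx => (Ne.isUnit hx).map C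
  have ha1 : (C a⁻¹ * C a : LineRing k) = 1 := by rw [← C_mul, inv_mul_cancel₀ ha, C_1]
  have hc1 : (C c⁻¹ * C c : LineRing k) = 1 := by rw [← C_mul, inv_mul_cancel₀ hc, C_1]
  refine ⟨{
    α := d.α, b := d.b, f := C a * d.f, g := C a * d.g, m₁ := C a⁻¹ * d.m₁
    m₂ := C a⁻¹ ^ 2 * C c⁻¹ * d.m₂, p := C c * d.p, r := C (a ^ 3 * c) * d.r
    zHom_f := d.zHom_f.C_mul a, zHom_g := d.zHom_g.C_mul a, zHom_p := d.zHom_p.C_mul c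
    zHom_r := d.zHom_r.C_mul _
    f_ne := mul_ne_zero (hC ha).ne_zero d.f_ne
    D_eq := ?_, E_zero_eq := ?_, E_one_eq := ?_, sq_eq := ?_, isRelPrime_fg := ?_
    isRelPrime_pr := ?_ }, rfl, rfl, ?_, ?_⟩
  · linear_combination d.D_eq - d.m₁ * d.f * ha1
  · linear_combination d.E_zero_eq - d.m₁ * d.g * ha1
  · rw [C_mul, C_pow]
    linear_combination C a * d.E_one_eq - C a * d.m₂ * d.r *
      ((C a⁻¹ * C a + 1) * C c⁻¹ * C c * ha1 + hc1)
  · linear_combination C a⁻¹ ^ 2 * d.sq_eq - C a⁻¹ ^ 2 * d.m₂ * d.p * hc1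
  · exact (isRelPrime_mul_unit_left (hC ha)).2 d.isRelPrime_fg
  · exact (isRelPrime_mul_unit_left_left (hC hc)).2
      ((isRelPrime_mul_unit_left_right (hC (mul_ne_zero (pow_ne_zero 3 ha) hc))).2
        d.isRelPrime_pr)
  · simp [a, hf]
  · simp [c, hp]

/-- A quadratic form with prescribed value on the tangent vector, unique if two of its
coefficients are divisible by a suitable power of the second variable. -/
theorem exists_normal_form (hf : lead d.f = 1) : ∃ u : ℕ → LineRing k,
    (∀ i, ZHom (u i) (d.α - 1 + d.b)) ∧ evalForm 2 u d.f d.g = d.r ∧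
    ∃ u₁ u₂, ZHom u₁ (d.α - 1) ∧ ZHom u₂ (d.α - 1) ∧ u 1 = X 1 ^ d.b * u₁ ∧
      u 2 = X 1 ^ d.b * u₂ := by
  obtain ⟨u, hu, hur⟩ := d.exists_evalForm (j := 2) (n := d.α - 1 + d.b) (by omega) d.zHom_r
    (by push_cast; ring)
  obtain ⟨c₂, u₂, hc₂, hu₂, e₂⟩ := exists_division d.zHom_f hf d.b (hu 2)
  obtain ⟨c₁, u₁, hc₁, hu₁, e₁⟩ := exists_division d.zHom_f hf d.b
    (u := u 1 + c₂ * d.g) ((hu 1).add (hc₂.mul d.zHom_g (by ring)))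
  refine ⟨fun i => if i = 0 then u 0 + c₁ * d.g else if i = 1 then X 1 ^ d.b * u₁ else
    X 1 ^ d.b * u₂, fun i => ?_, ?_, u₁, u₂, hu₁, hu₂, by simp, by simp⟩
  · dsimp only
    split_ifs
    · exact (hu 0).add (hc₁.mul d.zHom_g (by ring))
    · exact ((zHom_X 1).pow d.b rfl).mul hu₁ (by ring)
    · exact ((zHom_X 1).pow d.b rfl).mul hu₂ (by ring)
  · rw [evalForm_two] at hur ⊢
    simp only [if_true, one_ne_zero, if_false, OfNat.ofNat_ne_zero, OfNat.ofNat_ne_one]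
    linear_combination hur - d.f * d.g * e₁ - d.g ^ 2 * e₂

end Jet.Data

namespace Jet.Data₃

variable {J : Jet k} (d : J.Data₃)

/-- If `b₃ = b₂`, the denominator of the third order term can be normalized to one. -/
theorem exists_s_eq_one (hσ : d.σ = 0) :
    ∃ d' : J.Data₃, d'.toData = d.toData ∧ d'.u = d.u ∧ d'.σ = 0 ∧ d'.s = 1 := by
  have hs := d.zHom_s
  rw [hσ] at hs
  obtain ⟨c, hc⟩ := hs.exists_C
  have hc0 : c ≠ 0 := fun h => d.s_ne (by rw [hc, h, C_0])
  have hc1 : (C c * C c⁻¹ : LineRing k) = 1 := by rw [← C_mul, mul_inv_cancel₀ hc0, C_1]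
  refine ⟨{ d.toData with
    u := d.u, σ := 0, s := 1, e := C c⁻¹ * d.e, m₃ := d.m₃ * C c
    zHom_u := d.zHom_u, evalForm_u := d.evalForm_u, zHom_s := zHom_one
    zHom_e := by
      have := d.zHom_e.C_mul c⁻¹
      rwa [hσ] at this
    mul_eq := by rw [mul_one, ← hc]; exact d.mul_eq
    v_eq := by
      refine d.v_eq.trans ?_
      linear_combination -d.m₃ * d.e * hc1
    isRelPrime_se := isRelPrime_one_left }, rfl, rfl, rfl, rfl⟩

theorem v_sub_mem :
    d.v - polyForm 1 (fun i => if i = 0 then d.p * d.g else -(d.p * d.f)) ∈ stdLine k ^ 2 := by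
  have h : d.v - polyForm 1 (fun i => if i = 0 then d.p * d.g else -(d.p * d.f)) =
      -polyForm 2 d.u := by
    simp only [v, quadric, polyForm, Finset.sum_range_succ, Finset.sum_range_zero]
    simp
    ring
  rw [h]
  exact neg_mem (polyForm_mem 2 d.u)

/-- An equation of the quadruple structure that is generically smooth along the line. -/
def w : Coord k := emb (d.f ^ 3 * d.p * d.s) * d.v - emb d.e * X 0 ^ 3

theorem w_mem : d.w ∈ J.ideal 4 := by
  have hX : X 0 ^ 3 ∈ J.ideal 3 := J.X0_pow_mem_ideal.2 le_rfl
  rw [Jet.mem_ideal_iff_coeff]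
  intro i hi
  have h3 : d.w ∈ J.ideal 3 :=
    sub_mem (Ideal.mul_mem_left _ _ d.v_mem) (Ideal.mul_mem_left _ _ hX)
  rcases Nat.lt_or_ge i 3 with h | h
  · exact J.mem_ideal_iff_coeff.1 h3 i h
  obtain rfl : i = 3 := by omega
  have h2 : (J.hom d.v).coeff 3 = d.m₃ * d.e := d.v_eq
  have key : ∀ c e : LineRing k, (J.hom (emb c * d.v - emb e * X 0 ^ 3)).coeff 3 =
      c * (d.m₃ * d.e) - e * (d.m₁ * d.f) ^ 3 := by
    intro c e
    rw [map_sub, Polynomial.coeff_sub, map_mul, map_mul, Jet.hom_emb, Jet.hom_emb,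
      Polynomial.coeff_C_mul, Polynomial.coeff_C_mul, h2, map_pow, hom_X0, mul_pow,
      ← Polynomial.C_pow, Polynomial.coeff_X_pow_mul', if_pos le_rfl, Nat.sub_self,
      Polynomial.coeff_C_zero, d.D_eq]
  rw [w, key]
  linear_combination -d.f ^ 3 * d.e * d.p * d.mul_eq - d.e * d.f ^ 3 * d.m₁ * d.sq_eq

theorem zHom_w : ZHom d.w (4 * d.α + 2 * d.b + d.σ + 1) :=
  ((((d.zHom_f.pow 3 rfl).mul d.zHom_p rfl).mul d.zHom_s rfl).emb.mul d.zHom_v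
    (by push_cast; ring)).sub (d.zHom_e.emb.mul ((zHom_X 0).pow 3 rfl) (by push_cast; ring))

theorem w_sub_mem :
    d.w - polyForm 1 (fun i => if i = 0 then d.f ^ 3 * d.p * d.s * (d.p * d.g) else
      -(d.f ^ 3 * d.p * d.s * (d.p * d.f))) ∈ stdLine k ^ 2 := by
  have h := Ideal.mul_mem_left _ (emb (d.f ^ 3 * d.p * d.s)) d.v_sub_mem
  have h3 : emb d.e * X 0 ^ 3 ∈ stdLine k ^ 2 :=
    Ideal.mul_mem_left _ _ (Ideal.pow_le_pow_right (by omega) (Ideal.pow_mem_pow X0_mem 3))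
  convert sub_mem h h3 using 1
  simp only [w, polyForm, Finset.sum_range_succ, Finset.sum_range_zero]
  simp
  ring

/-- The triple structure is determined by the equation `v`. -/
theorem ideal_three_eq {J' : Jet k} {d' : J'.Data₃} (h : d.v = d'.v) :
    J.ideal 3 = J'.ideal 3 := by
  refine (J.isStdMultiple (by omega)).ext (J'.isStdMultiple (by omega))
    (J.X0_pow_mem_ideal.2 le_rfl) (fun i hi h => absurd (J.X0_pow_mem_ideal.1 h) (by omega))
    (J'.X0_pow_mem_ideal.2 le_rfl) (fun i hi h => absurd (J'.X0_pow_mem_ideal.1 h) (by omega))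
    d.v_mem (by rw [h]; exact d'.v_mem) d.v_sub_mem ?_
  simpa using ⟨d.p_ne, d.f_ne⟩

/-- The quadruple structure is determined by the equation `w`. -/
theorem ideal_four_eq {J' : Jet k} {d' : J'.Data₃} (h : d.w = d'.w) :
    J.ideal 4 = J'.ideal 4 := by
  refine (J.isStdMultiple (by omega)).ext (J'.isStdMultiple (by omega))
    (J.X0_pow_mem_ideal.2 le_rfl) (fun i hi h => absurd (J.X0_pow_mem_ideal.1 h) (by omega))
    (J'.X0_pow_mem_ideal.2 le_rfl) (fun i hi h => absurd (J'.X0_pow_mem_ideal.1 h) (by omega))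
    d.w_mem (by rw [h]; exact d'.w_mem) d.w_sub_mem ?_
  simp [d.p_ne, d.f_ne, d.s_ne]

end Jet.Data₃

end Normalization


/-! ### Transversality to a plane curve germ -/

section Transversality

open MvPolynomial

variable {k : Type*} [Field k]

/-- The span of the monomials `x₂ⁿ⁻ⁱ x₀ⁱ`, `i < d`, and the multiples of `x₃`. -/
def germSpace (k : Type*) [Field k] (d n : ℕ) : Submodule k (Coord k) :=
  (Ideal.span {(X 3 : Coord k)}).restrictScalars k ⊔
    Submodule.span k (Set.range fun i : Fin d => (X 2 : Coord k) ^ (n - i) * X 0 ^ (i : ℕ))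

/-- The forms of degree `n` in `germSpace`. -/
def germForms (k : Type*) [Field k] (d n : ℕ) : Submodule k (Forms k n) :=
  (germSpace k d n).comap (Forms k n).subtype

/-- Modulo the ideal `I`, all forms of degree `n` are represented by elements of `germSpace`. -/
def IsTransverse (d n : ℕ) (I : Ideal (Coord k)) : Prop :=
  ∀ F, ZHom F n → F ∈ I.restrictScalars k ⊔ germSpace k d n

theorem X3_mul_mem_germSpace {d n : ℕ} (G : Coord k) : X 3 * G ∈ germSpace k d n :=
  Submodule.mem_sup_left (Ideal.mem_span_singleton.2 (dvd_mul_right _ _))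

theorem monomial_mem_germSpace {d n i : ℕ} (hi : i < d) :
    (X 2 : Coord k) ^ (n - i) * X 0 ^ i ∈ germSpace k d n :=
  Submodule.mem_sup_right (Submodule.subset_span ⟨⟨i, hi⟩, rfl⟩)

/-- `germSpace` is generated by the multiples of `x₃` and the monomials `x₂ⁿ⁻ⁱ x₀ⁱ`, `i < d`. -/
theorem germSpace_le {d n : ℕ} {N : Submodule k (Coord k)} :
    germSpace k d n ≤ N ↔ (∀ G, X 3 * G ∈ N) ∧
      ∀ i < d, (X 2 : Coord k) ^ (n - i) * X 0 ^ i ∈ N := by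
  rw [germSpace, sup_le_iff, Submodule.span_le]
  refine and_congr ⟨fun h G => h (Ideal.mem_span_singleton.2 (dvd_mul_right _ _)), fun h F hF => ?_⟩
    ⟨fun h i hi => h ⟨⟨i, hi⟩, rfl⟩, fun h => ?_⟩
  · obtain ⟨G, rfl⟩ := Ideal.mem_span_singleton.1 hF
    exact h G
  · rintro _ ⟨i, rfl⟩
    exact h i i.2

theorem zcomp_mem_germSpace {d n : ℕ} (hdn : d ≤ n) {F : Coord k} (hF : F ∈ germSpace k d n) :
    zcomp n F ∈ germSpace k d n := by
  have h : germSpace k d n ≤ (germSpace k d n).comap (zcomp (n : ℤ)) := by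
    refine germSpace_le.2 ⟨fun G => ?_, fun i hi => ?_⟩
    · rw [Submodule.mem_comap, mul_comm, zcomp_mul (zHom_X 3) (n := n - 1) (by ring), mul_comm]
      exact X3_mul_mem_germSpace _
    · have h1 : ZHom ((X 2 : Coord k) ^ (n - i) * X 0 ^ i) n :=
        ((zHom_X 2).pow _ rfl).mul ((zHom_X 0).pow _ rfl) (by push_cast [show i ≤ n by omega]; ring)
      rw [Submodule.mem_comap, h1.zcomp_eq]
      exact monomial_mem_germSpace hi
  exact h hF

/-- Transversality of an ideal is a condition on its forms of degree `n`. -/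
theorem gradedPart_sup_germForms {d n : ℕ} (hdn : d ≤ n) {I : Ideal (Coord k)}
    (hI : ∀ F ∈ I, ∀ n : ℤ, zcomp n F ∈ I) :
    gradedPart I n ⊔ germForms k d n = ⊤ ↔ IsTransverse d n I := by
  constructor
  · intro h F hF
    have h1 : (⟨F, zHom_natCast.1 hF⟩ : Forms k n) ∈ gradedPart I n ⊔ germForms k d n :=
      h ▸ Submodule.mem_top
    obtain ⟨A, hA, B, hB, e⟩ := Submodule.mem_sup.1 h1
    exact Submodule.mem_sup.2 ⟨A.1, hA, B.1, hB, congrArg Subtype.val e⟩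
  · intro h
    rw [eq_top_iff]
    intro (F : Forms k n) _
    obtain ⟨A, hA, B, hB, e⟩ := Submodule.mem_sup.1 (h F.1 (zHom_natCast.2 F.2))
    refine Submodule.mem_sup.2 ⟨⟨zcomp n A, zHom_natCast.1 (zHom_zcomp _ _)⟩, hI A hA n,
      ⟨zcomp n B, zHom_natCast.1 (zHom_zcomp _ _)⟩, zcomp_mem_germSpace hdn hB, Subtype.ext ?_⟩
    change zcomp n A + zcomp n B = F.1
    rw [← map_add, e, (zHom_natCast.2 F.2).zcomp_eq]

/-- Transversality holds if the ideal contains an equation whose linear part has a coefficient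
of `x₁` that does not vanish for `x₃ = 0`: by this equation the monomials divisible by `x₁` can be
eliminated. -/
theorem isTransverse_of {I : Ideal (Coord k)} {d N n : ℕ} (hI : stdLine k ^ d ≤ I) {G : Coord k}
    (hG : G ∈ I) (hGN : ZHom G (N + 1)) {A : ℕ → LineRing k} (hAN : ∀ i, ZHom (A i) N)
    (hA : G - polyForm 1 A ∈ stdLine k ^ 2) (hl : lead (A 1) ≠ 0) (hn : N + d ≤ n) :
    IsTransverse d n I := by
  let T : Submodule k (Coord k) := I.restrictScalars k ⊔ germSpace k d n
  have hTI : ∀ F ∈ I, F ∈ T := fun F hF => Submodule.mem_sup_left hF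
  have hTw : ∀ F, X 3 * F ∈ T := fun F => Submodule.mem_sup_right (X3_mul_mem_germSpace F)
  -- Descending induction on the order of vanishing `j` along the line.
  have key : ∀ c j, j + c = d → ∀ F ∈ stdLine k ^ j, ZHom F n → F ∈ T := by
    intro c
    induction c with
    | zero =>
      rintro j rfl F hF -
      exact hTI F (hI hF)
    | succ c ih =>
      intro j hj F hF hFn
      obtain ⟨B, hB, hFB⟩ := exists_zHom_polyForm hF hFn
      suffices h : polyForm j B ∈ T by
        have h1 := T.add_mem (ih (j + 1) (by omega) _ hFB
          (hFn.sub (zHom_polyForm (n := (n : ℤ)) hB))) h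
        simpa using h1
      -- By the equation `G`, a factor `x₁` can be traded for `x₀`, up to multiples of `x₃` and
      -- terms of higher order.
      have mono : ∀ i ≤ j, (X 2 : Coord k) ^ (n - j) * X 0 ^ (j - i) * X 1 ^ i ∈ T := by
        intro i
        induction i with
        | zero =>
          intro _
          rw [Nat.sub_zero, pow_zero, mul_one]
          exact Submodule.mem_sup_right (monomial_mem_germSpace (by omega))
        | succ i ihi =>
          intro hi
          obtain ⟨A₀, -, e0⟩ := (hAN 0).exists_lead
          obtain ⟨A₁, -, e1⟩ := (hAN 1).exists_lead
          let R := G - polyForm 1 A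
          let M : Coord k := X 2 ^ (n - j - N) * X 0 ^ (j - (i + 1)) * X 1 ^ i
          have hM : M ∈ stdLine k ^ (j - 1) := by
            have := Ideal.mul_mem_mul (Ideal.pow_mem_pow (X0_mem (k := k)) (j - (i + 1)))
              (Ideal.pow_mem_pow (X1_mem (k := k)) i)
            rw [← pow_add, show j - (i + 1) + i = j - 1 by omega] at this
            simp only [M, mul_assoc]
            exact Ideal.mul_mem_left _ _ this
          have hMR : M * R ∈ T := by
            refine ih (j + 1) (by omega) _ ?_ ?_
            · have := Ideal.mul_mem_mul hM hA
              rwa [← pow_add, show j - 1 + 2 = j + 1 by omega] at this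
            · refine ((((zHom_X 2).pow _ rfl).mul ((zHom_X 0).pow _ rfl) rfl).mul
                ((zHom_X 1).pow _ rfl) rfl).mul
                (hGN.sub (zHom_polyForm (n := (N : ℤ) + 1) fun i => by simpa using hAN i)) ?_
              push_cast [show j ≤ n by omega, show N ≤ n - j by omega, hi]
              ring
          have hMG : M * G ∈ T := hTI _ (I.mul_mem_left _ hG)
          have e2 : polyForm 1 A = (C (lead (A 0)) * X 2 ^ N + X 3 * emb A₀) * X 0 +
              (C (lead (A 1)) * X 2 ^ N + X 3 * emb A₁) * X 1 := by
            have hC : ∀ c : k, emb (C c : LineRing k) = C c := fun c => by simp [emb]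
            rw [polyForm, Finset.sum_range_succ, Finset.sum_range_one, e0, e1]
            simp [hC]
          have e3 : (X 2 : Coord k) ^ (n - j) = X 2 ^ (n - j - N) * X 2 ^ N := by
            rw [← pow_add]
            congr 1
            omega
          have e4 : (X 0 : Coord k) ^ (j - i) = X 0 ^ (j - (i + 1)) * X 0 := by
            rw [← pow_succ]
            congr 1
            omega
          have e5 : lead (A 1) • ((X 2 : Coord k) ^ (n - j) * X 0 ^ (j - (i + 1)) * X 1 ^ (i + 1)) =
              M * G - M * R - lead (A 0) • (X 2 ^ (n - j) * X 0 ^ (j - i) * X 1 ^ i) -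
              X 3 * (M * (emb A₀ * X 0 + emb A₁ * X 1)) := by
            have : R = G - polyForm 1 A := rfl
            rw [this, e2, e4, e3, smul_eq_C_mul, smul_eq_C_mul]
            ring
          refine (T.smul_mem_iff hl).1 ?_
          rw [e5]
          exact T.sub_mem (T.sub_mem (T.sub_mem hMG hMR) (T.smul_mem _ (ihi (by omega)))) (hTw _)
      refine T.sum_mem fun i hi => ?_
      rw [Finset.mem_range] at hi
      have hB' : ZHom (B i) ((n - j : ℕ) : ℤ) := by
        have := hB i
        rwa [← Nat.cast_sub (by omega)] at this
      obtain ⟨c', -, e⟩ := hB'.exists_lead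
      have hC : ∀ c : k, emb (C c : LineRing k) = C c := fun c => by simp [emb]
      have e' : emb (B i) * X 0 ^ (j - i) * X 1 ^ i =
          lead (B i) • (X 2 ^ (n - j) * X 0 ^ (j - i) * X 1 ^ i) +
          X 3 * (emb c' * X 0 ^ (j - i) * X 1 ^ i) := by
        conv_lhs => rw [e]
        simp only [map_add, map_mul, map_pow, hC, emb_X0, emb_X1, smul_eq_C_mul]
        ring
      rw [e']
      exact T.add_mem (T.smul_mem _ (mono i (by omega))) (hTw _)
  intro F hF
  exact key d 0 (by omega) F (by simp) hF

/-- The translation `x₀ ↦ x₀ + s`, `x₁ ↦ x₁ + t`. -/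
def shift (s t : LineRing k) : Coord k →ₐ[k] Coord k :=
  aeval ![X 0 + emb s, X 1 + emb t, X 2, X 3]

section Shift

variable {s t : LineRing k}

@[simp] theorem shift_X0 : shift s t (X 0) = X 0 + emb s := by simp [shift]

@[simp] theorem shift_X1 : shift s t (X 1) = X 1 + emb t := by simp [shift]

@[simp] theorem shift_X2 : shift s t (X 2) = X 2 := by simp [shift]

@[simp] theorem shift_X3 : shift s t (X 3) = X 3 := by simp [shift]

@[simp] theorem shift_emb (c : LineRing k) : shift s t (emb c) = emb c := by
  suffices h : (shift s t).comp emb = emb from AlgHom.congr_fun h c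
  refine algHom_ext fun i => ?_
  fin_cases i <;> simp

theorem shift_shift (s' t' : LineRing k) (F : Coord k) :
    shift s t (shift s' t' F) = shift (s + s') (t + t') F := by
  suffices h : (shift s t).comp (shift s' t') = shift (s + s') (t + t') from AlgHom.congr_fun h F
  refine algHom_ext fun i => ?_
  fin_cases i <;> simp [add_assoc]

theorem shift_zero (F : Coord k) : shift 0 0 F = F := by
  suffices h : shift (0 : LineRing k) 0 = AlgHom.id k _ from AlgHom.congr_fun h F
  refine algHom_ext fun i => ?_
  fin_cases i <;> simp

theorem shift_neg_shift (F : Coord k) : shift (-s) (-t) (shift s t F) = F := by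
  rw [shift_shift, neg_add_cancel, neg_add_cancel, shift_zero]

theorem shift_shift_neg (F : Coord k) : shift s t (shift (-s) (-t) F) = F := by
  rw [shift_shift, add_neg_cancel, add_neg_cancel, shift_zero]

theorem exists_lin_eq_subst (M : Matrix (Fin 4) (Fin 4) k) (hM : M.det ≠ 0) :
    ∃ g : GL4 k, ∀ F, lin g F = subst M F := by
  refine ⟨(Matrix.GeneralLinearGroup.mkOfDetNeZero M hM)⁻¹, fun F => ?_⟩
  rw [lin_apply, inv_inv]
  rfl

theorem ZHom.eq_smul_X {s : LineRing k} (hs : ZHom s 1) :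
    ∃ a b : k, s = a • X 0 + b • X 1 := by
  obtain ⟨c, hc, e⟩ := ZHom.exists_lead (n := 1) (by simpa using hs)
  obtain ⟨b, rfl⟩ := ZHom.exists_C (F := c) (by simpa using hc)
  exact ⟨lead s, b, by rw [smul_eq_C_mul, smul_eq_C_mul]; linear_combination e⟩

theorem exists_lin_eq_shift (hs : ZHom s 1) (ht : ZHom t 1) :
    ∃ g : GL4 k, ∀ F, lin g F = shift s t F := by
  obtain ⟨a, b, rfl⟩ := hs.eq_smul_X
  obtain ⟨a', b', rfl⟩ := ht.eq_smul_X
  obtain ⟨g, hg⟩ := exists_lin_eq_subst !![1, 0, a, b; 0, 1, a', b'; 0, 0, 1, 0; 0, 0, 0, 1]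
    (by simp [Matrix.det_succ_row_zero, Fin.sum_univ_succ])
  refine ⟨g, fun F => (hg F).trans ?_⟩
  suffices h : subst _ = shift _ _ from AlgHom.congr_fun h F
  refine algHom_ext fun i => ?_
  rw [subst_X, Fin.sum_univ_four]
  fin_cases i <;> simp [add_assoc]

theorem exists_comap_shift_eq (hs : ZHom s 1) (ht : ZHom t 1) :
    ∃ g : GL4 k, ∀ I : Ideal (Coord k), I.comap (shift s t) = linIdeal g I := by
  obtain ⟨g, hg⟩ := exists_lin_eq_shift hs ht
  refine ⟨g⁻¹, fun I => ?_⟩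
  ext F
  rw [mem_linIdeal, inv_inv, hg, Ideal.mem_comap]

theorem shift_mem_germSpace {d n : ℕ} (hdn : d ≤ n) (hs : ZHom s 1) {F : Coord k}
    (hF : F ∈ germSpace k d n) : shift s t F ∈ germSpace k d n := by
  have h : germSpace k d n ≤ (germSpace k d n).comap (shift s t).toLinearMap := by
    refine germSpace_le.2 ⟨fun G => ?_, fun i hi => ?_⟩
    · simpa using X3_mul_mem_germSpace _
    · obtain ⟨a, b, rfl⟩ := hs.eq_smul_X
      obtain ⟨G, hG⟩ := sub_dvd_pow_sub_pow ((X 0 : Coord k) + emb (a • X 0 + b • X 1))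
        (X 0 + a • X 2) i
      have e : (X 0 : Coord k) + emb (a • X 0 + b • X 1) - (X 0 + a • X 2) = X 3 * C b := by
        rw [map_add, map_smul, map_smul, emb_X0, emb_X1]
        simp only [smul_eq_C_mul]
        ring
      rw [e, sub_eq_iff_eq_add] at hG
      rw [Submodule.mem_comap]
      simp only [AlgHom.toLinearMap_apply, map_mul, map_pow, shift_X0, shift_X2]
      rw [hG, mul_add]
      refine Submodule.add_mem _ ?_ ?_
      · rw [show (X 2 : Coord k) ^ (n - i) * (X 3 * C b * G) = X 3 * (X 2 ^ (n - i) * (C b * G)) by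
          ring]
        exact X3_mul_mem_germSpace _
      · rw [add_pow, Finset.mul_sum]
        refine Submodule.sum_mem _ fun j hj => ?_
        rw [Finset.mem_range] at hj
        have e2 : (X 2 : Coord k) ^ (n - i) * (X 0 ^ j * (a • X 2) ^ (i - j) * (i.choose j : Coord k)) =
            (a ^ (i - j) * i.choose j) • (X 2 ^ (n - j) * X 0 ^ j) := by
          rw [smul_eq_C_mul, smul_eq_C_mul, mul_pow, C_mul, C_pow,
            show n - j = (n - i) + (i - j) by omega, pow_add]
          simp only [map_natCast]
          ring
        rw [e2]
        exact Submodule.smul_mem _ _ (monomial_mem_germSpace (by omega))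
  exact h hF

theorem IsTransverse.comap_shift {I : Ideal (Coord k)} {d n : ℕ} (hdn : d ≤ n) (hs : ZHom s 1)
    (ht : ZHom t 1) (h : IsTransverse d n I) : IsTransverse d n (I.comap (shift s t)) := by
  intro F hF
  have hF' : ZHom (shift s t F) n := by
    obtain ⟨g, hg⟩ := exists_lin_eq_shift hs ht
    rw [← hg]
    exact hF.lin g
  obtain ⟨A, hA, B, hB, e⟩ := Submodule.mem_sup.1 (h _ hF')
  have hA' : A ∈ I := hA
  have h1 : shift (-s) (-t) A ∈ I.comap (shift s t) := by
    rw [Ideal.mem_comap, shift_shift_neg]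
    exact hA'
  have h2 : shift (-s) (-t) B ∈ germSpace k d n := shift_mem_germSpace hdn hs.neg hB
  have h3 : shift (-s) (-t) A + shift (-s) (-t) B = F := by rw [← map_add, e, shift_neg_shift]
  rw [← h3]
  exact Submodule.add_mem_sup (Submodule.restrictScalars_mem k _ _ |>.2 h1) h2

end Shift

/-- The support of a transverse multiple line is a graph over the `x₂, x₃`-plane. -/
theorem IsTransverse.exists_shift {I : Ideal (Coord k)} {d n : ℕ} (hdn : d ≤ n)
    (h : IsTransverse d n I) (hI : IsLineIdeal I.radical) : ∃ s t : LineRing k, ZHom s 1 ∧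
      ZHom t 1 ∧ (I.comap (shift s t)).radical = stdLine k := by
  obtain ⟨u, v, hu, hv, -, huv⟩ := hI
  let c : Coord k → Fin 4 → k := fun F j => coeff (Finsupp.single j 1) F
  have hform : ∀ F ∈ Forms k 1, F = c F 0 • X 0 + c F 1 • X 1 + emb (c F 2 • X 0 + c F 3 • X 1) := by
    intro F hF
    conv_lhs => rw [eq_sum_coeff_X hF, Fin.sum_univ_four]
    simp [c, add_assoc]
  -- The line does not meet the line `x₂ = x₃ = 0`, as `I` and `germSpace` together contain the
  -- powers of `x₀` and `x₁`, and `germSpace` vanishes for `x₂ = x₃ = 0`.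
  have hzero : ∀ x y : k, c u 0 * x + c u 1 * y = 0 → c v 0 * x + c v 1 * y = 0 →
      x = 0 ∧ y = 0 := by
    intro x y h1 h2
    let ev : Coord k →ₐ[k] k := aeval ![x, y, 0, 0]
    have hemb : ∀ a b : k, ev (emb (a • X 0 + b • X 1)) = 0 := fun a b => by simp [ev]
    have hrad : I.radical ≤ RingHom.ker ev := by
      rw [huv, Ideal.span_le]
      rintro F (rfl | rfl)
      · rw [SetLike.mem_coe, RingHom.mem_ker, hform _ hu, map_add, hemb]
        simpa [ev] using h1
      · rw [SetLike.mem_coe, RingHom.mem_ker, hform _ hv, map_add, hemb]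
        simpa [ev] using h2
    have hev : ∀ F, ZHom F n → ev F = 0 := by
      intro F hF
      obtain ⟨A, hA, B, hB, rfl⟩ := Submodule.mem_sup.1 (h F hF)
      have hle : germSpace k d n ≤ LinearMap.ker ev.toLinearMap := by
        refine germSpace_le.2 ⟨fun G => by simp [ev], fun i hi => ?_⟩
        rw [LinearMap.mem_ker, AlgHom.toLinearMap_apply]
        simp only [map_mul, map_pow]
        rw [show ev (X 2) = 0 by simp [ev], zero_pow (by omega), zero_mul]
      rw [map_add, show ev A = 0 from hrad (Ideal.le_radical hA), zero_add]
      exact hle hB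
    have hx := hev _ ((zHom_X 0).pow n (by ring))
    have hy := hev _ ((zHom_X 1).pow n (by ring))
    simp only [ev, map_pow, aeval_X, Matrix.cons_val_zero, Matrix.cons_val_one] at hx hy
    exact ⟨eq_zero_of_pow_eq_zero hx, eq_zero_of_pow_eq_zero hy⟩
  let Δ := c u 0 * c v 1 - c u 1 * c v 0
  have hΔ : Δ ≠ 0 := by
    intro h0
    have h1 := hzero (-(c u 1)) (c u 0) (by ring) (by linear_combination h0)
    have h2 := hzero (-(c v 1)) (c v 0) (by linear_combination -h0) (by ring)
    have h3 := hzero 1 0 (by rw [h1.2]; ring) (by rw [h2.2]; ring)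
    exact one_ne_zero h3.1
  -- Cramer's rule for the system `u = v = 0` in the unknowns `x₀` and `x₁`.
  let u' : LineRing k := c u 2 • X 0 + c u 3 • X 1
  let v' : LineRing k := c v 2 • X 0 + c v 3 • X 1
  have hlin : ∀ a b : k, ZHom (a • X 0 + b • X 1 : LineRing k) 1 := fun a b =>
    ((zHom_X 0).smul a).add ((zHom_X 1).smul b)
  let s : LineRing k := Δ⁻¹ • (c u 1 • v' - c v 1 • u')
  let t : LineRing k := Δ⁻¹ • (c v 0 • u' - c u 0 • v')
  have hs : ZHom s 1 := (((hlin _ _).smul _).sub ((hlin _ _).smul _)).smul _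
  have ht : ZHom t 1 := (((hlin _ _).smul _).sub ((hlin _ _).smul _)).smul _
  have hC1 : (C Δ : LineRing k) * C Δ⁻¹ = 1 := by rw [← C_mul, mul_inv_cancel₀ hΔ, C_1]
  have hCΔ : (C Δ : LineRing k) = C (c u 0) * C (c v 1) - C (c u 1) * C (c v 0) := by
    simp only [Δ, C_sub, C_mul]
  have es : C (c u 0) * s + C (c u 1) * t + u' = 0 := by
    simp only [s, t, smul_eq_C_mul]
    linear_combination u' * C Δ⁻¹ * hCΔ - u' * hC1
  have et : C (c v 0) * s + C (c v 1) * t + v' = 0 := by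
    simp only [s, t, smul_eq_C_mul]
    linear_combination v' * C Δ⁻¹ * hCΔ - v' * hC1
  have hu' : shift s t u = c u 0 • X 0 + c u 1 • X 1 := by
    have e1 : shift s t u = c u 0 • X 0 + c u 1 • X 1 + emb (C (c u 0) * s + C (c u 1) * t + u') := by
      conv_lhs => rw [hform u hu]
      have hC : ∀ c : k, emb (C c : LineRing k) = C c := fun c => by simp [emb]
      have hC2 : ∀ c : k, shift s t (C c) = C c := fun c => by simp [shift]
      simp only [map_add, map_mul, shift_X0, shift_X1, shift_emb, hC, hC2, u', smul_eq_C_mul]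
      ring
    rw [e1, es, map_zero, add_zero]
  have hv' : shift s t v = c v 0 • X 0 + c v 1 • X 1 := by
    have e1 : shift s t v = c v 0 • X 0 + c v 1 • X 1 + emb (C (c v 0) * s + C (c v 1) * t + v') := by
      conv_lhs => rw [hform v hv]
      have hC : ∀ c : k, emb (C c : LineRing k) = C c := fun c => by simp [emb]
      have hC2 : ∀ c : k, shift s t (C c) = C c := fun c => by simp [shift]
      simp only [map_add, map_mul, shift_X0, shift_X1, shift_emb, hC, hC2, v', smul_eq_C_mul]
      ring
    rw [e1, et, map_zero, add_zero]
  have hCΔ' : (C Δ : Coord k) = C (c u 0) * C (c v 1) - C (c u 1) * C (c v 0) := by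
    simp only [Δ, C_sub, C_mul]
  have hmem : ∀ F, shift s t F ∈ Ideal.span {shift s t u, shift s t v} → F ∈ I.radical := by
    intro F hF
    obtain ⟨a, b, e⟩ := Ideal.mem_span_pair.1 hF
    rw [huv]
    refine Ideal.mem_span_pair.2 ⟨shift (-s) (-t) a, shift (-s) (-t) b, ?_⟩
    have := congrArg (shift (-s) (-t)) e
    rwa [map_add, map_mul, map_mul, shift_neg_shift, shift_neg_shift, shift_neg_shift] at this
  have hCu : ∀ F, C Δ * F ∈ Ideal.span {shift s t u, shift s t v} →
      F ∈ Ideal.span {shift s t u, shift s t v} := fun F h =>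
    (Ideal.unit_mul_mem_iff_mem _ ((Ne.isUnit hΔ).map C)).1 h
  refine ⟨-s, -t, hs.neg, ht.neg, ?_⟩
  rw [← Ideal.comap_radical]
  refine le_antisymm (fun F hF => ?_) (Ideal.span_le.2 ?_)
  · rw [Ideal.mem_comap, huv] at hF
    obtain ⟨a, b, e⟩ := Ideal.mem_span_pair.1 hF
    have := congrArg (shift s t) e
    rw [shift_shift_neg, map_add, map_mul, map_mul, hu', hv'] at this
    rw [← this]
    refine add_mem (Ideal.mul_mem_left _ _ ?_) (Ideal.mul_mem_left _ _ ?_) <;>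
      exact add_mem (Submodule.smul_of_tower_mem _ _ X0_mem)
        (Submodule.smul_of_tower_mem _ _ X1_mem)
  · rintro F (rfl | rfl)
    · refine hmem _ ?_
      rw [shift_shift_neg]
      refine hCu _ (Ideal.mem_span_pair.2 ⟨C (c v 1), -C (c u 1), ?_⟩)
      rw [hu', hv', hCΔ']
      simp only [smul_eq_C_mul]
      ring
    · refine hmem _ ?_
      rw [shift_shift_neg]
      refine hCu _ (Ideal.mem_span_pair.2 ⟨-C (c v 0), C (c u 0), ?_⟩)
      rw [hu', hv', hCΔ']
      simp only [smul_eq_C_mul]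
      ring

/-- The ideal of a transverse multiple structure contains an equation with leading term
`x₂ⁿ⁻¹ x₁`. -/
theorem IsTransverse.exists_linear {I : Ideal (Coord k)} (hI : IsStdMultiple I) {d n : ℕ}
    (hdn : d ≤ n) (hn : 1 ≤ n) (h : IsTransverse d n I) : ∃ F ∈ I, ZHom F n ∧
      ∃ A : ℕ → LineRing k, F - polyForm 1 A ∈ stdLine k ^ 2 ∧ lead (A 1) = 1 := by
  have hF₀ : ZHom ((X 2 : Coord k) ^ (n - 1) * X 1) n :=
    ((zHom_X 2).pow _ rfl).mul (zHom_X 1) (by push_cast [hn]; ring)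
  obtain ⟨F, hF, B, hB, e⟩ := Submodule.mem_sup.1 (h _ hF₀)
  have hF' : F ∈ I := hF
  have e' : zcomp n F + zcomp n B = X 2 ^ (n - 1) * X 1 := by
    rw [← map_add, e, hF₀.zcomp_eq]
  have h1 : zcomp n F ∈ stdLine k ^ 1 := by
    rw [pow_one]
    exact hI.le (hI.zcomp_mem F hF' n)
  obtain ⟨A, hA⟩ := exists_polyForm h1
  refine ⟨zcomp n F, hI.zcomp_mem F hF' n, zHom_zcomp _ _, A, hA, ?_⟩
  -- The functional `L` reads off the coefficient of `x₂ⁿ⁻¹ x₁`, and vanishes on `germSpace`.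
  let κ : Coord k →ₐ[k] Polynomial (LineRing k) := arcHom (AlgHom.id k _) 0 Polynomial.X
  let L : Coord k →ₗ[k] k := lead.toLinearMap ∘ₗ
    (Polynomial.lcoeff (LineRing k) 1).restrictScalars k ∘ₗ κ.toLinearMap
  have hL : ∀ F, L F = lead ((κ F).coeff 1) := fun F => rfl
  have h2 : L (zcomp n F) = lead (A 1) := by
    have := coeff_arcHom_of_sub_mem (φ := AlgHom.id k (LineRing k)) (x := 0) (y := Polynomial.X)
      (x' := 0) (y' := 1) (mul_zero _).symm (mul_one _).symm hA
    rw [hL]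
    change lead (((arcHom _ _ _) _).coeff 1) = _
    rw [this]
    simp [Finset.sum_range_succ]
  have hX2 : κ (X 2) = Polynomial.C (X 0) := by
    rw [← emb_X0]
    exact arcHom_emb _ _ _ _
  have hX3 : κ (X 3) = Polynomial.C (X 1) := by
    rw [← emb_X1]
    exact arcHom_emb _ _ _ _
  have hX0 : κ (X 0) = 0 := arcHom_X0 _ _ _
  have hX1 : κ (X 1) = Polynomial.X := arcHom_X1 _ _ _
  have h3 : L (zcomp n B) = 0 := by
    have : germSpace k d n ≤ LinearMap.ker L := by
      refine germSpace_le.2 ⟨fun G => ?_, fun i hi => ?_⟩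
      · rw [LinearMap.mem_ker, hL, map_mul, hX3, Polynomial.coeff_C_mul]
        simp
      · rw [LinearMap.mem_ker, hL, map_mul, map_pow, map_pow, hX2, hX0, ← Polynomial.C_pow,
          Polynomial.coeff_C_mul]
        rcases Nat.eq_zero_or_pos i with rfl | hi
        · simp [Polynomial.coeff_one]
        · simp [zero_pow hi.ne']
    exact this (zcomp_mem_germSpace hdn hB)
  rw [← h2, ← add_zero (L _), ← h3, ← map_add, e', hL, map_mul, map_pow, hX2, hX1,
    ← Polynomial.C_pow, Polynomial.coeff_C_mul]
  simp

/-- For a transverse multiple line the forms `f` and `p` do not vanish at `x₃ = 0`: the linear part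
of an equation is a multiple of `p (g x₀ - f x₁)`. -/
theorem Jet.Data₃.lead_ne {J : Jet k} (D : J.Data₃) {d n : ℕ} (hd : 3 ≤ d) (hdn : d ≤ n)
    (h : IsTransverse d n (J.ideal d)) : lead D.f ≠ 0 ∧ lead D.p ≠ 0 := by
  obtain ⟨F, hF, hFn, A, hA, hl⟩ := h.exists_linear (J.isStdMultiple (by omega)) hdn (by omega)
  obtain ⟨γ, -, a, -, C, -, hFC⟩ := D.exists_third_order (J.ideal_antitone hd hF) hFn
  have h1 : polyForm 1 (fun i => A i - γ * (if i = 0 then D.p * D.g else -(D.p * D.f))) ∈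
      stdLine k ^ (1 + 1) := by
    have h2 : polyForm 1 a * D.q ∈ stdLine k ^ 2 := by
      have := Ideal.mul_mem_mul (polyForm_mem 1 a) (quadric_mem D.f D.g)
      rwa [← pow_succ] at this
    have h3 : polyForm 3 C ∈ stdLine k ^ 2 := Ideal.pow_le_pow_right (by omega) (polyForm_mem 3 C)
    have h4 := Ideal.pow_le_pow_right (show 2 ≤ 4 by omega) hFC
    have h5 := Ideal.mul_mem_left _ (emb γ) D.v_sub_mem
    convert sub_mem (add_mem (add_mem (add_mem h4 h3) h2) h5) hA using 1
    simp only [polyForm, Finset.sum_range_succ, Finset.sum_range_zero]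
    simp
    ring
  have h2 := polyForm_eq_zero h1 1 le_rfl
  simp only [one_ne_zero, if_false] at h2
  have h3 := congrArg lead h2
  rw [map_sub, hl, map_mul, map_neg, map_mul, map_zero] at h3
  constructor <;> intro h0 <;> rw [h0] at h3 <;> simp at h3

end Transversality


/-! ### The parameter space -/

section Parameters

open MvPolynomial

variable {k : Type*} [Field k]

/-- The degrees of the binary forms on which a normalized multiple line depends: two for the line,
then those describing `f, g`, `p`, `u` and, for multiplicity four, `e`. -/
def paramDegree (a b d : ℕ) : Fin 9 → ℤ :=
  ![1, 1, a, a + 1, b - 1, a + b, a, a, if d = 4 then 4 * a + 2 + 2 * b else -1]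

/-- The affine space parametrizing the normalized multiple lines of multiplicity `d` with
`deg f = a + 1` and `deg p = b`. -/
def Param (k : Type*) [Field k] (a b d : ℕ) : Type _ := ∀ i, binForms k (paramDegree a b d i)

namespace Param

variable {a b d : ℕ}

instance : AddCommGroup (Param k a b d) :=
  inferInstanceAs (AddCommGroup (∀ i, binForms k (paramDegree a b d i)))

instance : Module k (Param k a b d) :=
  inferInstanceAs (Module k (∀ i, binForms k (paramDegree a b d i)))

instance : Module.Finite k (Param k a b d) :=
  inferInstanceAs (Module.Finite k (∀ i, binForms k (paramDegree a b d i)))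

instance : TopologicalSpace (Param k a b d) := zariskiTopology k _

instance : IsZariski k (Param k a b d) := ⟨rfl⟩

theorem finrank (k : Type*) [Field k] (a b d : ℕ) :
    Module.finrank k (Param k a b d) =
      5 * a + 10 + 2 * b + (if d = 4 then 4 * a + 3 + 2 * b else 0) := by
  have h : Module.finrank k (Param k a b d) =
      ∑ i, Module.finrank k (binForms k (paramDegree a b d i)) :=
    Module.finrank_pi_fintype (R := k) (M := fun i => binForms k (paramDegree a b d i))
  rw [h]
  rw [Finset.sum_congr rfl fun i _ => finrank_binForms (k := k) (paramDegree a b d i)]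
  simp only [Fin.sum_univ_succ, paramDegree, Fin.sum_univ_zero]
  simp
  split_ifs <;> omega

/-- The parameters are linear coordinates with values in binary forms. -/
def coord (i : Fin 9) : Param k a b d →ₗ[k] LineRing k :=
  (binForms k (paramDegree a b d i)).subtype ∘ₗ
    LinearMap.proj (φ := fun i => binForms k (paramDegree a b d i)) i

theorem zHom_coord (i : Fin 9) (θ : Param k a b d) : ZHom (coord i θ) (paramDegree a b d i) :=
  (θ i).2

theorem ext {θ θ' : Param k a b d} (h : ∀ i, coord i θ = coord i θ') : θ = θ' :=
  funext fun i => Subtype.ext (h i)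

/-- The point with given coordinates. -/
def mk (c : Fin 9 → LineRing k) (hc : ∀ i, ZHom (c i) (paramDegree a b d i)) : Param k a b d :=
  fun i => ⟨c i, hc i⟩

variable (θ : Param k a b d)

/-- The first equation `x₀ = s` of the line. -/
def s : LineRing k := coord 0 θ

/-- The second equation `x₁ = t` of the line. -/
def t : LineRing k := coord 1 θ

/-- The first component of the tangent direction `(f, g)`; its leading coefficient is one. -/
def f : LineRing k := X 0 ^ (a + 1) + X 1 * coord 2 θ

/-- The second component of the tangent direction `(f, g)`. -/
def g : LineRing k := coord 3 θ

/-- The denominator of the second order term, with leading coefficient one. -/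
def p : LineRing k := X 0 ^ b + X 1 * coord 4 θ

/-- The quadratic form describing the second order term. -/
def u : ℕ → LineRing k := fun i =>
  if i = 0 then coord 5 θ else if i = 1 then X 1 ^ b * coord 6 θ else X 1 ^ b * coord 7 θ

/-- The third order term. -/
def e : LineRing k := coord 8 θ

/-- The value of the quadratic form `u` at the tangent direction. -/
def r : LineRing k := evalForm 2 θ.u θ.f θ.g

theorem zHom_s : ZHom θ.s 1 := zHom_coord 0 θ

theorem zHom_t : ZHom θ.t 1 := zHom_coord 1 θ

theorem zHom_f : ZHom θ.f ((a + 1 : ℕ) : ℤ) :=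
  ((zHom_X 0).pow _ (by ring)).add ((zHom_X 1).mul (zHom_coord 2 θ) (by
    simp [paramDegree]; ring))

theorem zHom_g : ZHom θ.g ((a + 1 : ℕ) : ℤ) := by
  simpa [paramDegree, g] using zHom_coord 3 θ

theorem zHom_p : ZHom θ.p b :=
  ((zHom_X 0).pow _ (by ring)).add ((zHom_X 1).mul (zHom_coord 4 θ) (by simp [paramDegree]))

theorem zHom_u (i : ℕ) : ZHom (θ.u i) (((a + 1 : ℕ) : ℤ) - 1 + b) := by
  unfold u
  split_ifs
  · simpa [paramDegree] using zHom_coord 5 θ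
  · exact ((zHom_X 1).pow b rfl).mul (zHom_coord 6 θ) (by simp [paramDegree]; ring)
  · exact ((zHom_X 1).pow b rfl).mul (zHom_coord 7 θ) (by simp [paramDegree]; ring)

theorem zHom_e : ZHom θ.e (4 * ((a + 1 : ℕ) : ℤ) - 2 + 2 * b) := by
  have h := zHom_coord 8 θ
  have h8 : paramDegree a b d 8 =
      if d = 4 then 4 * (a : ℤ) + 2 + 2 * b else -1 := rfl
  rw [h8] at h
  split_ifs at h
  · rwa [show 4 * ((a + 1 : ℕ) : ℤ) - 2 + 2 * b = 4 * a + 2 + 2 * b by push_cast; ring]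
  · have h0 := h.eq_zero (by omega)
    rw [e, h0]
    exact zHom_zero _

theorem zHom_r : ZHom θ.r (3 * ((a + 1 : ℕ) : ℤ) - 1 + b) :=
  zHom_evalForm θ.zHom_u θ.zHom_f θ.zHom_g (by push_cast; ring)

theorem lead_f : lead θ.f = 1 := by simp [f]

theorem lead_p : lead θ.p = 1 := by simp [p]

theorem f_ne : θ.f ≠ 0 := ne_zero_of_lead (by simp [lead_f])

theorem p_ne : θ.p ≠ 0 := ne_zero_of_lead (by simp [lead_p])

/-- The coefficient of order two of the second coordinate of the jet, chosen such that the
equation `f³ p v - e x₀³` holds to third order. -/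
def E₂ : LineRing k :=
  θ.p * θ.f * (θ.r * (θ.u 1 * θ.f + 2 * θ.u 2 * θ.g) - θ.e * θ.f)

/-- The jet with the given parameters, before translation. The parameter `t` of the jet is scaled
such that all coefficients are polynomials; this makes the multipliers `p f`, `p f²` and `p² f³`. -/
def jet : Jet k where
  D := θ.p * θ.f ^ 2
  E := Polynomial.C (θ.g * θ.p * θ.f) - Polynomial.C (θ.r * θ.p * θ.f) * Polynomial.X +
    Polynomial.C θ.E₂ * Polynomial.X ^ 2
  τ := b + 2 * a + 1
  zHom_D := θ.zHom_p.mul (θ.zHom_f.pow 2 rfl) (by push_cast; ring)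
  D_ne := mul_ne_zero θ.p_ne (pow_ne_zero 2 θ.f_ne)
  zHom_E i := by
    have h : ∀ i, (Polynomial.C (θ.g * θ.p * θ.f) -
        Polynomial.C (θ.r * θ.p * θ.f) * Polynomial.X +
        Polynomial.C θ.E₂ * Polynomial.X ^ 2).coeff i =
        if i = 0 then θ.g * θ.p * θ.f else if i = 1 then -(θ.r * θ.p * θ.f) else
          if i = 2 then θ.E₂ else 0 := by
      intro i
      simp only [Polynomial.coeff_add, Polynomial.coeff_sub, Polynomial.coeff_C_mul,
        Polynomial.coeff_X_pow, Polynomial.coeff_X, Polynomial.coeff_C]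
      rcases i with - | - | - | i <;> simp
    rw [h]
    split_ifs with h0 h1 h2
    · exact (θ.zHom_g.mul θ.zHom_p rfl).mul θ.zHom_f (by rw [h0]; push_cast; ring)
    · exact ((θ.zHom_r.mul θ.zHom_p rfl).mul θ.zHom_f (by rw [h1]; push_cast; ring)).neg
    · refine (θ.zHom_p.mul θ.zHom_f rfl).mul
        (n := 4 * a + 4 - 2 + 2 * b + a + 1)
        (ZHom.sub (θ.zHom_r.mul (((θ.zHom_u 1).mul θ.zHom_f rfl).add ?_) ?_)
          (θ.zHom_e.mul θ.zHom_f ?_)) ?_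
      · rw [mul_assoc, two_mul]
        have := (θ.zHom_u 2).mul θ.zHom_g rfl
        exact this.add this
      · push_cast; ring
      · push_cast; ring
      · rw [h2]; push_cast; ring
    · exact zHom_zero _

theorem coeff_jet_E (i : ℕ) : θ.jet.E.coeff i =
    if i = 0 then θ.g * θ.p * θ.f else if i = 1 then -(θ.r * θ.p * θ.f) else
      if i = 2 then θ.E₂ else 0 := by
  simp only [jet, Polynomial.coeff_add, Polynomial.coeff_sub, Polynomial.coeff_C_mul,
    Polynomial.coeff_X_pow, Polynomial.coeff_X, Polynomial.coeff_C]
  rcases i with - | - | - | i <;> simp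

theorem coeff_three_v : (θ.jet.hom (emb θ.p * quadric θ.f θ.g - polyForm 2 θ.u)).coeff 3 =
    θ.p ^ 2 * θ.f ^ 3 * θ.e := by
  have hr : Polynomial.C θ.r = Polynomial.C (θ.u 0) * Polynomial.C θ.f ^ 2 +
      Polynomial.C (θ.u 1) * Polynomial.C θ.f * Polynomial.C θ.g +
      Polynomial.C (θ.u 2) * Polynomial.C θ.g ^ 2 := by
    rw [r, evalForm_two]
    simp only [map_add, map_mul, map_pow]
  have hE₂ : Polynomial.C θ.E₂ = Polynomial.C θ.p * Polynomial.C θ.f * (Polynomial.C θ.r *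
      (Polynomial.C (θ.u 1) * Polynomial.C θ.f + 2 * Polynomial.C (θ.u 2) * Polynomial.C θ.g) -
      Polynomial.C θ.e * Polynomial.C θ.f) := by
    simp only [E₂, map_add, map_sub, map_mul, Polynomial.C_ofNat]
  let e₀ : LineRing k := θ.g * θ.p * θ.f
  let e₁ : LineRing k := θ.r * θ.p * θ.f
  let R : Polynomial (LineRing k) := -(Polynomial.C (θ.u 1 * θ.jet.D) * Polynomial.C θ.E₂ +
    Polynomial.C (θ.u 2) * (Polynomial.C e₁ ^ 2 + 2 * Polynomial.C e₀ * Polynomial.C θ.E₂ -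
      2 * Polynomial.C e₁ * Polynomial.C θ.E₂ * Polynomial.X +
      Polynomial.C θ.E₂ ^ 2 * Polynomial.X ^ 2))
  have key : θ.jet.hom (emb θ.p * quadric θ.f θ.g - polyForm 2 θ.u) =
      Polynomial.C (θ.p ^ 2 * θ.f ^ 3 * θ.e) * Polynomial.X ^ 3 + Polynomial.X ^ 4 * R := by
    simp only [quadric, polyForm, Finset.sum_range_succ, Finset.sum_range_zero, map_zero, map_add, map_sub,
      map_mul, map_pow, Jet.hom_emb, Jet.hom_X0, Jet.hom_X1, jet, R, e₀, e₁]
    simp only [zero_add, Nat.sub_zero, pow_zero, mul_one, Nat.sub_self, pow_one, Nat.reduceSub]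
    linear_combination (Polynomial.C θ.p ^ 2 * Polynomial.C θ.f ^ 2 * Polynomial.X ^ 2) * hr -
      Polynomial.X ^ 3 * Polynomial.C θ.p * Polynomial.C θ.f * hE₂
  rw [key]
  rw [Polynomial.coeff_add, Polynomial.coeff_C_mul_X_pow, if_pos rfl, Polynomial.coeff_X_pow_mul',
    if_neg (by omega), add_zero]

/-- The parameters for which the numerical data of the jet are as expected. -/
def IsReduced : Prop := IsRelPrime θ.f θ.g ∧ IsRelPrime θ.p θ.r

/-- The data of the jet. -/
def data {θ : Param k a b d} (h : θ.IsReduced) : θ.jet.Data₃ where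
  α := a + 1
  b := b
  f := θ.f
  g := θ.g
  m₁ := θ.p * θ.f
  m₂ := θ.p * θ.f ^ 2
  p := θ.p
  r := θ.r
  zHom_f := θ.zHom_f
  zHom_g := θ.zHom_g
  zHom_p := θ.zHom_p
  zHom_r := θ.zHom_r
  f_ne := θ.f_ne
  D_eq := by simp only [jet]; ring
  E_zero_eq := by rw [coeff_jet_E, if_pos rfl]; ring
  E_one_eq := by rw [coeff_jet_E, if_neg one_ne_zero, if_pos rfl]; ring
  sq_eq := by ring
  isRelPrime_fg := h.1
  isRelPrime_pr := h.2
  u := θ.u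
  σ := 0
  s := 1
  e := θ.e
  m₃ := θ.p ^ 2 * θ.f ^ 3
  zHom_u := θ.zHom_u
  evalForm_u := rfl
  zHom_s := zHom_one
  zHom_e := by simpa using θ.zHom_e
  mul_eq := by ring
  v_eq := θ.coeff_three_v
  isRelPrime_se := isRelPrime_one_left

end Param

end Parameters


/-! ### The family of curves over the parameter space -/

section Family

open MvPolynomial

variable {k : Type*} [Field k]

section Regular

variable {T : Type*} {𝒜 : Subalgebra k (T → k)}

theorem vreg_aeval {σ A : Type*} [CommRing A] [Algebra k A] {x : T → σ → A}
    (hx : ∀ i, (fun t => x t i) ∈ vreg 𝒜 A) {F : T → MvPolynomial σ k}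
    (hF : F ∈ vreg 𝒜 (MvPolynomial σ k)) : (fun t => aeval (x t) (F t)) ∈ vreg 𝒜 A := by
  have key : ∀ B : MvPolynomial σ k, (fun t => aeval (x t) B) ∈ vreg 𝒜 A := by
    intro B
    induction B using MvPolynomial.induction_on with
    | C c => simpa using vreg_const (𝒜 := 𝒜) (algebraMap k A c)
    | add F G h1 h2 =>
      simp only [map_add]
      exact (vreg 𝒜 _).add_mem h1 h2
    | mul_X F i h =>
      simp only [map_mul, aeval_X]
      exact vreg_mul h (hx i)
  induction hF using Submodule.span_induction with
  | mem F hF =>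
    obtain ⟨h, hh, B, rfl⟩ := hF
    simp only [map_smul]
    exact vreg_smul hh (key B)
  | zero =>
    simp only [Pi.zero_apply, map_zero]
    exact (vreg 𝒜 A).zero_mem
  | add F G _ _ h1 h2 =>
    simp only [Pi.add_apply, map_add]
    exact (vreg 𝒜 A).add_mem h1 h2
  | smul c F _ h1 =>
    simp only [Pi.smul_apply, map_smul]
    exact (vreg 𝒜 A).smul_mem c h1

theorem vreg_add {V : Type*} [AddCommGroup V] [Module k V] {F G : T → V} (hF : F ∈ vreg 𝒜 V)
    (hG : G ∈ vreg 𝒜 V) : (fun t => F t + G t) ∈ vreg 𝒜 V := (vreg 𝒜 V).add_mem hF hG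

theorem vreg_sub {V : Type*} [AddCommGroup V] [Module k V] {F G : T → V} (hF : F ∈ vreg 𝒜 V)
    (hG : G ∈ vreg 𝒜 V) : (fun t => F t - G t) ∈ vreg 𝒜 V := (vreg 𝒜 V).sub_mem hF hG

theorem vreg_pow {A : Type*} [CommRing A] [Algebra k A] {F : T → A} (hF : F ∈ vreg 𝒜 A) (n : ℕ) :
    (fun t => F t ^ n) ∈ vreg 𝒜 A := (vregAlg 𝒜 A).pow_mem hF n

theorem vreg_emb {c : T → LineRing k} (hc : c ∈ vreg 𝒜 (LineRing k)) :
    (fun t => emb (c t)) ∈ vreg 𝒜 (Coord k) := vreg_linear emb.toLinearMap hc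

theorem vreg_C {c : T → LineRing k} (hc : c ∈ vreg 𝒜 (LineRing k)) :
    (fun t => Polynomial.C (c t)) ∈ vreg 𝒜 (Polynomial (LineRing k)) :=
  vreg_linear (Polynomial.CAlgHom (R := k) (A := LineRing k)).toLinearMap hc

theorem vreg_shift {s t : T → LineRing k} (hs : s ∈ vreg 𝒜 (LineRing k))
    (ht : t ∈ vreg 𝒜 (LineRing k)) {F : T → Coord k} (hF : F ∈ vreg 𝒜 (Coord k)) :
    (fun x => shift (s x) (t x) (F x)) ∈ vreg 𝒜 (Coord k) := by
  refine vreg_aeval (fun i => ?_) hF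
  fin_cases i
  · exact vreg_add (vreg_const (X 0)) (vreg_emb hs)
  · exact vreg_add (vreg_const (X 1)) (vreg_emb ht)
  · exact vreg_const (X 2)
  · exact vreg_const (X 3)

end Regular

/-- Coprimality of binary forms is a rank condition. -/
theorem isRelPrime_iff_injective {F G : LineRing k} {i j : ℤ} (hF : ZHom F i) (hG : ZHom G j)
    (hF0 : F ≠ 0) : IsRelPrime F G ↔ Function.Injective
      ((LinearMap.mulRight k F ∘ₗ (binForms k (j - 1)).subtype).coprod
        (LinearMap.mulRight k G ∘ₗ (binForms k (i - 1)).subtype)) := by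
  rw [← LinearMap.ker_eq_bot, eq_bot_iff]
  constructor
  · rintro h ⟨⟨A, hA⟩, ⟨B, hB⟩⟩ hAB
    have e : A * F + B * G = 0 := hAB
    have h1 : F ∣ B := h.dvd_of_dvd_mul_right ⟨-A, by linear_combination e⟩
    obtain ⟨c, hc, h2⟩ := zHom_of_dvd_rel hB hF hF0 h1
    have hB0 : B = 0 := by rw [h2, hc.eq_zero (by omega), mul_zero]
    subst hB0
    rw [zero_mul, add_zero, mul_eq_zero, or_iff_left hF0] at e
    subst e
    rfl
  · intro h d hdF hdG
    obtain ⟨F', rfl⟩ := hdF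
    obtain ⟨G', rfl⟩ := hdG
    have hd0 := left_ne_zero_of_mul hF0
    obtain ⟨l, h1, h2⟩ := hF.of_mul hF0
    have h3 := hG.of_mul_left h1 hd0
    by_cases hl : l = 0
    · subst hl
      exact h1.isUnit hd0
    obtain ⟨m, hm⟩ := Int.eq_ofNat_of_zero_le (h1.degree_nonneg hd0)
    have hm1 : 1 ≤ m := by omega
    have hX : ZHom (X 0 ^ (m - 1) : LineRing k) (m - 1) := (zHom_X 0).pow _ (by
      push_cast [hm1]
      ring)
    have h4 := h (x := (⟨X 0 ^ (m - 1) * G', hX.mul h3 (by rw [hm]; ring)⟩,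
      ⟨-(X 0 ^ (m - 1) * F'), (hX.mul h2 (by rw [hm]; ring)).neg⟩)) (by
        change X 0 ^ (m - 1) * G' * (d * F') + -(X 0 ^ (m - 1) * F') * (d * G') = 0
        ring)
    have h5 : -(X 0 ^ (m - 1) * F') = 0 := congrArg (fun x => x.2.1) h4
    rw [neg_eq_zero, mul_eq_zero, or_iff_right (pow_ne_zero _ (X_ne_zero 0))] at h5
    exact absurd h5 (right_ne_zero_of_mul hF0)

namespace Param

variable {a b d : ℕ}

section Regular

variable {T : Type*} {𝒜 : Subalgebra k (T → k)} {θ : T → Param k a b d}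
  (hθ : ∀ i, (fun x => coord i (θ x)) ∈ vreg 𝒜 (LineRing k))

include hθ

theorem vreg_s : (fun x => (θ x).s) ∈ vreg 𝒜 (LineRing k) := hθ 0

theorem vreg_t : (fun x => (θ x).t) ∈ vreg 𝒜 (LineRing k) := hθ 1

theorem vreg_f : (fun x => (θ x).f) ∈ vreg 𝒜 (LineRing k) :=
  vreg_add (vreg_const _) (vreg_mul (vreg_const _) (hθ 2))

theorem vreg_g : (fun x => (θ x).g) ∈ vreg 𝒜 (LineRing k) := hθ 3

theorem vreg_p : (fun x => (θ x).p) ∈ vreg 𝒜 (LineRing k) :=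
  vreg_add (vreg_const _) (vreg_mul (vreg_const _) (hθ 4))

theorem vreg_u (i : ℕ) : (fun x => (θ x).u i) ∈ vreg 𝒜 (LineRing k) := by
  unfold u
  split_ifs
  · exact hθ 5
  · exact vreg_mul (vreg_const _) (hθ 6)
  · exact vreg_mul (vreg_const _) (hθ 7)

theorem vreg_e : (fun x => (θ x).e) ∈ vreg 𝒜 (LineRing k) := hθ 8

theorem vreg_r : (fun x => (θ x).r) ∈ vreg 𝒜 (LineRing k) := by
  have h0 := vreg_mul (vreg_u hθ 0) (vreg_mul (vreg_f hθ) (vreg_f hθ))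
  have h1 := vreg_mul (vreg_mul (vreg_u hθ 1) (vreg_f hθ)) (vreg_g hθ)
  have h2 := vreg_mul (vreg_u hθ 2) (vreg_mul (vreg_g hθ) (vreg_g hθ))
  simp only [r, evalForm_two, pow_two]
  exact vreg_add (vreg_add h0 h1) h2

theorem vreg_E₂ : (fun x => (θ x).E₂) ∈ vreg 𝒜 (LineRing k) :=
  vreg_mul (vreg_mul (vreg_p hθ) (vreg_f hθ)) (vreg_sub (vreg_mul (vreg_r hθ)
    (vreg_add (vreg_mul (vreg_u hθ 1) (vreg_f hθ))
      (vreg_mul (vreg_mul (vreg_const 2) (vreg_u hθ 2)) (vreg_g hθ))))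
    (vreg_mul (vreg_e hθ) (vreg_f hθ)))

theorem vreg_jet_hom {F : T → Coord k} (hF : F ∈ vreg 𝒜 (Coord k)) :
    (fun x => (θ x).jet.hom (F x)) ∈ vreg 𝒜 (Polynomial (LineRing k)) := by
  have hf := vreg_f hθ
  have hg := vreg_g hθ
  have hp := vreg_p hθ
  have hr := vreg_r hθ
  have h0 := vreg_mul hf hf
  have h1 := vreg_mul hp h0
  have hD := vreg_C h1
  have h2 := vreg_mul (vreg_mul hg hp) hf
  have h3 := vreg_mul (vreg_mul hr hp) hf
  have h4 := vreg_C h2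
  have h5 := vreg_C h3
  have h6 := vreg_C (vreg_E₂ hθ)
  have c1 := vreg_const (𝒜 := 𝒜) (Polynomial.X : Polynomial (LineRing k))
  have c2 := vreg_const (𝒜 := 𝒜) (Polynomial.X ^ 2 : Polynomial (LineRing k))
  have h7 := vreg_add (vreg_sub h4 (vreg_mul h5 c1)) (vreg_mul h6 c2)
  have hX : ∀ i, (fun x => (θ x).jet.hom (X i)) ∈ vreg 𝒜 (Polynomial (LineRing k)) := by
    intro i
    fin_cases i
    · simp only [Fin.zero_eta, Jet.hom_X0, jet, pow_two]
      exact vreg_mul c1 hD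
    · simp only [Fin.mk_one, Jet.hom_X1, jet]
      exact vreg_mul c1 h7
    · simpa [Jet.hom, arcHom] using vreg_const (𝒜 := 𝒜) (Polynomial.C (X 0 : LineRing k))
    · simpa [Jet.hom, arcHom] using vreg_const (𝒜 := 𝒜) (Polynomial.C (X 1 : LineRing k))
  have h := vreg_aeval hX hF
  have e : ∀ x, (θ x).jet.hom = aeval fun i => (θ x).jet.hom (X i) := fun x =>
    MvPolynomial.algHom_ext fun i => by rw [aeval_X]
  simp only [fun x => DFunLike.congr_fun (e x) (F x)]
  exact h

end Regular

theorem vreg_coord_subtype (Θ : Set (Param k a b d)) (i : Fin 9) :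
    (fun θ : Θ => coord i θ.1) ∈
      vreg (coordAlg k (Subtype.val : Θ → Param k a b d)) (LineRing k) :=
  vreg_linear (coord i) (vreg_coord (k := k) _)

theorem isOpen_coordAlg_subtype (Θ : Set (Param k a b d)) :
    ∀ P ∈ coordAlg k (Subtype.val : Θ → Param k a b d), IsOpen {t | P t ≠ 0} :=
  isOpen_coordAlg continuous_subtype_val

theorem isOpen_isReduced : IsOpen {θ : Param k a b d | θ.IsReduced} := by
  have h𝒜 : ∀ P ∈ coordAlg k (id : Param k a b d → Param k a b d), IsOpen {t | P t ≠ 0} :=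
    isOpen_coordAlg continuous_id
  have hθ : ∀ i, (fun θ : Param k a b d => coord i θ) ∈
      vreg (coordAlg k (id : Param k a b d → Param k a b d)) (LineRing k) := fun i =>
    vreg_linear (coord i) (vreg_coord (k := k) id)
  have h1 : IsOpen {θ : Param k a b d | IsRelPrime θ.f θ.g} := by
    simp only [isRelPrime_iff_injective (zHom_f _) (zHom_g _) (f_ne _)]
    exact isOpen_injective h𝒜 fun x =>
      vreg_add (vreg_mul (vreg_const x.1.1) (vreg_f hθ)) (vreg_mul (vreg_const x.2.1) (vreg_g hθ))
  have h2 : IsOpen {θ : Param k a b d | IsRelPrime θ.p θ.r} := by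
    simp only [isRelPrime_iff_injective (zHom_p _) (zHom_r _) (p_ne _)]
    exact isOpen_injective h𝒜 fun x =>
      vreg_add (vreg_mul (vreg_const x.1.1) (vreg_p hθ)) (vreg_mul (vreg_const x.2.1) (vreg_r hθ))
  exact h1.inter h2

/-- The tangent direction is independent modulo `p`. -/
def Indep (θ : Param k a b d) : Prop := ∀ A : ℕ → LineRing k, (∀ i, ZHom (A i) 0) →
  θ.p ∣ evalForm 1 A θ.f θ.g → A 0 = 0 ∧ A 1 = 0

/-- Independence modulo `p` is injectivity of the map `(a₀, a₁, c) ↦ a₀ f + a₁ g + c p`. -/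
theorem isOpen_indep : IsOpen {θ : Param k a b d | θ.Indep} := by
  have h𝒜 : ∀ P ∈ coordAlg k (id : Param k a b d → Param k a b d), IsOpen {t | P t ≠ 0} :=
    isOpen_coordAlg continuous_id
  have hθ : ∀ i, (fun θ : Param k a b d => coord i θ) ∈
      vreg (coordAlg k (id : Param k a b d → Param k a b d)) (LineRing k) := fun i =>
    vreg_linear (coord i) (vreg_coord (k := k) id)
  let L : Param k a b d → (binForms k 0 × binForms k 0) × binForms k ((a + 1 : ℕ) - b : ℤ) →ₗ[k]
      LineRing k := fun θ =>
    ((LinearMap.mulRight k θ.f ∘ₗ (binForms k 0).subtype).coprod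
      (LinearMap.mulRight k θ.g ∘ₗ (binForms k 0).subtype)).coprod
      (LinearMap.mulRight k θ.p ∘ₗ (binForms k _).subtype)
  convert isOpen_injective (A := L) h𝒜 fun x => vreg_add (vreg_add
    (vreg_mul (vreg_const x.1.1.1) (vreg_f hθ)) (vreg_mul (vreg_const x.1.2.1) (vreg_g hθ)))
    (vreg_mul (vreg_const x.2.1) (vreg_p hθ)) using 1
  ext θ
  rw [Set.mem_ofPred_eq, Set.mem_ofPred_eq, ← LinearMap.ker_eq_bot, eq_bot_iff]
  constructor
  · rintro h ⟨⟨⟨A, hA⟩, ⟨B, hB⟩⟩, ⟨c, hc⟩⟩ hx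
    have e : A * θ.f + B * θ.g + c * θ.p = 0 := hx
    have h1 := h (fun i => if i = 0 then A else B) (fun i => by
      split_ifs
      · exact hA
      · exact hB) ⟨-c, by rw [evalForm_one]; simp; linear_combination e⟩
    simp only [if_true, one_ne_zero, if_false] at h1
    obtain ⟨rfl, rfl⟩ := h1
    rw [zero_mul, zero_mul, zero_add, zero_add, mul_eq_zero, or_iff_left θ.p_ne] at e
    subst e
    rfl
  · rintro h A hA ⟨c, hc⟩
    have hc' : ZHom c ((a + 1 : ℕ) - b : ℤ) := by
      refine ZHom.of_mul_left (n := ((a + 1 : ℕ) : ℤ)) ?_ θ.zHom_p θ.p_ne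
      rw [← hc]
      exact zHom_evalForm hA θ.zHom_f θ.zHom_g (by push_cast; ring)
    have h1 := h (x := ((⟨A 0, hA 0⟩, ⟨A 1, hA 1⟩), ⟨-c, hc'.neg⟩)) (by
      change A 0 * θ.f + A 1 * θ.g + -c * θ.p = 0
      rw [evalForm_one] at hc
      linear_combination hc)
    exact ⟨congrArg (fun x => x.1.1.1) h1, congrArg (fun x => x.1.2.1) h1⟩

/-- The ideal of the multiple line with the given parameters. -/
def ideal (θ : Param k a b d) : Ideal (Coord k) := (θ.jet.ideal d).comap (shift θ.s θ.t)

theorem mem_ideal {θ : Param k a b d} {F : Coord k} :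
    F ∈ θ.ideal ↔ shift θ.s θ.t F ∈ θ.jet.ideal d := Iff.rfl

/-- The translation to the given line is a linear change of coordinates. -/
theorem exists_ideal_eq (θ : Param k a b d) :
    ∃ g : GL4 k, θ.ideal = linIdeal g (θ.jet.ideal d) := by
  obtain ⟨g, hg⟩ := exists_comap_shift_eq θ.zHom_s θ.zHom_t
  exact ⟨g, hg _⟩

theorem IsReduced.quotDim_ideal {θ : Param k a b d} (h : θ.IsReduced) (hd : d = 3 ∨ d = 4) {n : ℕ}
    (hn : 2 * a + 2 * b + 5 ≤ n) : quotDim θ.ideal ⊤ n =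
      if d = 3 then 3 * (n : ℤ) + 3 * (a + 1) + b
        else 4 * (n : ℤ) - 2 + 6 * (a + 1) + 2 * b := by
  obtain ⟨g, hg⟩ := θ.exists_ideal_eq
  rw [hg, ← linIdeal_top g, quotDim_linIdeal]
  rcases hd with rfl | rfl
  · have := (data h).quotDim_ideal_three (n := n) (by simp only [data]; omega)
    rw [this]
    simp [data]
  · have := (data h).quotDim_ideal_four (n := n) (by simp only [data]; omega)
    rw [this]
    simp [data]

/-- The forms of degree `n` in the ideal are the kernel of a regular family of linear maps, of
constant rank. -/
theorem continuous_hilbertPoint {Θ : Set (Param k a b d)} (hΘ : ∀ θ ∈ Θ, θ.IsReduced)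
    (hd : d = 3 ∨ d = 4) {n : ℕ} (hn : 2 * a + 2 * b + 5 ≤ n) :
    Continuous fun θ : Θ => hilbertPoint n θ.1.ideal := by
  let A : Θ → Forms k n →ₗ[k] (Fin d → LineRing k) := fun θ => LinearMap.pi fun i =>
    θ.1.jet.coeffHom i ∘ₗ (shift θ.1.s θ.1.t).toLinearMap ∘ₗ (Forms k n).subtype
  have hker : ∀ θ, LinearMap.ker (A θ) = gradedPart θ.1.ideal n := by
    intro θ
    ext F
    rw [LinearMap.mem_ker, mem_gradedPart, mem_ideal, Jet.mem_ideal_iff_coeff]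
    exact ⟨fun h i hi => congrFun h ⟨i, hi⟩, fun h => funext fun i => h i i.2⟩
  have hreg : ∀ F, (fun θ => A θ F) ∈
      vreg (coordAlg k (Subtype.val : Θ → Param k a b d)) (Fin d → LineRing k) := by
    intro F
    have hθ := vreg_coord_subtype Θ
    exact vreg_pi fun i => vreg_linear ((Polynomial.lcoeff (LineRing k) i).restrictScalars k)
      (vreg_jet_hom hθ (vreg_shift (vreg_s hθ) (vreg_t hθ) (vreg_const F.1)))
  have h := continuous_ker (isOpen_coordAlg_subtype Θ) hreg
    (r := (Module.finrank k (gradedPart (⊤ : Ideal (Coord k)) n) -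
      if d = 3 then 3 * (n : ℤ) + 3 * (a + 1) + b
        else 4 * (n : ℤ) - 2 + 6 * (a + 1) + 2 * b : ℤ).toNat) (by
      intro θ
      rw [hker, ← (hΘ θ θ.2).quotDim_ideal hd hn, quotDim]
      omega)
  convert h using 2 with θ
  rw [hker]
  rfl

end Param

end Family


/-! ### Recovering the parameters from the forms of large degree -/

section Reading

open MvPolynomial

variable {k : Type*} [Field k] {T : Type*} {𝒜 : Subalgebra k (T → k)}

theorem vreg_apply {V V' : Type*} [AddCommGroup V] [Module k V] [AddCommGroup V'] [Module k V']
    {A : T → V →ₗ[k] V'} (hA : ∀ v, (fun t => A t v) ∈ vreg 𝒜 V') {F : T → V}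
    (hF : F ∈ vreg 𝒜 V) : (fun t => A t (F t)) ∈ vreg 𝒜 V' := by
  induction hF using Submodule.span_induction with
  | mem F hF =>
    obtain ⟨h, hh, B, rfl⟩ := hF
    simp only [map_smul]
    exact vreg_smul hh (hA B)
  | zero =>
    simp only [Pi.zero_apply, map_zero]
    exact (vreg 𝒜 V').zero_mem
  | add F G _ _ h1 h2 =>
    simp only [Pi.add_apply, map_add]
    exact (vreg 𝒜 V').add_mem h1 h2
  | smul c F _ h1 =>
    simp only [Pi.smul_apply, map_smul]
    exact (vreg 𝒜 V').smul_mem c h1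

/-- Points that are not separated by the algebra `𝒜` are not separated by maps that are regular
up to Frobenius. -/
theorem eq_of_vreg {V : Type*} [AddCommGroup V] [Module k V] [Module.Finite k V] {F : T → V}
    (hF : F ∈ vreg 𝒜 V) {t t' : T} (h : ∀ P ∈ 𝒜, P t = P t') : F t = F t' := by
  refine (Module.finBasis k V).ext_elem fun i => ?_
  obtain ⟨e, P, hP, Q, hQ, h0, E⟩ := vreg_dual ((Module.finBasis k V).coord i) hF t
  have h1 := E t
  have h2 := E t'
  rw [← h P hP, ← h Q hQ, ← h1] at h2
  exact (iterateFrobenius_inj k (ringExpChar k) e (mul_right_cancel₀ h0 h2)).symm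

/-- The forms of degree `n` in the ideals `I t` are the fixed vectors of a regular family of linear
maps. -/
def HasRegularSections (𝒜 : Subalgebra k (T → k)) (n : ℕ) (I : T → Ideal (Coord k)) : Prop :=
  ∃ π : T → Coord k →ₗ[k] Coord k, (∀ F, (fun t => π t F) ∈ vreg 𝒜 (Coord k)) ∧
    ∀ t F, ZHom F n → (π t F = F ↔ F ∈ I t)

/-- A vector that is determined by a system of linear equations, requiring certain forms to lie in
`I t`, depends regularly on `t`. Forms of smaller degree `m` are allowed if `x₃` is not a zero
divisor modulo `I t`: they are multiplied by a power of `x₃`. -/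
theorem HasRegularSections.vreg_of_mem {n : ℕ} {I : T → Ideal (Coord k)}
    (hI : HasRegularSections 𝒜 n I) (hX : ∀ t (F : Coord k) (j : ℕ), X 3 ^ j * F ∈ I t → F ∈ I t)
    {m : ℕ} (hm : m ≤ n) {E : Type*} [AddCommGroup E] [Module k E] [Module.Finite k E]
    {L : T → E → Coord k} (hlin : ∀ t, IsLinearMap k (L t))
    (hL : ∀ x, (fun t => L t x) ∈ vreg 𝒜 (Coord k)) (hLm : ∀ t x, ZHom (L t x) m)
    {c : T → Coord k} (hc : c ∈ vreg 𝒜 (Coord k)) (hcm : ∀ t, ZHom (c t) m) {x : T → E}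
    (hx : ∀ t, c t + L t (x t) ∈ I t) (hinj : ∀ t x, L t x ∈ I t → x = 0) : x ∈ vreg 𝒜 E := by
  obtain ⟨π, hπ, hπI⟩ := hI
  have hz : ∀ {F : Coord k}, ZHom F m → ZHom (X 3 ^ (n - m) * F) n := fun h =>
    ((zHom_X 3).pow (n - m) rfl).mul h (by push_cast [hm]; ring)
  let A : T → E →ₗ[k] Coord k := fun t =>
    (π t - LinearMap.id) ∘ₗ LinearMap.mulLeft k (X 3 ^ (n - m)) ∘ₗ (hlin t).mk'
  have hA : ∀ t x, A t x = π t (X 3 ^ (n - m) * L t x) - X 3 ^ (n - m) * L t x := fun _ _ => rfl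
  refine vreg_solve (A := A) (b := fun t => -(π t (X 3 ^ (n - m) * c t) - X 3 ^ (n - m) * c t))
    (fun x => ?_) (fun t => ?_) ?_ fun t => ?_
  · simp only [hA]
    have h := vreg_mul (vreg_const (𝒜 := 𝒜) (X 3 ^ (n - m))) (hL x)
    exact vreg_sub (vreg_apply hπ h) h
  · rw [← LinearMap.ker_eq_bot, eq_bot_iff]
    intro x hx
    rw [LinearMap.mem_ker, hA, sub_eq_zero, hπI t _ (hz (hLm t x))] at hx
    exact hinj t x (hX _ _ _ hx)
  · have h := vreg_mul (vreg_const (𝒜 := 𝒜) (X 3 ^ (n - m))) hc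
    exact Submodule.neg_mem (vreg 𝒜 (Coord k)) (vreg_sub (vreg_apply hπ h) h :)
  · have h := (hπI t _ (hz ((hcm t).add (hLm t (x t))))).2 ((I t).mul_mem_left _ (hx t))
    rw [mul_add, map_add] at h
    rw [hA]
    linear_combination h

theorem vreg_subtype {V : Type*} [AddCommGroup V] [Module k V] {S : Submodule k V} {x : T → S}
    (hx : x ∈ vreg 𝒜 S) : (fun t => (x t : V)) ∈ vreg 𝒜 V := vreg_linear S.subtype hx

/-- On a chart of the Grassmannian the forms of degree `n` are the fixed vectors of the projection
along the chosen complement, whose entries are the affine coordinates of the chart. -/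
theorem hasRegularSections_chart {n : ℕ} (I : T → Ideal (Coord k)) {W : Submodule k (Forms k n)}
    (hW : ∀ t, IsCompl (hilbertPoint n (I t)).sub W) :
    HasRegularSections (coordAlg k fun t => Chart.proj (⟨hilbertPoint n (I t), hW t⟩ : Chart k W))
      n I := by
  let ρ : Coord k →ₗ[k] Forms k n := (homogeneousComponent n).codRestrict (Forms k n)
    (homogeneousComponent_mem n)
  let S : T → Chart k W := fun t => ⟨hilbertPoint n (I t), hW t⟩
  refine ⟨fun t => (Forms k n).subtype ∘ₗ (S t).proj ∘ₗ ρ, fun F => ?_, fun t F hF => ?_⟩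
  · exact vreg_linear (V := Forms k n →ₗ[k] Forms k n)
      ((Forms k n).subtype ∘ₗ LinearMap.applyₗ (ρ F)) (vreg_coord (k := k) _)
  · have hρ : (ρ F : Coord k) = F := by
      rw [LinearMap.codRestrict_apply, homogeneousComponent_of_mem hF.isHomogeneous, if_pos rfl]
    have h := (S t).proj_eq_iff (ρ F)
    have h' : ρ F ∈ (S t).1.sub ↔ F ∈ I t := by
      conv_rhs => rw [← hρ]
      exact mem_gradedPart
    rw [← h', ← h, Subtype.ext_iff, hρ]
    rfl

theorem ringExpChar_eq_of_prime {q : ℕ} (hq : q.Prime) (h : (q : k) = 0) : ringExpChar k = q := by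
  have h1 := (Nat.dvd_prime hq).1 (ringChar.dvd h)
  rcases h1 with h1 | h1
  · exact absurd h1 CharP.ringChar_ne_one
  · rw [ringExpChar, h1, max_eq_left hq.one_lt.le]

/-- A linear form is regular up to Frobenius if this holds for its power to a power of the
characteristic. -/
theorem vreg_of_pow {s : T → LineRing k} (hs : ∀ t, ZHom (s t) 1) {e : ℕ}
    (h : (fun t => s t ^ (ringExpChar k ^ e)) ∈ vreg 𝒜 (LineRing k)) :
    s ∈ vreg 𝒜 (LineRing k) := by
  set N := ringExpChar k ^ e with hN
  choose a b hab using fun t => (hs t).eq_smul_X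
  have hp : ∀ t, s t ^ N = a t ^ N • X 0 ^ N + b t ^ N • X 1 ^ N := by
    intro t
    rw [hab, hN, add_pow_expChar_pow, smul_pow, smul_pow]
  have hN0 : N ≠ 0 := pow_ne_zero _ (expChar_pos k _).ne'
  have e1 : Finsupp.single (1 : Fin 2) N ≠ Finsupp.single 0 N := fun h => by
    have := DFunLike.congr_fun h 1
    simp [hN0] at this
  have h0 : (fun t => a t) ∈ reg 𝒜 := by
    refine reg_of_pow (e := e) ?_
    convert vreg_dual (lcoeff k (Finsupp.single 0 N)) h using 1
    ext t
    simp only [hp, Pi.pow_apply, lcoeff_apply, coeff_add, coeff_smul, coeff_X_pow,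
      if_neg e1]
    simp [hN]
  have h1 : (fun t => b t) ∈ reg 𝒜 := by
    refine reg_of_pow (e := e) ?_
    convert vreg_dual (lcoeff k (Finsupp.single 1 N)) h using 1
    ext t
    simp only [hp, Pi.pow_apply, lcoeff_apply, coeff_add, coeff_smul, coeff_X_pow,
      if_neg e1.symm]
    simp [hN]
  have := vreg_add (vreg_smul_const h0 (X 0 : LineRing k)) (vreg_smul_const h1 (X 1 : LineRing k))
  convert this using 1
  ext1 t
  exact hab t

end Reading


section ReadingParameters

open MvPolynomial

variable {k : Type*} [Field k]

/-- A form of degree less than `deg f` divided by `f` up to powers of `x₁` vanishes if `f` has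
leading coefficient one. -/
theorem eq_zero_of_dvd_X_pow_mul {f c : LineRing k} {m n : ℤ} (hf : ZHom f m) (hl : lead f = 1)
    (hc : ZHom c n) (hn : n < m) {j : ℕ} (h : f ∣ X 1 ^ j * c) : c = 0 := by
  have hf0 : f ≠ 0 := ne_zero_of_lead (by simp [hl])
  have hrel : IsRelPrime f (X 1 ^ j) := by
    refine IsRelPrime.pow_right ?_
    refine isRelPrime_comm.1 ((X_prime (i := 1)).irreducible.isRelPrime_iff_not_dvd.2 ?_)
    rintro ⟨g, rfl⟩
    simp at hl
  obtain ⟨C, hC, rfl⟩ := zHom_of_dvd_rel hc hf hf0 (hrel.dvd_of_dvd_mul_left h)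
  rw [hC.eq_zero (by omega), mul_zero]

theorem coeff_eq_zero_of_X_pow_dvd {R : Type*} [CommRing R] {m : ℕ} {P : Polynomial R}
    (h : Polynomial.X ^ (m + 1) ∣ Polynomial.X ^ m * P) : P.coeff 0 = 0 := by
  have := Polynomial.X_pow_dvd_iff.1 h m (Nat.lt_succ_self m)
  rwa [Polynomial.coeff_X_pow_mul', if_pos le_rfl, Nat.sub_self] at this

namespace Param

variable {a b m : ℕ}

section

variable (θ : Param k a b (m + 3))

/-- Restriction of functions to the translated jet. -/
def eval : Coord k →ₐ[k] Polynomial (LineRing k) := θ.jet.hom.comp (shift θ.s θ.t)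

/-- The first equation of the line. -/
def x : Coord k := X 0 - emb θ.s

/-- The second equation of the line. -/
def y : Coord k := X 1 - emb θ.t

theorem mem_ideal_iff {F : Coord k} : F ∈ θ.ideal ↔ Polynomial.X ^ (m + 3) ∣ θ.eval F :=
  mem_ideal.trans (Jet.mem_ideal _)

theorem shift_x : shift θ.s θ.t θ.x = X 0 := by simp [x]

theorem shift_y : shift θ.s θ.t θ.y = X 1 := by simp [y]

theorem eval_x : θ.eval θ.x = Polynomial.X * Polynomial.C (θ.p * θ.f ^ 2) := by
  rw [eval, AlgHom.comp_apply, shift_x, Jet.hom_X0]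
  rfl

theorem eval_y : θ.eval θ.y = Polynomial.X * θ.jet.E := by
  rw [eval, AlgHom.comp_apply, shift_y, Jet.hom_X1]

theorem eval_emb (c : LineRing k) : θ.eval (emb c) = Polynomial.C c := by
  rw [eval, AlgHom.comp_apply, shift_emb, Jet.hom_emb]

theorem eval_X0 : θ.eval (X 0) = Polynomial.C (θ.p * θ.f ^ 2) * Polynomial.X +
    Polynomial.C θ.s := by
  have : (X 0 : Coord k) = θ.x + emb θ.s := by simp [x]
  rw [this, map_add, eval_x, eval_emb, mul_comm]

theorem zHom_x : ZHom θ.x 1 := (zHom_X 0).sub θ.zHom_s.emb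

theorem zHom_y : ZHom θ.y 1 := (zHom_X 1).sub θ.zHom_t.emb

theorem x_pow_mem : θ.x ^ (m + 3) ∈ θ.ideal := by
  rw [mem_ideal_iff, map_pow, eval_x, mul_pow]
  exact dvd_mul_right _ _

theorem mem_ideal_of_X3_mul (F : Coord k) (j : ℕ) (h : X 3 ^ j * F ∈ θ.ideal) : F ∈ θ.ideal := by
  have e : (X 3 ^ j : Coord k) = emb (X 1 ^ j) := by simp
  rw [e, mem_ideal_iff, map_mul, eval_emb, Polynomial.X_pow_dvd_iff] at h
  rw [mem_ideal_iff, Polynomial.X_pow_dvd_iff]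
  intro i hi
  have := h i hi
  rwa [Polynomial.coeff_C_mul, mul_eq_zero, or_iff_right (pow_ne_zero _ (X_ne_zero 1))] at this

end

section

variable {T : Type*} {𝒜 : Subalgebra k (T → k)} {θ : T → Param k a b (m + 3)} {n : ℕ}
  (H : HasRegularSections 𝒜 n fun t => (θ t).ideal)

include H

/-- The forms `xᵐ⁺³ + ∑ cᵢ x₀ⁱ` vanishing on the multiple line determine the coefficients of
`(x₀ - s)ᵐ⁺³`. -/
theorem vreg_coeff_s (hn : m + 3 ≤ n) (i : Fin (m + 3)) :
    (fun t => (-(θ t).s) ^ (m + 3 - i : ℕ) * ((m + 3).choose i : LineRing k)) ∈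
      vreg 𝒜 (LineRing k) := by
  let E := ∀ i : Fin (m + 3), binForms k ((m + 3 - i : ℕ) : ℤ)
  have hz : ∀ t (i : Fin (m + 3)), ZHom ((-(θ t).s) ^ (m + 3 - i : ℕ) *
      ((m + 3).choose i : LineRing k)) ((m + 3 - i : ℕ) : ℤ) := fun t i => by
    refine ((θ t).zHom_s.neg.pow _ (by ring)).mul (n := 0) ?_ (by ring)
    rw [← nsmul_one, ← Nat.cast_smul_eq_nsmul k]
    exact zHom_one.smul _
  let c : T → E := fun t i => ⟨_, hz t i⟩
  have key : c ∈ vreg 𝒜 E := by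
    refine H.vreg_of_mem (fun t => (θ t).mem_ideal_of_X3_mul) hn
      (L := fun _ c => ∑ i : Fin (m + 3), emb (c i : LineRing k) * X 0 ^ (i : ℕ))
      (c := fun _ => X 0 ^ (m + 3))
      (fun t => ?_) (fun x => vreg_const _) (fun t x => ?_) (vreg_const _)
      (fun t => (zHom_X 0).pow _ (by push_cast; ring)) (fun t => ?_) fun t c hc => ?_
    · constructor
      · intro c c'
        rw [← Finset.sum_add_distrib]
        refine Finset.sum_congr rfl fun i _ => ?_
        rw [← add_mul, ← map_add]
        rfl
      · intro r c
        rw [Finset.smul_sum]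
        refine Finset.sum_congr rfl fun i _ => ?_
        rw [← smul_mul_assoc, ← map_smul]
        rfl
    · refine ZHom.sum fun i _ => ?_
      have hi := i.2
      exact (ZHom.emb (x i).2).mul ((zHom_X 0).pow _ rfl) (by omega)
    · have h := (θ t).x_pow_mem
      have e : ∀ N : ℕ, (θ t).x ^ N = X 0 ^ N + ∑ i : Fin N,
          X 0 ^ (i : ℕ) * (-emb (θ t).s) ^ (N - i) * (N.choose i : Coord k) := by
        intro N
        rw [Param.x, sub_eq_add_neg, add_pow, Finset.sum_range_succ, Fin.sum_univ_eq_sum_range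
          (fun j => X 0 ^ j * (-emb (θ t).s) ^ (N - j) * (N.choose j : Coord k)), add_comm,
          Nat.sub_self, pow_zero, mul_one, Nat.choose_self, Nat.cast_one, mul_one]
      rw [e] at h
      convert h using 2
      refine Finset.sum_congr rfl fun i _ => ?_
      simp only [c, map_mul, map_pow, map_neg, map_natCast]
      ring
    · rw [mem_ideal_iff] at hc
      -- A polynomial in `x₀` of degree less than `m + 3` that vanishes on the multiple line is zero.
      let q : Polynomial (LineRing k) :=
        ∑ i : Fin (m + 3), Polynomial.C (c i : LineRing k) * Polynomial.X ^ (i : ℕ)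
      have hq : ∀ i : Fin (m + 3), q.coeff i = c i := by
        intro i
        simp only [q, Polynomial.finsetSum_coeff, Polynomial.coeff_C_mul, Polynomial.coeff_X_pow,
          Fin.val_inj, mul_ite, mul_one, mul_zero, Finset.sum_ite_eq, Finset.mem_univ, if_true]
      have hqd : q.natDegree < m + 3 := by
        refine (Polynomial.natDegree_sum_le_of_forall_le (n := m + 2) _ _ fun i _ => ?_).trans_lt
          (Nat.lt_succ_self _)
        exact (Polynomial.natDegree_C_mul_X_pow_le _ _).trans (by omega)
      let l : Polynomial (LineRing k) :=
        Polynomial.C ((θ t).p * (θ t).f ^ 2) * Polynomial.X + Polynomial.C (θ t).s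
      have hl : l.natDegree = 1 :=
        Polynomial.natDegree_linear (mul_ne_zero (θ t).p_ne (pow_ne_zero 2 (θ t).f_ne))
      have he : (θ t).eval (∑ i : Fin (m + 3), emb (c i : LineRing k) * X 0 ^ (i : ℕ)) =
          q.comp l := by
        change _ = Polynomial.compRingHom l q
        simp only [q, map_sum, map_mul, map_pow, eval_emb, eval_X0, Polynomial.coe_compRingHom_apply,
          Polynomial.C_comp, Polynomial.X_comp, l]
      rw [he] at hc
      have h0 : q.comp l = 0 := by
        refine Polynomial.eq_zero_of_dvd_of_natDegree_lt hc ?_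
        rw [Polynomial.natDegree_comp, hl, Polynomial.natDegree_X_pow]
        omega
      have hq0 : q = 0 := by
        rcases Polynomial.comp_eq_zero_iff.1 h0 with h | ⟨-, h⟩
        · exact h
        · rw [h, Polynomial.natDegree_C] at hl
          omega
      funext i
      refine Subtype.ext ?_
      rw [← hq i, hq0]
      rfl
  exact vreg_linear ((binForms k _).subtype ∘ₗ LinearMap.proj i) key

/-- The expansion of `(x₀ - s)ᵐ⁺³` contains the term `-(m + 3) s x₀ᵐ⁺²`, which determines `s` unless
the characteristic divides `m + 3`. For `m + 3 = 3, 4` the characteristic is then `3` or `2`, and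
`sᵐ⁺³` is a Frobenius power of `s`. -/
theorem vreg_s_of_sections (hm : m ≤ 1) (hn : m + 3 ≤ n) :
    (fun t => (θ t).s) ∈ vreg 𝒜 (LineRing k) := by
  by_cases h : ((m + 3 : ℕ) : k) = 0
  · -- Here `m + 3` is a power of the characteristic, and the constant term `sᵐ⁺³` is used.
    obtain ⟨e, he⟩ : ∃ e, m + 3 = ringExpChar k ^ e := by
      interval_cases m
      · exact ⟨1, by rw [ringExpChar_eq_of_prime Nat.prime_three h, pow_one]⟩
      · refine ⟨2, ?_⟩
        have h2 : ((2 : ℕ) : k) ^ 2 = 0 := by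
          rw [← h]
          norm_num
        rw [ringExpChar_eq_of_prime Nat.prime_two ((pow_eq_zero_iff two_ne_zero).1 h2)]
        rfl
    refine vreg_of_pow (fun t => (θ t).zHom_s) (e := e) ?_
    have h0 := (vreg 𝒜 (LineRing k)).smul_mem ((-1) ^ (m + 3)) (vreg_coeff_s H hn 0)
    rw [← he]
    convert h0 using 1
    funext t
    change _ = ((-1) ^ (m + 3) : k) • ((-(θ t).s) ^ (m + 3) * (((m + 3).choose 0 : ℕ) : LineRing k))
    rw [Nat.choose_zero_right, Nat.cast_one, mul_one, ← smul_pow, neg_smul, one_smul, neg_neg]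
  · have h0 := (vreg 𝒜 (LineRing k)).smul_mem (-((m + 3 : ℕ) : k)⁻¹)
      (vreg_coeff_s H hn (Fin.last (m + 2)))
    convert h0 using 1
    funext t
    have h1 : (C ((m + 3 : ℕ) : k)⁻¹ : LineRing k) * ((m + 3 : ℕ) : LineRing k) = 1 := by
      rw [← map_natCast (C : k →+* LineRing k), ← C_mul, inv_mul_cancel₀ h, C_1]
    simp only [Pi.smul_apply, Fin.val_last, smul_eq_C_mul, C_neg]
    rw [show m + 3 - (m + 2) = 1 by omega, show (m + 3).choose (m + 2) = m + 3 from
      Nat.choose_succ_self_right (m + 2), pow_one]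
    linear_combination (-(θ t).s) * h1

/-- The surface `(x₀ - s)ᵐ⁺² (x₁ - t) = 0` containing the multiple line determines `t`. -/
theorem vreg_t_of_sections (hs : (fun t => (θ t).s) ∈ vreg 𝒜 (LineRing k)) (hn : m + 3 ≤ n) :
    (fun t => (θ t).t) ∈ vreg 𝒜 (LineRing k) := by
  have hx : (fun t => (θ t).x) ∈ vreg 𝒜 (Coord k) := vreg_sub (vreg_const _) (vreg_emb hs)
  have hxp := vreg_pow hx (m + 2)
  have key : (fun t => (⟨-(θ t).t, (θ t).zHom_t.neg⟩ : binForms k 1)) ∈ vreg 𝒜 (binForms k 1) := by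
    refine H.vreg_of_mem (E := binForms k 1) (fun t => (θ t).mem_ideal_of_X3_mul) hn
      (L := fun t δ => emb (δ : LineRing k) * (θ t).x ^ (m + 2))
      (c := fun t => X 1 * (θ t).x ^ (m + 2)) (fun t => ⟨fun c c' => ?_, fun r c => ?_⟩)
      (fun c => vreg_mul (vreg_const _) hxp) (fun t c => ?_) (vreg_mul (vreg_const _) hxp)
      (fun t => (zHom_X 1).mul ((θ t).zHom_x.pow _ rfl) (by push_cast; ring))
      (fun t => ?_) fun t c hc => ?_
    · rw [Submodule.coe_add, map_add, add_mul]
    · rw [Submodule.coe_smul, map_smul, smul_mul_assoc]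
    · exact (ZHom.emb c.2).mul ((θ t).zHom_x.pow _ rfl) (by push_cast; ring)
    · have e : X 1 * (θ t).x ^ (m + 2) + emb (-(θ t).t) * (θ t).x ^ (m + 2) =
          (θ t).y * (θ t).x ^ (m + 2) := by rw [y, map_neg]; ring
      rw [e, mem_ideal_iff, map_mul, map_pow, eval_x, eval_y]
      exact ⟨(θ t).jet.E * Polynomial.C ((θ t).p * (θ t).f ^ 2) ^ (m + 2), by ring⟩
    · rw [mem_ideal_iff, map_mul, map_pow, eval_x, eval_emb] at hc
      have h := coeff_eq_zero_of_X_pow_dvd (m := m + 2)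
        (P := Polynomial.C ((c : LineRing k) * ((θ t).p * (θ t).f ^ 2) ^ (m + 2))) (by
          convert hc using 1
          rw [Polynomial.C_mul, Polynomial.C_pow]
          ring)
      rw [Polynomial.coeff_C_zero, mul_eq_zero, or_iff_left (pow_ne_zero _ (mul_ne_zero (θ t).p_ne
        (pow_ne_zero 2 (θ t).f_ne)))] at h
      exact Subtype.ext h
  have h := Submodule.neg_mem (vreg 𝒜 (LineRing k)) (vreg_subtype key :)
  convert h using 1
  funext t
  exact (neg_neg _).symm

end

end Param

end ReadingParameters


section ReadingParameters

open MvPolynomial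

variable {k : Type*} [Field k]

namespace Param

variable {a b m : ℕ}

section

variable (θ : Param k a b (m + 3))

/-- The translate of `quadric f g` to the line. -/
def q : Coord k := emb θ.g * θ.x - emb θ.f * θ.y

/-- The translate of a quadratic form in the equations of the line. -/
def quad (u₀ u₁ u₂ : LineRing k) : Coord k :=
  emb u₀ * θ.x ^ 2 + emb u₁ * θ.x * θ.y + emb u₂ * θ.y ^ 2

theorem zHom_q : ZHom θ.q (a + 2) :=
  (θ.zHom_g.emb.mul θ.zHom_x (by push_cast; ring)).sub
    (θ.zHom_f.emb.mul θ.zHom_y (by push_cast; ring))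

theorem zHom_quad {u₀ u₁ u₂ : LineRing k} {n l : ℤ} (h₀ : ZHom u₀ n) (h₁ : ZHom u₁ n)
    (h₂ : ZHom u₂ n) (hl : l = n + 2) : ZHom (θ.quad u₀ u₁ u₂) l :=
  ((h₀.emb.mul (θ.zHom_x.pow 2 rfl) (by rw [hl]; push_cast; ring)).add
    ((h₁.emb.mul θ.zHom_x rfl).mul θ.zHom_y (by rw [hl]; ring))).add
    (h₂.emb.mul (θ.zHom_y.pow 2 rfl) (by rw [hl]; push_cast; ring))

theorem jet_D : θ.jet.D = θ.p * θ.f ^ 2 := rfl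

theorem data_w {θ : Param k a b (m + 3)} (h : θ.IsReduced) : (data h).w =
    emb (θ.f ^ 3 * θ.p) * (emb θ.p * quadric θ.f θ.g - polyForm 2 θ.u) - emb θ.e * X 0 ^ 3 := by
  rw [Jet.Data₃.w]
  simp only [data, mul_one]
  rfl

theorem eval_q : θ.eval θ.q = θ.jet.hom (quadric θ.f θ.g) := by
  simp only [q, quadric, map_sub, map_mul, eval_x, eval_y, eval_emb, Jet.hom_X0, Jet.hom_X1,
    Jet.hom_emb, jet_D]

theorem eval_quad_eq (u₀ u₁ u₂ : LineRing k) : θ.eval (θ.quad u₀ u₁ u₂) =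
    Polynomial.C u₀ * θ.eval θ.x ^ 2 + Polynomial.C u₁ * θ.eval θ.x * θ.eval θ.y +
      Polynomial.C u₂ * θ.eval θ.y ^ 2 := by
  simp only [quad, map_add, map_mul, map_pow, eval_emb]

theorem eval_quad (u : ℕ → LineRing k) :
    θ.eval (θ.quad (u 0) (u 1) (u 2)) = θ.jet.hom (polyForm 2 u) := by
  simp only [quad, polyForm, Finset.sum_range_succ, Finset.sum_range_zero, map_add, map_mul,
    map_pow, eval_x, eval_y, eval_emb, Jet.hom_X0, Jet.hom_X1, Jet.hom_emb, zero_add,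
    pow_zero, mul_one, Nat.sub_zero, Nat.sub_self, Nat.reduceSub, pow_one, jet_D]

theorem eval_v : θ.eval (emb θ.p * θ.q - θ.quad (θ.u 0) (θ.u 1) (θ.u 2)) =
    θ.jet.hom (emb θ.p * quadric θ.f θ.g - polyForm 2 θ.u) := by
  rw [map_sub, map_mul, eval_q, eval_quad, eval_emb, map_sub, map_mul, Jet.hom_emb]

end

section

variable {T : Type*} {𝒜 : Subalgebra k (T → k)} {θ : T → Param k a b (m + 3)} {n : ℕ}
  (H : HasRegularSections 𝒜 n fun t => (θ t).ideal) (hθ : ∀ t, (θ t).IsReduced)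

section

variable (hs : (fun t => (θ t).s) ∈ vreg 𝒜 (LineRing k))
  (ht : (fun t => (θ t).t) ∈ vreg 𝒜 (LineRing k))

include hs in
theorem vreg_x : (fun t => (θ t).x) ∈ vreg 𝒜 (Coord k) := vreg_sub (vreg_const _) (vreg_emb hs)

include ht in
theorem vreg_y : (fun t => (θ t).y) ∈ vreg 𝒜 (Coord k) := vreg_sub (vreg_const _) (vreg_emb ht)

include H hθ hs ht in
/-- The surfaces `xᵐ⁺¹ (g x - f y)` containing the multiple line determine `f` and `g`. -/
theorem vreg_fg_of_sections (hn : a + m + 3 ≤ n) :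
    (fun t => coord 2 (θ t)) ∈ vreg 𝒜 (LineRing k) ∧
      (fun t => coord 3 (θ t)) ∈ vreg 𝒜 (LineRing k) := by
  have hx := vreg_x hs
  have hy := vreg_y ht
  have hxp := vreg_pow hx (m + 1)
  let E := binForms k a × binForms k (a + 1)
  have key : (fun t => ((⟨coord 2 (θ t), zHom_coord 2 _⟩, ⟨coord 3 (θ t), zHom_coord 3 _⟩) : E)) ∈
      vreg 𝒜 E := by
    have h0 := vreg_const (𝒜 := 𝒜) (emb (X 0 ^ (a + 1) : LineRing k))
    refine H.vreg_of_mem (fun t => (θ t).mem_ideal_of_X3_mul) hn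
      (L := fun t c => (emb (c.2 : LineRing k) * (θ t).x - emb (X 1 * (c.1 : LineRing k)) *
        (θ t).y) * (θ t).x ^ (m + 1))
      (c := fun t => -(emb (X 0 ^ (a + 1)) * (θ t).y * (θ t).x ^ (m + 1)))
      (fun t => ⟨fun c c' => ?_, fun r c => ?_⟩)
      (fun c => ?_) (fun t c => ?_) ?_ (fun t => ?_) (fun t => ?_) fun t c hc => ?_
    · change (emb ((c.2 : LineRing k) + (c'.2 : LineRing k)) * (θ t).x -
        emb (X 1 * ((c.1 : LineRing k) + (c'.1 : LineRing k))) * (θ t).y) * (θ t).x ^ (m + 1) = _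
      simp only [map_add, map_mul]
      ring
    · change (emb (r • (c.2 : LineRing k)) * (θ t).x -
        emb (X 1 * (r • (c.1 : LineRing k))) * (θ t).y) * (θ t).x ^ (m + 1) = _
      simp only [mul_smul_comm, map_smul, map_mul]
      simp only [smul_eq_C_mul]
      ring
    · have h1 := vreg_mul (vreg_const (𝒜 := 𝒜) (emb (c.2 : LineRing k))) hx
      have h2 := vreg_mul (vreg_const (𝒜 := 𝒜) (emb (X 1 * (c.1 : LineRing k)))) hy
      exact vreg_mul (vreg_sub h1 h2) hxp
    · refine ZHom.mul (m := a + 2) (((ZHom.emb c.2.2).mul (θ t).zHom_x (by ring)).sub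
        ((ZHom.emb ((zHom_X 1).mul c.1.2 rfl)).mul (θ t).zHom_y (by ring)))
        ((θ t).zHom_x.pow _ rfl) (by push_cast; ring)
    · exact Submodule.neg_mem (vreg 𝒜 (Coord k)) (vreg_mul (vreg_mul h0 hy) hxp :)
    · exact ((((zHom_X 0).pow (a + 1) rfl).emb.mul (θ t).zHom_y rfl).mul ((θ t).zHom_x.pow _ rfl)
        (by push_cast; ring)).neg
    · have e : -(emb (X 0 ^ (a + 1)) * (θ t).y * (θ t).x ^ (m + 1)) +
          (emb (coord 3 (θ t)) * (θ t).x - emb (X 1 * coord 2 (θ t)) * (θ t).y) *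
            (θ t).x ^ (m + 1) = (θ t).x ^ (m + 1) * (θ t).q := by
        simp only [q, f, g, map_add]
        ring
      rw [e, mem_ideal_iff, map_mul, map_pow, eval_x, eval_q, mul_pow, mul_right_comm]
      change Polynomial.X ^ (m + 1 + 2) ∣ _
      rw [pow_add _ (m + 1) 2]
      exact (mul_dvd_mul_left _ ((Jet.mem_ideal _).1 (data (hθ t)).q_mem)).mul_right _
    · rw [mem_ideal_iff, map_mul, map_pow, map_sub, map_mul, map_mul, eval_emb, eval_emb, eval_x,
        eval_y] at hc
      set D := (θ t).p * (θ t).f ^ 2 with hD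
      have hD0 : D ≠ 0 := mul_ne_zero (θ t).p_ne (pow_ne_zero 2 (θ t).f_ne)
      have h := coeff_eq_zero_of_X_pow_dvd (m := m + 2)
        (P := (Polynomial.C ((c.2 : LineRing k) * D) - Polynomial.C (X 1 * (c.1 : LineRing k)) *
          (θ t).jet.E) * Polynomial.C (D ^ (m + 1))) (by
            convert hc using 1
            rw [Polynomial.C_mul, Polynomial.C_pow]
            ring)
      rw [Polynomial.coeff_mul_C, mul_eq_zero, or_iff_left (pow_ne_zero _ hD0),
        Polynomial.coeff_sub, Polynomial.coeff_C_mul, Polynomial.coeff_C_zero, coeff_jet_E,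
        if_pos rfl] at h
      have h1 : (c.2 : LineRing k) * (θ t).f = X 1 * (c.1 : LineRing k) * (θ t).g := by
        refine mul_left_cancel₀ (mul_ne_zero (θ t).p_ne (θ t).f_ne) ?_
        linear_combination h
      -- As `f` and `g` are coprime, `f` divides `x₃ c.1`, where `c.1` has smaller degree than `f`.
      have h2 : (c.1 : LineRing k) = 0 := by
        refine eq_zero_of_dvd_X_pow_mul (θ t).zHom_f (θ t).lead_f c.1.2 (by push_cast; omega)
          (j := 1) ?_
        rw [pow_one]
        exact (hθ t).1.dvd_of_dvd_mul_right ⟨c.2, by linear_combination -h1⟩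
      rw [h2, mul_zero, zero_mul, mul_eq_zero, or_iff_left (θ t).f_ne] at h1
      exact Prod.ext (Subtype.ext h2) (Subtype.ext h1)
  exact ⟨vreg_linear ((binForms k _).subtype ∘ₗ LinearMap.fst k _ _) key,
    vreg_linear ((binForms k _).subtype ∘ₗ LinearMap.snd k _ _) key⟩

end

section

variable (hx : (fun t => (θ t).x) ∈ vreg 𝒜 (Coord k))
  (hy : (fun t => (θ t).y) ∈ vreg 𝒜 (Coord k)) (hq : (fun t => (θ t).q) ∈ vreg 𝒜 (Coord k))

include H hθ hx hy hq in
/-- The surfaces `xᵐ (p (g x - f y) - u(x, y))` containing the multiple line determine `p` and,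
thanks to its normalization, `u`. -/
theorem vreg_pu_of_sections (hn : a + b + m + 2 ≤ n) :
    ((fun t => coord 4 (θ t)) ∈ vreg 𝒜 (LineRing k) ∧
      (fun t => coord 5 (θ t)) ∈ vreg 𝒜 (LineRing k)) ∧
      (fun t => coord 6 (θ t)) ∈ vreg 𝒜 (LineRing k) ∧
      (fun t => coord 7 (θ t)) ∈ vreg 𝒜 (LineRing k) := by
  have hxp := vreg_pow hx m
  have hx2 := vreg_pow hx 2
  have hy2 := vreg_pow hy 2
  let E := (binForms k (b - 1) × binForms k (a + b)) × (binForms k a × binForms k a)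
  have key : (fun t => (((⟨coord 4 (θ t), zHom_coord 4 _⟩, ⟨coord 5 (θ t), zHom_coord 5 _⟩),
      (⟨coord 6 (θ t), zHom_coord 6 _⟩, ⟨coord 7 (θ t), zHom_coord 7 _⟩)) : E)) ∈ vreg 𝒜 E := by
    have h0 := vreg_const (𝒜 := 𝒜) (emb (X 0 ^ b : LineRing k))
    refine H.vreg_of_mem (fun t => (θ t).mem_ideal_of_X3_mul) hn
      (L := fun t c => (emb (X 1 * (c.1.1 : LineRing k)) * (θ t).q -
        (θ t).quad c.1.2 (X 1 ^ b * (c.2.1 : LineRing k)) (X 1 ^ b * (c.2.2 : LineRing k))) *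
          (θ t).x ^ m)
      (c := fun t => emb (X 0 ^ b) * (θ t).q * (θ t).x ^ m)
      (fun t => ⟨fun c c' => ?_, fun r c => ?_⟩)
      (fun c => ?_) (fun t c => ?_) ?_ (fun t => ?_) (fun t => ?_) fun t c hc => ?_
    · change (emb (X 1 * ((c.1.1 : LineRing k) + (c'.1.1 : LineRing k))) * (θ t).q -
        (θ t).quad ((c.1.2 : LineRing k) + (c'.1.2 : LineRing k))
          (X 1 ^ b * ((c.2.1 : LineRing k) + (c'.2.1 : LineRing k)))
          (X 1 ^ b * ((c.2.2 : LineRing k) + (c'.2.2 : LineRing k)))) * (θ t).x ^ m = _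
      simp only [quad, map_add, map_mul]
      ring
    · change (emb (X 1 * (r • (c.1.1 : LineRing k))) * (θ t).q -
        (θ t).quad (r • (c.1.2 : LineRing k)) (X 1 ^ b * (r • (c.2.1 : LineRing k)))
          (X 1 ^ b * (r • (c.2.2 : LineRing k)))) * (θ t).x ^ m = _
      simp only [quad, mul_smul_comm, map_smul, map_mul]
      simp only [smul_eq_C_mul]
      ring
    · have h1 := vreg_mul (vreg_const (𝒜 := 𝒜) (emb (X 1 * (c.1.1 : LineRing k)))) hq
      have e0 := vreg_mul (vreg_const (𝒜 := 𝒜) (emb (c.1.2 : LineRing k))) hx2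
      have e1 := vreg_mul (vreg_mul (vreg_const (𝒜 := 𝒜)
        (emb (X 1 ^ b * (c.2.1 : LineRing k)))) hx) hy
      have e2 := vreg_mul (vreg_const (𝒜 := 𝒜) (emb (X 1 ^ b * (c.2.2 : LineRing k)))) hy2
      exact vreg_mul (vreg_sub h1 (vreg_add (vreg_add e0 e1) e2)) hxp
    · refine ZHom.mul (m := a + b + 2) (((ZHom.emb ((zHom_X 1).mul c.1.1.2 rfl)).mul (θ t).zHom_q
        (by ring)).sub ((θ t).zHom_quad c.1.2.2 (((zHom_X 1).pow b rfl).mul c.2.1.2 (by ring))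
          (((zHom_X 1).pow b rfl).mul c.2.2.2 (by ring)) rfl))
        ((θ t).zHom_x.pow _ rfl) (by push_cast; ring)
    · exact vreg_mul (vreg_mul h0 hq) hxp
    · exact (((zHom_X 0).pow b rfl).emb.mul (θ t).zHom_q rfl).mul ((θ t).zHom_x.pow _ rfl)
        (by push_cast; ring)
    · have e : emb (X 0 ^ b) * (θ t).q * (θ t).x ^ m + (emb (X 1 * coord 4 (θ t)) * (θ t).q -
          (θ t).quad (coord 5 (θ t)) (X 1 ^ b * coord 6 (θ t)) (X 1 ^ b * coord 7 (θ t))) *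
            (θ t).x ^ m = (θ t).x ^ m * (emb (θ t).p * (θ t).q -
              (θ t).quad ((θ t).u 0) ((θ t).u 1) ((θ t).u 2)) := by
        simp only [p, u, map_add, if_true, one_ne_zero, if_false, OfNat.ofNat_ne_zero,
          OfNat.ofNat_ne_one]
        ring
      rw [e, mem_ideal_iff, map_mul, map_pow, eval_x, eval_v, mul_pow, mul_right_comm, pow_add]
      exact (mul_dvd_mul_left _ ((Jet.mem_ideal _).1 (data (hθ t)).v_mem)).mul_right _
    · obtain ⟨Q, hQ⟩ := (Jet.mem_ideal _).1 (data (hθ t)).q_mem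
      have hQ0 : Q.coeff 0 = (θ t).p * (θ t).f ^ 2 * (θ t).r := by
        have := (data (hθ t)).coeff_two_q
        rwa [hQ, Polynomial.coeff_X_pow_mul', if_pos le_rfl, Nat.sub_self] at this
      have hq' : (θ t).eval (θ t).q = Polynomial.X ^ 2 * Q := by
        rw [eval_q]
        exact hQ
      rw [mem_ideal_iff, map_mul, map_pow, map_sub, map_mul, hq', eval_quad_eq, eval_emb, eval_x,
        eval_y] at hc
      set D := (θ t).p * (θ t).f ^ 2 with hD
      have hD0 : D ≠ 0 := mul_ne_zero (θ t).p_ne (pow_ne_zero 2 (θ t).f_ne)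
      have h := coeff_eq_zero_of_X_pow_dvd (m := m + 2)
        (P := (Polynomial.C (X 1 * (c.1.1 : LineRing k)) * Q -
          (Polynomial.C ((c.1.2 : LineRing k) * D ^ 2) +
            Polynomial.C (X 1 ^ b * (c.2.1 : LineRing k) * D) * (θ t).jet.E +
            Polynomial.C (X 1 ^ b * (c.2.2 : LineRing k)) * ((θ t).jet.E * (θ t).jet.E))) *
          Polynomial.C (D ^ m)) (by
            convert hc using 1
            simp only [Polynomial.C_mul, Polynomial.C_pow]
            ring)
      rw [Polynomial.coeff_mul_C, mul_eq_zero, or_iff_left (pow_ne_zero _ hD0),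
        Polynomial.coeff_sub, Polynomial.coeff_C_mul, Polynomial.coeff_add, Polynomial.coeff_add,
        Polynomial.coeff_C_zero, Polynomial.coeff_C_mul, Polynomial.coeff_C_mul,
        Polynomial.mul_coeff_zero, hQ0, coeff_jet_E, if_pos rfl] at h
      have hf0 := (θ t).f_ne
      have hp0 := (θ t).p_ne
      have h1 : X 1 * (c.1.1 : LineRing k) * (θ t).r = (θ t).p * ((c.1.2 : LineRing k) *
          (θ t).f ^ 2 + X 1 ^ b * (c.2.1 : LineRing k) * (θ t).f * (θ t).g +
          X 1 ^ b * (c.2.2 : LineRing k) * (θ t).g ^ 2) := by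
        refine mul_left_cancel₀ (mul_ne_zero hp0 (pow_ne_zero 2 hf0)) ?_
        linear_combination h
      -- As `p` and `r` are coprime, the component for `p` vanishes; then so do those for `u`, as
      -- `f` and `g` are coprime and the cofactors of `x₃ᵇ` have smaller degree than `f`.
      have h2 : (c.1.1 : LineRing k) = 0 := by
        refine eq_zero_of_dvd_X_pow_mul (θ t).zHom_p (θ t).lead_p c.1.1.2 (by omega) (j := 1) ?_
        rw [pow_one]
        exact (hθ t).2.dvd_of_dvd_mul_right ⟨_, h1⟩
      rw [h2, mul_zero, zero_mul, eq_comm, mul_eq_zero, or_iff_right hp0] at h1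
      have h3 : (c.2.2 : LineRing k) = 0 := by
        refine eq_zero_of_dvd_X_pow_mul (θ t).zHom_f (θ t).lead_f c.2.2.2 (by push_cast; omega)
          (j := b) ?_
        exact ((hθ t).1.pow_right (n := 2)).dvd_of_dvd_mul_right
          ⟨-((c.1.2 : LineRing k) * (θ t).f + X 1 ^ b * (c.2.1 : LineRing k) * (θ t).g),
            by linear_combination h1⟩
      rw [h3] at h1
      have h4 : (c.1.2 : LineRing k) * (θ t).f = -(X 1 ^ b * (c.2.1 : LineRing k) * (θ t).g) := by
        refine mul_left_cancel₀ hf0 ?_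
        linear_combination h1
      have h5 : (c.2.1 : LineRing k) = 0 := by
        refine eq_zero_of_dvd_X_pow_mul (θ t).zHom_f (θ t).lead_f c.2.1.2 (by push_cast; omega)
          (j := b) ?_
        exact (hθ t).1.dvd_of_dvd_mul_right ⟨-c.1.2, by linear_combination h4⟩
      rw [h5, mul_zero, zero_mul, neg_zero, mul_eq_zero, or_iff_left hf0] at h4
      exact Prod.ext (Prod.ext (Subtype.ext h2) (Subtype.ext h4))
        (Prod.ext (Subtype.ext h5) (Subtype.ext h3))
  have k1 := vreg_linear (LinearMap.fst k _ _) key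
  have k2 := vreg_linear (LinearMap.snd k _ _) key
  exact ⟨⟨vreg_linear ((binForms k _).subtype ∘ₗ LinearMap.fst k _ _) k1,
    vreg_linear ((binForms k _).subtype ∘ₗ LinearMap.snd k _ _) k1⟩,
    vreg_linear ((binForms k _).subtype ∘ₗ LinearMap.fst k _ _) k2,
    vreg_linear ((binForms k _).subtype ∘ₗ LinearMap.snd k _ _) k2⟩

include H hθ hx in
/-- The surface `f³ p v - e x³` containing the multiple line determines `e`. -/
theorem vreg_e_of_sections (hm : m ≤ 1) (hv : (fun t => emb ((θ t).f ^ 3 * (θ t).p) *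
      (emb (θ t).p * (θ t).q - (θ t).quad ((θ t).u 0) ((θ t).u 1) ((θ t).u 2))) ∈
        vreg 𝒜 (Coord k)) (hn : 4 * a + 2 * b + 5 ≤ n) :
    (fun t => coord 8 (θ t)) ∈ vreg 𝒜 (LineRing k) := by
  interval_cases m
  · have h0 : ∀ t, coord 8 (θ t) = 0 := fun t => (zHom_coord 8 (θ t)).eq_zero (by
      change (if 0 + 3 = 4 then 4 * (a : ℤ) + 2 + 2 * b else -1 : ℤ) < 0
      norm_num)
    simp only [h0]
    exact vreg_const 0
  · have hx3 := vreg_pow hx 3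
    have key : (fun t => (⟨(θ t).e, (θ t).zHom_e⟩ : binForms k _)) ∈
        vreg 𝒜 (binForms k (4 * ((a + 1 : ℕ) : ℤ) - 2 + 2 * b)) := by
      refine H.vreg_of_mem (E := binForms k (4 * ((a + 1 : ℕ) : ℤ) - 2 + 2 * b))
        (fun t => (θ t).mem_ideal_of_X3_mul) hn
        (L := fun t c => -(emb (c : LineRing k) * (θ t).x ^ 3)) (fun t => ⟨fun c c' => ?_,
          fun r c => ?_⟩) (fun c => ?_) (fun t c => ?_) hv (fun t => ?_) (fun t => ?_)
          fun t c hc => ?_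
      · rw [Submodule.coe_add, map_add]
        ring
      · rw [Submodule.coe_smul, map_smul, smul_mul_assoc, smul_neg]
      · have h := vreg_mul (vreg_const (𝒜 := 𝒜) (emb (c : LineRing k))) hx3
        exact Submodule.neg_mem (vreg 𝒜 (Coord k)) h
      · exact ((ZHom.emb c.2).mul ((θ t).zHom_x.pow 3 rfl) (by push_cast; ring)).neg
      · refine (((θ t).zHom_f.pow 3 rfl).mul (θ t).zHom_p rfl).emb.mul
          (n := a + b + 2) (((θ t).zHom_p.emb.mul (θ t).zHom_q (by ring)).sub
          ((θ t).zHom_quad ((θ t).zHom_u 0) ((θ t).zHom_u 1) ((θ t).zHom_u 2)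
            (by push_cast; ring))) (by push_cast; ring)
      · have h := (Jet.mem_ideal _).1 (data (hθ t)).w_mem
        have e : (θ t).eval (emb ((θ t).f ^ 3 * (θ t).p) * (emb (θ t).p * (θ t).q -
            (θ t).quad ((θ t).u 0) ((θ t).u 1) ((θ t).u 2)) + -(emb (θ t).e * (θ t).x ^ 3)) =
            (θ t).jet.hom (data (hθ t)).w := by
          have ew : (θ t).jet.hom (data (hθ t)).w = (θ t).jet.hom (emb ((θ t).f ^ 3 * (θ t).p)) *
              (θ t).jet.hom (emb (θ t).p * quadric (θ t).f (θ t).g - polyForm 2 (θ t).u) -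
              (θ t).jet.hom (emb (θ t).e) * (θ t).jet.hom (X 0) ^ 3 := by
            rw [data_w, map_sub, map_mul _ (emb ((θ t).f ^ 3 * (θ t).p)), map_mul _ (emb (θ t).e),
              map_pow _ (X 0)]
          rw [ew, map_add, map_mul (θ t).eval, eval_v, map_neg, map_mul (θ t).eval, map_pow, eval_x,
            eval_emb, eval_emb, Jet.hom_emb, Jet.hom_emb, Jet.hom_X0, jet_D]
          ring
        rw [mem_ideal_iff]
        exact e ▸ h
      · rw [Ideal.neg_mem_iff, mem_ideal_iff, map_mul, map_pow, eval_x, eval_emb] at hc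
        have h := coeff_eq_zero_of_X_pow_dvd (m := 3)
          (P := Polynomial.C ((c : LineRing k) * ((θ t).p * (θ t).f ^ 2) ^ 3)) (by
            convert hc using 1
            rw [Polynomial.C_mul, Polynomial.C_pow]
            ring)
        rw [Polynomial.coeff_C_zero, mul_eq_zero, or_iff_left (pow_ne_zero _ (mul_ne_zero
          (θ t).p_ne (pow_ne_zero 2 (θ t).f_ne)))] at h
        exact Subtype.ext h
    exact (vreg_subtype key :)

end

end

end Param

end ReadingParameters


section ReadingParameters

open MvPolynomial

variable {k : Type*} [Field k]

namespace Param

variable {a b m : ℕ}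

section

variable {T : Type*} {𝒜 : Subalgebra k (T → k)} {θ : T → Param k a b (m + 3)} {n : ℕ}
  (H : HasRegularSections 𝒜 n fun t => (θ t).ideal) (hθ : ∀ t, (θ t).IsReduced)

theorem vreg_q (hx : (fun t => (θ t).x) ∈ vreg 𝒜 (Coord k))
    (hy : (fun t => (θ t).y) ∈ vreg 𝒜 (Coord k)) (hf : (fun t => (θ t).f) ∈ vreg 𝒜 (LineRing k))
    (hg : (fun t => (θ t).g) ∈ vreg 𝒜 (LineRing k)) :
    (fun t => (θ t).q) ∈ vreg 𝒜 (Coord k) := by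
  have hg' := vreg_emb hg
  have hf' := vreg_emb hf
  exact vreg_sub (vreg_mul hg' hx) (vreg_mul hf' hy)

include H hθ in
/-- The parameters of a multiple line depend regularly, up to Frobenius, on its forms of large
degree. -/
theorem vreg_of_sections (hm : m ≤ 1) (hn : 4 * a + 2 * b + 5 ≤ n) :
    θ ∈ vreg 𝒜 (Param k a b (m + 3)) := by
  have hs := vreg_s_of_sections H hm (by omega)
  have ht := vreg_t_of_sections H hs (by omega)
  obtain ⟨h2, h3⟩ := vreg_fg_of_sections H hθ hs ht (by omega)
  have hx := vreg_x hs
  have hy := vreg_y ht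
  have hf : (fun t => (θ t).f) ∈ vreg 𝒜 (LineRing k) :=
    vreg_add (vreg_const _) (vreg_mul (vreg_const _) h2)
  have hg : (fun t => (θ t).g) ∈ vreg 𝒜 (LineRing k) := h3
  have hq : (fun t => (θ t).q) ∈ vreg 𝒜 (Coord k) := vreg_q hx hy hf hg
  obtain ⟨⟨h4, h5⟩, h6, h7⟩ := vreg_pu_of_sections H hθ hx hy hq (by omega)
  have hp : (fun t => (θ t).p) ∈ vreg 𝒜 (LineRing k) :=
    vreg_add (vreg_const _) (vreg_mul (vreg_const _) h4)
  have hu1 := vreg_mul (vreg_const (𝒜 := 𝒜) (X 1 ^ b : LineRing k)) h6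
  have hu2 := vreg_mul (vreg_const (𝒜 := 𝒜) (X 1 ^ b : LineRing k)) h7
  have hu : ∀ i, (fun t => (θ t).u i) ∈ vreg 𝒜 (LineRing k) := by
    intro i
    unfold u
    split_ifs
    exacts [h5, hu1, hu2]
  have hx2 := vreg_pow hx 2
  have hy2 := vreg_pow hy 2
  have hf3 := vreg_pow hf 3
  have hu' := fun i => vreg_emb (hu i)
  have hp' := vreg_emb hp
  have e0 := vreg_mul (hu' 0) hx2
  have e1 := vreg_mul (vreg_mul (hu' 1) hx) hy
  have e2 := vreg_mul (hu' 2) hy2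
  have e3 := vreg_mul hp' hq
  have hfp := vreg_mul hf3 hp
  have e4 := vreg_emb hfp
  have e5 := vreg_sub e3 (vreg_add (vreg_add e0 e1) e2)
  have hv : (fun t => emb ((θ t).f ^ 3 * (θ t).p) * (emb (θ t).p * (θ t).q -
      (θ t).quad ((θ t).u 0) ((θ t).u 1) ((θ t).u 2))) ∈ vreg 𝒜 (Coord k) := by
    simp only [quad]
    exact vreg_mul e4 e5
  have h8 := vreg_e_of_sections H hθ hx hm hv (by omega)
  have hcoord : ∀ i, (fun t => coord i (θ t)) ∈ vreg 𝒜 (LineRing k) := by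
    intro i
    match i with
    | 0 => exact hs
    | 1 => exact ht
    | 2 => exact h2
    | 3 => exact h3
    | 4 => exact h4
    | 5 => exact h5
    | 6 => exact h6
    | 7 => exact h7
    | 8 => exact h8
  exact vreg_of_injective (LinearMap.pi fun i => coord i)
    (fun θ θ' h => ext fun i => congrFun h i) (vreg_pi hcoord)

end

end Param

end ReadingParameters


/-! ### Every multiple line with constant type can be moved into the parametrized family -/

section Position

open MvPolynomial

variable {k : Type*} [Field k]

theorem IsSpaceCurve.zcomp_mem {I : Ideal (Coord k)} (h : IsSpaceCurve I) (F : Coord k)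
    (hF : F ∈ I) (n : ℤ) : zcomp n F ∈ I := by
  rcases lt_or_ge n 0 with hn | hn
  · rw [(zHom_zcomp n F).eq_zero hn]
    exact zero_mem _
  · obtain ⟨m, rfl⟩ := Int.eq_ofNat_of_zero_le hn
    rw [zcomp_natCast]
    exact h.homogeneous F hF m

namespace Jet.Data₃

variable {J : Jet k} (D : J.Data₃) {m : ℕ}

/-- For multiplicity three and four, the type is constant exactly if `σ = 0`, a condition only for
multiplicity four. -/
theorem hasType_iff_of_const (hm : m ≤ 1) {a : ℤ} {b : ℕ} :
    HasType (J.ideal (m + 3)) a (fun _ : Fin (m + 1) => b) ↔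
      a = D.α - 1 ∧ b = D.b ∧ (m = 1 → D.σ = 0) := by
  interval_cases m
  · rw [D.toData.hasType_iff (m := 1) D.hasType_three]
    refine and_congr_right fun _ => ?_
    rw [funext_iff]
    simp
  · rw [D.toData.hasType_iff (m := 2) D.hasType_four]
    refine and_congr_right fun _ => ?_
    rw [funext_iff, Fin.forall_fin_two]
    simp only [Matrix.cons_val_zero, Matrix.cons_val_one, forall_const]
    omega

/-- The multiple structure lies on a generically smooth surface of small degree, `v` or `w`. -/
theorem exists_equation (hm : m ≤ 1) (hσ : m = 1 → D.σ = 0) : ∃ G ∈ J.ideal (m + 3), ∃ N : ℕ,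
    N ≤ 4 * D.α + 2 * D.b ∧ ZHom G (N + 1) ∧ ∃ A : ℕ → LineRing k, (∀ i, ZHom (A i) N) ∧
      G - polyForm 1 A ∈ stdLine k ^ 2 ∧ A 1 ≠ 0 ∧
      (lead D.f ≠ 0 → lead D.p ≠ 0 → lead D.s ≠ 0 → lead (A 1) ≠ 0) := by
  interval_cases m
  · refine ⟨D.v, D.v_mem, D.α + D.b, by omega, by exact_mod_cast D.zHom_v, _, fun i => ?_,
      D.v_sub_mem, ?_, fun hf hp _ => ?_⟩
    · split_ifs
      · exact D.zHom_p.mul D.zHom_g (by push_cast; ring)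
      · exact (D.zHom_p.mul D.zHom_f (by push_cast; ring)).neg
    · simp [D.p_ne, D.f_ne]
    · simp [hf, hp]
  · have hσ' := hσ rfl
    refine ⟨D.w, D.w_mem, 4 * D.α + 2 * D.b + D.σ, by omega, by exact_mod_cast D.zHom_w, _,
      fun i => ?_, D.w_sub_mem, ?_, fun hf hp hs => ?_⟩
    · have h := ((D.zHom_f.pow 3 rfl).mul D.zHom_p rfl).mul D.zHom_s rfl
      split_ifs
      · exact h.mul (D.zHom_p.mul D.zHom_g rfl) (by push_cast; ring)
      · exact (h.mul (D.zHom_p.mul D.zHom_f rfl) (by push_cast; ring)).neg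
    · simp [D.p_ne, D.f_ne, D.s_ne]
    · simp [hf, hp, hs]

end Jet.Data₃

/-- After a change of coordinates along the line a non-zero form has non-zero value at the point
`(1, 0)`. -/
theorem exists_lin_lead_ne [Infinite k] {A : LineRing k} (hA : A ≠ 0) :
    ∃ (g : GL4 k) (σ : LineRing k →ₐ[k] LineRing k), lead (σ A) ≠ 0 ∧ lin g (X 0) = X 0 ∧
      lin g (X 1) = X 1 ∧ (∀ c, lin g (emb c) = emb (σ c)) ∧
        ∀ c n, ZHom c n → ZHom (σ c) n := by
  obtain ⟨x, hx⟩ : ∃ x : Fin 2 → k, MvPolynomial.eval x (X 0 * A) ≠ 0 := by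
    by_contra! h
    exact mul_ne_zero (X_ne_zero 0) hA (MvPolynomial.funext fun x => by rw [h, map_zero])
  rw [map_mul, eval_X] at hx
  obtain ⟨g, hg⟩ := exists_lin_eq_subst !![1, 0, 0, 0; 0, 1, 0, 0; 0, 0, x 0, 0; 0, 0, x 1, 1]
    (by simpa [Matrix.det_succ_row_zero, Fin.sum_univ_succ] using left_ne_zero_of_mul hx)
  let σ : LineRing k →ₐ[k] LineRing k := aeval ![x 0 • X 0, x 1 • X 0 + X 1]
  have hσ : ∀ c, lin g (emb c) = emb (σ c) := by
    intro c
    rw [hg]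
    suffices h : (subst _).comp emb = emb.comp σ from AlgHom.congr_fun h c
    refine algHom_ext fun i => ?_
    fin_cases i <;> simp [σ, subst_X, Fin.sum_univ_four]
  refine ⟨g, σ, ?_, ?_, ?_, hσ, fun c n hc => ?_⟩
  · have h : lead.comp σ = (aeval x : LineRing k →ₐ[k] k) := by
      refine algHom_ext fun i => ?_
      fin_cases i <;> simp [σ]
    have h' : lead (σ A) = MvPolynomial.eval x A := by
      rw [← AlgHom.comp_apply, h, ← DFunLike.congr_fun (coe_aeval_eq_eval x) A]
      rfl
    rw [h']
    exact right_ne_zero_of_mul hx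
  · simp [hg, subst_X, Fin.sum_univ_four]
  · simp [hg, subst_X, Fin.sum_univ_four]
  · have h1 := hc.emb.lin g
    rw [hσ] at h1
    have h2 := h1.res
    rwa [res_emb] at h2

theorem linIdeal_mono {I I' : Ideal (Coord k)} (h : I ≤ I') (g : GL4 k) :
    linIdeal g I ≤ linIdeal g I' := Ideal.comap_mono h

/-- A multiple line of constant type becomes transverse after a linear change of coordinates, moving
the line to `x₀ = x₁ = 0` and then choosing a point of it at which the surface of `exists_equation`
is smooth. -/
theorem HasType.exists_isTransverse [Infinite k] {m a b : ℕ} (hm : m ≤ 1) {I : Ideal (Coord k)}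
    (hI : HasType I a (fun _ : Fin (m + 1) => b)) {n : ℕ}
    (hn : 4 * (a + 1) + 2 * b + (m + 3) ≤ n) :
    ∃ g, IsTransverse (m + 3) n (MultipleLines.linIdeal g I) := by
  obtain ⟨g, hg, hle | ⟨J, hJ⟩⟩ := hI.line.normal_position
  · exact absurd (hI.linIdeal g).quasiprimitive (hg.not_isQuasiprimitive hle)
  obtain ⟨d₀⟩ := J.nonempty_data
  obtain ⟨D, -⟩ := d₀.exists_data₃
  have hT := hI.linIdeal g
  rw [hJ] at hT
  obtain ⟨hα, hb, hσ⟩ := (D.hasType_iff_of_const hm).1 hT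
  obtain ⟨G, hG, N, hN, hGN, A, hAN, hA, hA1, -⟩ := D.exists_equation hm hσ
  obtain ⟨w, σ, hl, hw0, hw1, hw, hσz⟩ := exists_lin_lead_ne hA1
  refine ⟨w * g, ?_⟩
  rw [← linIdeal_linIdeal, hJ]
  have hP : MultipleLines.linIdeal w (stdLine k) = stdLine k := by
    rw [linIdeal_eq_map, stdLine, Ideal.map_span, Set.image_pair, hw0, hw1]
  have hpow : ∀ j, MultipleLines.linIdeal w (stdLine k ^ j) = stdLine k ^ j := fun j => by
    rw [linIdeal_pow, hP]
  refine isTransverse_of (A := fun i => σ (A i)) (hpow (m + 3) ▸ linIdeal_mono (J.pow_le_ideal _) w)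
    ((lin_mem_linIdeal w).2 hG) (hGN.lin w) (fun i => hσz _ _ (hAN i)) ?_ hl (by omega)
  have h := (lin_mem_linIdeal w).2 hA
  rw [hpow, map_sub] at h
  convert h using 2
  simp only [polyForm, Finset.sum_range_succ, Finset.sum_range_zero, map_add, map_mul, map_pow, hw0,
    hw1, hw, map_zero]

end Position


section Parametrization

open MvPolynomial

variable {k : Type*} [Field k] {a b m : ℕ}

namespace Param

theorem IsReduced.hasType {θ : Param k a b (m + 3)} (h : θ.IsReduced) (hm : m ≤ 1) :
    HasType θ.ideal a (fun _ : Fin (m + 1) => b) := by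
  obtain ⟨g, hg⟩ := θ.exists_ideal_eq
  rw [hg, hasType_linIdeal_iff, (data h).hasType_iff_of_const hm]
  exact ⟨by simp [data], rfl, fun _ => rfl⟩

/-- The curves of the parametrized family are transverse, since the leading coefficients of `f` and
`p` are one. -/
theorem IsReduced.isTransverse {θ : Param k a b (m + 3)} (h : θ.IsReduced) (hm : m ≤ 1) {n : ℕ}
    (hn : 4 * (a + 1) + 2 * b + (m + 3) ≤ n) : IsTransverse (m + 3) n θ.ideal := by
  obtain ⟨G, hG, N, hN, hGN, A, hAN, hA, -, hl⟩ := (data h).exists_equation hm fun _ => rfl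
  refine IsTransverse.comap_shift (by omega) θ.zHom_s θ.zHom_t ?_
  refine isTransverse_of (θ.jet.pow_le_ideal _) hG hGN hAN hA (hl ?_ ?_ ?_) ?_
  · change lead θ.f ≠ 0
    rw [lead_f]
    exact one_ne_zero
  · change lead θ.p ≠ 0
    rw [lead_p]
    exact one_ne_zero
  · change lead 1 ≠ 0
    rw [map_one]
    exact one_ne_zero
  · have h1 : (data h).α = a + 1 := rfl
    have h2 : (data h).b = b := rfl
    omega

end Param

/-- A transverse multiple line whose support is `x₀ = x₁ = 0` has normalized data. -/
theorem HasType.exists_normalized {I : Ideal (Coord k)}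
    (hI : HasType I a (fun _ : Fin (m + 1) => b)) (hm : m ≤ 1) (hstd : IsStdMultiple I) {n : ℕ} (hn : m + 3 ≤ n) (h : IsTransverse (m + 3) n I) :
    ∃ (J : Jet k) (D : J.Data₃), I = J.ideal (m + 3) ∧ D.α = a + 1 ∧ D.b = b ∧ lead D.f = 1 ∧
      lead D.p = 1 ∧ (m = 1 → D.σ = 0 ∧ D.s = 1) ∧ ∃ u₁ u₂, ZHom u₁ a ∧ ZHom u₂ a ∧
        D.u 1 = X 1 ^ b * u₁ ∧ D.u 2 = X 1 ^ b * u₂ := by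
  obtain ⟨F, hF, hFn, A, hA, hl⟩ := h.exists_linear hstd hn (by omega)
  obtain ⟨J, e, he, rfl⟩ := hstd.exists_jet hF hA (ne_zero_of_lead (by simp [hl]))
  obtain ⟨γ, hγ⟩ := hI.line.degree
  obtain rfl := J.eq_of_hasDegreeGenus he hγ
  obtain ⟨d₀⟩ := J.nonempty_data
  obtain ⟨D₀, -⟩ := d₀.exists_data₃
  obtain ⟨hα, hb, -⟩ := (D₀.hasType_iff_of_const hm).1 hI
  obtain ⟨hf, hp⟩ := D₀.lead_ne (by omega) hn h
  obtain ⟨d₁, hα₁, hb₁, hf₁, hp₁⟩ := D₀.toData.exists_monic hf hp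
  obtain ⟨u, hu, hur, u₁, u₂, hu₁, hu₂, e₁, e₂⟩ := d₁.exists_normal_form hf₁
  obtain ⟨D₂, hD₂, hD₂u⟩ := d₁.exists_data₃_of hu hur
  obtain ⟨D, hD, hDu, hDs⟩ : ∃ D : J.Data₃, D.toData = d₁ ∧ D.u = u ∧
      (m = 1 → D.σ = 0 ∧ D.s = 1) := by
    rcases eq_or_ne m 1 with h1 | h1
    · obtain ⟨D, hD, hDu, hσ, hs⟩ := D₂.exists_s_eq_one
        (((D₂.hasType_iff_of_const hm).1 hI).2.2 h1)
      exact ⟨D, hD.trans hD₂, hDu.trans hD₂u, fun _ => ⟨hσ, hs⟩⟩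
    · exact ⟨D₂, hD₂, hD₂u, fun h => absurd h h1⟩
  subst hD
  subst hDu
  have ha : ((D.α : ℤ) - 1) = a := by rw [hα, hα₁]
  rw [ha] at hu₁ hu₂
  have hb' : D.b = b := by rw [hb, hb₁]
  rw [hb'] at e₁ e₂
  exact ⟨J, D, rfl, by omega, hb', hf₁, hp₁, hDs, u₁, u₂, hu₁, hu₂, e₁, e₂⟩

/-- Every transverse multiple line with constant type occurs in the parametrized family: translate
its support to `x₀ = x₁ = 0`, normalize its data, and compare the equations `v` or `w`. -/
theorem HasType.exists_param {I : Ideal (Coord k)} (hI : HasType I a (fun _ : Fin (m + 1) => b))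
    (hm : m ≤ 1) {n : ℕ} (hn : m + 3 ≤ n) (h : IsTransverse (m + 3) n I) :
    ∃ θ : Param k a b (m + 3), θ.IsReduced ∧ θ.ideal = I := by
  obtain ⟨s, t, hs, ht, hr⟩ := h.exists_shift hn hI.line.support
  obtain ⟨g, hg⟩ := exists_comap_shift_eq hs ht
  have hI' : HasType (I.comap (shift s t)) a (fun _ : Fin (m + 1) => b) := by
    rw [hg]
    exact hI.linIdeal g
  obtain ⟨J, D, hJ, hα, hb, hf, hp, hσ, u₁, u₂, hu₁, hu₂, e₁, e₂⟩ :=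
    hI'.exists_normalized hm (hI'.line.curve.isStdMultiple hr) hn (h.comap_shift hn hs ht)
  obtain ⟨f', hf', ef⟩ := D.zHom_f.exists_lead
  obtain ⟨p', hp', ep⟩ := D.zHom_p.exists_lead
  rw [hf, C_1, one_mul, hα] at ef
  rw [hp, C_1, one_mul, hb] at ep
  let c : Fin 9 → LineRing k :=
    ![-s, -t, f', D.g, p', D.u 0, u₁, u₂, if m = 1 then D.e else 0]
  have hc : ∀ i, ZHom (c i) (paramDegree a b (m + 3) i) := by
    intro i
    match i with
    | 0 => exact hs.neg
    | 1 => exact ht.neg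
    | 2 =>
      change ZHom f' a
      rw [hα] at hf'
      convert hf' using 1
      push_cast
      ring
    | 3 =>
      change ZHom D.g (a + 1)
      have := D.zHom_g
      rw [hα] at this
      exact_mod_cast this
    | 4 =>
      change ZHom p' (b - 1)
      rwa [hb] at hp'
    | 5 =>
      change ZHom (D.u 0) (a + b)
      have := D.zHom_u 0
      rw [hα, hb] at this
      convert this using 1
      push_cast
      ring
    | 6 => exact hu₁
    | 7 => exact hu₂
    | 8 =>
      change ZHom (if m = 1 then D.e else 0) (if m + 3 = 4 then 4 * (a : ℤ) + 2 + 2 * b else -1)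
      by_cases h1 : m = 1
      · rw [if_pos h1, if_pos (by omega)]
        have := D.zHom_e
        rw [hα, hb, (hσ h1).1] at this
        convert this using 1
        push_cast
        ring
      · rw [if_neg h1]
        exact zHom_zero _
  let θ : Param k a b (m + 3) := Param.mk c hc
  have hθf : θ.f = D.f := ef.symm
  have hθg : θ.g = D.g := rfl
  have hθp : θ.p = D.p := ep.symm
  have hθu0 : θ.u 0 = D.u 0 := rfl
  have hθu1 : θ.u 1 = D.u 1 := e₁.symm
  have hθu2 : θ.u 2 = D.u 2 := e₂.symm
  have hθr : θ.r = D.r := by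
    rw [Param.r, evalForm_two, hθf, hθg, hθu0, hθu1, hθu2, ← evalForm_two, D.evalForm_u]
  have hred : θ.IsReduced := by
    rw [Param.IsReduced, hθf, hθg, hθp, hθr]
    exact ⟨D.isRelPrime_fg, D.isRelPrime_pr⟩
  have hv : (Param.data hred).v = D.v := by
    change emb θ.p * quadric θ.f θ.g - polyForm 2 θ.u = emb D.p * quadric D.f D.g - polyForm 2 D.u
    rw [hθf, hθg, hθp]
    simp only [polyForm, Finset.sum_range_succ, Finset.sum_range_zero, hθu0, hθu1, hθu2]
  have hJ' : θ.jet.ideal (m + 3) = J.ideal (m + 3) := by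
    rcases eq_or_ne m 1 with rfl | h1
    · refine Jet.Data₃.ideal_four_eq (d := Param.data hred) (d' := D) ?_
      have hθe : θ.e = D.e := rfl
      rw [Jet.Data₃.w, Jet.Data₃.w, hv, (hσ rfl).2]
      change emb (θ.f ^ 3 * θ.p * 1) * D.v - emb θ.e * X 0 ^ 3 = _
      rw [hθf, hθp, hθe]
    · obtain rfl : m = 0 := by omega
      exact Jet.Data₃.ideal_three_eq (d := Param.data hred) (d' := D) hv
  refine ⟨θ, hred, ?_⟩
  ext F
  rw [Param.mem_ideal, hJ', ← hJ, Ideal.mem_comap]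
  change shift s t (shift (-s) (-t) F) ∈ I ↔ _
  rw [shift_shift_neg]

end Parametrization


/-! ### Irreducibility and dimension -/

section Families

open MvPolynomial

variable {k : Type*} [Field k] {a b m : ℕ}

/-- The transverse subspaces: those that together with `germForms` span all forms. -/
def transverse (k : Type*) [Field k] (d n : ℕ) : Set (Grassmannian k (Forms k n)) :=
  {S | S.sub ⊔ germForms k d n = ⊤}

theorem isOpen_transverse (d n : ℕ) : IsOpen (transverse k d n) := isOpen_sup_eq_top _

theorem IsSpaceCurve.hilbertPoint_mem_transverse {I : Ideal (Coord k)} (h : IsSpaceCurve I)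
    {d n : ℕ} (hdn : d ≤ n) : hilbertPoint n I ∈ transverse k d n ↔ IsTransverse d n I :=
  gradedPart_sup_germForms hdn h.zcomp_mem

theorem coordAlg_chart_apply_eq {T V : Type*} [AddCommGroup V] [Module k V] {W : Submodule k V}
    {I : T → Grassmannian k V} (hI : ∀ t, IsCompl (I t).sub W) {t t' : T} (h : I t = I t') :
    ∀ P ∈ coordAlg k fun t => Chart.proj (⟨I t, hI t⟩ : Chart k W), P t = P t' := by
  rintro _ ⟨P, -, rfl⟩
  have e : (⟨I t, hI t⟩ : Chart k W) = ⟨I t', hI t'⟩ := Subtype.ext h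
  exact congrArg (fun S : Chart k W => P S.proj) e

namespace Param

/-- On a chart of the Grassmannian the parameters are regular functions, up to Frobenius, of the
affine coordinates. -/
theorem vreg_chart {Θ : Set (Param k a b (m + 3))} (hΘ : ∀ θ ∈ Θ, θ.IsReduced) (hm : m ≤ 1) {n : ℕ}
    (hn : 4 * a + 2 * b + 10 ≤ n) (W : Submodule k (Forms k n)) :
    (fun t : {θ : Θ // IsCompl (hilbertPoint n θ.1.ideal).sub W} => t.1.1) ∈
      vreg (coordAlg k fun t : {θ : Θ // IsCompl (hilbertPoint n θ.1.ideal).sub W} =>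
        Chart.proj (⟨hilbertPoint n t.1.1.ideal, t.2⟩ : Chart k W)) (Param k a b (m + 3)) := by
  let T := {θ : Θ // IsCompl (hilbertPoint n θ.1.ideal).sub W}
  have H := hasRegularSections_chart (fun t : T => t.1.1.ideal) (W := W) fun t => t.2
  exact vreg_of_sections (θ := fun t : T => t.1.1) H (fun t => hΘ _ t.1.2) hm (by omega)

/-- The parameters are determined by the forms of degree `n`, as they are functions of the affine
coordinates of a chart. -/
theorem injective_hilbertPoint {Θ : Set (Param k a b (m + 3))} (hΘ : ∀ θ ∈ Θ, θ.IsReduced)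
    (hm : m ≤ 1) {n : ℕ} (hn : 4 * a + 2 * b + 10 ≤ n) :
    Function.Injective fun θ : Θ => hilbertPoint n θ.1.ideal := by
  intro θ θ' h
  obtain ⟨W, hW⟩ := exists_isCompl (hilbertPoint n θ.1.ideal).sub
  have h' : hilbertPoint n θ.1.ideal = hilbertPoint n θ'.1.ideal := h
  have hW' : IsCompl (hilbertPoint n θ'.1.ideal).sub W := h' ▸ hW
  have hv := vreg_chart hΘ hm hn W
  exact Subtype.ext (eq_of_vreg hv (t := ⟨θ, hW⟩) (t' := ⟨θ', hW'⟩)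
    (coordAlg_chart_apply_eq (I := fun t : {θ : Θ // IsCompl (hilbertPoint n θ.1.ideal).sub W} =>
      hilbertPoint n t.1.1.ideal) (fun t => t.2) h'))

end Param

/-- A family of multiple lines of constant type that is described by an open condition on the
parameters is irreducible, and its dimension is the number of parameters: the transverse members
form an open subset homeomorphic to `Θ`, whose translates under the general linear group cover the
family. -/
theorem irreducible_of_hasType [Infinite k] (hm : m ≤ 1) {F : Set (Ideal (Coord k))}
    (hF : ∀ g, ∀ I ∈ F, linIdeal g I ∈ F) (hFT : ∀ I ∈ F, HasType I a (fun _ : Fin (m + 1) => b))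
    {Θ : Set (Param k a b (m + 3))} (hΘo : IsOpen Θ) (hne : Θ.Nonempty)
    (hΘ : ∀ θ, θ ∈ Θ ↔ θ.IsReduced ∧ θ.ideal ∈ F) {n : ℕ} (hn : 4 * a + 2 * b + 10 ≤ n) :
    IsInducing (fun θ : Θ => hilbertPoint n θ.1.ideal) ∧ IsIrreducible (hilbertPoint n '' F) ∧
      topologicalKrullDim (hilbertPoint n '' F) = Module.finrank k (Param k a b (m + 3)) := by
  have hred : ∀ θ ∈ Θ, θ.IsReduced := fun θ h => ((hΘ θ).1 h).1
  refine irreducible_of_parametrization n hF (isOpen_transverse (m + 3) n) (fun I hI => ?_) hΘo hne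
    (Φ := fun θ : Θ => θ.1.ideal) (fun θ => ⟨((hΘ θ).1 θ.2).2, ?_⟩) (fun I hI h => ?_)
    (Param.continuous_hilbertPoint hred (by omega) (by omega))
    (Param.injective_hilbertPoint hred hm hn) (Param.vreg_chart hred hm hn)
  · obtain ⟨g, hg⟩ := (hFT I hI).exists_isTransverse hm (n := n) (by omega)
    exact ⟨g, (((hFT I hI).linIdeal g).line.curve.hilbertPoint_mem_transverse (by omega)).2 hg⟩
  · have h := hred _ θ.2
    exact ((h.hasType hm).line.curve.hilbertPoint_mem_transverse (by omega)).2
      (h.isTransverse hm (by omega))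
  · obtain ⟨θ, h1, rfl⟩ := (hFT I hI).exists_param hm (n := n) (by omega)
      (((hFT I hI).line.curve.hilbertPoint_mem_transverse (by omega)).1 h)
    exact ⟨⟨θ, (hΘ θ).2 ⟨h1, hI⟩⟩, rfl⟩

/-- A property that is open on the parameters holds for the general member of a family of
constant type, namely on an open subset of the transverse members, which is dense as the family is
irreducible. -/
theorem generalMember_of_hasType [Infinite k] (hm : m ≤ 1) {Q : Ideal (Coord k) → Prop}
    {Θ : Set (Param k a b (m + 3))} (hΘo : IsOpen Θ)
    (hne : Θ.Nonempty) (hΘ : ∀ θ, θ ∈ Θ ↔ θ.IsReduced ∧ Q θ.ideal) :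
    GeneralMember {I | HasType I a (fun _ : Fin (m + 1) => b)} Q := by
  refine eventually_atTop.2 ⟨4 * a + 2 * b + 10, fun n hn => ?_⟩
  let Θ' : Set (Param k a b (m + 3)) := {θ | θ.IsReduced}
  let F : Set (Ideal (Coord k)) := {I | HasType I a (fun _ : Fin (m + 1) => b)}
  obtain ⟨hind, hirr, -⟩ := irreducible_of_hasType hm (F := F) (fun g I hI => hI.linIdeal g)
    (fun I hI => hI) Param.isOpen_isReduced (hne.mono fun θ h => ((hΘ θ).1 h).1)
    (fun θ => ⟨fun h => ⟨h, h.hasType hm⟩, fun h => h.1⟩) hn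
  obtain ⟨O, hO, hOΘ⟩ := hind.isOpen_iff.1 (hΘo.preimage (continuous_subtype_val (p := (· ∈ Θ'))))
  have hmem : ∀ θ : Param k a b (m + 3), θ.IsReduced →
      (hilbertPoint n θ.ideal ∈ O ↔ θ ∈ Θ) := fun θ h =>
    Set.ext_iff.1 hOΘ (⟨θ, h⟩ : Θ')
  have hO' : IsOpen (O ∩ transverse k (m + 3) n) := hO.inter (isOpen_transverse _ _)
  refine ⟨O ∩ transverse k (m + 3) n, hO', ?_, fun I hI hIU => ?_⟩
  · refine subset_closure_inter_of_isPreirreducible_of_isOpen hirr.2 hO' ?_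
    obtain ⟨θ, hθ⟩ := hne
    have h := ((hΘ θ).1 hθ).1
    exact ⟨_, ⟨_, h.hasType hm, rfl⟩, (hmem θ h).2 hθ,
      ((h.hasType hm).line.curve.hilbertPoint_mem_transverse (by omega)).2
        (h.isTransverse hm (by omega))⟩
  · have hI' : HasType I a (fun _ : Fin (m + 1) => b) := hI
    obtain ⟨θ, h1, rfl⟩ := hI'.exists_param hm (n := n) (by omega)
      ((hI'.line.curve.hilbertPoint_mem_transverse (by omega)).1 hIU.2)
    exact ((hΘ θ).1 ((hmem θ h1).1 hIU.1)).2

end Families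


/-! ### The curves `C_{3,ℓ}` and `C_{4,ℓ}` -/

section Conclusion

open MvPolynomial

variable {k : Type*} [Field k] {a b d : ℕ}

theorem isRelPrime_X_pow {F : LineRing k} (hF : lead F ≠ 0) (n : ℕ) :
    IsRelPrime F (X 1 ^ n) := by
  refine IsRelPrime.pow_right ((X_prime.irreducible.isRelPrime_iff_not_dvd.2 ?_).symm)
  rintro ⟨c, rfl⟩
  simp at hF

namespace Param

/-- The point with `f = x₂^{a+1}`, `g = x₃^{a+1}`, `r = x₃^{b+3a+2}` and arbitrary `p`. -/
theorem exists_isReduced {q : LineRing k} (hq : ZHom q (b - 1)) : ∃ θ : Param k a b d,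
    θ.IsReduced ∧ θ.f = X 0 ^ (a + 1) ∧ θ.g = X 1 ^ (a + 1) ∧ θ.p = X 0 ^ b + X 1 * q := by
  let c : Fin 9 → LineRing k := ![0, 0, 0, X 1 ^ (a + 1), q, 0, 0, X 1 ^ a, 0]
  have hc : ∀ i, ZHom (c i) (paramDegree a b d i) := by
    intro i
    match i with
    | 0 => exact zHom_zero _
    | 1 => exact zHom_zero _
    | 2 => exact zHom_zero _
    | 3 => exact (zHom_X 1).pow _ (by simp [paramDegree])
    | 4 => exact hq
    | 5 => exact zHom_zero _
    | 6 => exact zHom_zero _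
    | 7 => exact (zHom_X 1).pow _ (by simp [paramDegree])
    | 8 => exact zHom_zero _
  let θ : Param k a b d := mk c hc
  have hf : θ.f = X 0 ^ (a + 1) := by
    change X 0 ^ (a + 1) + X 1 * 0 = _
    rw [mul_zero, add_zero]
  have hg : θ.g = X 1 ^ (a + 1) := rfl
  have hr : θ.r = X 1 ^ (b + a + (a + 1) * 2) := by
    have h0 : θ.u 0 = 0 := rfl
    have h1 : θ.u 1 = 0 := mul_zero _
    have h2 : θ.u 2 = X 1 ^ b * X 1 ^ a := rfl
    rw [r, evalForm_two, h0, h1, h2, hg]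
    ring
  refine ⟨θ, ⟨?_, ?_⟩, hf, hg, rfl⟩
  · rw [hg]
    exact isRelPrime_X_pow (by simp [lead_f]) _
  · rw [hr]
    exact isRelPrime_X_pow (by simp [lead_p]) _

/-- The point with `f = x₂^{a+1}`, `g = x₃^{a+1}` and `p = x₂ (x₂ - x₃)` is independent modulo `p`,
as `f` and `g` take independent values on the divisor of `p`. -/
theorem exists_indep (k : Type*) [Field k] (a d : ℕ) :
    ∃ θ : Param k a 2 d, θ.IsReduced ∧ θ.Indep := by
  obtain ⟨θ, h, hf, hg, hp⟩ := exists_isReduced (a := a) (b := 2) (d := d)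
    (q := -(X 0 : LineRing k)) (by
    have h : ZHom (-X 0 : LineRing k) 1 := (zHom_X 0).neg
    exact h)
  refine ⟨θ, h, fun A hA ⟨c, hc⟩ => ?_⟩
  rw [evalForm_one, hf, hg, hp] at hc
  have h1 := congrArg (aeval (R := k) (S₁ := LineRing k) ![0, 1]) hc
  have h2 := congrArg (aeval (R := k) (S₁ := LineRing k) ![1, 1]) hc
  obtain ⟨c₀, h₀⟩ := (hA 0).exists_C
  obtain ⟨c₁, h₁⟩ := (hA 1).exists_C
  rw [h₀, h₁] at h1 h2 ⊢
  simp at h1 h2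
  subst h1
  simpa using h2

/-- All triple lines of type `(ℓ; 1)` are curves `C_{3,ℓ}`. -/
theorem isC_three_ideal (θ : Param k a 1 3) (h : θ.IsReduced) : IsC 3 a θ.ideal := by
  obtain ⟨g, hg⟩ := θ.exists_ideal_eq
  rw [hg, isC_linIdeal_iff, (data h).isC_three_iff]
  exact ⟨rfl, rfl⟩

/-- Among the quadruple lines of type `(ℓ; 2, 2)`, the curves `C_{4,ℓ}` are those for which `f` and
`g` are independent modulo `p`. -/
theorem isC_four_ideal_iff {θ : Param k a 2 4} (h : θ.IsReduced) :
    IsC 4 a θ.ideal ↔ θ.Indep := by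
  obtain ⟨g, hg⟩ := θ.exists_ideal_eq
  rw [hg, isC_linIdeal_iff, (data h).isC_four_iff]
  exact ⟨fun h => h.2.2.2, fun h => ⟨rfl, rfl, rfl, h⟩⟩

end Param

theorem isIrreducibleFamily_isC_three [Infinite k] (ℓ : ℕ) :
    IsIrreducibleFamily {I : Ideal (Coord k) | IsC 3 ℓ I} (5 * ℓ + 12) := by
  refine eventually_atTop.2 ⟨4 * ℓ + 2 * 1 + 10, fun n hn => ?_⟩
  obtain ⟨-, h1, h2⟩ := irreducible_of_hasType (k := k) (m := 0) (a := ℓ) (b := 1) (by omega)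
    (F := {I | IsC 3 ℓ I}) (fun g I hI => IsC.linIdeal g hI)
    (fun I hI => by
      have h := (hI.line.three ℓ).2.1 hI
      convert h using 1
      ext i
      fin_cases i
      rfl)
    Param.isOpen_isReduced
    (by
      obtain ⟨θ, h, -⟩ := Param.exists_isReduced (k := k) (a := ℓ) (b := 1) (d := 3) (zHom_zero _)
      exact ⟨θ, h⟩)
    (fun θ => ⟨fun h => ⟨h, θ.isC_three_ideal h⟩, fun h => h.1⟩) hn
  refine ⟨h1, h2.trans ?_⟩
  rw [Param.finrank]
  norm_cast

theorem mem_indep_iff {a : ℕ} (θ : Param k a 2 4) :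
    θ ∈ {θ : Param k a 2 4 | θ.IsReduced} ∩ {θ | θ.Indep} ↔ θ.IsReduced ∧ IsC 4 a θ.ideal :=
  and_congr_right fun h => (Param.isC_four_ideal_iff h).symm

theorem isIrreducibleFamily_isC_four [Infinite k] (ℓ : ℕ) :
    IsIrreducibleFamily {I : Ideal (Coord k) | IsC 4 ℓ I} (9 * ℓ + 21) := by
  refine eventually_atTop.2 ⟨4 * ℓ + 2 * 2 + 10, fun n hn => ?_⟩
  obtain ⟨-, h1, h2⟩ := irreducible_of_hasType (k := k) (m := 1) (a := ℓ) (b := 2) (by omega)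
    (F := {I | IsC 4 ℓ I}) (fun g I hI => IsC.linIdeal g hI)
    (fun I hI => by
      have h := (hI.line.four ℓ).2 hI
      convert h using 1
      ext i
      fin_cases i <;> rfl)
    (Param.isOpen_isReduced.inter Param.isOpen_indep) (Param.exists_indep k ℓ 4) mem_indep_iff hn
  refine ⟨h1, h2.trans ?_⟩
  rw [Param.finrank, if_pos rfl]
  norm_cast
  omega

theorem generalMember_isC_four [Infinite k] (ℓ : ℕ) :
    GeneralMember {I : Ideal (Coord k) | HasType I ℓ ![2, 2]} (fun I => IsC 4 ℓ I) := by
  have h := generalMember_of_hasType (k := k) (m := 1) (a := ℓ) (b := 2) (by omega)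
    (Q := fun I => IsC 4 ℓ I) (Param.isOpen_isReduced.inter Param.isOpen_indep)
    (Param.exists_indep k ℓ 4) mem_indep_iff
  have e : (![2, 2] : Fin 2 → ℕ) = fun _ => 2 := by
    ext i
    fin_cases i <;> rfl
  rw [e]
  exact h

end Conclusion

end MultipleLines

end

theorem mainTheorem1 {k : Type*} [Field k] [IsAlgClosed k] (ℓ : ℕ) :
    -- triple lines
    (∀ I : Ideal (MultipleLines.Coord k), MultipleLines.IsMultipleLine 3 I →
      (MultipleLines.SatisfiesCondition 3 ℓ I ↔
        ∃ (a : ℤ) (b : ℕ), MultipleLines.HasType I a ![b] ∧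
          ((a = ℓ ∧ 1 ≤ b) ∨ (ℓ : ℤ) + 1 ≤ a)) ∧
      (MultipleLines.IsC 3 ℓ I ↔ MultipleLines.HasType I ℓ ![1])) ∧
    MultipleLines.IsIrreducibleFamily
      {I : Ideal (MultipleLines.Coord k) | MultipleLines.IsC 3 ℓ I} (5 * ℓ + 12) ∧
    -- quadruple lines
    (∀ I : Ideal (MultipleLines.Coord k), MultipleLines.IsMultipleLine 4 I →
      (MultipleLines.SatisfiesCondition 4 ℓ I →
        ∃ (a : ℤ) (b₂ b₃ : ℕ), MultipleLines.HasType I a ![b₂, b₃] ∧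
          ((a = ℓ ∧ 2 ≤ b₂) ∨ (ℓ : ℤ) + 1 ≤ a)) ∧
      (MultipleLines.IsC 4 ℓ I → MultipleLines.HasType I ℓ ![2, 2])) ∧
    MultipleLines.GeneralMember
      {I : Ideal (MultipleLines.Coord k) | MultipleLines.HasType I ℓ ![2, 2]}
      (fun I => MultipleLines.IsC 4 ℓ I) ∧
    MultipleLines.IsIrreducibleFamily
      {I : Ideal (MultipleLines.Coord k) | MultipleLines.IsC 4 ℓ I} (9 * ℓ + 21) := by
  exact ⟨fun I hI => hI.three ℓ, MultipleLines.isIrreducibleFamily_isC_three ℓ,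
    fun I hI => hI.four ℓ, MultipleLines.generalMember_isC_four ℓ,
    MultipleLines.isIrreducibleFamily_isC_four ℓ⟩
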